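/- **Setting.** Let $\Sigma^3$ be an oriented handlebody of genus $g\ge 0$ with a (possibly degenerate) triangulation $\mathcal T$ by finitely many tetrahedra with faces identified in pairs, and let $\mathbb D_i$, $i\in C$, $|C|=g$, be cuts lying on the triangulation: pairwise disjoint properly embedded discs, each a union of interior triangles of $\mathcal T$, such that cutting $\Sigma^3$ open along all of them gives a 3-ball. Assume that $\mathcal T$ is *non-tardis*: for any half-integer labels of the boundary edges, only finitely many labellings of all edges by half-integers extend them and are admissible (the three labels of each triangle satisfy the triangle inequalities and have integer sum). A boundary state $\Psi$ consists of a half-integer $k_e$ for each boundary edge $e$ and an $\mathrm{SU}(2)$-intertwiner on each boundary triangle, i.e. a complex multiple $c_a$ of the standard trivalent vertex (zero if the three labels are not admissible). *Spin network evaluation.* Let a trivalent graph be given with a cyclic order of the three legs at each vertex, a spin $j$ on each link, and group elements of $\mathrm{SU}(2)$ on the links. Replace each link of spin $j$ by a flat band of $2j$ strands, apply $\frac1{(2j)!}\sum_{\tau\in S_{2j}}\mathrm{sgn}(\tau)\,\tau$ to the strands, and connect the strands at each vertex pairwise without crossings. Each strand of a link carries the group element of that link. A closed loop with holonomy $g$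 has the value $-\operatorname{tr} g$; the evaluation is the sum over the permutations of the products of the loop values. It is zero if the labels at some vertex are not admissible. (This is the Penrose, or chromatic, evaluation; a loop of spin $j$ has the value $\dim(j)=(-1)^{2j}(2j+1)$; crossings of links contribute no further sign.) Denote by $\langle\mathrm{Theta}\rangle$ and $\langle\mathrm{Tet}\rangle$ the evaluations of the planar theta and tetrahedral networks, without group elements, labelled by the three edges of a triangle and the six edges of a tetrahedron. *The Ponzano–Regge amplitude* is $$\mathcal Z_{PR}(\Psi,\Sigma^3)=\prod_{a}c_a\ \sum_{j}\ \prod_{e\ \mathrm{interior}}(-1)^{2j_e}(2j_e+1)\prod_{\Delta\ \mathrm{interior}}\frac1{\langle\mathrm{Theta}\rangle_\Delta}\prod_{\sigma}\langle\mathrm{Tet}\rangle_\sigma ,$$ where $a$ runs over the boundary triangles, $e$ over the interior edges, $\Delta$ over the interior triangles, $\sigma$ over the tetrahedra, and the sum is over the (finitely many) admissible labellings $j$ of the edges of $\mathcal T$ with $j_e=k_e$ on the boundary. *The boundary network.* For $h=(h_i)_{i\in C}\in \mathrm{SU}(2)^{C}$ let $\langle(\partial\Sigma^3)^*_{h}\rangle$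 be $\prod_a c_a$ times the evaluation of the graph dual to the triangulated surface $\partial\Sigma^3$: one vertex for each boundary triangle, one link across each boundary edge $e$, with the spin $k_e$, and $h_i$ inserted on every link that crosses the circle $\partial\mathbb D_i$, always in the same direction across the circle. The network is evaluated in the planar projection of the boundary of the cut manifold: the graph cut along the circles $\partial\mathbb D_i$ is drawn in the plane without crossings, with the cyclic orders at the vertices given by the surface, and the corresponding open ends at the two copies of each circle are connected by flat bands. **Lemma.** For every boundary state $\Psi$ the function $h\mapsto\langle(\partial\Sigma^3)^*_{h}\rangle$ is integrable for the product of the normalised Haar measures, and $$\mathcal Z_{PR}(\Psi,\Sigma^3)=\int_{\mathrm{SU}(2)^{C}}\ \prod_{i\in C}\mathrm dh_i\ \langle(\partial\Sigma^3)^*_{h}\rangle .$$ -/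

import Mathlib

open MeasureTheory

noncomputable section

/-! ### The group `SU(2)` and its Haar probability measure -/

/-- The group `SU(2)`. -/
abbrev SU2 : Type := ↥(Matrix.specialUnitaryGroup (Fin 2) ℂ)

instance SU2.instIsTopologicalGroup : IsTopologicalGroup SU2 where
  continuous_mul := continuous_mul
  continuous_inv := Continuous.subtype_mk (continuous_star.comp continuous_subtype_val) _

instance SU2.instCompactSpace : CompactSpace SU2 := by
  refine isCompact_iff_compactSpace.mp (Metric.isCompact_of_isClosed_isBounded
    (α := Fin 2 → Fin 2 → ℂ) (s := (Matrix.specialUnitaryGroup (Fin 2) ℂ :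
      Set (Matrix (Fin 2) (Fin 2) ℂ))) ?_ ?_)
  · have h : (Matrix.specialUnitaryGroup (Fin 2) ℂ : Set (Matrix (Fin 2) (Fin 2) ℂ)) =
        {A | A * star A = 1} ∩ {A | A.det = 1} := by
      ext A
      simp [Matrix.mem_specialUnitaryGroup_iff, Matrix.mem_unitaryGroup_iff]
    rw [h]
    exact (isClosed_eq (continuous_id.mul continuous_star) continuous_const).inter
      (isClosed_eq (Continuous.matrix_det continuous_id) continuous_const)
  · refine (Metric.isBounded_closedBall (x := (0 : Fin 2 → Fin 2 → ℂ)) (r := 1)).subset ?_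
    intro A hA
    rw [mem_closedBall_zero_iff, pi_norm_le_iff_of_nonneg zero_le_one]
    intro i
    rw [pi_norm_le_iff_of_nonneg zero_le_one]
    intro j
    exact entry_norm_bound_of_unitary (Matrix.specialUnitaryGroup_le_unitaryGroup hA) i j

instance SU2.instMeasurableSpace : MeasurableSpace SU2 := borel SU2

instance SU2.instBorelSpace : BorelSpace SU2 := ⟨rfl⟩

/-- The Haar measure of `SU(2)` with total mass one. -/
def haarSU2 : Measure SU2 :=
  Measure.haarMeasure ⟨⟨Set.univ, isCompact_univ⟩, by simp⟩

/-! ### Trivalent spin networks and their evaluation -/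

/-- Three spins `a/2`, `b/2`, `c/2` admit a nonzero intertwiner: integer total spin and the
triangle inequalities. -/
def Admissible (a b c : ℕ) : Prop :=
  Even (a + b + c) ∧ a ≤ b + c ∧ b ≤ c + a ∧ c ≤ a + b

/-- A trivalent ribbon graph with `SU(2)` spins and group elements on its links. `D` is the set of
half-links; the orbits of `rot` are the vertices, with the cyclic order of their three legs in the
surface (or in the plane); the orbits of `opp` are the links. The label `label d` is *twice* the
spin of the link of `d`; `hol d` is the group element met when the link is traversed
starting from `d`. -/
structure SpinNetwork (D : Type*) where
  rot : D → D
  opp : D → D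
  label : D → ℕ
  label_opp : ∀ d, label (opp d) = label d
  hol : D → SU2

namespace SpinNetwork

variable {D : Type*} (N : SpinNetwork D)

/-- Every link of spin `n/2` is drawn as a ribbon of `n` parallel strands, each carrying the
fundamental representation. A point `⟨d, p⟩` is the end, at the vertex of `d`, of the `p`-th strand
of the leg `d`; the strands of a leg are counted in the cyclic order around that vertex. -/
abbrev Strand : Type _ := Σ d : D, Fin (N.label d)

/-- The trivalent vertex: the strands of the three legs are joined pairwise in the plane without
crossings, `(a + b - c) / 2` of them joining the legs with labels `a` and `b`. (For admissible
labels the bounds tested by `if` always hold.) -/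
def atVertex (s : N.Strand) : N.Strand :=
  let next := N.rot s.1
  let prev := N.rot (N.rot s.1)
  if (s.2 : ℕ) < (N.label prev + N.label s.1 - N.label next) / 2 then
    if h : N.label prev - 1 - s.2 < N.label prev then ⟨prev, ⟨_, h⟩⟩ else s
  else
    if h : N.label s.1 - 1 - s.2 < N.label next then ⟨next, ⟨_, h⟩⟩ else s

/-- The strands of a link after each leg `d` has been permuted by `τ d`. An untwisted planar ribbon
reverses the counting, as the strands are counted around the two end vertices in the
same sense. -/
def alongLink (τ : ∀ d, Equiv.Perm (Fin (N.label d))) (s : N.Strand) : N.Strand :=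
  ⟨N.opp s.1, (τ (N.opp s.1))⁻¹ (Fin.cast (N.label_opp s.1).symm (Fin.rev (τ s.1 s.2)))⟩

/-- The closed loops formed by the strands. -/
def Loop (τ : ∀ d, Equiv.Perm (Fin (N.label d))) : Type _ :=
  Quot fun s s' : N.Strand => s' = N.atVertex s ∨ s' = N.alongLink τ s

/-- The product of the group elements along the loop of `s`, beginning at `s` (passing through
a vertex and along a link in each step). -/
def loopHol (τ : ∀ d, Equiv.Perm (Fin (N.label d))) (s : N.Strand) : SU2 :=
  let step := fun r => N.alongLink τ (N.atVertex r)
  ((List.range (Function.minimalPeriod step s)).map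
    fun i => N.hol (N.atVertex (step^[i] s)).1).prod

open Classical in
/-- The (Penrose, or chromatic) evaluation of a spin network. On every leg the strands
are projected on the spin-`n/2` irrep by `(1 / n!) ∑ τ, sign τ • τ`, and a closed loop
with holonomy `g` has the value `- tr g`; thus a loop of spin `j` has the value
`(-1)^(2j) (2j+1)`. In a plane drawing with the cyclic orders `rot` at the vertices, links may
cross each other; in this calculus a crossing only routes the strands, so that the value depends
on nothing but the cyclic orders, and it is the usual planar evaluation if there are no crossings.
There is no nonzero intertwiner at a vertex with non-admissible labels, so
that the evaluation is then zero. -/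
def eval [Fintype D] : ℂ :=
  if ∀ d, Admissible (N.label d) (N.label (N.rot d)) (N.label (N.rot (N.rot d))) then
    ∑ τ : (∀ d, Equiv.Perm (Fin (N.label d))),
      (∏ d, ((Equiv.Perm.sign (τ d) : ℤ) : ℂ) / (N.label d).factorial) *
        ∏ᶠ l : N.Loop τ, -(N.loopHol τ (Quot.out l)).1.trace
  else 0

end SpinNetwork

/-- The planar theta network with labels `k 0`, `k 1`, `k 2`. -/
def thetaNetwork (k : Fin 3 → ℕ) : SpinNetwork (Bool × Fin 3) where
  rot d := (d.1, bif d.1 then d.2 + 1 else d.2 - 1)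
  opp d := (!d.1, d.2)
  label d := k d.2
  label_opp _ := rfl
  hol _ := 1

/-- Ordered pairs of different elements of `Fin 4`. The vertices of a tetrahedron are numbered by
`Fin 4`, and so are its faces: face `f` is the one opposite to vertex `f`. -/
abbrev FacePair : Type := {p : Fin 4 × Fin 4 // p.1 ≠ p.2}

def FacePair.swap (p : FacePair) : FacePair := ⟨(p.1.2, p.1.1), p.2.symm⟩

def FacePair.map (π : Equiv.Perm (Fin 4)) (p : FacePair) : FacePair :=
  ⟨(π p.1.1, π p.1.2), fun h => p.2 (π.injective h)⟩

/-- `nextIn f a`: the side of the face `f` (named by the other face `a` which contains it) that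
follows the side `a` in the orientation of `f` induced by the tetrahedron `0123`. -/
def nextIn (f a : Fin 4) : Fin 4 :=
  (![![0, 2, 3, 1], ![3, 1, 0, 2], ![1, 3, 2, 0], ![2, 0, 1, 3]] : Fin 4 → Fin 4 → Fin 4) f a

theorem nextIn_ne (p : FacePair) : p.1.1 ≠ nextIn p.1.1 p.1.2 := by
  revert p; decide

/-- Rotation of a side within its face. -/
def FacePair.rot (p : FacePair) : FacePair := ⟨(p.1.1, nextIn p.1.1 p.1.2), nextIn_ne p⟩

/-- The planar tetrahedral network: the dual of the surface of a tetrahedron. The link crossing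
the edge common to the faces `f`, `a` has the label `l (f, a)`. -/
def tetNetwork (l : FacePair → ℕ) (hl : ∀ p, l p.swap = l p) : SpinNetwork FacePair where
  rot := FacePair.rot
  opp := FacePair.swap
  label := l
  label_opp := hl
  hol _ := 1

/-! ### Triangulated oriented 3-manifolds -/

/-- An oriented (possibly degenerate) triangulation: tetrahedra indexed by `T`, some of whose
faces are identified in pairs. `glue t f = some (t', π)` means that face `f` of `t` is identified
with face `π f` of `t'`, vertex `v ≠ f` of `t` with vertex `π v` of `t'`; `glue t f = none` means
that face `f` of `t` lies on the boundary. All identifications reverse the orientation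
of the faces. -/
structure Triangulation (T : Type*) where
  glue : T → Fin 4 → Option (T × Equiv.Perm (Fin 4))
  symm : ∀ t f t' π, glue t f = some (t', π) → glue t' (π f) = some (t, π⁻¹)
  odd : ∀ t f t' π, glue t f = some (t', π) → Equiv.Perm.sign π = -1
  free : ∀ t f t' π, glue t f = some (t', π) → (t', π f) ≠ (t, f)

/-- A tetrahedron with an ordered pair of different elements of `Fin 4`. A flag `(t, (f, a))` is
mostly read as: the face `f` of the tetrahedron `t` and the edge of `t` common to the
faces `f` and `a`. -/
abbrev TetFlag (T : Type*) : Type _ := T × FacePair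

namespace Triangulation

variable {T : Type*} (M : Triangulation T)

def swap (x : TetFlag T) : TetFlag T := (x.1, x.2.swap)

/-- Cross the face named by the first entry of a flag; nothing happens at a boundary face. -/
def cross (x : TetFlag T) : TetFlag T :=
  match M.glue x.1 x.2.1.1 with
  | none => x
  | some (t', π) => (t', x.2.map π)

/-- One step of the rotation about the edge of the flag `(t, (f, a))`: traverse `t` from the
face `f` to the face `a`, and cross this face if it is not on the boundary. -/
def turn (x : TetFlag T) : TetFlag T := M.cross (swap x)

/-- The face `f` of a flag `(t, (f, a))` lies on the boundary. -/
def OnBoundary (x : TetFlag T) : Prop := M.glue x.1 x.2.1.1 = none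

instance (x : TetFlag T) : Decidable (M.OnBoundary x) :=
  inferInstanceAs (Decidable (M.glue x.1 x.2.1.1 = none))

/-- The edges of the triangulation. -/
def Edge : Type _ := Quot fun x y : TetFlag T => y = swap x ∨ y = M.cross x

def edge (x : TetFlag T) : M.Edge := Quot.mk _ x

/-- The vertices of the triangulation; `(t, v)` stands for the vertex `v` of the tetrahedron `t`. -/
def Vertex : Type _ := Quot fun x y : T × Fin 4 =>
  ∃ f t' π, f ≠ x.2 ∧ M.glue x.1 f = some (t', π) ∧ y = (t', π x.2)

def vertex (x : T × Fin 4) : M.Vertex := Quot.mk _ x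

/-- The edges on the boundary. -/
abbrev BdryEdge : Type _ := {e : M.Edge // ∃ x, M.OnBoundary x ∧ M.edge x = e}

/-- The interior edges. -/
abbrev InnerEdge : Type _ := {e : M.Edge // ¬ ∃ x, M.OnBoundary x ∧ M.edge x = e}

/-- The triangles on the boundary. -/
abbrev BdryFace : Type _ := {x : T × Fin 4 // M.glue x.1 x.2 = none}

/-- The interior triangles; each is a pair of identified faces of tetrahedra. -/
def InnerFace : Type _ := Quot fun x y : {x : T × Fin 4 // M.glue x.1 x.2 ≠ none} =>
  ∃ π, M.glue x.1.1 x.1.2 = some (y.1.1, π) ∧ π x.1.2 = y.1.2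

/-- The boundary triangles with one of their three sides: the half-links of the graph dual to the
boundary surface. -/
abbrev BdryDart : Type _ := {x : TetFlag T // M.OnBoundary x}

/-- The number of steps after which the rotation about an edge, begun at a boundary face, arrives
at a boundary face. -/
def turnSteps (x : TetFlag T) : ℕ := sInf {i | 0 < i ∧ M.OnBoundary (M.turn^[i] x)}

/-- If `x` is a boundary triangle with one of its sides, then this is the boundary triangle on the
other side of that edge, with the same edge. -/
def opp (x : TetFlag T) : TetFlag T := M.turn^[M.turnSteps x] x

theorem swap_swap (x : TetFlag T) : swap (swap x) = x := rfl

theorem cross_cross (x : TetFlag T) : M.cross (M.cross x) = x := by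
  rcases x with ⟨t, ⟨⟨f, a⟩, h⟩⟩
  rcases hg : M.glue t f with _ | ⟨t', π⟩
  · have h1 : M.cross (t, ⟨(f, a), h⟩) = (t, ⟨(f, a), h⟩) := by simp [cross, hg]
    rw [h1, h1]
  · have h1 : M.cross (t, ⟨(f, a), h⟩) = (t', FacePair.map π ⟨(f, a), h⟩) := by simp [cross, hg]
    rw [h1]
    simp [cross, FacePair.map, M.symm _ _ _ _ hg]

theorem turn_injective : Function.Injective M.turn := by
  intro x y h
  have h1 := congrArg M.cross h
  simp only [turn, cross_cross] at h1
  simpa only [swap_swap] using congrArg swap h1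

theorem onBoundary_opp [Finite T] {x : TetFlag T} (hx : M.OnBoundary x) : M.OnBoundary (M.opp x) := by
  have hne : {i | 0 < i ∧ M.OnBoundary (M.turn^[i] x)}.Nonempty := by
    obtain ⟨i, hi, h⟩ := Function.mem_periodicPts.mp (M.turn_injective.mem_periodicPts x)
    exact ⟨i, hi, by rw [h.eq]; exact hx⟩
  exact (Nat.sInf_mem hne).2

theorem edge_turn (x : TetFlag T) : M.edge (M.turn x) = M.edge x :=
  ((Quot.sound (Or.inl rfl) : M.edge x = M.edge (swap x)).trans (Quot.sound (Or.inr rfl))).symm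

theorem edge_opp (x : TetFlag T) : M.edge (M.opp x) = M.edge x := by
  unfold opp
  generalize M.turnSteps x = i
  induction i with
  | zero => rfl
  | succ i ih => rw [Function.iterate_succ_apply', edge_turn, ih]

/-! #### The Ponzano–Regge amplitude -/

/-- A boundary state: spins on the boundary edges (`spin e` is twice the spin) and an intertwiner
on each boundary triangle. The space of intertwiners of three irreps being at most
one-dimensional, the intertwiner is given by its factor `coeff` with respect to the
trivalent vertex. -/
structure BoundaryState where
  spin : M.BdryEdge → ℕ
  coeff : M.BdryFace → ℂ

/-- The labels of the three sides of every triangle are admissible. -/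
def AdmissibleLabelling (n : M.Edge → ℕ) : Prop :=
  ∀ x : TetFlag T, Admissible (n (M.edge x)) (n (M.edge (x.1, x.2.rot)))
    (n (M.edge (x.1, x.2.rot.rot)))

/-- The admissible labellings of the edges which extend given labels of the boundary edges. -/
def Extensions (k : M.BdryEdge → ℕ) : Set (M.Edge → ℕ) :=
  {n | M.AdmissibleLabelling n ∧ ∀ e : M.BdryEdge, n e.1 = k e}

/-- Non-tardis: the labels of the boundary edges restrict those of the interior edges to a finite
range. -/
def NonTardis : Prop := ∀ k : M.BdryEdge → ℕ, (M.Extensions k).Finite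

/-- The theta network of the three sides of the face `f` of the tetrahedron `t`. -/
def thetaOf (n : M.Edge → ℕ) (t : T) (f : Fin 4) : ℂ :=
  (thetaNetwork fun i => n (M.edge (t, FacePair.rot^[i] ⟨(f, f + 1), by revert f; decide⟩))).eval

/-- The tetrahedral network of the tetrahedron `t`. -/
def tetOf (n : M.Edge → ℕ) (t : T) : ℂ :=
  (tetNetwork (fun p => n (M.edge (t, p)))
    fun p => congrArg n (Quot.sound (Or.inl rfl) : M.edge (t, p) = M.edge (t, p.swap)).symm).eval

/-- The summand of the Ponzano–Regge state sum:
`∏ (-1)^(2j) (2j+1)` over the interior edges, `∏ 1 / ⟨Theta⟩` over the interior triangles,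
`∏ ⟨Tet⟩` over the tetrahedra. -/
def weight [Fintype T] (n : M.Edge → ℕ) : ℂ :=
  (∏ᶠ e : M.InnerEdge, (-1) ^ n e.1 * ((n e.1 : ℂ) + 1)) *
    (∏ᶠ q : M.InnerFace, (M.thetaOf n (Quot.out q).1.1 (Quot.out q).1.2)⁻¹) *
    ∏ t, M.tetOf n t

/-- The Ponzano–Regge amplitude of a boundary state. -/
def ponzanoRegge [Fintype T] (Ψ : M.BoundaryState) : ℂ :=
  (∏ x, Ψ.coeff x) * ∑ᶠ n ∈ M.Extensions Ψ.spin, M.weight n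

/-! #### Balls and discs -/

/-- The tetrahedra are connected with each other through faces. -/
def Connected : Prop :=
  ∀ t t', Relation.ReflTransGen (fun a b => ∃ f π, M.glue a f = some (b, π)) t t'

/-- The corners of the link of a vertex: a pair `(t, (v, w))` stands for the end at `v` of the edge
`vw` of the tetrahedron `t`. -/
def EdgeEnd : Type _ := Quot fun x y : TetFlag T =>
  ∃ f t' π, f ≠ x.2.1.1 ∧ f ≠ x.2.1.2 ∧ M.glue x.1 f = some (t', π) ∧ y = (t', x.2.map π)

/-- The sides of the link of a vertex: a pair `(t, (f, v))` stands for the corner at `v` of the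
face `f` of the tetrahedron `t`. -/
def FaceCorner : Type _ := Quot fun x y : TetFlag T => y = M.cross x

/-- The Euler characteristic of the link of a vertex. The link consists of one triangle for each
corner of a tetrahedron at that vertex, and it is a connected oriented surface. -/
def linkEuler (q : M.Vertex) : ℤ :=
  ({e : M.EdgeEnd | ∃ x : TetFlag T, e = Quot.mk _ x ∧ M.vertex (x.1, x.2.1.1) = q}.ncard : ℤ) -
    ({e : M.FaceCorner | ∃ x : TetFlag T, e = Quot.mk _ x ∧ M.vertex (x.1, x.2.1.2) = q}.ncard : ℤ) +
    ({x : T × Fin 4 | M.vertex x = q}.ncard : ℤ)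

/-- A vertex of a boundary triangle. -/
def IsBdryVertex (q : M.Vertex) : Prop :=
  ∃ t f v, M.glue t f = none ∧ v ≠ f ∧ M.vertex (t, v) = q

/-- Every vertex has a disc (on the boundary) or a sphere (in the interior) as its link: a connected
oriented surface is a disc iff it has a boundary and Euler characteristic one, a sphere iff it
has no boundary and Euler characteristic two. -/
def IsManifold : Prop :=
  ∀ q : M.Vertex, (M.IsBdryVertex q → M.linkEuler q = 1) ∧ (¬ M.IsBdryVertex q → M.linkEuler q = 2)

/-- A flat connection on the graph dual to the triangulation: `c t f` is the parallel transport out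
of the tetrahedron `t` through its face `f`, and the holonomy about interior edges is trivial. -/
def IsFlat {G : Type} [Group G] (c : T → Fin 4 → G) : Prop :=
  (∀ t f t' π, M.glue t f = some (t', π) → c t' (π f) = (c t f)⁻¹) ∧
  ∀ x : TetFlag T, (¬ ∃ y, M.OnBoundary y ∧ M.edge y = M.edge x) →
    ((List.range (Function.minimalPeriod M.turn x)).map
      fun i => c (M.turn^[i] x).1 (M.turn^[i] x).2.1.2).prod = 1

/-- Simple connectedness of a (connected) triangulated manifold: every flat connection, with values
in any group, is a pure gauge; that is, every homomorphism from the fundamental group to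
a group is trivial. -/
def SimplyConnected : Prop :=
  ∀ (G : Type) [Group G] (c : T → Fin 4 → G), M.IsFlat c →
    ∃ g : T → G, ∀ t f t' π, M.glue t f = some (t', π) → c t f = g t * (g t')⁻¹

/-- A set of boundary triangles is connected through edges. -/
def FaceConnected (S : Set (T × Fin 4)) : Prop :=
  ∀ x ∈ S, ∀ y ∈ S, Relation.ReflTransGen (fun u v => v ∈ S ∧ ∃ p r : FacePair,
    p.1.1 = u.2 ∧ r.1.1 = v.2 ∧ M.opp (u.1, p) = (v.1, r)) x y

/-- The Euler characteristic (vertices minus edges plus triangles) of the union of a set of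
boundary triangles. -/
def faceEuler (S : Set (T × Fin 4)) : ℤ :=
  ({q : M.Vertex | ∃ x ∈ S, ∃ v, v ≠ x.2 ∧ M.vertex (x.1, v) = q}.ncard : ℤ) -
    ({e : M.Edge | ∃ x ∈ S, ∃ p : FacePair, p.1.1 = x.2 ∧ M.edge (x.1, p) = e}.ncard : ℤ) +
    (S.ncard : ℤ)

/-- A triangulated 3-ball: a compact connected simply connected 3-manifold whose boundary
is a 2-sphere. (By the solution of the Poincaré conjecture these are exactly the
triangulations of the ball.) -/
structure IsBall : Prop where
  nonempty : Nonempty T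
  connected : M.Connected
  manifold : M.IsManifold
  simplyConnected : M.SimplyConnected
  bdryConnected : M.FaceConnected {x | M.glue x.1 x.2 = none}
  bdryEuler : M.faceEuler {x | M.glue x.1 x.2 = none} = 2

/-- The set `S` of boundary triangles forms a closed disc embedded in the boundary sphere
of a ball. -/
structure IsDisc (S : Set (T × Fin 4)) : Prop where
  onBoundary : ∀ x ∈ S, M.glue x.1 x.2 = none
  connected : M.FaceConnected S
  euler : M.faceEuler S = 1

end Triangulation

/-! ### Handlebodies with cuts, and the boundary spin network -/

/-- A family of two-sided surfaces, indexed by `C`, made of interior triangles of `M`: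
`side t f = some (i, s)` means that the face `f` of the tetrahedron `t` lies on the `i`-th surface,
with the tetrahedron `t` on the side `s` of it. -/
structure CutSystem {T : Type*} (M : Triangulation T) (C : Type*) where
  side : T → Fin 4 → Option (C × Bool)
  inner : ∀ t f, M.glue t f = none → side t f = none
  opposite : ∀ t f t' π, M.glue t f = some (t', π) →
    side t' (π f) = (side t f).map fun s => (s.1, !s.2)

namespace CutSystem

variable {T C : Type*} {M : Triangulation T} (D : CutSystem M C)

/-- The manifold cut open along the surfaces. -/
def cutOpen : Triangulation T where
  glue t f := if D.side t f = none then M.glue t f else none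
  symm t f t' π h := by
    split_ifs at h with hs
    have h' := D.opposite t f t' π h
    rw [hs] at h'
    simp only [Option.map_none] at h'
    rw [if_pos h', M.symm t f t' π h]
  odd t f t' π h := by
    split_ifs at h with hs
    exact M.odd t f t' π h
  free t f t' π h := by
    split_ifs at h with hs
    exact M.free t f t' π h

/-- The copy, on the side `s`, of the `i`-th surface in the boundary of the cut manifold. -/
def copy (i : C) (s : Bool) : Set (T × Fin 4) := {x | D.side x.1 x.2 = some (i, s)}

/-- `M` is a handlebody and the surfaces are discs forming a set of cuts of it: cutting along them
yields a 3-ball, in whose boundary the two copies of each surface are embedded discs,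
all these discs are disjoint, and `M` is recovered from the ball by identifying the two copies of
each disc by a simplicial isomorphism (neighbouring triangles of one copy are identified, along the
common edge as well, with neighbouring triangles of the other). The genus is the number of cuts. -/
structure IsHandlebody : Prop where
  ball : D.cutOpen.IsBall
  disc : ∀ i s, D.cutOpen.IsDisc (D.copy i s)
  disjoint : ∀ i s j r, (i, s) ≠ (j, r) → ∀ x ∈ D.copy i s, ∀ y ∈ D.copy j r,
    ∀ v w, v ≠ x.2 → w ≠ y.2 → D.cutOpen.vertex (x.1, v) ≠ D.cutOpen.vertex (y.1, w)
  simplicial : ∀ i s (x : TetFlag T), (x.1, x.2.1.1) ∈ D.copy i s →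
    ((D.cutOpen.opp x).1, (D.cutOpen.opp x).2.1.1) ∈ D.copy i s →
      D.cutOpen.opp (M.cross x) = M.cross (D.cutOpen.opp x)

/-- The group element met when leaving the tetrahedron `t` through its face `f`: `h i` or its
inverse, according to the direction, on the `i`-th cut, and `1` elsewhere. -/
def transport (h : C → SU2) (t : T) (f : Fin 4) : SU2 :=
  match D.side t f with
  | none => 1
  | some (i, true) => h i
  | some (i, false) => (h i)⁻¹

/-- The spin network dual to the boundary surface of `M`: a vertex for each boundary triangle, a
link across each boundary edge with the label of this edge, and the group element `h i`
inserted on the links which cross the boundary circle of the `i`-th cut, always in the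
same direction across the circle. The legs at each vertex have the cyclic order of the boundary of
the cut manifold (a sphere with pairs of discs removed): this is the planar drawing of the cut
graph, whose open ends at the two copies of each circle are then connected by flat bands. (Rotating about a boundary edge, from one boundary triangle to the
other, one meets the `i`-th cut iff the edge lies on its boundary circle.) -/
def boundaryNetwork [Finite T] (k : M.BdryEdge → ℕ) (h : C → SU2) : SpinNetwork M.BdryDart where
  rot x := ⟨(x.1.1, x.1.2.rot), x.2⟩
  opp x := ⟨M.opp x.1, M.onBoundary_opp x.2⟩
  label x := k ⟨M.edge x.1, x.1, x.2, rfl⟩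
  label_opp x := congrArg k (Subtype.ext (M.edge_opp x.1))
  hol x := ((List.range (M.turnSteps x.1)).map
    fun i => D.transport h (M.turn^[i] x.1).1 (M.turn^[i] x.1).2.1.2).prod

/-- The evaluation of the boundary spin network, with the intertwiners of the state `Ψ`. -/
def boundaryEval [Fintype T] (Ψ : M.BoundaryState) (h : C → SU2) : ℂ :=
  (∏ x, Ψ.coeff x) * (D.boundaryNetwork Ψ.spin h).eval

end CutSystem

end

/-! For fixed labels, the Haar mean over `SU(2)` of a product of three irreducible representations
is the projection on their invariants. It vanishes for non-admissible labels; otherwise it has rank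
one and equals the product of the two vertex tensors of the triangle divided by its theta evaluation
(`integral_linkMat`). Used at every interior triangle, this turns the factors `1/⟨Theta⟩` and
`⟨Tet⟩` into an integral over one group element per interior triangle. In the integrand the strands
turn around the edges: an interior edge yields the character of its holonomy, and the strands at the
boundary edges form the boundary network of the connection (`amplitude_eq_integral`).

The signs need care, since every closed loop counts `-tr`. The parity of the number of loops is the
sign of a permutation which carries one oriented matching of the strand ends to another
(`relSign_match`). Such relative signs multiply along chains of matchings. The total is `(-1)^(2j)`
per interior edge (`relSign_flags`), and this cancels the same sign in the edge weight.

What remains is formally the expansion `δ = ∑ (2j+1) χ_j` at every interior edge. The delta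
functions are replaced by normalised powers of `(2 + tr) / 4`; these are finite combinations of
characters whose coefficients tend to `2j+1`. Only admissible extensions of the boundary labels
contribute, finitely many by non-tardis, so the state sum is a limit of integrals, which may be
taken in two stages (`sum_weight_eq_of_tendsto`). Non-tardis also yields the total mass one of the
product of approximate delta functions: for zero boundary spins only the zero labelling survives
(`integral_edgeDelta_eq_one`). So redundant delta functions do no harm: a single function with
maximum one is raised to a power and normalised.

In the first stage the delta functions at the edges away from the cuts force the connection to be
flat on the cut manifold, hence trivial there up to gauge, by simple connectedness. In the second
stage those at the edges inside the cuts force the group elements at the triangles of one disc to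
agree, which leaves one `h i` per cut. In both stages the limit is found from orbit means
(`tendsto_integral_pow_of_orbits`): a group of translations preserves the Haar measure and the
peaked function, and at the maximum the mean of the integrand over every orbit is the same number,
namely the next integral. -/

noncomputable section

/-! ### Sign calculus: oriented matchings and the number of closed loops. -/

/-! ### Signs of permutations of disjoint unions -/

-- Both sides are homomorphisms on a product of groups, so it suffices to compare them on the single
-- factors `Pi.mulSingle a σ`, where the left side is the sign of `σ` extended by the identity.
open Classical in
theorem sign_sigmaCongrRight {α : Type*} {β : α → Type*} [Fintype α] [∀ a, Fintype (β a)]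
    [DecidableEq (Σ a, β a)] [∀ a, DecidableEq (β a)] (f : ∀ a, Equiv.Perm (β a)) :
    Equiv.Perm.sign (Equiv.Perm.sigmaCongrRight f) = ∏ a, Equiv.Perm.sign (f a) := by
  let φ : (∀ a, Equiv.Perm (β a)) →* ℤˣ :=
    Equiv.Perm.sign.comp (Equiv.Perm.sigmaCongrRightHom β)
  let ψ : (∀ a, Equiv.Perm (β a)) →* ℤˣ :=
    { toFun := fun f => ∏ a, Equiv.Perm.sign (f a)
      map_one' := by simp
      map_mul' := fun f g => by simp [Finset.prod_mul_distrib] }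
  suffices h : φ = ψ from DFunLike.congr_fun h f
  refine MonoidHom.noncommPiCoprodEquiv.symm.injective (Subtype.ext (funext fun a => ?_))
  refine MonoidHom.ext fun σ => ?_
  change φ (Pi.mulSingle a σ) = ψ (Pi.mulSingle a σ)
  have h2 : ψ (Pi.mulSingle a σ) = Equiv.Perm.sign σ := by
    change ∏ b, Equiv.Perm.sign ((Pi.mulSingle a σ : ∀ b, Equiv.Perm (β b)) b) = _
    rw [Finset.prod_eq_single a]
    · simp
    · intro b _ hb
      simp [Pi.mulSingle_eq_of_ne hb]
    · simp
  rw [h2]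
  change Equiv.Perm.sign (Equiv.Perm.sigmaCongrRight (Pi.mulSingle a σ)) = _
  let e : β a ≃ {x : Σ a, β a // x.1 = a} :=
    { toFun := fun y => ⟨⟨a, y⟩, rfl⟩
      invFun := fun x => x.2 ▸ x.1.2
      left_inv := fun y => rfl
      right_inv := by rintro ⟨⟨b, y⟩, rfl⟩; rfl }
  rw [← Equiv.Perm.sign_extendDomain σ e]
  congr 1
  ext1 ⟨b, y⟩
  by_cases hb : b = a
  · subst hb
    rw [Equiv.Perm.extendDomain_apply_subtype σ e (b := ⟨b, y⟩) rfl]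
    simp [e]
  · rw [Equiv.Perm.extendDomain_apply_not_subtype σ e (b := ⟨b, y⟩) hb]
    simp [Pi.mulSingle_eq_of_ne hb]

/-- The permutation consists of one copy of `ρ` for each element of `β`. For `β = Bool`, the two
ends of an arc, it is therefore even. -/
theorem sign_prodCongr_refl {α β : Type*} [Fintype α] [Fintype β] [DecidableEq α] [DecidableEq β]
    (ρ : Equiv.Perm α) :
    Equiv.Perm.sign (Equiv.prodCongr ρ (Equiv.refl β)) = Equiv.Perm.sign ρ ^ Fintype.card β := by
  have h : Equiv.prodCongr ρ (Equiv.refl β) = Equiv.prodCongrLeft fun _ : β => ρ := by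
    ext x <;> rfl
  rw [h, Equiv.Perm.sign_prodCongrLeft]
  simp

/-! ### Oriented perfect matchings -/

/-- A perfect matching of the points of `S` (a fixed point free involution) with an orientation
of its arcs: the tail of each arc is marked by `true`. -/
structure OMatching (S : Type*) where
  m : S → S
  o : S → Bool
  invol : ∀ s, m (m s) = s
  o_m : ∀ s, o (m s) = !o s

namespace OMatching

variable {S S' : Type*}

/-- A permutation maps the oriented matching `A` to `B`. -/
def Transport (A B : OMatching S) (θ : Equiv.Perm S) : Prop :=
  ∀ s, θ (A.m s) = B.m (θ s) ∧ B.o (θ s) = A.o s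

theorem Transport.trans {A B C : OMatching S} {θ η : Equiv.Perm S} (h : A.Transport B θ)
    (h' : B.Transport C η) : A.Transport C (η * θ) := fun s =>
  ⟨by simp [(h s).1, (h' _).1], by simp [(h s).2, (h' _).2]⟩

theorem Transport.symm {A B : OMatching S} {θ : Equiv.Perm S} (h : A.Transport B θ) :
    B.Transport A θ⁻¹ := fun s =>
  ⟨by rw [Equiv.Perm.inv_eq_iff_eq, (h _).1]; simp, by rw [← (h _).2]; simp⟩

/-- The tails of the arcs. -/
abbrev Tail (A : OMatching S) : Type _ := {s : S // A.o s = true}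

/-- The points of a matching are the tails and heads of its arcs. -/
def tailEquiv (A : OMatching S) : A.Tail × Bool ≃ S where
  toFun r := bif r.2 then r.1.1 else A.m r.1.1
  invFun s := if h : A.o s = true then (⟨s, h⟩, true) else (⟨A.m s, by simp [A.o_m, h]⟩, false)
  left_inv := by
    rintro ⟨⟨r, hr⟩, _ | _⟩
    · simp [A.o_m, hr, A.invol]
    · simp [hr]
  right_inv s := by
    by_cases h : A.o s = true <;> simp [h, A.invol]

theorem tailEquiv_true (A : OMatching S) (r : A.Tail) : A.tailEquiv (r, true) = r.1 := rfl

theorem tailEquiv_false (A : OMatching S) (r : A.Tail) : A.tailEquiv (r, false) = A.m r.1 := rfl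

variable [Fintype S]

theorem prod_eq_tails (A : OMatching S) (f : S → ℂ) :
    ∏ s, f s = ∏ r : A.Tail, f r.1 * f (A.m r.1) := by
  rw [← A.tailEquiv.prod_comp, Fintype.prod_prod_type]
  simp [tailEquiv_true, tailEquiv_false]

theorem card_tail (A : OMatching S) : Fintype.card S = 2 * Fintype.card A.Tail := by
  rw [← Fintype.card_congr A.tailEquiv]
  simp [mul_comm]

/-- The product of a kernel over the arcs of an oriented matching. -/
def weight {I : Type*} (A : OMatching S) (κ : S → I → I → ℂ) (i : S → I) : ℂ :=
  ∏ s, if A.o s then κ s (i s) (i (A.m s)) else 1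

theorem weight_eq_tails {I : Type*} (A : OMatching S) (κ : S → I → I → ℂ) (i : S → I) :
    A.weight κ i = ∏ r : A.Tail, κ r.1 (i r.1) (i (A.m r.1)) := by
  rw [weight, A.prod_eq_tails]
  refine Finset.prod_congr rfl fun r _ => ?_
  simp [r.2, A.o_m]

/-- Both matchings have half as many arcs as there are points; any bijection of the tails extends to
the heads. -/
theorem exists_transport (A B : OMatching S) : ∃ θ, A.Transport B θ := by
  have hc : Fintype.card A.Tail = Fintype.card B.Tail := by
    have := A.card_tail
    have := B.card_tail
    omega
  let e := Fintype.equivOfCardEq hc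
  refine ⟨(A.tailEquiv.symm.trans (Equiv.prodCongr e (Equiv.refl Bool))).trans B.tailEquiv, ?_⟩
  intro s
  obtain ⟨⟨r, b⟩, rfl⟩ := A.tailEquiv.surjective s
  have h1 : A.m (A.tailEquiv (r, b)) = A.tailEquiv (r, !b) := by
    cases b <;> simp [tailEquiv_true, tailEquiv_false, A.invol]
  rw [h1]
  simp only [Equiv.trans_apply, Equiv.symm_apply_apply, Equiv.prodCongr_apply, Prod.map]
  cases b
  · simp [tailEquiv_true, tailEquiv_false, B.invol, B.o_m, A.o_m, r.2, (e r).2]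
  · simp [tailEquiv_true, tailEquiv_false, r.2, (e r).2]

/-- A permutation which preserves an oriented matching moves tail and head of each arc together, so
every exchange of arcs is done twice. -/
theorem Transport.sign_eq_one [DecidableEq S] {A : OMatching S} {θ : Equiv.Perm S} (h : A.Transport A θ) :
    Equiv.Perm.sign θ = 1 := by
  let ρ : Equiv.Perm A.Tail := θ.subtypePerm fun s => by simp [(h s).2]
  have h2 : θ = (A.tailEquiv.symm.trans (Equiv.prodCongr ρ (Equiv.refl Bool))).trans
      A.tailEquiv := by
    ext1 s
    obtain ⟨⟨r, b⟩, rfl⟩ := A.tailEquiv.surjective s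
    cases b
    · simp only [Equiv.trans_apply, Equiv.symm_apply_apply, Equiv.prodCongr_apply, Prod.map]
      exact (h r.1).1
    · simp only [Equiv.trans_apply, Equiv.symm_apply_apply, Equiv.prodCongr_apply, Prod.map]
      rfl
  rw [h2, Equiv.Perm.sign_symm_trans_trans, sign_prodCongr_refl]
  simp

open Classical in
/-- The relative sign of two oriented perfect matchings: the sign of any permutation which maps one
to the other. -/
def relSign (A B : OMatching S) : ℤˣ := Equiv.Perm.sign (exists_transport A B).choose

/-- Independence of the choice: two permutations from `A` to `B` differ by one which preserves `A`,
and this is even. -/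
theorem Transport.relSign_eq [DecidableEq S] {A B : OMatching S} {θ : Equiv.Perm S} (h : A.Transport B θ) :
    relSign A B = Equiv.Perm.sign θ := by
  obtain rfl : ‹DecidableEq S› = fun a b => Classical.propDecidable (a = b) := Subsingleton.elim _ _
  classical
  have h2 := (h.trans (exists_transport A B).choose_spec.symm).sign_eq_one
  rw [map_mul, Equiv.Perm.sign_inv] at h2
  exact mul_eq_one_iff_eq_inv.mp h2 |>.trans (by simp)

theorem relSign_mul (A B C : OMatching S) : relSign A B * relSign B C = relSign A C := by
  classical
  obtain ⟨θ, h⟩ := exists_transport A B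
  obtain ⟨η, h'⟩ := exists_transport B C
  rw [h.relSign_eq, h'.relSign_eq, (h.trans h').relSign_eq, map_mul, mul_comm]

theorem relSign_self (A : OMatching S) : relSign A A = 1 := by
  classical
  have h : A.Transport A 1 := fun s => ⟨rfl, rfl⟩
  rw [h.relSign_eq, map_one]

theorem relSign_comm (A B : OMatching S) : relSign A B = relSign B A := by
  have h := relSign_mul A B A
  rw [relSign_self] at h
  exact mul_eq_one_iff_eq_inv.mp h |>.trans (by simp)

/-- If `A` and `B` commute and reversing an arc of `A` amounts to moving it along `B` — off a set on
which they coincide — then their relative sign is one. -/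
theorem relSign_eq_one_of_mirror (A B : OMatching S) (p : S → Prop)
    (hp : ∀ s, p s → p (A.m s) ∧ p (B.m s) ∧ A.m (B.m s) = B.m (A.m s) ∧ A.o (B.m s) = !A.o s ∧
      B.o (A.m s) = B.o s)
    (hn : ∀ s, ¬ p s → A.m s = B.m s ∧ A.o s = B.o s) : relSign A B = 1 := by
  classical
  -- An orbit of the two commuting involutions within `p` has four points, distinguished by the pair
  -- `(A.o, B.o)`. The point which is a tail for both is fixed, the other three are permuted
  -- cyclically; this carries the arcs of `A` to those of `B`.
  let f : S → S := fun s => if p s then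
    (if A.o s then (if B.o s then s else B.m s) else (if B.o s then B.m (A.m s) else A.m s)) else s
  have hf3 : ∀ s, f (f (f s)) = s := by
    intro s
    by_cases hs : p s
    · obtain ⟨h1, h2, h3, h4, h5⟩ := hp s hs
      obtain ⟨h1', h2', h3', h4', h5'⟩ := hp _ h1
      obtain ⟨h1'', h2'', h3'', h4'', h5''⟩ := hp _ h2
      have e1 := A.o_m s
      have e2 := B.o_m s
      have e3 := A.o_m (B.m s)
      have e4 := B.o_m (A.m s)
      have i1 := A.invol s
      have i2 := B.invol s
      have i3 := A.invol (B.m s)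
      have i4 := B.invol (A.m s)
      cases hA : A.o s <;> cases hB : B.o s <;> simp_all [f]
    · simp [f, hs]
  let θ : Equiv.Perm S := ⟨f, fun s => f (f s), hf3, hf3⟩
  have ht : A.Transport B θ := by
    intro s
    change f (A.m s) = B.m (f s) ∧ B.o (f s) = A.o s
    by_cases hs : p s
    · obtain ⟨h1, h2, h3, h4, h5⟩ := hp s hs
      obtain ⟨h1', h2', h3', h4', h5'⟩ := hp _ h1
      have e1 := A.o_m s
      have e2 := B.o_m s
      have e3 := A.o_m (B.m s)
      have e4 := B.o_m (A.m s)
      have i1 := A.invol s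
      have i2 := B.invol s
      have i4 := B.invol (A.m s)
      cases hA : A.o s <;> cases hB : B.o s <;> simp_all [f]
    · have hs' : ¬ p (A.m s) := by
        intro h
        have := (hp _ h).1
        rw [A.invol] at this
        exact hs this
      simp only [f, hs, hs', if_false]
      exact ⟨(hn s hs).1, (hn s hs).2.symm⟩
  rw [ht.relSign_eq]
  -- A permutation of order dividing three is even.
  have h3 : θ ^ 3 = 1 := by
    ext s
    exact hf3 s
  have h4 := congrArg Equiv.Perm.sign h3
  rw [map_pow, map_one] at h4
  rcases Int.units_eq_one_or (Equiv.Perm.sign θ) with h | h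
  · exact h
  · rw [h] at h4
    exact absurd h4 (by decide)

/-- If the kernel is alternating, then the reversal of arcs changes the weight by the sign of the
two orientations. -/
theorem weight_reorient {I : Type*} (A A' : OMatching S) (hm : A.m = A'.m) (κ : S → I → I → ℂ)
    (hκ : ∀ s i j, κ (A.m s) j i = -κ s i j) (i : S → I) :
    A'.weight κ i = ((relSign A A' : ℤ) : ℂ) * A.weight κ i := by
  classical
  -- Tail and head are exchanged at exactly the arcs which the two orientations direct differently.
  -- Each exchange gives `-1` in the sign, and `-1` in the weight as the kernel is alternating.
  let f : A.Tail → Equiv.Perm Bool := fun r => if A'.o r.1 then 1 else Equiv.swap true false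
  let θ : Equiv.Perm S := (A.tailEquiv.symm.trans (Equiv.prodCongrRight f)).trans A.tailEquiv
  have ht : A.Transport A' θ := by
    intro s
    obtain ⟨⟨r, b⟩, rfl⟩ := A.tailEquiv.surjective s
    have h1 : A.m (A.tailEquiv (r, b)) = A.tailEquiv (r, !b) := by
      cases b <;> simp [tailEquiv_true, tailEquiv_false, A.invol]
    rw [h1]
    have h2 := A'.o_m r.1
    rw [← hm] at h2
    have h3 := A.o_m r.1
    have h4 := A'.invol r.1
    have h5 : ∀ x, θ (A.tailEquiv x) = A.tailEquiv (Equiv.prodCongrRight f x) := by simp [θ]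
    rw [h5, h5]
    cases b <;> cases h : A'.o r.1 <;>
      simp_all [f, tailEquiv_true, tailEquiv_false, r.2]
  have hs : Equiv.Perm.sign θ = ∏ r, Equiv.Perm.sign (f r) := by
    rw [Equiv.Perm.sign_symm_trans_trans, Equiv.Perm.sign_prodCongrRight]
  rw [ht.relSign_eq, hs, weight, A.prod_eq_tails, weight_eq_tails]
  push_cast
  rw [← Finset.prod_mul_distrib]
  refine Finset.prod_congr rfl fun r _ => ?_
  have h2 := A'.o_m r.1
  rw [← hm] at h2
  cases h : A'.o r.1
  · simp [h2, h, f, hκ, ← hm, A.invol]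
  · simp [h2, h, f, ← hm]

/-- Transport of an oriented matching along a permutation. -/
def map (A : OMatching S) (e : S ≃ S') : OMatching S' where
  m s := e (A.m (e.symm s))
  o s := A.o (e.symm s)
  invol s := by simp [A.invol]
  o_m s := by simp [A.o_m]

theorem relSign_map_perm [DecidableEq S] (A B : OMatching S) (θ : Equiv.Perm S) :
    relSign A (B.map θ) = relSign A B * Equiv.Perm.sign θ := by
  have h : B.Transport (B.map θ) θ := fun s => by simp [map]
  rw [← relSign_mul A B, h.relSign_eq]

/-- Two matchings which agree off the image of `S'`, and there are given by `A'` and `B'`. -/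
theorem relSign_extend [Fintype S'] (A B : OMatching S) (A' B' : OMatching S')
    (e : S' → S) (he : Function.Injective e)
    (hA : ∀ s, A.m (e s) = e (A'.m s) ∧ A.o (e s) = A'.o s)
    (hB : ∀ s, B.m (e s) = e (B'.m s) ∧ B.o (e s) = B'.o s)
    (h : ∀ s, s ∉ Set.range e → A.m s = B.m s ∧ A.o s = B.o s) :
    relSign A B = relSign A' B' := by
  classical
  obtain ⟨θ, hθ⟩ := exists_transport A' B'
  let ε : S' ≃ {s // s ∈ Set.range e} := Equiv.ofInjective e he
  have hε : ∀ s, (ε s : S) = e s := fun s => rfl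
  have ht : A.Transport B (θ.extendDomain ε) := by
    intro s
    by_cases hs : s ∈ Set.range e
    · obtain ⟨s, rfl⟩ := hs
      rw [(hA s).1, ← hε, ← hε, Equiv.Perm.extendDomain_apply_image,
        Equiv.Perm.extendDomain_apply_image, hε, hε, hε, (hB _).1, (hB _).2, (hA s).2, (hθ s).1,
        (hθ s).2]
      exact ⟨rfl, rfl⟩
    · have hs' : A.m s ∉ Set.range e := by
        rintro ⟨s', h'⟩
        apply hs
        refine ⟨A'.m s', ?_⟩
        rw [← (hA s').1, h', A.invol]
      rw [Equiv.Perm.extendDomain_apply_not_subtype _ _ hs,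
        Equiv.Perm.extendDomain_apply_not_subtype _ _ hs']
      exact ⟨(h s hs).1, (h s hs).2.symm⟩
  rw [ht.relSign_eq, hθ.relSign_eq, Equiv.Perm.sign_extendDomain]

/-- The disjoint union of oriented matchings. -/
def sigma {ι : Type*} {S : ι → Type*} (A : ∀ t, OMatching (S t)) : OMatching (Σ t, S t) where
  m s := ⟨s.1, (A s.1).m s.2⟩
  o s := (A s.1).o s.2
  invol s := by simp [(A s.1).invol]
  o_m s := (A s.1).o_m s.2

theorem relSign_sigma {ι : Type*} {S : ι → Type*} [Fintype ι] [∀ t, Fintype (S t)]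
    (A B : ∀ t, OMatching (S t)) :
    relSign (sigma A) (sigma B) = ∏ t, relSign (A t) (B t) := by
  classical
  choose θ hθ using fun t => exists_transport (A t) (B t)
  have ht : (sigma A).Transport (sigma B) (Equiv.Perm.sigmaCongrRight θ) := fun s => by
    simp [sigma, (hθ s.1 s.2).1, (hθ s.1 s.2).2]
  rw [ht.relSign_eq, sign_sigmaCongrRight]
  exact Finset.prod_congr rfl fun t _ => ((hθ t).relSign_eq).symm

end OMatching

/-! ### Sums over paths and cycles -/

/-- Summation over the inner states of an open path multiplies the matrices. The function `f` of the
two end states is kept general, because in the induction the last matrix is absorbed in it. -/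
theorem sum_path {I : Type*} [Fintype I] [DecidableEq I] (N : ℕ → Matrix I I ℂ) (m : ℕ) (f : I → I → ℂ) :
    ∑ i : Fin (m + 1) → I, (∏ k : Fin m, N k (i k.castSucc) (i k.succ)) * f (i 0) (i (Fin.last m)) =
      ∑ x, ∑ y, ((List.range m).map N).prod x y * f x y := by
  induction m generalizing f with
  | zero =>
    rw [← (Equiv.funUnique (Fin 1) I).symm.sum_comp]
    simp [Matrix.one_apply]
  | succ m ih =>
    rw [← (Fin.snocEquiv fun _ : Fin (m + 2) => I).sum_comp, Fintype.sum_prod_type,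
      Finset.sum_comm]
    have h : ∀ (i : Fin (m + 1) → I) (c : I),
        (∏ k : Fin (m + 1), N k ((Fin.snocEquiv fun _ : Fin (m + 2) => I) (c, i) k.castSucc)
          ((Fin.snocEquiv fun _ : Fin (m + 2) => I) (c, i) k.succ)) *
        f ((Fin.snocEquiv fun _ : Fin (m + 2) => I) (c, i) 0)
          ((Fin.snocEquiv fun _ : Fin (m + 2) => I) (c, i) (Fin.last (m + 1))) =
        (∏ k : Fin m, N k (i k.castSucc) (i k.succ)) * (N m (i (Fin.last m)) c * f (i 0) c) := by
      intro i c
      rw [Fin.prod_univ_castSucc]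
      have h0 : (0 : Fin (m + 2)) = (0 : Fin (m + 1)).castSucc := rfl
      rw [h0]
      simp only [Fin.snocEquiv_apply, Fin.snoc_castSucc, Fin.snoc_last, Fin.succ_last,
        ← Fin.castSucc_succ, Fin.val_castSucc, Fin.val_last]
      ring
    simp only [h, ← Finset.mul_sum]
    rw [ih fun x y => ∑ c, N m y c * f x c]
    simp only [List.range_succ, List.map_append, List.prod_append, List.map_cons, List.map_nil,
      List.prod_cons, List.prod_nil, mul_one, Matrix.mul_apply, Finset.sum_mul, Finset.mul_sum,
      mul_assoc]
    exact Finset.sum_congr rfl fun x _ => Finset.sum_comm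

/-- The last matrix closes the path and serves as the end function in `sum_path`. -/
theorem sum_cycle {I : Type*} [Fintype I] [DecidableEq I] (N : ℕ → Matrix I I ℂ) (m : ℕ) (hm : 0 < m) :
    ∑ i : Fin m → I, ∏ k : Fin m, N k (i k) (i (finRotate m k)) =
      ((List.range m).map N).prod.trace := by
  obtain ⟨m, rfl⟩ : ∃ n, m = n + 1 := ⟨m - 1, by omega⟩
  have h := sum_path N m fun x y => N m y x
  rw [List.range_succ, List.map_append, List.prod_append]
  simp only [List.map_cons, List.map_nil, List.prod_cons, List.prod_nil, mul_one, Matrix.trace,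
    Matrix.diag, Matrix.mul_apply]
  rw [← h]
  refine Finset.sum_congr rfl fun i _ => ?_
  rw [Fin.prod_univ_castSucc]
  have h0 : ∀ k : Fin m, finRotate (m + 1) k.castSucc = k.succ := fun k => by
    rw [finRotate_apply, Fin.coeSucc_eq_succ]
  simp [h0]

/-! ### Orbits of two fixed point free involutions -/

/-- Two fixed point free involutions of `S`, and the quotient of `S` by them with representatives. -/
structure LoopSystem (S Q : Type*) where
  a : S → S
  b : S → S
  a_invol : ∀ s, a (a s) = s
  b_invol : ∀ s, b (b s) = s
  a_ne : ∀ s, a s ≠ s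
  b_ne : ∀ s, b s ≠ s
  cls : S → Q
  out : Q → S
  cls_out : ∀ q, cls (out q) = q
  cls_a : ∀ s, cls (a s) = cls s
  cls_b : ∀ s, cls (b s) = cls s
  ind : ∀ P : S → Prop, (∀ s, P s → P (a s)) → (∀ s, P s → P (b s)) →
    ∀ s s', cls s = cls s' → P s → P s'

namespace LoopSystem

variable {S Q : Type*} (L : LoopSystem S Q)

/-- Go along both involutions. -/
def step (s : S) : S := L.b (L.a s)

theorem step_a (s : S) : L.step (L.a (L.step s)) = L.a s := by
  simp [step, L.a_invol, L.b_invol]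

/-- The permutation of one step. -/
def perm : Equiv.Perm S where
  toFun := L.step
  invFun s := L.a (L.b s)
  left_inv s := by simp [step, L.a_invol, L.b_invol]
  right_inv s := by simp [step, L.a_invol, L.b_invol]

/-- As in a dihedral group, the reflection `a` conjugates the rotation `perm` to its inverse. -/
theorem perm_zpow_a (j : ℤ) (s : S) : (L.perm ^ j) (L.a s) = L.a ((L.perm ^ (-j)) s) := by
  have h : ∀ (k : ℕ) s, (L.perm ^ k) (L.a ((L.perm ^ k) s)) = L.a s := by
    intro k
    induction k with
    | zero => simp
    | succ k ih =>
      intro s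
      rw [pow_succ', Equiv.Perm.mul_apply, Equiv.Perm.mul_apply, ← Equiv.Perm.mul_apply,
        ← pow_succ', pow_succ, Equiv.Perm.mul_apply]
      have h2 : L.perm (L.a (L.perm ((L.perm ^ k) s))) = L.a ((L.perm ^ k) s) := L.step_a _
      rw [h2, ih]
  rcases Int.eq_nat_or_neg j with ⟨k, rfl | rfl⟩
  · have h2 : L.a ((L.perm ^ (-(k : ℤ))) s) = (L.perm ^ k) (L.a ((L.perm ^ k) ((L.perm ^ k)⁻¹ s))) := by
      rw [h, zpow_neg, zpow_natCast]
    rw [h2, ← Equiv.Perm.mul_apply (L.perm ^ k) (L.perm ^ k)⁻¹, mul_inv_cancel, zpow_natCast]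
    rfl
  · have := h k s
    rw [neg_neg, zpow_neg, zpow_natCast, Equiv.Perm.inv_eq_iff_eq, this]

/-- Otherwise a reflection of the dihedral group would have a fixed point: an even power gives a
fixed point of `a`, an odd one a fixed point of `b`. Thus every loop has two disjoint classes of
points, which can be coloured alternately. -/
theorem perm_zpow_ne (j : ℤ) (s : S) : (L.perm ^ j) s ≠ L.a s := by
  intro h
  rcases Int.even_or_odd' j with ⟨r, rfl | rfl⟩
  · apply L.a_ne ((L.perm ^ r) s)
    have h2 := congrArg (L.perm ^ (-r)) h
    rw [L.perm_zpow_a, ← Equiv.Perm.mul_apply, ← zpow_add, neg_neg] at h2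
    rw [← h2]
    congr 2
    ring
  · apply L.b_ne (L.a ((L.perm ^ r) s))
    have h2 := congrArg (L.perm ^ (-r)) h
    rw [L.perm_zpow_a, ← Equiv.Perm.mul_apply, ← zpow_add, neg_neg] at h2
    have h3 : (L.perm ^ (-r + (2 * r + 1))) s = L.perm ((L.perm ^ r) s) := by
      rw [← Equiv.Perm.mul_apply, ← zpow_one_add]
      congr 2
      ring
    exact h3.symm.trans h2

theorem iterate_ne (k l : ℕ) (s : S) : L.step^[k] s ≠ L.a (L.step^[l] s) := by
  have h : ∀ k, L.step^[k] s = (L.perm ^ (k : ℤ)) s := fun k => by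
    rw [zpow_natCast, ← Equiv.Perm.iterate_eq_pow]; rfl
  rw [h, h]
  intro h2
  apply L.perm_zpow_ne (k + l) s
  rw [add_comm, zpow_add, Equiv.Perm.mul_apply, h2, L.perm_zpow_a, ← Equiv.Perm.mul_apply,
    ← zpow_add]
  simp

theorem cls_step (s : S) : L.cls (L.step s) = L.cls s := by rw [step, L.cls_b, L.cls_a]

theorem cls_iterate (k : ℕ) (s : S) : L.cls (L.step^[k] s) = L.cls s := by
  induction k with
  | zero => rfl
  | succ k ih => rw [Function.iterate_succ_apply', cls_step, ih]

/-- The number of steps of a loop. -/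
def len (q : Q) : ℕ := Function.minimalPeriod L.step (L.out q)

theorem step_injective : Function.Injective L.step := L.perm.injective

theorem iterate_finRotate (q : Q) (k : Fin (L.len q)) :
    L.step^[(finRotate _ k : Fin (L.len q)).1] (L.out q) = L.step (L.step^[k.1] (L.out q)) := by
  rw [← Function.iterate_succ_apply' L.step k.1]
  have h : ((finRotate _ k : Fin (L.len q)) : ℕ) = (k + 1) % L.len q := by
    have hp : 0 < L.len q := k.pos
    generalize L.len q = m at k hp
    obtain ⟨m, rfl⟩ : ∃ n, m = n + 1 := ⟨m - 1, by omega⟩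
    rw [finRotate_apply, Fin.val_add, Fin.val_one']
    simp
  rw [h]
  exact Function.iterate_mod_minimalPeriod_eq

/-- The points of all loops, in the order in which they are met. -/
def point (x : Σ q : Q, Fin (L.len q) × Bool) : S :=
  bif x.2.2 then L.step^[x.2.1] (L.out x.1) else L.a (L.step^[x.2.1] (L.out x.1))

theorem cls_point (x : Σ q : Q, Fin (L.len q) × Bool) : L.cls (L.point x) = x.1 := by
  rcases x with ⟨q, k, _ | _⟩
  · simp [point, L.cls_a, cls_iterate, L.cls_out]
  · simp [point, cls_iterate, L.cls_out]

theorem a_point (q : Q) (k : Fin (L.len q)) (c : Bool) :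
    L.a (L.point ⟨q, k, c⟩) = L.point ⟨q, k, !c⟩ := by
  cases c <;> simp [point, L.a_invol]

theorem b_point_false (q : Q) (k : Fin (L.len q)) :
    L.b (L.point ⟨q, k, false⟩) = L.point ⟨q, finRotate _ k, true⟩ := by
  simp only [point, cond_true, cond_false]
  rw [L.iterate_finRotate]
  rfl

variable [Finite S]

theorem len_pos (q : Q) : 0 < L.len q :=
  Function.minimalPeriod_pos_of_mem_periodicPts (L.step_injective.mem_periodicPts _)

/-- Injectivity is minimality of the period together with `iterate_ne`; surjectivity holds since the
listed points are closed under both involutions and meet every class. -/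
theorem point_bijective : Function.Bijective L.point := by
  constructor
  · rintro ⟨q, k, c⟩ ⟨q', k', c'⟩ h
    obtain rfl : q = q' := by
      have := congrArg L.cls h
      rwa [cls_point, cls_point] at this
    have hk : ∀ k k' : Fin (L.len q), L.step^[k] (L.out q) = L.step^[k'] (L.out q) → k = k' := by
      intro k k' h
      apply Fin.ext
      rwa [Function.iterate_eq_iterate_iff_of_lt_minimalPeriod k.2 k'.2] at h
    cases c <;> cases c'
    · have h2 := congrArg L.a h
      simp only [point, cond_false, L.a_invol] at h2
      obtain rfl := hk _ _ h2
      rfl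
    · exact absurd h.symm (L.iterate_ne _ _ _)
    · exact absurd h (L.iterate_ne _ _ _)
    · obtain rfl := hk _ _ h
      rfl
  · intro s
    refine L.ind (fun s => ∃ x, L.point x = s) ?_ ?_ (L.out (L.cls s)) s (L.cls_out _) ?_
    · rintro _ ⟨⟨q, k, c⟩, rfl⟩
      exact ⟨_, (L.a_point q k c).symm⟩
    · rintro _ ⟨⟨q, k, _ | _⟩, rfl⟩
      · exact ⟨_, (L.b_point_false q k).symm⟩
      · obtain ⟨k', rfl⟩ := (finRotate _).surjective k
        refine ⟨⟨q, k', false⟩, ?_⟩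
        rw [← L.b_point_false, L.b_invol]
    · exact ⟨⟨L.cls s, ⟨0, L.len_pos _⟩, true⟩, rfl⟩

/-- All points of `S`, arranged by loops. -/
def equiv : (Σ q : Q, Fin (L.len q) × Bool) ≃ S := Equiv.ofBijective _ L.point_bijective

theorem equiv_apply (x : Σ q : Q, Fin (L.len q) × Bool) : L.equiv x = L.point x := rfl

/-- The points with even distance from the representative of their loop. -/
def color (s : S) : Bool := (L.equiv.symm s).2.2

theorem color_point (x : Σ q : Q, Fin (L.len q) × Bool) : L.color (L.point x) = x.2.2 := by
  rw [color, ← equiv_apply, Equiv.symm_apply_apply]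

theorem color_out (q : Q) : L.color (L.out q) = true :=
  L.color_point ⟨q, ⟨0, L.len_pos _⟩, true⟩

theorem color_a (s : S) : L.color (L.a s) = !L.color s := by
  obtain ⟨⟨q, k, c⟩, rfl⟩ := L.point_bijective.2 s
  rw [a_point, color_point, color_point]

theorem color_b (s : S) : L.color (L.b s) = !L.color s := by
  have h : ∀ s, L.color s = false → L.color (L.b s) = true := by
    intro s hs
    obtain ⟨⟨q, k, c⟩, rfl⟩ := L.point_bijective.2 s
    rw [color_point] at hs
    obtain rfl : c = false := hs
    rw [b_point_false, color_point]
  cases hs : L.color s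
  · exact h s hs
  · cases hb : L.color (L.b s)
    · rfl
    · obtain ⟨⟨q, k, c⟩, rfl⟩ := L.point_bijective.2 s
      rw [color_point] at hs
      obtain rfl : c = true := hs
      obtain ⟨k', rfl⟩ := (finRotate _).surjective k
      rw [← L.b_point_false, L.b_invol, color_point] at hb
      exact absurd hb (by simp)

/-- The matching by the first involution, oriented along the loops. -/
def matchA : OMatching S := ⟨L.a, L.color, L.a_invol, L.color_a⟩

/-- The matching by the second involution, oriented along the loops. -/
def matchB : OMatching S := ⟨L.b, fun s => !L.color s, L.b_invol, fun s => by rw [L.color_b]⟩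

/-- This is where the minus sign of a closed loop comes from. On a loop with `2m` points the arcs of
the first matching go to those of the second by `m` exchanges of the two colours, followed by a
cyclic shift of `m` points, with total sign `(-1)^m (-1)^(m-1) = -1`. -/
theorem relSign_match [Fintype S] [Fintype Q] :
    L.matchA.relSign L.matchB = (-1) ^ Fintype.card Q := by
  classical
  let flip : Equiv.Perm Bool := Equiv.swap true false
  let f : ∀ q : Q, Equiv.Perm (Fin (L.len q) × Bool) := fun q =>
    (Equiv.prodCongrLeft fun c : Bool => if c then finRotate (L.len q) else 1) *
      (Equiv.prodCongrRight fun _ => flip)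
  have hf : ∀ q, Equiv.Perm.sign (f q) = -1 := by
    intro q
    have hp := L.len_pos q
    simp only [f, map_mul, Equiv.Perm.sign_prodCongrLeft, Equiv.Perm.sign_prodCongrRight]
    generalize L.len q = m at hp
    obtain ⟨m, rfl⟩ : ∃ n, m = n + 1 := ⟨m - 1, by omega⟩
    simp only [Fintype.prod_bool, if_true, sign_finRotate, flip]
    rw [Equiv.Perm.sign_swap (by simp)]
    simp only [Finset.prod_const, Finset.card_univ, Fintype.card_fin, add_tsub_cancel_right,
      Bool.false_eq_true, if_false, map_one, mul_one]
    rw [← pow_add, Odd.neg_one_pow ⟨m, by omega⟩]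
  let θ : Equiv.Perm S := (L.equiv.symm.trans (Equiv.Perm.sigmaCongrRight f)).trans L.equiv
  have hθ : ∀ x, θ (L.equiv x) = L.equiv (Equiv.Perm.sigmaCongrRight f x) := by simp [θ]
  have ht : L.matchA.Transport L.matchB θ := by
    intro s
    obtain ⟨⟨q, k, c⟩, rfl⟩ := L.equiv.surjective s
    have h1 : L.matchA.m (L.equiv ⟨q, k, c⟩) = L.equiv ⟨q, k, !c⟩ := L.a_point q k c
    rw [h1, hθ, hθ]
    have hb := L.b_point_false q k
    have hb' : L.b (L.point ⟨q, finRotate _ k, true⟩) = L.point ⟨q, k, false⟩ := by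
      rw [← hb, L.b_invol]
    cases c <;>
      simp [f, flip, matchA, matchB, equiv_apply, color_point, hb, hb', -finRotate_apply]
  rw [ht.relSign_eq, Equiv.Perm.sign_symm_trans_trans, sign_sigmaCongrRight]
  simp [hf]

theorem prod_point [Fintype S] [Fintype Q] (f : S → ℂ) : ∏ s, f s =
    ∏ q : Q, ∏ k : Fin (L.len q), f (L.point ⟨q, k, true⟩) * f (L.point ⟨q, k, false⟩) := by
  classical
  rw [← L.equiv.prod_comp, Fintype.prod_sigma]
  simp [Fintype.prod_prod_type, equiv_apply]

/-- Summing a product of kernels over all states yields the product of the traces along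
the loops. -/
theorem sum_weight [Fintype S] [DecidableEq S] [Fintype Q] {I : Type*} [Fintype I] [DecidableEq I]
    (κ κ' : S → I → I → ℂ) :
    ∑ i : S → I, L.matchA.weight κ i * L.matchB.weight κ' i =
      ∏ q, ((List.range (L.len q)).map fun k => Matrix.of (κ (L.step^[k] (L.out q))) *
        Matrix.of (κ' (L.a (L.step^[k] (L.out q))))).prod.trace := by
  classical
  have hw : ∀ i : S → I, L.matchA.weight κ i * L.matchB.weight κ' i =
      ∏ q : Q, ∏ k : Fin (L.len q),
        κ (L.point ⟨q, k, true⟩) (i (L.point ⟨q, k, true⟩)) (i (L.point ⟨q, k, false⟩)) *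
        κ' (L.point ⟨q, k, false⟩) (i (L.point ⟨q, k, false⟩))
          (i (L.point ⟨q, finRotate _ k, true⟩)) := by
    intro i
    rw [OMatching.weight, OMatching.weight, ← Finset.prod_mul_distrib, L.prod_point]
    refine Finset.prod_congr rfl fun q _ => Finset.prod_congr rfl fun k _ => ?_
    simp [matchA, matchB, color_point, a_point, b_point_false, -finRotate_apply]
  let E : (∀ q : Q, Fin (L.len q) × Bool → I) ≃ (S → I) :=
    (Equiv.piCurry fun (q : Q) (_ : Fin (L.len q) × Bool) => I).symm.trans
      (Equiv.arrowCongr L.equiv (Equiv.refl I))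
  have hE : ∀ i q k c, E i (L.point ⟨q, k, c⟩) = i q (k, c) := by
    intro i q k c
    change Sigma.uncurry i (L.equiv.symm (L.equiv ⟨q, k, c⟩)) = _
    rw [Equiv.symm_apply_apply]
    rfl
  rw [← E.sum_comp]
  simp only [hw, hE]
  have h := Finset.prod_univ_sum (fun _ => Finset.univ)
    (fun (q : Q) (i : Fin (L.len q) × Bool → I) => ∏ k : Fin (L.len q),
        κ (L.point ⟨q, k, true⟩) (i (k, true)) (i (k, false)) *
        κ' (L.point ⟨q, k, false⟩) (i (k, false)) (i (finRotate _ k, true)))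
  rw [Fintype.piFinset_univ] at h
  rw [← h]
  refine Finset.prod_congr rfl fun q _ => ?_
  rw [← sum_cycle (fun k => Matrix.of (κ (L.step^[k] (L.out q))) *
    Matrix.of (κ' (L.a (L.step^[k] (L.out q))))) _ (L.len_pos q)]
  -- The states of colour `false` are the summation indices of the matrix products, and those of
  -- colour `true` remain as the indices of the cycle.
  let e : (Fin (L.len q) × Bool → I) ≃ (Fin (L.len q) → I) × (Fin (L.len q) → I) :=
    { toFun := fun i => (fun k => i (k, true), fun k => i (k, false))
      invFun := fun p x => bif x.2 then p.1 x.1 else p.2 x.1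
      left_inv := fun i => by ext ⟨k, c⟩; cases c <;> rfl
      right_inv := fun p => rfl }
  rw [← e.symm.sum_comp, Fintype.sum_prod_type]
  refine Finset.sum_congr rfl fun i _ => ?_
  simp only [Matrix.mul_apply]
  rw [Finset.prod_univ_sum, Fintype.piFinset_univ]
  rfl

end LoopSystem

/-! ### Spin networks as contractions of spinor tensors. -/

/-! ### Evaluation of a spin network as a contraction of tensors -/

/-- The invariant antisymmetric form on `ℂ²`. -/
def epsMat : Matrix (Fin 2) (Fin 2) ℂ := !![0, 1; -1, 0]

/-- The inverse of the invariant antisymmetric form. -/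
def epsInv : Matrix (Fin 2) (Fin 2) ℂ := !![0, -1; 1, 0]

theorem epsInv_mul_epsMat : epsInv * epsMat = 1 := by
  ext i j; fin_cases i <;> fin_cases j <;> simp [epsInv, epsMat]

theorem epsMat_mul_epsInv : epsMat * epsInv = 1 := by
  ext i j; fin_cases i <;> fin_cases j <;> simp [epsInv, epsMat]

theorem epsMat_transpose : epsMat.transpose = epsInv := by
  ext i j; fin_cases i <;> fin_cases j <;> simp [epsInv, epsMat]

theorem epsInv_transpose : epsInv.transpose = epsMat := by
  rw [← epsMat_transpose, Matrix.transpose_transpose]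

theorem epsInv_eq_neg : epsInv = -epsMat := by
  ext i j; fin_cases i <;> fin_cases j <;> simp [epsInv, epsMat]

/-- For a 2×2 matrix, `gᵀ ε g = (det g) ε`. -/
theorem SU2.transpose_mul_eps (g : SU2) : g.1.transpose * epsMat * g.1 = epsMat := by
  have h : g.1.det = 1 := (Matrix.mem_specialUnitaryGroup_iff.mp g.2).2
  rw [Matrix.det_fin_two] at h
  ext i j
  fin_cases i <;> fin_cases j <;>
    simp [epsMat, Matrix.mul_apply, Fin.sum_univ_two] <;>
    first | ring1 | linear_combination h | linear_combination -1 * h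

theorem SU2.coe_mul_inv (g : SU2) : g.1 * (g⁻¹).1 = 1 := by
  have h : g * g⁻¹ = 1 := mul_inv_cancel g
  exact congrArg Subtype.val h

theorem SU2.eps_mul_inv (g : SU2) : epsMat * (g⁻¹).1 = g.1.transpose * epsMat := by
  rw [← g.transpose_mul_eps, Matrix.mul_assoc, Matrix.mul_assoc, SU2.coe_mul_inv, Matrix.mul_one,
    g.transpose_mul_eps]

/-- A link traversed backwards carries the inverse group element. So the link kernel is alternating,
and its sign can be traded against the orientation of the strand by `weight_reorient`. -/
theorem SU2.eps_mul_alternating (g : SU2) (i j : Fin 2) :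
    (epsMat * (g⁻¹).1) j i = -(epsMat * g.1) i j := by
  have h : (epsMat * (g⁻¹).1) = -(epsMat * g.1).transpose := by
    rw [SU2.eps_mul_inv, Matrix.transpose_mul, epsMat_transpose, epsInv_eq_neg, Matrix.mul_neg,
      neg_neg]
  rw [h]
  rfl

theorem epsInv_alternating (i j : Fin 2) : epsInv j i = -epsInv i j := by
  fin_cases i <;> fin_cases j <;> simp [epsInv]

/-- The loops formed by two fixed point free involutions. -/
def LoopSystem.ofQuot {S : Type*} (a b : S → S) (ha : ∀ s, a (a s) = s) (hb : ∀ s, b (b s) = s)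
    (ha' : ∀ s, a s ≠ s) (hb' : ∀ s, b s ≠ s) :
    LoopSystem S (Quot fun s s' => s' = a s ∨ s' = b s) where
  a := a
  b := b
  a_invol := ha
  b_invol := hb
  a_ne := ha'
  b_ne := hb'
  cls := Quot.mk _
  out := Quot.out
  cls_out := Quot.out_eq
  cls_a _ := (Quot.sound (r := fun s s' => s' = a s ∨ s' = b s) (Or.inl rfl)).symm
  cls_b _ := (Quot.sound (r := fun s s' => s' = a s ∨ s' = b s) (Or.inr rfl)).symm
  ind := by
    intro P h1 h2 s s' h hs
    have h3 : ∀ s s', (s' = a s ∨ s' = b s) → P s = P s' := by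
      rintro s s' (rfl | rfl)
      · exact propext ⟨h1 s, fun h => ha s ▸ h1 _ h⟩
      · exact propext ⟨h2 s, fun h => hb s ▸ h2 _ h⟩
    have h4 : P s = P s' := congrArg (Quot.lift P h3) h
    exact h4 ▸ hs

namespace OMatching

theorem m_ne {S : Type*} (A : OMatching S) (s : S) : A.m s ≠ s := fun h => by
  have h2 := A.o_m s
  rw [h] at h2
  simp at h2

variable {S : Type*} [Fintype S]

theorem weight_map {I : Type*} (A : OMatching S) (e : Equiv.Perm S) (κ : S → I → I → ℂ)
    (hκ : ∀ s, κ (e s) = κ s) (i : S → I) : (A.map e).weight κ i = A.weight κ (i ∘ e) := by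
  rw [weight, weight, ← Equiv.prod_comp e]
  refine Finset.prod_congr rfl fun s _ => ?_
  simp [map, hκ]

/-- Signed contractions do not depend on the orientations. -/
theorem relSign_weight_congr {I : Type*} {A A' B B' : OMatching S} (hA : A.m = A'.m) (hB : B.m = B'.m)
    {κ κ' : S → I → I → ℂ} (hκ : ∀ s i j, κ (A.m s) j i = -κ s i j)
    (hκ' : ∀ s i j, κ' (B.m s) j i = -κ' s i j) (i j : S → I) :
    ((relSign A B : ℤ) : ℂ) * (A.weight κ i * B.weight κ' j) =
      ((relSign A' B' : ℤ) : ℂ) * (A'.weight κ i * B'.weight κ' j) := by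
  rw [A.weight_reorient A' hA κ hκ, B.weight_reorient B' hB κ' hκ', ← relSign_mul A A' B,
    ← relSign_mul A' B' B, relSign_comm B' B]
  push_cast
  ring

end OMatching

/-! #### Strands -/

/-- A map of the legs, with ribbons attached without twist. -/
def strandMap {D : Type*} (ℓ : D → ℕ) (a : D → D) (h : ∀ d, ℓ (a d) = ℓ d) (s : Σ d, Fin (ℓ d)) :
    Σ d, Fin (ℓ d) :=
  ⟨a s.1, Fin.cast (h s.1).symm (Fin.rev s.2)⟩

theorem strand_ext {D : Type*} {ℓ : D → ℕ} {s s' : Σ d, Fin (ℓ d)} (h : s.1 = s'.1)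
    (h2 : (s.2 : ℕ) = s'.2) : s = s' := by
  rcases s with ⟨d, p⟩
  rcases s' with ⟨d', p'⟩
  obtain rfl : d = d' := h
  obtain rfl : p = p' := Fin.ext h2
  rfl

/-- The matching of the strands along links. -/
def strandMatching {D : Type*} (ℓ : D → ℕ) (a : D → D) (h : ∀ d, ℓ (a d) = ℓ d)
    (ha : ∀ d, a (a d) = d) (o : D → Bool) (ho : ∀ d, o (a d) = !o d) :
    OMatching (Σ d, Fin (ℓ d)) where
  m := strandMap ℓ a h
  o s := o s.1
  invol s := strand_ext (ha _) (by
    have := h s.1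
    have := s.2.2
    simp only [strandMap, Fin.val_cast, Fin.val_rev]
    omega)
  o_m s := ho _

/-- The symmetrization of `n` spinors. -/
def symKernel (n : ℕ) (i j : Fin n → Fin 2) : ℂ :=
  (n.factorial : ℂ)⁻¹ * ∑ σ : Equiv.Perm (Fin n), if i ∘ σ = j then 1 else 0

/-- The average over the permutations of the strands of all legs is a contraction with symmetrizers:
the delta functions in `symKernel` pick out the permuted state. -/
theorem sum_symKernel {D : Type*} [Fintype D] [DecidableEq D] (ℓ : D → ℕ)
    (f : (Σ d, Fin (ℓ d)) → Fin 2) (F : ((Σ d, Fin (ℓ d)) → Fin 2) → ℂ) :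
    ∑ τ : ∀ d, Equiv.Perm (Fin (ℓ d)), (∏ d, ((ℓ d).factorial : ℂ)⁻¹) *
        F (f ∘ (Equiv.Perm.sigmaCongrRight τ)) =
      ∑ j, (∏ d, symKernel (ℓ d) (fun p => f ⟨d, p⟩) fun p => j ⟨d, p⟩) * F j := by
  classical
  simp only [symKernel, Finset.prod_mul_distrib, Finset.prod_univ_sum, Fintype.piFinset_univ,
    Finset.mul_sum, Finset.sum_mul]
  rw [Finset.sum_comm]
  refine Finset.sum_congr rfl fun τ _ => ?_
  rw [Finset.sum_eq_single (f ∘ (Equiv.Perm.sigmaCongrRight τ))]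
  · have h : ∏ d, (if (fun p => f ⟨d, p⟩) ∘ ⇑(τ d) =
        fun p => (f ∘ ⇑(Equiv.Perm.sigmaCongrRight τ)) ⟨d, p⟩ then (1 : ℂ) else 0) = 1 :=
      Finset.prod_eq_one fun d _ => if_pos rfl
    rw [h, mul_one]
  · intro j _ hj
    have : ∃ d, (fun p => f ⟨d, p⟩) ∘ (τ d) ≠ fun p => j ⟨d, p⟩ := by
      by_contra! h
      apply hj
      ext1 ⟨d, p⟩
      exact (congrFun (h d) p).symm
    obtain ⟨d, hd⟩ := this
    have h : ∏ d, (if (fun p => f ⟨d, p⟩) ∘ ⇑(τ d) = fun p => j ⟨d, p⟩ then (1 : ℂ) else 0) = 0 :=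
      Finset.prod_eq_zero (Finset.mem_univ d) (if_neg hd)
    rw [h, mul_zero, zero_mul]
  · simp

namespace SpinNetwork

variable {D : Type*} (N : SpinNetwork D)

/-- The half-links at a vertex are three in number, links have two ends, and group elements are
inverted when links are traversed backwards. -/
structure Regular : Prop where
  rot_rot_rot : ∀ d, N.rot (N.rot (N.rot d)) = d
  rot_ne : ∀ d, N.rot d ≠ d
  opp_opp : ∀ d, N.opp (N.opp d) = d
  opp_ne : ∀ d, N.opp d ≠ d
  hol_opp : ∀ d, N.hol (N.opp d) = (N.hol d)⁻¹

/-- All vertices carry admissible labels. -/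
def AllAdmissible : Prop :=
  ∀ d, Admissible (N.label d) (N.label (N.rot d)) (N.label (N.rot (N.rot d)))

/-- The strand leads to the next leg of the vertex. -/
def toNext (s : N.Strand) : Bool :=
  !decide ((s.2 : ℕ) < (N.label (N.rot (N.rot s.1)) + N.label s.1 - N.label (N.rot s.1)) / 2)

variable {N}

/-- For admissible labels the bound tested in `atVertex` holds, so that its default value is never
taken. -/
theorem atVertex_of_toNext (ha : N.AllAdmissible) {s : N.Strand} (h : N.toNext s = true) :
    (N.atVertex s).1 = N.rot s.1 ∧ ((N.atVertex s).2 : ℕ) = N.label s.1 - 1 - s.2 := by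
  have h1 : ¬ (s.2 : ℕ) < (N.label (N.rot (N.rot s.1)) + N.label s.1 - N.label (N.rot s.1)) / 2 := by
    simpa [toNext] using h
  obtain ⟨h2, h3, h4, h5⟩ := ha s.1
  have h6 := s.2.2
  have h7 : N.label s.1 - 1 - s.2 < N.label (N.rot s.1) := by
    obtain ⟨m, hm⟩ := h2
    omega
  have h8 : N.atVertex s = ⟨N.rot s.1, ⟨N.label s.1 - 1 - s.2, h7⟩⟩ := by
    unfold atVertex
    simp only [h1, if_false, h7, dif_pos]
  rw [h8]
  exact ⟨rfl, rfl⟩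

theorem atVertex_of_not_toNext (ha : N.AllAdmissible) {s : N.Strand} (h : N.toNext s = false) :
    (N.atVertex s).1 = N.rot (N.rot s.1) ∧
      ((N.atVertex s).2 : ℕ) = N.label (N.rot (N.rot s.1)) - 1 - s.2 := by
  have h1 : (s.2 : ℕ) < (N.label (N.rot (N.rot s.1)) + N.label s.1 - N.label (N.rot s.1)) / 2 := by
    simpa [toNext] using h
  obtain ⟨h2, h3, h4, h5⟩ := ha s.1
  have h6 := s.2.2
  have h7 : N.label (N.rot (N.rot s.1)) - 1 - s.2 < N.label (N.rot (N.rot s.1)) := by omega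
  have h8 : N.atVertex s =
      ⟨N.rot (N.rot s.1), ⟨N.label (N.rot (N.rot s.1)) - 1 - s.2, h7⟩⟩ := by
    unfold atVertex
    simp only [h1, if_true, h7, dif_pos]
  rw [h8]
  exact ⟨rfl, rfl⟩

/-- The number of strands joining two legs is the same seen from either leg. This needs the parity
condition, by which the division by two in `toNext` is exact. -/
theorem toNext_atVertex (h3 : ∀ d, N.rot (N.rot (N.rot d)) = d) (ha : N.AllAdmissible) (s : N.Strand) :
    N.toNext (N.atVertex s) = !N.toNext s := by
  obtain ⟨⟨m, hm⟩, a3, a4, a5⟩ := ha s.1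
  have h6 := s.2.2
  cases h : N.toNext s
  · obtain ⟨e1, e2⟩ := atVertex_of_not_toNext ha h
    simp only [toNext, Bool.not_eq_eq_eq_not, Bool.not_false, decide_eq_true_eq, Bool.not_true,
      decide_eq_false_iff_not] at h ⊢
    rw [e2, e1, h3, h3]
    omega
  · obtain ⟨e1, e2⟩ := atVertex_of_toNext ha h
    simp only [toNext, Bool.not_eq_eq_eq_not, Bool.not_false, decide_eq_true_eq, Bool.not_true,
      decide_eq_false_iff_not] at h ⊢
    rw [e2, e1, h3]
    omega

theorem atVertex_atVertex (h3 : ∀ d, N.rot (N.rot (N.rot d)) = d) (ha : N.AllAdmissible)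
    (s : N.Strand) : N.atVertex (N.atVertex s) = s := by
  have hn := toNext_atVertex h3 ha s
  have h6 := s.2.2
  cases h : N.toNext s
  · obtain ⟨e1, e2⟩ := atVertex_of_not_toNext ha h
    rw [h] at hn
    obtain ⟨e3, e4⟩ := atVertex_of_toNext ha hn
    refine strand_ext (by rw [e3, e1, h3]) ?_
    rw [e4, e2, e1]
    simp only [toNext, Bool.not_eq_eq_eq_not, Bool.not_false, decide_eq_true_eq] at h
    obtain ⟨-, a3, a4, a5⟩ := ha s.1
    omega
  · obtain ⟨e1, e2⟩ := atVertex_of_toNext ha h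
    rw [h] at hn
    obtain ⟨e3, e4⟩ := atVertex_of_not_toNext ha hn
    refine strand_ext (by rw [e3, e1, h3]) ?_
    rw [e4, e2, e1, h3]
    omega

/-- The matching of the strands at the vertices, oriented by the cyclic orders. -/
def vertexMatching (h3 : ∀ d, N.rot (N.rot (N.rot d)) = d) (ha : N.AllAdmissible) :
    OMatching N.Strand :=
  ⟨N.atVertex, N.toNext, atVertex_atVertex h3 ha, toNext_atVertex h3 ha⟩

/-- The matching of the strands along the links. -/
def linkMatching (N : SpinNetwork D) (hN : N.Regular) (o : D → Bool) (ho : ∀ d, o (N.opp d) = !o d) :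
    OMatching N.Strand :=
  strandMatching N.label N.opp N.label_opp hN.opp_opp o ho

/-- The kernel at the strands of a vertex. -/
def vertexKernel {S : Type*} (_ : S) : Fin 2 → Fin 2 → ℂ := epsInv

theorem vertexKernel_alternating {S : Type*} (s s' : S) (i j : Fin 2) :
    vertexKernel s' j i = -vertexKernel s i j := epsInv_alternating i j

/-- The kernel along the strands of a link. -/
def linkKernel (N : SpinNetwork D) (s : N.Strand) : Fin 2 → Fin 2 → ℂ := epsMat * (N.hol s.1).1

theorem linkKernel_alternating (hN : N.Regular) {s s' : N.Strand} (h : s'.1 = N.opp s.1)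
    (i j : Fin 2) : N.linkKernel s' j i = -N.linkKernel s i j := by
  have h2 : N.linkKernel s' = (epsMat * ((N.hol s.1)⁻¹).1 : Matrix _ _ ℂ) := by
    rw [← hN.hol_opp, ← h, linkKernel]
  rw [h2]
  exact SU2.eps_mul_alternating _ _ _

theorem eval_eq_zero [Fintype D] (ha : ¬ N.AllAdmissible) : N.eval = 0 := if_neg ha

/-- The factors `-1` of the loops are collected in a relative sign by `relSign_match`. The traces
are the sum over spinor states by `sum_weight`, as the kernels `epsInv` at the vertices and `epsMat
* hol` along the links multiply to the group element. Both kernels are alternating, so the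
orientations along the loops, which depend on `τ`, can be replaced by fixed ones. -/
theorem prod_loops [Fintype D] [DecidableEq D] (hN : N.Regular) (ha : N.AllAdmissible) (o : D → Bool)
    (ho : ∀ d, o (N.opp d) = !o d) (τ : ∀ d, Equiv.Perm (Fin (N.label d))) :
    ∏ᶠ l : N.Loop τ, -(N.loopHol τ (Quot.out l)).1.trace =
      ((OMatching.relSign (vertexMatching hN.rot_rot_rot ha) (N.linkMatching hN o ho) : ℤ) : ℂ) *
      (∏ d, ((Equiv.Perm.sign (τ d) : ℤ) : ℂ)) *
      ∑ i : N.Strand → Fin 2, (vertexMatching hN.rot_rot_rot ha).weight vertexKernel i *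
        (N.linkMatching hN o ho).weight N.linkKernel (i ∘ ⇑(Equiv.Perm.sigmaCongrRight τ)⁻¹) := by
  classical
  set V := vertexMatching hN.rot_rot_rot ha with hV
  set L := N.linkMatching hN o ho with hL
  let T : Equiv.Perm N.Strand := Equiv.Perm.sigmaCongrRight τ
  -- Permuting the strands moves the link matching along a permutation of the strand ends; this is
  -- the origin of the product of the signs of `τ`.
  have hm : (L.map T⁻¹).m = N.alongLink τ := rfl
  let Λ : LoopSystem N.Strand (N.Loop τ) :=
    LoopSystem.ofQuot N.atVertex (N.alongLink τ) V.invol (L.map T⁻¹).invol V.m_ne (L.map T⁻¹).m_ne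
  have : Fintype (N.Loop τ) := Fintype.ofFinite (Quot _)
  have hκ : ∀ s i j, N.linkKernel (Λ.matchB.m s) j i = -N.linkKernel s i j := fun s i j =>
    linkKernel_alternating hN rfl i j
  have hA : Λ.matchA.m = V.m := rfl
  have hB : Λ.matchB.m = (L.map T⁻¹).m := rfl
  have hs := Λ.sum_weight vertexKernel N.linkKernel
  -- Sign and weights together do not depend on the orientations of the arcs.
  have hc : ∀ i, ((OMatching.relSign Λ.matchA Λ.matchB : ℤ) : ℂ) *
      (Λ.matchA.weight vertexKernel i * Λ.matchB.weight N.linkKernel i) =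
      ((OMatching.relSign V (L.map T⁻¹) : ℤ) : ℂ) *
      (V.weight vertexKernel i * (L.map T⁻¹).weight N.linkKernel i) := fun i =>
    
    OMatching.relSign_weight_congr hA hB (fun s i j => vertexKernel_alternating s _ i j) hκ i i
  have hT : ((Equiv.Perm.sign T⁻¹ : ℤ) : ℂ) = ∏ d, ((Equiv.Perm.sign (τ d) : ℤ) : ℂ) := by
    rw [Equiv.Perm.sign_inv, sign_sigmaCongrRight]
    push_cast
    rfl
  have hw : ∀ i, (L.map T⁻¹).weight N.linkKernel i = L.weight N.linkKernel (i ∘ ⇑T⁻¹) :=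
    OMatching.weight_map L T⁻¹ N.linkKernel fun s => rfl
  rw [OMatching.relSign_map_perm] at hc
  simp only [hw] at hc
  push_cast at hc
  rw [hT] at hc
  rw [Finset.mul_sum]
  rw [Finset.sum_congr rfl fun i _ => (hc i).symm]
  rw [← Finset.mul_sum, hs, Λ.relSign_match, finprod_eq_prod_of_fintype]
  simp only [Finset.prod_neg]
  congr 1
  · simp
  · refine Finset.prod_congr rfl fun l _ => ?_
    congr 1
    rw [loopHol, Submonoid.coe_list_prod, List.map_map]
    refine congrArg List.prod (List.map_congr_left fun k _ => ?_)
    change _ = epsInv * (epsMat * _)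
    rw [← Matrix.mul_assoc, epsInv_mul_epsMat, Matrix.one_mul]
    rfl

/-- The evaluation of a spin network with admissible labels. -/
theorem eval_eq [Fintype D] [DecidableEq D] (hN : N.Regular) (ha : N.AllAdmissible) (o : D → Bool)
    (ho : ∀ d, o (N.opp d) = !o d) :
    N.eval = ((OMatching.relSign (vertexMatching hN.rot_rot_rot ha) (N.linkMatching hN o ho) : ℤ) : ℂ) *
      ∑ i : N.Strand → Fin 2, ∑ j : N.Strand → Fin 2,
        (vertexMatching hN.rot_rot_rot ha).weight vertexKernel i *
        (∏ d, symKernel (N.label d) (fun p => i ⟨d, p⟩) fun p => j ⟨d, p⟩) *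
        (N.linkMatching hN o ho).weight N.linkKernel j := by
  obtain rfl : ‹DecidableEq D› = fun a b => Classical.propDecidable (a = b) := Subsingleton.elim _ _
  classical
  refine Eq.trans (if_pos ha) ?_
  have h1 : ∀ τ : ∀ d, Equiv.Perm (Fin (N.label d)),
      (∏ d, ((Equiv.Perm.sign (τ d) : ℤ) : ℂ) / (N.label d).factorial) *
        ∏ᶠ l : N.Loop τ, -(N.loopHol τ (Quot.out l)).1.trace =
      ((OMatching.relSign (vertexMatching hN.rot_rot_rot ha) (N.linkMatching hN o ho) : ℤ) : ℂ) *
      ∑ i : N.Strand → Fin 2, (vertexMatching hN.rot_rot_rot ha).weight vertexKernel i *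
        ((∏ d, ((N.label d).factorial : ℂ)⁻¹) *
        (N.linkMatching hN o ho).weight N.linkKernel
          (i ∘ ⇑(Equiv.Perm.sigmaCongrRight fun d => (τ d)⁻¹))) := by
    intro τ
    rw [prod_loops hN ha o ho τ]
    have h2 : ∏ d, ((Equiv.Perm.sign (τ d) : ℤ) : ℂ) / (N.label d).factorial =
        (∏ d, ((Equiv.Perm.sign (τ d) : ℤ) : ℂ)) * ∏ d, ((N.label d).factorial : ℂ)⁻¹ := by
      rw [← Finset.prod_mul_distrib]
      rfl
    -- The sign of `τ` occurs twice, in the antisymmetrizer and in the count of the loops. It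
    -- cancels, and antisymmetrized strands become symmetrized spinors.
    have h3 : (∏ d, ((Equiv.Perm.sign (τ d) : ℤ) : ℂ)) * ∏ d, ((Equiv.Perm.sign (τ d) : ℤ) : ℂ) = 1 := by
      rw [← Finset.prod_mul_distrib]
      refine Finset.prod_eq_one fun d _ => ?_
      rcases Int.units_eq_one_or (Equiv.Perm.sign (τ d)) with h | h <;> simp [h]
    rw [h2, Equiv.Perm.sigmaCongrRight_inv]
    simp only [mul_left_comm _ (∏ d, ((N.label d).factorial : ℂ)⁻¹), ← Finset.mul_sum]
    linear_combination (exp := 1) (((OMatching.relSign (vertexMatching hN.rot_rot_rot ha)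
      (N.linkMatching hN o ho) : ℤ) : ℂ) * (∏ d, ((N.label d).factorial : ℂ)⁻¹) *
      ∑ i : N.Strand → Fin 2, (vertexMatching hN.rot_rot_rot ha).weight vertexKernel i *
        (N.linkMatching hN o ho).weight N.linkKernel
          (i ∘ ⇑(Equiv.Perm.sigmaCongrRight fun d => (τ d)⁻¹))) * h3
  rw [Finset.sum_congr rfl fun τ _ => h1 τ, ← Finset.mul_sum, Finset.sum_comm]
  congr 1
  refine Finset.sum_congr rfl fun i _ => ?_
  rw [← Finset.mul_sum, ← Equiv.sum_comp (Equiv.inv (∀ d, Equiv.Perm (Fin (N.label d))))]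
  simp only [mul_assoc]
  rw [← Finset.mul_sum (s := Finset.univ (α := N.Strand → Fin 2))]
  congr 1
  refine Eq.trans ?_ (sum_symKernel N.label i fun j => (N.linkMatching hN o ho).weight N.linkKernel j)
  simp only [Equiv.inv_apply, Pi.inv_apply, inv_inv]

end SpinNetwork

/-! ### Representations of SU(2): characters, orthogonality and invariant projections. -/

/-! ### Haar measure of `SU(2)` -/

instance haarSU2.instIsHaarMeasure : haarSU2.IsHaarMeasure := by
  unfold haarSU2; infer_instance

instance haarSU2.instIsProbabilityMeasure : IsProbabilityMeasure haarSU2 :=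
  ⟨by unfold haarSU2; exact Measure.haarMeasure_self⟩

instance SU2.instSecondCountableTopology : SecondCountableTopology SU2 :=
  haveI : SecondCountableTopology (Matrix (Fin 2) (Fin 2) ℂ) :=
    inferInstanceAs (SecondCountableTopology (Fin 2 → Fin 2 → ℂ))
  TopologicalSpace.Subtype.secondCountableTopology
    (Matrix.specialUnitaryGroup (Fin 2) ℂ : Set (Matrix (Fin 2) (Fin 2) ℂ))

/-- A right translate of the measure is again a Haar probability measure, and there is only one; the
same argument applies to the inversion. -/
instance haarSU2.instIsMulRightInvariant : haarSU2.IsMulRightInvariant where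
  map_mul_right_eq_self g := by
    have : IsProbabilityMeasure (haarSU2.map (· * g)) :=
      Measure.isProbabilityMeasure_map (by fun_prop)
    exact Measure.isHaarMeasure_eq_of_isProbabilityMeasure _ _

instance haarSU2.instIsInvInvariant : haarSU2.IsInvInvariant where
  inv_eq_self := by
    have h1 : IsProbabilityMeasure haarSU2.inv := by
      unfold Measure.inv
      exact Measure.isProbabilityMeasure_map measurable_inv.aemeasurable
    have h2 : haarSU2.inv.IsHaarMeasure := { }
    exact Measure.isHaarMeasure_eq_of_isProbabilityMeasure _ _

theorem integrable_of_continuous {X : Type*} [TopologicalSpace X] [CompactSpace X]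
    [MeasurableSpace X] [BorelSpace X] {μ : Measure X} [IsFiniteMeasure μ] {f : X → ℂ}
    (hf : Continuous f) : Integrable f μ :=
  hf.integrable_of_hasCompactSupport (HasCompactSupport.of_compactSpace f)

theorem SU2.continuous_entry (i j : Fin 2) : Continuous fun g : SU2 => g.1 i j :=
  (continuous_apply j).comp ((continuous_apply i).comp continuous_subtype_val)

/-! ### Tensor powers and symmetrizers -/

/-- The action of a matrix on a tensor power of `ℂ²`. -/
def tensorMat (S : Type*) [Fintype S] (g : Matrix (Fin 2) (Fin 2) ℂ) :
    Matrix (S → Fin 2) (S → Fin 2) ℂ :=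
  Matrix.of fun i j => ∏ s, g (i s) (j s)

theorem tensorMat_one {S : Type*} [Fintype S] : tensorMat S 1 = 1 := by
  ext i j
  simp only [tensorMat, Matrix.of_apply, Matrix.one_apply]
  by_cases h : i = j
  · simp [h]
  · obtain ⟨s, hs⟩ := Function.ne_iff.mp h
    rw [if_neg h]
    exact Finset.prod_eq_zero (Finset.mem_univ s) (if_neg hs)

section Tensor

variable {S : Type*} [Fintype S] [DecidableEq S]

theorem tensorMat_mul (g h : Matrix (Fin 2) (Fin 2) ℂ) :
    tensorMat S g * tensorMat S h = tensorMat S (g * h) := by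
  ext i j
  simp only [tensorMat, Matrix.mul_apply, Matrix.of_apply]
  rw [Finset.prod_univ_sum, Fintype.piFinset_univ]
  exact Finset.sum_congr rfl fun k _ => Finset.prod_mul_distrib.symm

/-- The action of a permutation on a tensor power. -/
def permMat (σ : Equiv.Perm S) : Matrix (S → Fin 2) (S → Fin 2) ℂ :=
  Matrix.of fun i j => if i ∘ σ = j then 1 else 0

theorem permMat_mul_apply (σ : Equiv.Perm S) (A : Matrix (S → Fin 2) (S → Fin 2) ℂ)
    (i j : S → Fin 2) : (permMat σ * A) i j = A (i ∘ σ) j := by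
  simp [permMat, Matrix.mul_apply]

theorem mul_permMat_apply (σ : Equiv.Perm S) (A : Matrix (S → Fin 2) (S → Fin 2) ℂ)
    (i j : S → Fin 2) : (A * permMat σ) i j = A i (j ∘ σ.symm) := by
  have h : ∀ k : S → Fin 2, k ∘ σ = j ↔ k = j ∘ σ.symm := fun k => by
    constructor
    · rintro rfl; ext s; simp
    · rintro rfl; ext s; simp
  simp [permMat, Matrix.mul_apply, h]

theorem permMat_mul (σ τ : Equiv.Perm S) : permMat σ * permMat τ = permMat (σ * τ) := by
  ext i j
  rw [permMat_mul_apply]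
  rfl

theorem permMat_tensorMat (σ : Equiv.Perm S) (g : Matrix (Fin 2) (Fin 2) ℂ) :
    permMat σ * tensorMat S g = tensorMat S g * permMat σ := by
  ext i j
  rw [permMat_mul_apply, mul_permMat_apply]
  simp only [tensorMat, Matrix.of_apply]
  rw [← Equiv.prod_comp σ fun s => g (i s) ((j ∘ σ.symm) s)]
  simp

end Tensor

/-- The projection on the symmetric tensors. -/
def symMat (n : ℕ) : Matrix (Fin n → Fin 2) (Fin n → Fin 2) ℂ := Matrix.of (symKernel n)

theorem symMat_eq (n : ℕ) : symMat n = (n.factorial : ℂ)⁻¹ • ∑ σ : Equiv.Perm (Fin n), permMat σ := by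
  ext i j
  simp [symMat, symKernel, Matrix.sum_apply, permMat]

theorem symMat_mul_permMat {n : ℕ} (σ : Equiv.Perm (Fin n)) : symMat n * permMat σ = symMat n := by
  rw [symMat_eq, Matrix.smul_mul, Finset.sum_mul]
  congr 1
  simp only [permMat_mul]
  exact Equiv.sum_comp (Equiv.mulRight σ) fun τ => permMat τ

theorem permMat_mul_symMat {n : ℕ} (σ : Equiv.Perm (Fin n)) : permMat σ * symMat n = symMat n := by
  rw [symMat_eq, Matrix.mul_smul, Finset.mul_sum]
  congr 1
  simp only [permMat_mul]
  exact Equiv.sum_comp (Equiv.mulLeft σ) fun τ => permMat τ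

theorem symMat_mul_symMat (n : ℕ) : symMat n * symMat n = symMat n := by
  nth_rewrite 2 [symMat_eq]
  rw [Matrix.mul_smul, Finset.mul_sum]
  simp only [symMat_mul_permMat, Finset.sum_const, Finset.card_univ, Fintype.card_perm,
    Fintype.card_fin]
  rw [← Nat.cast_smul_eq_nsmul ℂ, smul_smul, inv_mul_cancel₀ (by exact_mod_cast n.factorial_ne_zero),
    one_smul]

theorem symMat_tensorMat (n : ℕ) (g : Matrix (Fin 2) (Fin 2) ℂ) :
    symMat n * tensorMat (Fin n) g = tensorMat (Fin n) g * symMat n := by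
  rw [symMat_eq, Matrix.smul_mul, Matrix.mul_smul, Finset.mul_sum, Finset.sum_mul]
  simp only [permMat_tensorMat]

theorem symKernel_comm (n : ℕ) (i j : Fin n → Fin 2) : symKernel n j i = symKernel n i j := by
  rw [symKernel, symKernel, ← Equiv.sum_comp (Equiv.inv (Equiv.Perm (Fin n)))]
  congr 1
  refine Finset.sum_congr rfl fun σ _ => ?_
  have h : j ∘ ⇑(Equiv.inv (Equiv.Perm (Fin n)) σ) = i ↔ i ∘ σ = j := by
    constructor
    · rintro rfl; ext s; simp
    · rintro rfl; ext s; simp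
  simp only [h]

theorem star_symKernel (n : ℕ) (i j : Fin n → Fin 2) : star (symKernel n i j) = symKernel n i j := by
  simp only [symKernel, star_mul', star_inv₀, star_natCast, star_sum]
  congr 1
  refine Finset.sum_congr rfl fun σ _ => ?_
  split_ifs <;> simp

/-! ### Characters -/

/-- The character of spin `n / 2`. -/
def chi (n : ℕ) (g : Matrix (Fin 2) (Fin 2) ℂ) : ℂ := (symMat n * tensorMat (Fin n) g).trace

theorem chi_conj (n : ℕ) (u u' g : Matrix (Fin 2) (Fin 2) ℂ) (h : u' * u = 1) :
    chi n (u * g * u') = chi n g := by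
  rw [chi, ← tensorMat_mul, ← Matrix.mul_assoc, Matrix.trace_mul_comm, ← Matrix.mul_assoc,
    ← symMat_tensorMat, Matrix.mul_assoc, tensorMat_mul, ← Matrix.mul_assoc, h, Matrix.one_mul]
  rfl

/-- Only diagonal entries contribute. A state with `k` zeros has the entry `k! (n-k)! / n!` in the
symmetrizer, and there are `n.choose k` such states, so each monomial occurs with coefficient one.
-/
theorem chi_diagonal (n : ℕ) (x y : ℂ) :
    chi n (Matrix.diagonal ![x, y]) = ∑ k ∈ Finset.range (n + 1), x ^ k * y ^ (n - k) := by
  have h1 : ∀ i : Fin n → Fin 2, (symMat n * tensorMat (Fin n) (Matrix.diagonal ![x, y])) i i =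
      symKernel n i i * ∏ p, ![x, y] (i p) := by
    intro i
    rw [Matrix.mul_apply, Finset.sum_eq_single i]
    · simp [symMat, tensorMat]
    · intro j _ hj
      obtain ⟨s, hs⟩ := Function.ne_iff.mp hj
      have : tensorMat (Fin n) (Matrix.diagonal ![x, y]) j i = 0 :=
        Finset.prod_eq_zero (Finset.mem_univ s) (Matrix.diagonal_apply_ne _ hs)
      rw [this, mul_zero]
    · simp
  -- The permutations which fix the state are those which preserve the set of its zeros.
  have h2 : ∀ A : Finset (Fin n), symKernel n (fun p => if p ∈ A then 0 else 1)
      (fun p => if p ∈ A then 0 else 1) =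
      (n.factorial : ℂ)⁻¹ * (A.card.factorial * (n - A.card).factorial : ℕ) := by
    intro A
    rw [symKernel]
    congr 1
    rw [Finset.sum_boole, ← Fintype.card_subtype, DomMulAct.stabilizer_card]
    rw [Fin.prod_univ_two]
    congr 3
    · rw [Fintype.card_subtype]
      congr 1
      ext p; simp
    · have h := Finset.card_compl A
      rw [Fintype.card_fin] at h
      rw [Fintype.card_subtype, ← h]
      congr 1
      ext p; simp
  let e : Finset (Fin n) ≃ (Fin n → Fin 2) :=
    { toFun := fun A p => if p ∈ A then 0 else 1
      invFun := fun i => Finset.univ.filter fun p => i p = 0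
      left_inv := fun A => by ext p; simp
      right_inv := fun i => by
        ext p
        have : i p = 0 ∨ i p = 1 := by generalize i p = c; fin_cases c <;> simp
        rcases this with h | h <;> simp [h] }
  have he : ∀ A : Finset (Fin n), ∏ p, ![x, y] (e A p) = x ^ A.card * y ^ (n - A.card) := by
    intro A
    have : ∀ p, ![x, y] (e A p) = if p ∈ A then x else y := fun p => by
      by_cases h : p ∈ A <;> simp [e, h]
    simp only [this]
    rw [Finset.prod_ite]
    simp only [Finset.prod_const]
    congr 2
    · congr 1; ext p; simp
    · have h := Finset.card_compl A
      rw [Fintype.card_fin] at h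
      rw [← h]
      congr 1; ext p; simp
  rw [chi, Matrix.trace]
  simp only [Matrix.diag_apply, h1]
  rw [← e.sum_comp]
  simp only [he]
  have h3 := Finset.sum_powerset_apply_card (fun k => (n.factorial : ℂ)⁻¹ *
    (k.factorial * (n - k).factorial : ℕ) * (x ^ k * y ^ (n - k))) (x := (Finset.univ : Finset (Fin n)))
  rw [Finset.powerset_univ] at h3
  refine Eq.trans (Finset.sum_congr rfl fun A _ => ?_) (h3.trans ?_)
  · rw [← h2 A]
    rfl
  · rw [Finset.card_univ, Fintype.card_fin]
    refine Finset.sum_congr rfl fun k hk => ?_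
    have hk' : k ≤ n := by simpa [Nat.lt_succ_iff] using hk
    have h4 : (n.choose k : ℂ) * ((k.factorial * (n - k).factorial : ℕ) : ℂ) = n.factorial := by
      rw [← Nat.choose_mul_factorial_mul_factorial hk']
      push_cast
      ring
    have h5 : (n.factorial : ℂ)⁻¹ * n.factorial = 1 :=
      inv_mul_cancel₀ (by exact_mod_cast n.factorial_ne_zero)
    rw [nsmul_eq_mul]
    linear_combination (n.factorial : ℂ)⁻¹ * (x ^ k * y ^ (n - k)) * h4 + (x ^ k * y ^ (n - k)) * h5

/-- For determinant one the adjoint is the adjugate `tr g - g`. Hence `g` is an affine function of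
the Hermitian matrix `i (g - g*)`, and the spectral theorem diagonalizes it. -/
theorem SU2.exists_diagonal (g : SU2) : ∃ u u' : Matrix (Fin 2) (Fin 2) ℂ, ∃ x y : ℂ,
    u' * u = 1 ∧ g.1 = u * Matrix.diagonal ![x, y] * u' ∧ x * y = 1 ∧ x + y = g.1.trace := by
  have hdet : g.1.det = 1 := (Matrix.mem_specialUnitaryGroup_iff.mp g.2).2
  have hu : star g.1 * g.1 = 1 :=
    Matrix.mem_unitaryGroup_iff'.mp (Matrix.mem_specialUnitaryGroup_iff.mp g.2).1
  have hadj : star g.1 = g.1.trace • (1 : Matrix (Fin 2) (Fin 2) ℂ) - g.1 := by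
    have h1 : g.1.adjugate = star g.1 := by
      have := congrArg (fun M => star g.1 * M) (Matrix.mul_adjugate g.1)
      simp only [hdet, one_smul, mul_one, ← mul_assoc, hu, one_mul] at this
      exact this
    rw [← h1]
    ext i j
    fin_cases i <;> fin_cases j <;>
      simp [Matrix.adjugate_fin_two, Matrix.trace_fin_two]
  let H : Matrix (Fin 2) (Fin 2) ℂ := Complex.I • (g.1 - star g.1)
  have hH : H.IsHermitian := by
    simp only [H, Matrix.IsHermitian, Matrix.conjTranspose_smul, Matrix.conjTranspose_sub]
    rw [Matrix.star_eq_conjTranspose, Matrix.conjTranspose_conjTranspose]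
    ext i j
    simp
    ring
  have hg : g.1 = (g.1.trace / 2) • (1 : Matrix (Fin 2) (Fin 2) ℂ) - (Complex.I / 2) • H := by
    simp only [H]
    rw [hadj]
    ext i j
    simp only [Matrix.sub_apply, Matrix.smul_apply, smul_eq_mul]
    linear_combination ((g.1 i j) - (g.1.trace * (1 : Matrix (Fin 2) (Fin 2) ℂ) i j) / 2) *
      Complex.I_sq
  let U : Matrix (Fin 2) (Fin 2) ℂ := (hH.eigenvectorUnitary : Matrix (Fin 2) (Fin 2) ℂ)
  have hU : star U * U = 1 := Unitary.coe_star_mul_self hH.eigenvectorUnitary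
  have hU' : U * star U = 1 := Unitary.coe_mul_star_self hH.eigenvectorUnitary
  have hspec : H = U * Matrix.diagonal (RCLike.ofReal ∘ hH.eigenvalues) * star U := by
    conv_lhs => rw [hH.spectral_theorem]
    rfl
  let x : Fin 2 → ℂ := fun i => g.1.trace / 2 - Complex.I / 2 * hH.eigenvalues i
  have hx : Matrix.diagonal ![x 0, x 1] = (g.1.trace / 2) • (1 : Matrix (Fin 2) (Fin 2) ℂ) -
      (Complex.I / 2) • Matrix.diagonal (RCLike.ofReal ∘ hH.eigenvalues) := by
    ext i j
    fin_cases i <;> fin_cases j <;> simp [x]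
  have hg2 : g.1 = U * Matrix.diagonal ![x 0, x 1] * star U := by
    rw [hx, Matrix.mul_sub, Matrix.sub_mul, Matrix.mul_smul, Matrix.mul_one, Matrix.smul_mul, hU',
      Matrix.mul_smul, Matrix.smul_mul, ← hspec]
    exact hg
  refine ⟨U, star U, x 0, x 1, hU, hg2, ?_, ?_⟩
  · have h := congrArg Matrix.det hg2
    rw [hdet, Matrix.det_mul_right_comm, Matrix.det_mul, hU', Matrix.det_one, one_mul,
      Matrix.det_diagonal] at h
    simpa using h.symm
  · have h := congrArg Matrix.trace hg2
    rw [Matrix.trace_mul_comm, ← Matrix.mul_assoc, hU, Matrix.one_mul, Matrix.trace_diagonal] at h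
    simpa using h.symm

theorem chi_zero (g : Matrix (Fin 2) (Fin 2) ℂ) : chi 0 g = 1 := by
  simp only [chi, symMat, symKernel, tensorMat, Matrix.trace, Matrix.mul_apply, Matrix.diag,
    Matrix.of_apply, Subsingleton.elim _ (default : Fin 0 → Fin 2)]
  simp

theorem chi_one (g : SU2) : chi 1 g.1 = g.1.trace := by
  obtain ⟨u, u', x, y, h1, h2, h3, h4⟩ := g.exists_diagonal
  rw [← h4, h2, chi_conj 1 _ _ _ h1, chi_diagonal]
  simp [Finset.sum_range_succ]
  ring

/-- The Clebsch–Gordan rule for spin one half, verified on eigenvalues `x`, `y` with `x * y = 1`. -/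
theorem trace_mul_chi (n : ℕ) (g : SU2) :
    g.1.trace * chi (n + 1) g.1 = chi (n + 2) g.1 + chi n g.1 := by
  obtain ⟨u, u', x, y, h1, h2, h3, h4⟩ := g.exists_diagonal
  rw [← h4, h2, chi_conj _ _ _ _ h1, chi_conj _ _ _ _ h1, chi_conj _ _ _ _ h1, chi_diagonal,
    chi_diagonal, chi_diagonal]
  have e1 : ∀ m, ∑ k ∈ Finset.range (m + 2), x ^ k * y ^ (m + 1 - k) =
      y * ∑ k ∈ Finset.range (m + 1), x ^ k * y ^ (m - k) + x ^ (m + 1) := by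
    intro m
    rw [Finset.sum_range_succ, Finset.mul_sum]
    congr 1
    · refine Finset.sum_congr rfl fun k hk => ?_
      have : m + 1 - k = m - k + 1 := by
        have := Finset.mem_range.mp hk
        omega
      rw [this, pow_succ]
      ring
    · simp
  rw [e1 (n + 1), e1 n]
  linear_combination (∑ k ∈ Finset.range (n + 1), x ^ k * y ^ (n - k)) * h3

theorem SU2.continuous_trace : Continuous fun g : SU2 => g.1.trace := by
  simp only [Matrix.trace_fin_two]
  exact (SU2.continuous_entry 0 0).add (SU2.continuous_entry 1 1)

theorem continuous_tensorMat {S : Type*} [Fintype S] (i j : S → Fin 2) :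
    Continuous fun g : SU2 => tensorMat S g.1 i j :=
  continuous_finsetProd _ fun _ _ => SU2.continuous_entry _ _

theorem continuous_chi (n : ℕ) : Continuous fun g : SU2 => chi n g.1 := by
  simp only [chi, Matrix.trace, Matrix.diag, Matrix.mul_apply]
  exact continuous_finsetSum _ fun i _ => continuous_finsetSum _ fun j _ =>
    continuous_const.mul (continuous_tensorMat _ _)

/-! ### Integrals of characters -/

theorem exists_perm_comp {n : ℕ} {i j : Fin n → Fin 2}
    (h : Fintype.card {s // i s = 0} = Fintype.card {s // j s = 0}) :
    ∃ σ : Equiv.Perm (Fin n), i ∘ σ = j := by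
  let e : {s // j s = 0} ≃ {s // i s = 0} := Fintype.equivOfCardEq h.symm
  refine ⟨e.extendSubtype, funext fun s => ?_⟩
  have h2 : ∀ c : Fin 2, c ≠ 0 → c = 1 := by decide
  by_cases hs : j s = 0
  · rw [Function.comp_apply, hs]
    exact e.extendSubtype_mem s hs
  · rw [Function.comp_apply, h2 _ hs]
    exact h2 _ (e.extendSubtype_not_mem s hs)

theorem prod_ite_zero {n : ℕ} (i : Fin n → Fin 2) (x y : ℂ) :
    (∏ s, if i s = 0 then x else y) =
      x ^ Fintype.card {s // i s = 0} * y ^ (n - Fintype.card {s // i s = 0}) := by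
  rw [Finset.prod_ite, Finset.prod_const, Finset.prod_const]
  congr 2
  · exact (Fintype.card_subtype _).symm
  · have h := Finset.card_compl (Finset.univ.filter fun s => i s = 0)
    rw [Fintype.card_fin, ← Fintype.card_subtype] at h
    rw [← h]
    congr 1
    ext; simp

/-- The diagonal element of `SU(2)` with eigenvalue `exp (I θ)`. -/
def SU2.torus (θ : ℝ) : SU2 :=
  ⟨Matrix.diagonal ![Complex.exp (θ * Complex.I), Complex.exp (-(θ * Complex.I))], by
    rw [Matrix.mem_specialUnitaryGroup_iff, Matrix.mem_unitaryGroup_iff]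
    constructor
    · rw [Matrix.star_eq_conjTranspose, Matrix.diagonal_conjTranspose, Matrix.diagonal_mul_diagonal,
        ← Matrix.diagonal_one]
      congr 1
      ext s
      fin_cases s <;> simp [← Complex.exp_conj, ← Complex.exp_add]
    · simp [Matrix.det_diagonal, ← Complex.exp_add]⟩

/-- A rotation of `ℝ²`. -/
def SU2.rotation : SU2 :=
  ⟨!![3 / 5, 4 / 5; -(4 / 5), 3 / 5], by
    rw [Matrix.mem_specialUnitaryGroup_iff, Matrix.mem_unitaryGroup_iff]
    constructor
    · ext i j
      fin_cases i <;> fin_cases j <;>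
        simp only [Fin.zero_eta, Fin.mk_one, Matrix.mul_apply, Matrix.star_apply, Fin.sum_univ_two,
          Matrix.of_apply, Matrix.cons_val', Matrix.cons_val_zero, Matrix.cons_val_one,
          Matrix.cons_val_fin_one, star_neg, star_div₀, star_ofNat, Matrix.one_apply_eq, ne_eq,
          zero_ne_one, one_ne_zero, not_false_eq_true, Matrix.one_apply_ne] <;> norm_num
    · simp [Matrix.det_fin_two]; norm_num⟩

/-- There are no invariant vectors in a nontrivial symmetric power. -/
theorem invariant_eq_zero {n : ℕ} (hn : n ≠ 0) (f : (Fin n → Fin 2) → ℂ)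
    (hσ : ∀ (σ : Equiv.Perm (Fin n)) i, f (i ∘ σ) = f i)
    (hT : ∀ (g : SU2) i, ∑ j, tensorMat (Fin n) g.1 i j * f j = f i) : f = 0 := by
  -- A state with `c` zeros has weight `d = c - (n - c)` under the torus. If `d ≠ 0`, the torus
  -- element of angle `π / d` acts on it by `-1`.
  have key : ∀ i, 2 * Fintype.card {s // i s = 0} ≠ n → f i = 0 := by
    intro i hi
    set c := Fintype.card {s // i s = 0} with hc
    have hcn : c ≤ n := (Fintype.card_subtype_le _).trans_eq (Fintype.card_fin n)
    let d : ℝ := 2 * c - n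
    have hd : d ≠ 0 := fun h => hi (by
      have : (2 * c : ℝ) = n := by linarith
      exact_mod_cast this)
    have h1 := hT (SU2.torus (Real.pi / d)) i
    rw [Finset.sum_eq_single i] at h1
    · have h2 : tensorMat (Fin n) (SU2.torus (Real.pi / d)).1 i i = -1 := by
        have h3 : ∀ s, (SU2.torus (Real.pi / d)).1 (i s) (i s) =
            if i s = 0 then Complex.exp ((Real.pi / d : ℝ) * Complex.I) else
              Complex.exp (-((Real.pi / d : ℝ) * Complex.I)) := by
          intro s
          simp only [SU2.torus]
          generalize i s = c
          fin_cases c <;> simp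
        simp only [tensorMat, Matrix.of_apply, h3]
        rw [prod_ite_zero, ← hc, ← Complex.exp_nat_mul, ← Complex.exp_nat_mul, ← Complex.exp_add,
          ← Complex.exp_pi_mul_I]
        congr 1
        rw [Nat.cast_sub hcn]
        have h4 : (d : ℂ) = 2 * c - n := by simp [d]
        have h5 : (d : ℂ) ≠ 0 := by exact_mod_cast hd
        push_cast
        field_simp
        rw [h4]
        ring
      rw [h2] at h1
      linear_combination (-1 / 2 : ℂ) * h1
    · intro j _ hj
      obtain ⟨s, hs⟩ := Function.ne_iff.mp hj
      have : tensorMat (Fin n) (SU2.torus (Real.pi / d)).1 i j = 0 :=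
        Finset.prod_eq_zero (Finset.mem_univ s) (Matrix.diagonal_apply_ne _ hs.symm)
      rw [this, zero_mul]
    · simp
  ext i
  by_cases hi : 2 * Fintype.card {s // i s = 0} = n
  -- On the states of weight zero `f` is constant by symmetry. The rotation is applied and read off
  -- at the state without ones, where `f` vanishes as `n ≠ 0`. As the first row of the rotation
  -- consists of positive numbers, this gives a nonzero multiple of the constant.
  · have h0 : f (fun _ => 0) = 0 := key _ (by
      rw [Fintype.card_subtype]
      simp
      omega)
    have h1 := hT SU2.rotation fun _ => 0
    rw [h0] at h1
    set c := Fintype.card {s // i s = 0} with hc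
    have h2 : ∀ j, tensorMat (Fin n) SU2.rotation.1 (fun _ => 0) j * f j =
        if Fintype.card {s // j s = 0} = c then (3 / 5) ^ c * (4 / 5) ^ (n - c) * f i else 0 := by
      intro j
      split_ifs with hj
      · obtain ⟨σ, rfl⟩ := exists_perm_comp (i := i) (j := j) (hc.symm.trans hj.symm)
        rw [hσ]
        congr 1
        rw [← hj, ← prod_ite_zero (i ∘ σ)]
        change (∏ s, SU2.rotation.1 0 ((i ∘ σ) s)) = _
        refine Finset.prod_congr rfl fun s _ => ?_
        simp only [SU2.rotation]
        generalize (i ∘ σ) s = c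
        fin_cases c <;> simp
      · rw [key j (by omega), mul_zero]
    simp only [h2] at h1
    rw [Finset.sum_ite, Finset.sum_const, Finset.sum_const_zero, add_zero, nsmul_eq_mul] at h1
    have h3 : ((Finset.univ.filter fun j : Fin n → Fin 2 =>
        Fintype.card {s // j s = 0} = c).card : ℂ) ≠ 0 := by
      rw [Nat.cast_ne_zero, Finset.card_ne_zero]
      exact ⟨i, by simp [hc]⟩
    have h4 : ((3 / 5 : ℂ)) ^ c * (4 / 5) ^ (n - c) ≠ 0 :=
      mul_ne_zero (pow_ne_zero _ (by norm_num)) (pow_ne_zero _ (by norm_num))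
    simpa [h3, h4] using h1
  · exact key i hi

/-! ### The average of a tensor product of irreducible representations -/

section Average

variable {L : Type*} [Fintype L] (k : L → ℕ)

/-- The tensor product of matrices. -/
def prodMat {k : L → ℕ} (A : ∀ l, Matrix (Fin (k l) → Fin 2) (Fin (k l) → Fin 2) ℂ) :
    Matrix ((Σ l, Fin (k l)) → Fin 2) ((Σ l, Fin (k l)) → Fin 2) ℂ :=
  Matrix.of fun i j => ∏ l, A l (fun p => i ⟨l, p⟩) (fun p => j ⟨l, p⟩)

/-- The action of `SU(2)` on a tensor product of irreducible representations, extended by zero to the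
tensor power of `ℂ²`. -/
def repMat (g : Matrix (Fin 2) (Fin 2) ℂ) :
    Matrix ((Σ l, Fin (k l)) → Fin 2) ((Σ l, Fin (k l)) → Fin 2) ℂ :=
  prodMat fun l => symMat (k l) * tensorMat (Fin (k l)) g

/-- The projection on the invariant vectors in a tensor product of irreducible representations. -/
def invMat : Matrix ((Σ l, Fin (k l)) → Fin 2) ((Σ l, Fin (k l)) → Fin 2) ℂ :=
  Matrix.of fun i j => ∫ g : SU2, repMat k g.1 i j ∂haarSU2

theorem repMat_conjTranspose (g : SU2) : (repMat k g.1).conjTranspose = repMat k (g⁻¹).1 := by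
  have h1 : ∀ n, (symMat n * tensorMat (Fin n) g.1).conjTranspose =
      symMat n * tensorMat (Fin n) (g⁻¹).1 := by
    intro n
    rw [Matrix.conjTranspose_mul, symMat_tensorMat]
    congr 1
    · ext i j
      simp only [tensorMat, Matrix.conjTranspose_apply, Matrix.of_apply, star_prod]
      rfl
    · ext i j
      rw [Matrix.conjTranspose_apply, symMat, Matrix.of_apply, Matrix.of_apply, star_symKernel,
        symKernel_comm]
  ext i j
  rw [Matrix.conjTranspose_apply]
  simp only [repMat, prodMat, Matrix.of_apply, star_prod, ← h1, Matrix.conjTranspose_apply]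

theorem continuous_repMat (i j : (Σ l, Fin (k l)) → Fin 2) :
    Continuous fun g : SU2 => repMat k g.1 i j := by
  simp only [repMat, prodMat, Matrix.of_apply, Matrix.mul_apply]
  exact continuous_finsetProd _ fun l _ => continuous_finsetSum _ fun j _ =>
    continuous_const.mul (continuous_tensorMat _ _)

/-- The representation is unitary, and the Haar measure is invariant under inversion. -/
theorem invMat_conjTranspose : (invMat k).conjTranspose = invMat k := by
  ext i j
  rw [Matrix.conjTranspose_apply, invMat, Matrix.of_apply, Matrix.of_apply]
  calc star (∫ g : SU2, repMat k g.1 j i ∂haarSU2) = ∫ g : SU2, star (repMat k g.1 j i) ∂haarSU2 :=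
        integral_conj.symm
    _ = ∫ g : SU2, repMat k (g⁻¹).1 i j ∂haarSU2 := by
        refine integral_congr_ae (.of_forall fun g => ?_)
        exact congrFun (congrFun (repMat_conjTranspose k g) i) j
    _ = _ := integral_inv_eq_self (fun g : SU2 => repMat k g.1 i j) haarSU2

theorem integral_haarSU2_const (c : ℂ) : ∫ _ : SU2, c ∂haarSU2 = c := by
  simp

variable [DecidableEq L]

theorem prodMat_mul {k : L → ℕ} (A B : ∀ l, Matrix (Fin (k l) → Fin 2) (Fin (k l) → Fin 2) ℂ) :
    prodMat A * prodMat B = prodMat fun l => A l * B l := by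
  ext i j
  simp only [prodMat, Matrix.mul_apply, Matrix.of_apply]
  rw [Finset.prod_univ_sum, Fintype.piFinset_univ]
  simp only [← Finset.prod_mul_distrib]
  exact Equiv.sum_comp (Equiv.piCurry fun (l : L) (_ : Fin (k l)) => Fin 2) fun s =>
    ∏ l, A l (fun p => i ⟨l, p⟩) (s l) * B l (s l) (fun p => j ⟨l, p⟩)

theorem trace_prodMat {k : L → ℕ} (A : ∀ l, Matrix (Fin (k l) → Fin 2) (Fin (k l) → Fin 2) ℂ) :
    (prodMat A).trace = ∏ l, (A l).trace := by
  simp only [Matrix.trace, prodMat, Matrix.diag, Matrix.of_apply]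
  rw [Finset.prod_univ_sum, Fintype.piFinset_univ]
  exact Equiv.sum_comp (Equiv.piCurry fun (l : L) (_ : Fin (k l)) => Fin 2) fun s =>
    ∏ l, A l (s l) (s l)

theorem repMat_mul (g h : Matrix (Fin 2) (Fin 2) ℂ) :
    repMat k g * repMat k h = repMat k (g * h) := by
  rw [repMat, repMat, prodMat_mul, repMat]
  congr 1
  ext1 l
  rw [Matrix.mul_assoc, ← Matrix.mul_assoc (tensorMat _ g), ← symMat_tensorMat, Matrix.mul_assoc,
    tensorMat_mul, ← Matrix.mul_assoc, symMat_mul_symMat]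

theorem trace_repMat (g : Matrix (Fin 2) (Fin 2) ℂ) : (repMat k g).trace = ∏ l, chi (k l) g :=
  trace_prodMat _

theorem repMat_mul_invMat (h : SU2) : repMat k h.1 * invMat k = invMat k := by
  ext i j
  rw [Matrix.mul_apply]
  simp only [invMat, Matrix.of_apply, ← integral_const_mul]
  rw [← integral_finsetSum _ fun m _ => (integrable_of_continuous (continuous_repMat k m j)).const_mul _,
    ← integral_mul_left_eq_self (fun g : SU2 => repMat k g.1 i j) h]
  refine integral_congr_ae (.of_forall fun g => ?_)
  change _ = repMat k (h.1 * g.1) i j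
  rw [← repMat_mul, Matrix.mul_apply]

theorem invMat_mulVec (v : ((Σ l, Fin (k l)) → Fin 2) → ℂ)
    (hv : ∀ g : SU2, (repMat k g.1).mulVec v = v) : (invMat k).mulVec v = v := by
  ext i
  simp only [Matrix.mulVec, dotProduct, invMat, Matrix.of_apply, ← integral_mul_const]
  rw [← integral_finsetSum _ fun m _ => (integrable_of_continuous (continuous_repMat k i m)).mul_const _]
  rw [← integral_haarSU2_const (v i)]
  refine integral_congr_ae (.of_forall fun g => ?_)
  exact congrFun (hv g) i

/-- The columns of the mean are invariant vectors, and the mean fixes invariant vectors. -/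
theorem invMat_mul_invMat : invMat k * invMat k = invMat k := by
  ext i j
  exact congrFun (invMat_mulVec k (fun m => invMat k m j) fun g => funext fun i =>
    congrFun (congrFun (repMat_mul_invMat k g) i) j) i

theorem trace_invMat : (invMat k).trace = ∫ g : SU2, ∏ l, chi (k l) g.1 ∂haarSU2 := by
  simp only [Matrix.trace, Matrix.diag, invMat, Matrix.of_apply, ← trace_repMat]
  rw [integral_finsetSum _ fun m _ => integrable_of_continuous (continuous_repMat k m m)]

-- For an orthogonal projection `tr (R* R) = tr R`, and the left side is the sum of the squared
-- moduli of the entries.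
open scoped ComplexOrder in
theorem eq_zero_of_projection {m : Type*} [Fintype m] {R : Matrix m m ℂ} (h1 : R.conjTranspose = R)
    (h2 : R * R = R) (h3 : R.trace = 0) : R = 0 := by
  rw [← Matrix.trace_conjTranspose_mul_self_eq_zero_iff, h1, h2, h3]

theorem invMat_eq_zero (h : ∫ g : SU2, ∏ l, chi (k l) g.1 ∂haarSU2 = 0) : invMat k = 0 :=
  eq_zero_of_projection (invMat_conjTranspose k) (invMat_mul_invMat k) (by rw [trace_invMat, h])

/-- The trace is the dimension of the space of invariants, here a line spanned by `v`. The
orthogonal projection `P` on this line satisfies `invMat k * P = P`, so that the difference is again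
an orthogonal projection, of trace zero. As `v` is real, the bilinear form may be used in place of
the Hermitian one. -/
theorem invMat_eq_of_one (h : ∫ g : SU2, ∏ l, chi (k l) g.1 ∂haarSU2 = 1)
    (v : ((Σ l, Fin (k l)) → Fin 2) → ℂ) (hv : ∀ g : SU2, (repMat k g.1).mulVec v = v)
    (hr : ∀ i, star (v i) = v i) (hs : ∑ i, v i * v i ≠ 0) (i j : (Σ l, Fin (k l)) → Fin 2) :
    invMat k i j = v i * v j / ∑ i, v i * v i := by
  set N := ∑ i, v i * v i with hN
  have hNr : star N = N := by
    simp only [hN, star_sum, star_mul', hr]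
  let P : Matrix ((Σ l, Fin (k l)) → Fin 2) ((Σ l, Fin (k l)) → Fin 2) ℂ :=
    Matrix.of fun i j => v i * v j / N
  have hP1 : P.conjTranspose = P := by
    ext i j
    simp only [P, Matrix.conjTranspose_apply, Matrix.of_apply, star_div₀, star_mul', hr, hNr,
      mul_comm]
  have hP2 : P * P = P := by
    ext i j
    simp only [P, Matrix.mul_apply, Matrix.of_apply]
    have : ∀ x, v i * v x / N * (v x * v j / N) = v i * v j / N / N * (v x * v x) := fun x => by ring
    simp only [this, ← Finset.mul_sum, ← hN]
    field_simp
  have hQP : invMat k * P = P := by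
    ext i j
    have h1 := congrFun (invMat_mulVec k v hv) i
    simp only [Matrix.mulVec, dotProduct] at h1
    simp only [P, Matrix.mul_apply, Matrix.of_apply]
    have : ∀ x, invMat k i x * (v x * v j / N) = invMat k i x * v x * (v j / N) := fun x => by ring
    simp only [this, ← Finset.sum_mul, h1]
    ring
  have hPQ : P * invMat k = P := by
    have := congrArg Matrix.conjTranspose hQP
    rwa [Matrix.conjTranspose_mul, hP1, invMat_conjTranspose] at this
  have hPt : P.trace = 1 := by
    simp only [P, Matrix.trace, Matrix.diag, Matrix.of_apply, ← Finset.sum_div, ← hN]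
    exact div_self hs
  have hR : invMat k - P = 0 := by
    refine eq_zero_of_projection ?_ ?_ ?_
    · rw [Matrix.conjTranspose_sub, hP1, invMat_conjTranspose]
    · rw [Matrix.sub_mul, Matrix.mul_sub, Matrix.mul_sub, hP2, hQP, hPQ, invMat_mul_invMat]
      simp
    · rw [Matrix.trace_sub, hPt, trace_invMat, h, sub_self]
  exact congrFun (congrFun (sub_eq_zero.mp hR) i) j

end Average

/-! ### Orthogonality of characters -/

/-- The columns of the mean of the representation are invariant symmetric tensors, and these vanish
for positive spin by `invariant_eq_zero`. -/
theorem integral_chi (n : ℕ) : ∫ g : SU2, chi n g.1 ∂haarSU2 = if n = 0 then 1 else 0 := by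
  split_ifs with hn
  · subst hn
    simp [chi_zero]
  · have hi : ∀ i j, Integrable (fun g : SU2 => (symMat n * tensorMat (Fin n) g.1) i j) haarSU2 :=
      fun i j => integrable_of_continuous (by
        simp only [Matrix.mul_apply]
        exact continuous_finsetSum _ fun m _ => continuous_const.mul (continuous_tensorMat _ _))
    simp only [chi, Matrix.trace, Matrix.diag]
    rw [integral_finsetSum _ fun i _ => hi i i]
    refine Finset.sum_eq_zero fun j _ => ?_
    refine congrFun (invariant_eq_zero hn (fun i => ∫ g : SU2,
      (symMat n * tensorMat (Fin n) g.1) i j ∂haarSU2) (fun σ i => ?_) fun h i => ?_) j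
    · refine integral_congr_ae (.of_forall fun g => ?_)
      simp only
      rw [← permMat_mul_apply σ (symMat n * tensorMat (Fin n) g.1), ← Matrix.mul_assoc,
        permMat_mul_symMat]
    · simp only [← integral_const_mul]
      rw [← integral_finsetSum _ fun m _ => (hi m j).const_mul _,
        ← integral_mul_left_eq_self (fun g : SU2 => (symMat n * tensorMat (Fin n) g.1) i j) h]
      refine integral_congr_ae (.of_forall fun g => ?_)
      simp only
      rw [← Matrix.mul_apply, ← Matrix.mul_assoc, ← symMat_tensorMat, Matrix.mul_assoc,
        tensorMat_mul]
      rfl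

theorem trace_mul_chi' (n : ℕ) (g : SU2) :
    g.1.trace * chi n g.1 = chi (n + 1) g.1 + if n = 0 then 0 else chi (n - 1) g.1 := by
  cases n with
  | zero => rw [chi_zero, chi_one]; simp
  | succ n => simpa using trace_mul_chi n g

/-- A factor `tr` can be moved from one character to the other. With `trace_mul_chi'` this is a
recursion in `a` which ends at `integral_chi`. -/
theorem integral_chi_mul_chi (a b : ℕ) :
    ∫ g : SU2, chi a g.1 * chi b g.1 ∂haarSU2 = if a = b then 1 else 0 := by
  have hc : ∀ a b, Integrable (fun g : SU2 => chi a g.1 * chi b g.1) haarSU2 := fun a b =>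
    integrable_of_continuous ((continuous_chi a).mul (continuous_chi b))
  have rec1 : ∀ a b, ∫ g : SU2, chi (a + 1) g.1 * chi b g.1 ∂haarSU2 +
      (if a = 0 then 0 else ∫ g : SU2, chi (a - 1) g.1 * chi b g.1 ∂haarSU2) =
      ∫ g : SU2, chi a g.1 * chi (b + 1) g.1 ∂haarSU2 +
      (if b = 0 then 0 else ∫ g : SU2, chi a g.1 * chi (b - 1) g.1 ∂haarSU2) := by
    intro a b
    have e1 : (if a = 0 then 0 else ∫ g : SU2, chi (a - 1) g.1 * chi b g.1 ∂haarSU2) =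
        ∫ g : SU2, (if a = 0 then 0 else chi (a - 1) g.1) * chi b g.1 ∂haarSU2 := by
      split_ifs <;> simp
    have e2 : (if b = 0 then 0 else ∫ g : SU2, chi a g.1 * chi (b - 1) g.1 ∂haarSU2) =
        ∫ g : SU2, chi a g.1 * (if b = 0 then 0 else chi (b - 1) g.1) ∂haarSU2 := by
      split_ifs <;> simp
    rw [e1, e2, ← integral_add (hc _ _), ← integral_add (hc _ _)]
    · refine integral_congr_ae (.of_forall fun g => ?_)
      simp only
      rw [← add_mul, ← mul_add, ← trace_mul_chi', ← trace_mul_chi']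
      ring
    · split_ifs
      · simp
      · exact hc _ _
    · split_ifs
      · simp
      · exact hc _ _
  have h0 : ∀ b, ∫ g : SU2, chi 0 g.1 * chi b g.1 ∂haarSU2 = if 0 = b then 1 else 0 := by
    intro b
    simp only [chi_zero, one_mul, integral_chi, eq_comm]
  induction a using Nat.strong_induction_on generalizing b with
  | _ a ih =>
    rcases a with _ | a
    · exact h0 b
    · have h1 := rec1 a b
      rw [ih a (by omega)] at h1
      have h2 : (if b = 0 then 0 else ∫ g : SU2, chi a g.1 * chi (b - 1) g.1 ∂haarSU2) =
          if a + 1 = b then 1 else 0 := by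
        split_ifs with h3 h4 h5
        · omega
        · rfl
        · rw [ih a (by omega), if_pos (by omega)]
        · rw [ih a (by omega), if_neg (by omega)]
      have h3 : (if a = 0 then 0 else ∫ g : SU2, chi (a - 1) g.1 * chi b g.1 ∂haarSU2) =
          if a = b + 1 then 1 else 0 := by
        split_ifs with h3 h4 h5
        · omega
        · rfl
        · rw [ih _ (by omega), if_pos (by omega)]
        · rw [ih _ (by omega), if_neg (by omega)]
      rw [h2, h3] at h1
      linear_combination h1

-- The recursion of `integral_chi_mul_chi` is repeated with a third character as a spectator. The
-- indicator function of `Admissible` satisfies the same recursion, and for `a = 0` admissibility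
-- means `b = c`.
open Classical in
theorem integral_chi_mul_chi_mul_chi (a b c : ℕ) :
    ∫ g : SU2, chi a g.1 * chi b g.1 * chi c g.1 ∂haarSU2 = if Admissible a b c then 1 else 0 := by
  have hc : ∀ a b, Integrable (fun g : SU2 => chi a g.1 * chi b g.1 * chi c g.1) haarSU2 :=
    fun a b => integrable_of_continuous
      (((continuous_chi a).mul (continuous_chi b)).mul (continuous_chi c))
  have rec1 : ∀ a b, ∫ g : SU2, chi (a + 1) g.1 * chi b g.1 * chi c g.1 ∂haarSU2 +
      (if a = 0 then 0 else ∫ g : SU2, chi (a - 1) g.1 * chi b g.1 * chi c g.1 ∂haarSU2) =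
      ∫ g : SU2, chi a g.1 * chi (b + 1) g.1 * chi c g.1 ∂haarSU2 +
      (if b = 0 then 0 else ∫ g : SU2, chi a g.1 * chi (b - 1) g.1 * chi c g.1 ∂haarSU2) := by
    intro a b
    have e1 : (if a = 0 then 0 else ∫ g : SU2, chi (a - 1) g.1 * chi b g.1 * chi c g.1 ∂haarSU2) =
        ∫ g : SU2, (if a = 0 then 0 else chi (a - 1) g.1) * chi b g.1 * chi c g.1 ∂haarSU2 := by
      split_ifs <;> simp
    have e2 : (if b = 0 then 0 else ∫ g : SU2, chi a g.1 * chi (b - 1) g.1 * chi c g.1 ∂haarSU2) =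
        ∫ g : SU2, chi a g.1 * (if b = 0 then 0 else chi (b - 1) g.1) * chi c g.1 ∂haarSU2 := by
      split_ifs <;> simp
    rw [e1, e2, ← integral_add (hc _ _), ← integral_add (hc _ _)]
    · refine integral_congr_ae (.of_forall fun g => ?_)
      simp only
      rw [← add_mul, ← add_mul, ← add_mul, ← mul_add, ← trace_mul_chi', ← trace_mul_chi']
      ring
    · split_ifs
      · simp
      · exact hc _ _
    · split_ifs
      · simp
      · exact hc _ _
  have h0 : ∀ b, ∫ g : SU2, chi 0 g.1 * chi b g.1 * chi c g.1 ∂haarSU2 =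
      if Admissible 0 b c then 1 else 0 := by
    intro b
    simp only [chi_zero, one_mul, integral_chi_mul_chi]
    refine if_congr ?_ rfl rfl
    simp only [Admissible, Nat.even_iff]
    omega
  induction a using Nat.strong_induction_on generalizing b with
  | _ a ih =>
    rcases a with _ | a
    · exact h0 b
    · have h1 := rec1 a b
      rw [ih a (by omega)] at h1
      have h2 : (if b = 0 then 0 else ∫ g : SU2, chi a g.1 * chi (b - 1) g.1 * chi c g.1 ∂haarSU2) =
          if b ≠ 0 ∧ Admissible a (b - 1) c then 1 else 0 := by
        by_cases hb : b = 0
        · simp [hb]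
        · rw [if_neg hb, ih a (by omega)]; simp [hb]
      have h3 : (if a = 0 then 0 else ∫ g : SU2, chi (a - 1) g.1 * chi b g.1 * chi c g.1 ∂haarSU2) =
          if a ≠ 0 ∧ Admissible (a - 1) b c then 1 else 0 := by
        by_cases hb : a = 0
        · simp [hb]
        · rw [if_neg hb, ih (a - 1) (by omega)]; simp [hb]
      rw [h2, h3] at h1
      rw [eq_sub_of_add_eq h1]
      simp only [Admissible, Nat.even_iff]
      split_ifs <;> first | omega | norm_num

/-! ### Intertwiners of trivalent vertices and theta networks. -/

/-! ### The tensors of trivalent vertices -/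

theorem strandMap_val {D : Type*} (ℓ : D → ℕ) (a : D → D) (h : ∀ d, ℓ (a d) = ℓ d) (s : Σ d, Fin (ℓ d)) :
    ((strandMap ℓ a h s).2 : ℕ) = ℓ s.1 - 1 - s.2 := by
  simp only [strandMap, Fin.val_cast, Fin.val_rev]
  omega

namespace OMatching

variable {S : Type*} [Fintype S]

theorem sum_prod_tails {I : Type*} [Fintype I] [DecidableEq S] (A : OMatching S) (φ : A.Tail → I → I → ℂ) :
    ∑ j : S → I, ∏ r : A.Tail, φ r (j r.1) (j (A.m r.1)) = ∏ r : A.Tail, ∑ a, ∑ b, φ r a b := by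
  classical
  let e : (A.Tail → I × I) ≃ (S → I) :=
    { toFun := fun f s => bif (A.tailEquiv.symm s).2 then (f (A.tailEquiv.symm s).1).1 else
        (f (A.tailEquiv.symm s).1).2
      invFun := fun j r => (j (A.tailEquiv (r, true)), j (A.tailEquiv (r, false)))
      left_inv := fun f => by ext r <;> simp
      right_inv := fun j => by
        ext s
        obtain ⟨⟨r, b⟩, rfl⟩ := A.tailEquiv.surjective s
        cases b <;> simp }
  have he : ∀ f r, e f r.1 = (f r).1 ∧ e f (A.m r.1) = (f r).2 := by
    intro f r
    have h1 : e f (A.tailEquiv (r, true)) = (f r).1 := by simp [e]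
    have h2 : e f (A.tailEquiv (r, false)) = (f r).2 := by simp [e]
    exact ⟨h1, h2⟩
  rw [← Equiv.sum_comp e]
  simp only [he]
  simp only [← Fintype.sum_prod_type']
  rw [Finset.prod_univ_sum, Fintype.piFinset_univ]

/-- Matrices acting at the single points can be sorted by arcs, as the kernel of an arc only
involves its two ends. -/
theorem contract_weight {I : Type*} [Fintype I] [DecidableEq S] (A : OMatching S) (G : S → I → I → ℂ) (κ : S → I → I → ℂ)
    (i : S → I) : ∑ j : S → I, (∏ s, G s (i s) (j s)) * A.weight κ j =
      A.weight (fun s a b => ∑ c, ∑ d, G s a c * G (A.m s) b d * κ s c d) i := by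
  rw [weight_eq_tails, ← A.sum_prod_tails
    fun r c d => G r.1 (i r.1) c * G (A.m r.1) (i (A.m r.1)) d * κ r.1 c d]
  refine Finset.sum_congr rfl fun j _ => ?_
  rw [weight_eq_tails, A.prod_eq_tails, ← Finset.prod_mul_distrib]

/-- Reversal of all arcs. -/
theorem prod_not {I : Type*} (A : OMatching S) {κ : I → I → ℂ} (hκ : ∀ a b, κ b a = -κ a b) (i : S → I) :
    (∏ s, if !A.o s then κ (i s) (i (A.m s)) else 1) =
      (-1) ^ Fintype.card A.Tail * A.weight (fun _ => κ) i := by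
  rw [weight_eq_tails, A.prod_eq_tails, ← Finset.card_univ, ← Finset.prod_const,
    ← Finset.prod_mul_distrib]
  refine Finset.prod_congr rfl fun r _ => ?_
  simp only [r.2, A.o_m, A.invol, Bool.not_true, Bool.false_eq_true, if_false, one_mul, Bool.not_false,
    if_true, neg_one_mul]
  exact hκ _ _

end OMatching

namespace SpinNetwork

section Tensor

variable {D : Type*} [Fintype D] (N : SpinNetwork D)

/-- The contraction at all vertices, before symmetrization. -/
def vertexWeight (j : N.Strand → Fin 2) : ℂ :=
  ∏ s, if N.toNext s then epsInv (j s) (j (N.atVertex s)) else 1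

/-- The tensor product of the intertwiners at all vertices. -/
def vertexTensor [DecidableEq D] (i : N.Strand → Fin 2) : ℂ :=
  ∑ j, N.vertexWeight j * ∏ d, symKernel (N.label d) (fun p => j ⟨d, p⟩) fun p => i ⟨d, p⟩

theorem vertexTensor_real [DecidableEq D] (i : N.Strand → Fin 2) : star (N.vertexTensor i) = N.vertexTensor i := by
  have h : ∀ a b, star (epsInv a b) = epsInv a b := fun a b => by
    fin_cases a <;> fin_cases b <;> simp [epsInv]
  simp only [vertexTensor, vertexWeight, star_sum, star_mul', star_prod, star_symKernel]
  refine Finset.sum_congr rfl fun j _ => ?_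
  congr 1
  refine Finset.prod_congr rfl fun s _ => ?_
  split_ifs
  · exact h _ _
  · exact star_one _

theorem prodMat_tensorMat (k : D → ℕ) (g : Matrix (Fin 2) (Fin 2) ℂ) :
    (prodMat fun d => tensorMat (Fin (k d)) g) = tensorMat (Σ d, Fin (k d)) g := by
  ext i j
  simp only [prodMat, tensorMat, Matrix.of_apply, Fintype.prod_sigma]

theorem permMat_sigmaCongrRight {k : D → ℕ} (σ : ∀ d, Equiv.Perm (Fin (k d))) :
    permMat (Equiv.Perm.sigmaCongrRight σ) = prodMat fun d => permMat (σ d) := by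
  ext i j
  simp only [permMat, prodMat, Matrix.of_apply]
  by_cases h : i ∘ Equiv.Perm.sigmaCongrRight σ = j
  · subst h
    rw [if_pos rfl]
    exact (Finset.prod_eq_one fun d _ => if_pos rfl).symm
  · rw [if_neg h]
    obtain ⟨⟨d, p⟩, hd⟩ := Function.ne_iff.mp h
    exact (Finset.prod_eq_zero (Finset.mem_univ d) (if_neg fun h2 => hd (congrFun h2 p))).symm

variable {N} [DecidableEq D]

theorem eval_eq_vertexTensor (hN : N.Regular) (ha : N.AllAdmissible) (o : D → Bool)
    (ho : ∀ d, o (N.opp d) = !o d) :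
    N.eval = ((OMatching.relSign (vertexMatching hN.rot_rot_rot ha) (N.linkMatching hN o ho) : ℤ) : ℂ) *
      ∑ j : N.Strand → Fin 2, N.vertexTensor j * (N.linkMatching hN o ho).weight N.linkKernel j := by
  rw [N.eval_eq hN ha o ho, Finset.sum_comm]
  simp only [vertexTensor, Finset.sum_mul]
  rfl

theorem vertexTensor_eq_mulVec : N.vertexTensor =
    (prodMat fun d => symMat (N.label d)).mulVec N.vertexWeight := by
  ext i
  simp only [vertexTensor, Matrix.mulVec, dotProduct, prodMat, Matrix.of_apply, symMat]
  refine Finset.sum_congr rfl fun j _ => ?_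
  rw [mul_comm]
  congr 1
  exact Finset.prod_congr rfl fun d _ => (symKernel_comm _ _ _).symm

theorem repMat_eq (k : D → ℕ) (g : Matrix (Fin 2) (Fin 2) ℂ) :
    repMat k g = (prodMat fun d => symMat (k d)) * tensorMat (Σ d, Fin (k d)) g := by
  rw [← prodMat_tensorMat, prodMat_mul]
  rfl

theorem repMat_eq' (k : D → ℕ) (g : Matrix (Fin 2) (Fin 2) ℂ) :
    repMat k g = tensorMat (Σ d, Fin (k d)) g * (prodMat fun d => symMat (k d)) := by
  rw [← prodMat_tensorMat, prodMat_mul]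
  simp only [← symMat_tensorMat]
  rfl

theorem sym_mulVec_vertexTensor :
    (prodMat fun d => symMat (N.label d)).mulVec N.vertexTensor = N.vertexTensor := by
  rw [vertexTensor_eq_mulVec, Matrix.mulVec_mulVec, prodMat_mul]
  simp only [symMat_mul_symMat]

theorem vertexTensor_comp (σ : ∀ d, Equiv.Perm (Fin (N.label d))) (i : N.Strand → Fin 2) :
    N.vertexTensor (i ∘ Equiv.Perm.sigmaCongrRight σ) = N.vertexTensor i := by
  refine Finset.sum_congr rfl fun j _ => ?_
  congr 1
  refine Finset.prod_congr rfl fun d _ => ?_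
  rw [← symKernel_comm, ← symKernel_comm (N.label d) (fun p => j ⟨d, p⟩)]
  have h := congrFun (congrFun (permMat_mul_symMat (σ d)) fun p => i ⟨d, p⟩) fun p => j ⟨d, p⟩
  rw [permMat_mul_apply] at h
  exact h

theorem sym_mulVec_comp {k : D → ℕ} (σ : ∀ d, Equiv.Perm (Fin (k d))) (w : ((Σ d, Fin (k d)) → Fin 2) → ℂ) :
    ((prodMat fun d => symMat (k d)).mulVec fun i => w (i ∘ Equiv.Perm.sigmaCongrRight σ)) =
      (prodMat fun d => symMat (k d)).mulVec w := by
  have h : (fun i => w (i ∘ Equiv.Perm.sigmaCongrRight σ)) =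
      (permMat (Equiv.Perm.sigmaCongrRight σ)).mulVec w := by
    ext i
    simp [permMat, Matrix.mulVec, dotProduct]
  rw [h, Matrix.mulVec_mulVec, permMat_sigmaCongrRight, prodMat_mul]
  simp only [symMat_mul_permMat]

/-- A product state with the same spinor on all strands of a leg is symmetric, so the symmetrizer
does not change it. -/
theorem sum_symKernel_mul {k : D → ℕ} (j : (Σ d, Fin (k d)) → Fin 2) (x : D → Fin 2 → ℂ) :
    ∑ i : (Σ d, Fin (k d)) → Fin 2, (∏ d, symKernel (k d) (fun p => j ⟨d, p⟩) fun p => i ⟨d, p⟩) *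
      ∏ s, x s.1 (i s) = ∏ s, x s.1 (j s) := by
  rw [← sum_symKernel k j fun i => ∏ s, x s.1 (i s)]
  have h : ∀ τ : ∀ d, Equiv.Perm (Fin (k d)), ∏ s : Σ d, Fin (k d),
      x s.1 ((j ∘ Equiv.Perm.sigmaCongrRight τ) s) = ∏ s : Σ d, Fin (k d), x s.1 (j s) := fun τ =>
    Equiv.prod_comp (Equiv.Perm.sigmaCongrRight τ) fun s => x s.1 (j s)
  simp only [h, Finset.sum_const, Finset.card_univ, Fintype.card_pi, Fintype.card_perm,
    Fintype.card_fin, nsmul_eq_mul]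
  rw [← mul_assoc, Nat.cast_prod, ← Finset.prod_mul_distrib, Finset.prod_eq_one, one_mul]
  exact fun d _ => mul_inv_cancel₀ (by exact_mod_cast (k d).factorial_ne_zero)

theorem SU2.mul_epsInv_mul_transpose (g : SU2) : g.1 * epsInv * g.1.transpose = epsInv := by
  have h := g.eps_mul_inv
  have h2 : g.1.transpose = epsMat * (g⁻¹).1 * epsInv := by
    rw [h, Matrix.mul_assoc, epsMat_mul_epsInv, Matrix.mul_one]
  rw [h2, Matrix.mul_assoc, ← Matrix.mul_assoc epsInv, ← Matrix.mul_assoc epsInv, epsInv_mul_epsMat,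
    Matrix.one_mul, ← Matrix.mul_assoc, SU2.coe_mul_inv, Matrix.one_mul]

/-- Each arc is invariant because `g ε⁻¹ gᵀ = ε⁻¹`, and the symmetrizers commute with the action of
the group. -/
theorem repMat_mulVec_vertexTensor (h3 : ∀ d, N.rot (N.rot (N.rot d)) = d) (ha : N.AllAdmissible)
    (g : SU2) : (repMat N.label g.1).mulVec N.vertexTensor = N.vertexTensor := by
  have h : (tensorMat N.Strand g.1).mulVec N.vertexWeight = N.vertexWeight := by
    ext i
    refine ((vertexMatching h3 ha).contract_weight (fun _ => g.1) vertexKernel i).trans ?_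
    refine Finset.prod_congr rfl fun s _ => ?_
    have h4 : ∀ a b, ∑ c, ∑ d, g.1 a c * g.1 b d * epsInv c d = epsInv a b := by
      intro a b
      conv_rhs => rw [← SU2.mul_epsInv_mul_transpose g]
      simp only [Matrix.mul_apply, Matrix.transpose_apply, Finset.sum_mul]
      rw [Finset.sum_comm]
      exact Finset.sum_congr rfl fun d _ => Finset.sum_congr rfl fun c _ => by ring
    simp only [vertexKernel, h4]
    rfl
  rw [repMat_eq', ← Matrix.mulVec_mulVec, sym_mulVec_vertexTensor, vertexTensor_eq_mulVec,
    Matrix.mulVec_mulVec, ← repMat_eq', repMat_eq, ← Matrix.mulVec_mulVec, h]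

end Tensor

/-- A single vertex with legs numbered by `Fin 3`, in cyclic or anticyclic order. -/
abbrev vertexNet (b : Bool) (k : Fin 3 → ℕ) : SpinNetwork (Fin 3) where
  rot d := bif b then d + 1 else d - 1
  opp d := d
  label := k
  label_opp _ := rfl
  hol _ := 1

theorem vertexNet_rot (b : Bool) (k : Fin 3 → ℕ) (d : Fin 3) :
    (vertexNet b k).rot ((vertexNet b k).rot ((vertexNet b k).rot d)) = d := by
  have h : ∀ (b : Bool) (d : Fin 3), (bif b then (bif b then (bif b then d + 1 else d - 1) + 1 else
    (bif b then d + 1 else d - 1) - 1) + 1 else (bif b then (bif b then d + 1 else d - 1) + 1 else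
    (bif b then d + 1 else d - 1) - 1) - 1) = d := by decide
  exact h b d

theorem vertexNet_allAdmissible (b : Bool) {k : Fin 3 → ℕ} (h : Admissible (k 0) (k 1) (k 2)) :
    (vertexNet b k).AllAdmissible := by
  obtain ⟨h1, h2, h3, h4⟩ := h
  have e1 : (1 + 1 : Fin 3) = 2 := rfl
  have e2 : (2 + 1 : Fin 3) = 0 := rfl
  have e3 : (0 - 1 : Fin 3) = 2 := rfl
  have e4 : (2 - 1 : Fin 3) = 1 := rfl
  intro d
  rw [Nat.even_iff] at h1
  fin_cases d <;> cases b <;>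
    simp [Admissible, Nat.even_iff, e1, e2, e3, e4] <;> omega

/-- Vertices may be treated one by one. -/
theorem vertexTensor_eq_prod {D : Type*} [Fintype D] [DecidableEq D] {N : SpinNetwork D}
    (ha : N.AllAdmissible) {ι : Type*} [Fintype ι] (b : ι → Bool) (e : ι × Fin 3 ≃ D)
    (he : ∀ x l, N.rot (e (x, l)) = e (x, bif b x then l + 1 else l - 1)) (i : N.Strand → Fin 2) :
    N.vertexTensor i = ∏ x, (vertexNet (b x) fun l => N.label (e (x, l))).vertexTensor
      fun s => i ⟨e (x, s.1), s.2⟩ := by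
  classical
  let V : ι → SpinNetwork (Fin 3) := fun x => vertexNet (b x) fun l => N.label (e (x, l))
  have hV : ∀ x, (V x).AllAdmissible := fun x l => by
    have := ha (e (x, l))
    rw [he, he] at this
    exact this
  let f : (Σ x : ι, (V x).Strand) → N.Strand := fun y => ⟨e (y.1, y.2.1), y.2.2⟩
  have hf : Function.Bijective f := by
    constructor
    · rintro ⟨x, l, p⟩ ⟨x', l', p'⟩ h
      have h1 := e.injective (congrArg Sigma.fst h)
      simp only [Prod.mk.injEq] at h1
      obtain ⟨rfl, rfl⟩ := h1
      obtain rfl : p = p' := Fin.ext (congrArg (fun s : N.Strand => (s.2 : ℕ)) h)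
      rfl
    · rintro ⟨d, p⟩
      obtain ⟨⟨x, l⟩, rfl⟩ := e.surjective d
      exact ⟨⟨x, l, p⟩, rfl⟩
  let E := Equiv.ofBijective f hf
  have h1 : ∀ x s, N.toNext (f ⟨x, s⟩) = (V x).toNext s := by
    intro x s
    simp only [toNext, f, he]
    rfl
  have h2 : ∀ x s, N.atVertex (f ⟨x, s⟩) = f ⟨x, (V x).atVertex s⟩ := by
    intro x s
    cases h : (V x).toNext s
    · obtain ⟨a1, a2⟩ := atVertex_of_not_toNext (hV x) h
      rw [← h1] at h
      obtain ⟨a3, a4⟩ := atVertex_of_not_toNext ha h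
      refine strand_ext ?_ ?_
      · rw [a3]
        simp only [f, he, a1]
        rfl
      · rw [a4]
        simp only [f, he, a2]
        rfl
    · obtain ⟨a1, a2⟩ := atVertex_of_toNext (hV x) h
      rw [← h1] at h
      obtain ⟨a3, a4⟩ := atVertex_of_toNext ha h
      refine strand_ext ?_ ?_
      · rw [a3]
        simp only [f, he, a1]
        rfl
      · rw [a4]
        simp only [f, a2]
        rfl
  have h3 : ∀ j, N.vertexWeight j = ∏ x, (V x).vertexWeight fun s => j (f ⟨x, s⟩) := by
    intro j
    rw [vertexWeight, ← Equiv.prod_comp E, Fintype.prod_sigma]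
    refine Finset.prod_congr rfl fun x _ => Finset.prod_congr rfl fun s _ => ?_
    change (if N.toNext (f ⟨x, s⟩) = true then epsInv (j (f ⟨x, s⟩)) (j (N.atVertex (f ⟨x, s⟩))) else 1) = _
    rw [h1, h2]
  have h4 : ∀ j : N.Strand → Fin 2, ∏ d, symKernel (N.label d) (fun p => j ⟨d, p⟩) (fun p => i ⟨d, p⟩) =
      ∏ x, ∏ l, symKernel ((V x).label l) (fun p => j (f ⟨x, l, p⟩)) fun p => i (f ⟨x, l, p⟩) := by
    intro j
    rw [← Equiv.prod_comp e, Fintype.prod_prod_type]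
  simp only [vertexTensor, h3, h4, ← Finset.prod_mul_distrib]
  rw [Finset.prod_univ_sum, Fintype.piFinset_univ]
  let E' : (N.Strand → Fin 2) ≃ (∀ x, (V x).Strand → Fin 2) :=
    (Equiv.arrowCongr E.symm (Equiv.refl _)).trans (Equiv.piCurry fun x (_ : (V x).Strand) => Fin 2)
  rw [← Equiv.sum_comp E']
  rfl

end SpinNetwork

/-! ### Theta networks -/

namespace SpinNetwork

/-- A map of the legs which reverses the cyclic order reverses the strands at a vertex. -/
theorem mirror {D D' : Type*} {N : SpinNetwork D} {N' : SpinNetwork D'} (ha : N.AllAdmissible)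
    (ha' : N'.AllAdmissible) (f : D → D') (hl : ∀ d, N'.label (f d) = N.label d) {s : N.Strand}
    (h1 : N'.rot (f s.1) = f (N.rot (N.rot s.1))) (h2 : N'.rot (N'.rot (f s.1)) = f (N.rot s.1))
    {r : N'.Strand} (hr1 : r.1 = f s.1) (hr2 : (r.2 : ℕ) = N.label s.1 - 1 - s.2) :
    N'.toNext r = (!N.toNext s) ∧ (N'.atVertex r).1 = f (N.atVertex s).1 ∧
      ((N'.atVertex r).2 : ℕ) = N.label (N.atVertex s).1 - 1 - (N.atVertex s).2 := by
  have h5 := s.2.2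
  obtain ⟨⟨m, hm⟩, b2, b3, b4⟩ := ha s.1
  have p1 : N'.label r.1 = N.label s.1 := by rw [hr1, hl]
  have p2 : N'.label (N'.rot r.1) = N.label (N.rot (N.rot s.1)) := by rw [hr1, h1, hl]
  have p3 : N'.label (N'.rot (N'.rot r.1)) = N.label (N.rot s.1) := by rw [hr1, h2, hl]
  have h0 : N'.toNext r = !N.toNext s := by
    simp only [toNext, p1, p2, p3, hr2]
    rw [Bool.not_not, ← decide_not, decide_eq_decide]
    omega
  refine ⟨h0, ?_⟩
  cases hs : N.toNext s
  · rw [hs] at h0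
    obtain ⟨a1, a2⟩ := atVertex_of_not_toNext ha hs
    obtain ⟨a3, a4⟩ := atVertex_of_toNext ha' h0
    simp only [toNext, Bool.not_eq_eq_eq_not, Bool.not_false, decide_eq_true_eq] at hs
    refine ⟨by rw [a3, a1, hr1, h1], ?_⟩
    rw [a4, a2, a1]
    omega
  · rw [hs] at h0
    obtain ⟨a1, a2⟩ := atVertex_of_toNext ha hs
    obtain ⟨a3, a4⟩ := atVertex_of_not_toNext ha' h0
    refine ⟨by rw [a3, a1, hr1, h2], ?_⟩
    rw [a4, a2, a1]
    omega

/-- Reversal of the strands of each leg. -/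
def strandRev {D : Type*} (k : D → ℕ) : Equiv.Perm (Σ d, Fin (k d)) :=
  Equiv.Perm.sigmaCongrRight fun _ => Fin.revPerm

theorem strandRev_apply {D : Type*} (k : D → ℕ) (s : Σ d, Fin (k d)) :
    strandRev k s = ⟨s.1, Fin.rev s.2⟩ := rfl

section Vertex

variable {k : Fin 3 → ℕ}

/-- The vertex with legs numbered by `Fin 3`, as a matching of strands. -/
def vertexNetMatching (h : Admissible (k 0) (k 1) (k 2)) (b : Bool) : OMatching (vertexNet b k).Strand :=
  vertexMatching (vertexNet_rot b k) (vertexNet_allAdmissible b h)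

theorem vertexNet_mirror (h : Admissible (k 0) (k 1) (k 2)) (s : Σ d, Fin (k d)) :
    (vertexNet true k).toNext (strandRev k s) = (!(vertexNet false k).toNext s) ∧
    (vertexNet true k).atVertex (strandRev k s) = strandRev k ((vertexNet false k).atVertex s) := by
  have e : ∀ d : Fin 3, d + 1 = d - 1 - 1 ∧ d + 1 + 1 = d - 1 := by decide
  obtain ⟨h1, h2, h3⟩ := mirror (N := vertexNet false k) (N' := vertexNet true k) (s := s)
    (r := strandRev k s) (vertexNet_allAdmissible false h) (vertexNet_allAdmissible true h)
    id (fun _ => rfl) (e s.1).1 (e s.1).2 rfl (by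
      rw [strandRev_apply, Fin.val_rev, add_comm, Nat.sub_add_eq])
  refine ⟨h1, strand_ext h2 ?_⟩
  refine h3.trans ?_
  change _ = ((Fin.rev ((vertexNet false k).atVertex s).2 : Fin _) : ℕ)
  rw [Fin.val_rev, add_comm, Nat.sub_add_eq]

/-- The number of strands through a vertex. -/
def vertexStrands (h : Admissible (k 0) (k 1) (k 2)) : ℕ :=
  Fintype.card (vertexNetMatching h false).Tail

theorem neg_one_pow_mul_self (m : ℕ) : (-1 : ℂ) ^ m * (-1) ^ m = 1 := by
  rw [← mul_pow]; norm_num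

/-- The kernel `epsInv` at all ends preserves the form of the arcs. Reversing the strands of each
leg turns the vertex into the one with the opposite cyclic order, where all arcs have the opposite
direction; this costs one sign per arc. -/
theorem vertexWeight_mirror (h : Admissible (k 0) (k 1) (k 2)) (i : (Σ d, Fin (k d)) → Fin 2) :
    ∑ j : (Σ d, Fin (k d)) → Fin 2, (∏ s, epsInv (j s) (i s)) * (vertexNet true k).vertexWeight j =
      (-1) ^ vertexStrands h * (vertexNet false k).vertexWeight (i ∘ strandRev k) := by
  refine ((vertexNetMatching h true).contract_weight (fun _ a c => epsInv c a) vertexKernel i).trans ?_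
  have h1 : ∀ a b, ∑ c, ∑ d, epsInv c a * epsInv d b * epsInv c d = epsInv a b := by
    intro a b
    fin_cases a <;> fin_cases b <;> simp [epsInv, Fin.sum_univ_two]
  refine Eq.trans ?_ ((vertexNetMatching h false).prod_not epsInv_alternating (i ∘ strandRev k))
  refine (Equiv.prod_comp (strandRev k) _).symm.trans ?_
  refine Finset.prod_congr rfl fun s _ => ?_
  simp only [vertexKernel, h1]
  change (if (vertexNet true k).toNext (strandRev k s) = true then
    epsInv (i (strandRev k s)) (i ((vertexNet true k).atVertex (strandRev k s))) else 1) = _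
  rw [(vertexNet_mirror h s).1, (vertexNet_mirror h s).2]
  rfl

/-- `vertexWeight_mirror` passed through the symmetrizers, which make the reversal of the strands
invisible. -/
theorem sum_epsInv_vertexTensor (h : Admissible (k 0) (k 1) (k 2)) (i : (Σ d, Fin (k d)) → Fin 2) :
    ∑ j : (Σ d, Fin (k d)) → Fin 2, (∏ s, epsInv (j s) (i s)) * (vertexNet true k).vertexTensor j =
      (-1) ^ vertexStrands h * (vertexNet false k).vertexTensor i := by
  have h1 : (tensorMat (Σ d, Fin (k d)) epsInv.transpose).mulVec (vertexNet true k).vertexWeight =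
      (-1 : ℂ) ^ vertexStrands h • fun i => (vertexNet false k).vertexWeight (i ∘ strandRev k) :=
    funext fun i => vertexWeight_mirror h i
  have h2 : (tensorMat (Σ d, Fin (k d)) epsInv.transpose).mulVec (vertexNet true k).vertexTensor =
      (-1 : ℂ) ^ vertexStrands h • (vertexNet false k).vertexTensor := by
    rw [vertexTensor_eq_mulVec, Matrix.mulVec_mulVec]
    have := (repMat_eq' k epsInv.transpose).symm.trans (repMat_eq k epsInv.transpose)
    refine (congrArg (fun A => A.mulVec (vertexNet true k).vertexWeight) this).trans ?_
    rw [← Matrix.mulVec_mulVec, h1, Matrix.mulVec_smul]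
    congr 1
    exact (sym_mulVec_comp _ _).trans (vertexTensor_eq_mulVec (N := vertexNet false k)).symm
  exact congrFun h2 i

-- The tensor is real, so the sum is its squared norm, and it suffices to find a state with which it
-- pairs to a nonzero number.
open scoped ComplexOrder in
theorem sum_vertexTensor_ne_zero (h : Admissible (k 0) (k 1) (k 2)) :
    ∑ i : (Σ d, Fin (k d)) → Fin 2,
      (vertexNet true k).vertexTensor i * (vertexNet true k).vertexTensor i ≠ 0 := by
  intro h0
  have h1 : (vertexNet true k).vertexTensor = 0 := by
    rw [← dotProduct_star_self_eq_zero]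
    refine Eq.trans (Finset.sum_congr rfl fun i _ => ?_) h0
    rw [Pi.star_apply, vertexTensor_real]
  -- Three pairwise independent spinors, one for each leg. The pairing is a product over the arcs of
  -- determinants of two of them, since an arc joins different legs.
  let x : Fin 3 → Fin 2 → ℂ := ![![1, 0], ![0, 1], ![1, 1]]
  have h2 : ∑ i : (Σ d, Fin (k d)) → Fin 2, (vertexNet true k).vertexTensor i * ∏ s, x s.1 (i s) =
      ∑ j : (Σ d, Fin (k d)) → Fin 2, (∏ s, x s.1 (j s)) * (vertexNet true k).vertexWeight j := by
    simp only [vertexTensor, Finset.sum_mul]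
    rw [Finset.sum_comm]
    refine Finset.sum_congr rfl fun j _ => ?_
    rw [← sum_symKernel_mul j x, Finset.sum_mul]
    exact Finset.sum_congr rfl fun i _ => by ring!
  rw [h1] at h2
  simp only [Pi.zero_apply, zero_mul, Finset.sum_const_zero] at h2
  have h3 := (vertexNetMatching h true).contract_weight (fun s _ c => x s.1 c) vertexKernel fun _ => 0
  refine absurd (h2.trans h3) (Ne.symm (Finset.prod_ne_zero_iff.mpr fun s _ => ?_))
  split_ifs with hs
  · have h4 := (atVertex_of_toNext (vertexNet_allAdmissible true h) hs).1
    change (((vertexNetMatching h true).m s).1 = s.1 + 1) at h4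
    simp only [vertexKernel, h4]
    generalize s.1 = l
    fin_cases l <;> simp [x, epsInv, Fin.sum_univ_two]
  · exact one_ne_zero

theorem thetaNetwork_regular (k : Fin 3 → ℕ) : (thetaNetwork k).Regular where
  rot_rot_rot := by simp only [thetaNetwork]; decide
  rot_ne := by simp only [thetaNetwork]; decide
  opp_opp _ := by simp [thetaNetwork]
  opp_ne := by simp only [thetaNetwork]; decide
  hol_opp _ := by simp [thetaNetwork]

theorem thetaNetwork_allAdmissible (h : Admissible (k 0) (k 1) (k 2)) :
    (thetaNetwork k).AllAdmissible := by
  rintro ⟨b, d⟩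
  have := vertexNet_allAdmissible b h d
  cases b <;> exact this

/-- For admissible labels the number of strand ends is even. -/
theorem tensorMat_neg_one (h : Admissible (k 0) (k 1) (k 2)) : tensorMat (Σ d, Fin (k d)) (-1) = 1 := by
  ext i j
  have h1 : tensorMat (Σ d, Fin (k d)) (-1) i j =
      (-1) ^ Fintype.card (Σ d, Fin (k d)) * tensorMat (Σ d, Fin (k d)) 1 i j := by
    simp only [tensorMat, Matrix.of_apply, Matrix.neg_apply, Finset.prod_neg, Finset.card_univ]
  have h2 : Fintype.card (Σ d, Fin (k d)) = 2 * _ := (vertexNetMatching h true).card_tail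
  rw [h1, tensorMat_one, h2, pow_mul]
  norm_num

/-- The inverse of `sum_epsInv_vertexTensor`: `ε² = -1` acts trivially on an even number of strand
ends. -/
theorem sum_epsMat_vertexTensor (h : Admissible (k 0) (k 1) (k 2)) (i : (Σ d, Fin (k d)) → Fin 2) :
    ∑ j : (Σ d, Fin (k d)) → Fin 2, (vertexNet false k).vertexTensor j * ∏ s, epsMat (i s) (j s) =
      (-1) ^ vertexStrands h * (vertexNet true k).vertexTensor i := by
  have h1 : (tensorMat (Σ d, Fin (k d)) epsMat).mulVec (vertexNet true k).vertexTensor =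
      (-1 : ℂ) ^ vertexStrands h • (vertexNet false k).vertexTensor := by
    rw [← epsInv_transpose]
    exact funext fun i => sum_epsInv_vertexTensor h i
  have h2 : epsMat * epsMat = -1 := by
    have := epsInv_mul_epsMat
    rw [epsInv_eq_neg, Matrix.neg_mul] at this
    rw [← this, neg_neg]
  have h3 := congrArg (tensorMat (Σ d, Fin (k d)) epsMat).mulVec h1
  rw [Matrix.mulVec_mulVec, tensorMat_mul, h2, tensorMat_neg_one h, Matrix.one_mulVec,
    Matrix.mulVec_smul] at h3
  have h4 := congrFun h3 i
  rw [h4, Pi.smul_apply, smul_eq_mul, ← mul_assoc, neg_one_pow_mul_self, one_mul]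
  exact Finset.sum_congr rfl fun j _ => mul_comm _ _

/-- The links of a theta network reflect one vertex onto the other with opposite cyclic order, which
is the situation of `relSign_eq_one_of_mirror`. -/
theorem thetaNetwork_relSign (hr : (thetaNetwork k).Regular) (ha : (thetaNetwork k).AllAdmissible) :
    OMatching.relSign (vertexMatching hr.rot_rot_rot ha)
      ((thetaNetwork k).linkMatching hr (fun d => d.1) fun _ => rfl) = 1 := by
  refine OMatching.relSign_eq_one_of_mirror _ _ (fun _ => True) (fun s _ => ?_) fun s hs => absurd trivial hs
  have e : ∀ d : Bool × Fin 3, ((!d.1, bif !d.1 then d.2 + 1 else d.2 - 1) : Bool × Fin 3) =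
      (!d.1, bif d.1 then (bif d.1 then d.2 + 1 else d.2 - 1) + 1 else
        (bif d.1 then d.2 + 1 else d.2 - 1) - 1) ∧
      ((!d.1, bif !d.1 then (bif !d.1 then d.2 + 1 else d.2 - 1) + 1 else
        (bif !d.1 then d.2 + 1 else d.2 - 1) - 1) : Bool × Fin 3) =
      (!d.1, bif d.1 then d.2 + 1 else d.2 - 1) := by decide
  obtain ⟨h1, h2, h3⟩ := mirror (N := thetaNetwork k) (N' := thetaNetwork k) (s := s)
    (r := ((thetaNetwork k).linkMatching hr (fun d => d.1) fun d => rfl).m s) ha ha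
    (thetaNetwork k).opp (fun _ => rfl) (e s.1).1 (e s.1).2 rfl (strandMap_val _ (thetaNetwork k).opp (thetaNetwork k).label_opp s)
  refine ⟨trivial, trivial, strand_ext h2 ?_, h1, ?_⟩
  · exact h3.trans (strandMap_val _ (thetaNetwork k).opp (thetaNetwork k).label_opp _).symm
  · change ((thetaNetwork k).atVertex s).1.1 = s.1.1
    cases hs : (thetaNetwork k).toNext s
    · rw [(atVertex_of_not_toNext ha hs).1]; rfl
    · rw [(atVertex_of_toNext ha hs).1]; rfl

theorem thetaNetwork_vertexTensor (ha : (thetaNetwork k).AllAdmissible)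
    (j : (thetaNetwork k).Strand → Fin 2) : (thetaNetwork k).vertexTensor j =
      (vertexNet true k).vertexTensor (fun s => j ⟨(true, s.1), s.2⟩) *
      (vertexNet false k).vertexTensor (fun s => j ⟨(false, s.1), s.2⟩) := by
  rw [vertexTensor_eq_prod ha (fun b : Bool => b) (Equiv.refl _) (fun _ _ => rfl), Fintype.prod_bool]
  rfl

theorem thetaNetwork_linkWeight (hr : (thetaNetwork k).Regular) (j : (thetaNetwork k).Strand → Fin 2) :
    ((thetaNetwork k).linkMatching hr (fun d => d.1) fun _ => rfl).weight
      (thetaNetwork k).linkKernel j = ∏ s : Σ d, Fin (k d),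
        epsMat (j ⟨(true, s.1), s.2⟩) (j ⟨(false, s.1), Fin.rev s.2⟩) := by
  have hκ : (thetaNetwork k).linkKernel = fun _ => epsMat := by
    ext s a b
    simp [linkKernel, thetaNetwork]
  rw [hκ]
  refine Eq.trans (Fintype.prod_sigma _) ?_
  rw [Fintype.prod_prod_type, Fintype.prod_bool, Fintype.prod_sigma]
  have h1 : ∀ a b : ℂ, b = 1 → a * b = a := fun a b hb => by rw [hb, mul_one]
  exact h1 _ _ (Finset.prod_eq_one fun d _ => Finset.prod_eq_one fun p _ => rfl)

/-- The states of the strands on both ends of a theta network. -/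
def thetaStates (k : Fin 3 → ℕ) : ((thetaNetwork k).Strand → Fin 2) ≃
    ((Σ d, Fin (k d)) → Fin 2) × ((Σ d, Fin (k d)) → Fin 2) where
  toFun j := (fun s => j ⟨(true, s.1), s.2⟩, fun s => j ⟨(false, s.1), Fin.rev s.2⟩)
  invFun y s := bif s.1.1 then y.1 ⟨s.1.2, s.2⟩ else y.2 ⟨s.1.2, Fin.rev s.2⟩
  left_inv j := by
    ext1 ⟨⟨b, d⟩, p⟩
    cases b
    · exact congrArg (fun q => j ⟨(false, d), q⟩) (Fin.rev_rev p)
    · rfl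
  right_inv y := Prod.ext rfl (funext fun s => congrArg (fun q => y.2 ⟨s.1, q⟩) (Fin.rev_rev s.2))

/-- The evaluation of a theta network in terms of its intertwiner. -/
theorem thetaNetwork_eval (h : Admissible (k 0) (k 1) (k 2)) :
    (thetaNetwork k).eval = (-1) ^ vertexStrands h * ∑ i : (Σ d, Fin (k d)) → Fin 2,
      (vertexNet true k).vertexTensor i * (vertexNet true k).vertexTensor i := by
  have hr := thetaNetwork_regular k
  have ha := thetaNetwork_allAdmissible h
  rw [eval_eq_vertexTensor hr ha (fun d => d.1) fun d => rfl, thetaNetwork_relSign hr ha]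
  simp only [thetaNetwork_vertexTensor ha, thetaNetwork_linkWeight hr]
  rw [← Equiv.sum_comp (thetaStates k).symm, Fintype.sum_prod_type]
  simp only [Units.val_one, Int.cast_one, one_mul]
  rw [Finset.mul_sum]
  refine Finset.sum_congr rfl fun i _ => ?_
  rw [mul_left_comm, ← sum_epsMat_vertexTensor h i, Finset.mul_sum]
  refine Finset.sum_congr rfl fun i' _ => ?_
  have h1 := vertexTensor_comp (N := vertexNet false k) (fun _ => Fin.revPerm) i'
  have h2 : ∏ s : Σ d, Fin (k d), epsMat (i s) (i' ⟨s.1, Fin.rev (Fin.rev s.2)⟩) =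
      ∏ s, epsMat (i s) (i' s) := by simp only [Fin.rev_rev]
  rw [mul_assoc, ← h1, ← h2]
  rfl

/-- The tensor product of the representation matrices of a group element along three parallel links,
which join two mirror symmetric vertices. -/
def linkMat (n : ℕ) (g : Matrix (Fin 2) (Fin 2) ℂ) : Matrix (Fin n → Fin 2) (Fin n → Fin 2) ℂ :=
  symMat n * tensorMat (Fin n) (g * epsInv) * permMat Fin.revPerm

theorem prod_linkMat (g : SU2) (i i' : (Σ d, Fin (k d)) → Fin 2) :
    ∏ l, linkMat (k l) g.1 (fun p => i ⟨l, p⟩) (fun p => i' ⟨l, p⟩) =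
      ∑ m : (Σ d, Fin (k d)) → Fin 2, repMat k g.1 i m * ∏ s, epsInv (m s) ((i' ∘ strandRev k) s) := by
  have h1 : prodMat (fun l => linkMat (k l) g.1) i i' =
      (repMat k g.1 * (tensorMat (Σ d, Fin (k d)) epsInv * permMat (strandRev k))) i i' := by
    rw [strandRev, permMat_sigmaCongrRight, ← prodMat_tensorMat, repMat, prodMat_mul, prodMat_mul]
    simp only [linkMat, ← tensorMat_mul, Matrix.mul_assoc]
  refine h1.trans ?_
  rw [Matrix.mul_apply]
  refine Finset.sum_congr rfl fun m _ => ?_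
  rw [mul_permMat_apply]
  rfl

theorem integral_prod_linkMat (i i' : (Σ d, Fin (k d)) → Fin 2) :
    ∫ g : SU2, ∏ l, linkMat (k l) g.1 (fun p => i ⟨l, p⟩) (fun p => i' ⟨l, p⟩) ∂haarSU2 =
      ∑ m : (Σ d, Fin (k d)) → Fin 2, invMat k i m * ∏ s, epsInv (m s) ((i' ∘ strandRev k) s) := by
  simp only [prod_linkMat]
  rw [integral_finsetSum _ fun m _ => (integrable_of_continuous (continuous_repMat k i m)).mul_const _]
  simp only [integral_mul_const]
  rfl

/-- The integral over the group element at a face. -/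
theorem integral_linkMat (h : Admissible (k 0) (k 1) (k 2)) (i i' : (Σ d, Fin (k d)) → Fin 2) :
    ∫ g : SU2, ∏ l, linkMat (k l) g.1 (fun p => i ⟨l, p⟩) (fun p => i' ⟨l, p⟩) ∂haarSU2 =
      (thetaNetwork k).eval⁻¹ *
        ((vertexNet true k).vertexTensor i * (vertexNet false k).vertexTensor i') := by
  -- The space of invariants has dimension one and contains the vertex tensor, which therefore
  -- determines the projection.
  have h1 : ∫ g : SU2, ∏ l, chi (k l) g.1 ∂haarSU2 = 1 := by
    simp only [Fin.prod_univ_three, integral_chi_mul_chi_mul_chi, if_pos h]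
  have h2 : ∀ m, invMat k i m = _ := fun m => invMat_eq_of_one k h1 (vertexNet true k).vertexTensor
    (repMat_mulVec_vertexTensor (vertexNet_rot true k) (vertexNet_allAdmissible true h))
    (fun i => vertexTensor_real (vertexNet true k) i) (sum_vertexTensor_ne_zero h) i m
  rw [integral_prod_linkMat, thetaNetwork_eval h]
  -- The second copy of the vertex tensor becomes the mirror vertex. The sign which arises is the
  -- one in `thetaNetwork_eval`, so the squared norm in the denominator becomes the theta
  -- evaluation.
  have h3 := sum_epsInv_vertexTensor h (i' ∘ strandRev k)
  have h4 := vertexTensor_comp (N := vertexNet false k) (fun _ => Fin.revPerm) i'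
  have h5 : ((-1 : ℂ) ^ vertexStrands h)⁻¹ = (-1) ^ vertexStrands h :=
    inv_eq_of_mul_eq_one_left (neg_one_pow_mul_self _)
  rw [← h4, mul_inv, h5]
  simp only [h2]
  have h6 : ∀ m : (Σ d, Fin (k d)) → Fin 2, (vertexNet true k).vertexTensor i *
      (vertexNet true k).vertexTensor m / (∑ i : (Σ d, Fin (k d)) → Fin 2,
        (vertexNet true k).vertexTensor i * (vertexNet true k).vertexTensor i) *
      ∏ s, epsInv (m s) ((i' ∘ strandRev k) s) = (vertexNet true k).vertexTensor i *
      (∑ i : (Σ d, Fin (k d)) → Fin 2, (vertexNet true k).vertexTensor i * (vertexNet true k).vertexTensor i)⁻¹ *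
      ((∏ s, epsInv (m s) ((i' ∘ strandRev k) s)) * (vertexNet true k).vertexTensor m) := fun m => by
    ring
  simp only [h6, ← Finset.mul_sum]
  rw [h3]
  ring!

theorem integral_linkMat_eq_zero (h : ¬ Admissible (k 0) (k 1) (k 2)) (i i' : (Σ d, Fin (k d)) → Fin 2) :
    ∫ g : SU2, ∏ l, linkMat (k l) g.1 (fun p => i ⟨l, p⟩) (fun p => i' ⟨l, p⟩) ∂haarSU2 = 0 := by
  have h1 : ∫ g : SU2, ∏ l, chi (k l) g.1 ∂haarSU2 = 0 := by
    simp only [Fin.prod_univ_three, integral_chi_mul_chi_mul_chi, if_neg h]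
  rw [integral_prod_linkMat, invMat_eq_zero k h1]
  simp

end Vertex

end SpinNetwork

/-! ### Combinatorics of a triangulation: flags, edges, faces and connections. -/

/-! ### Rotation about the edges of a triangulation -/

theorem FacePair.swap_ne (p : FacePair) : p.swap ≠ p := fun h =>
  p.2 (congrArg (fun q : FacePair => q.1.2) h)

theorem FacePair.rot_rot_rot (p : FacePair) : p.rot.rot.rot = p := by
  revert p; decide

theorem FacePair.rot_ne (p : FacePair) : p.rot ≠ p := by
  revert p; decide

/-- An odd identification reverses the cyclic order of the sides, and `rot` applied twice is the
inverse rotation. -/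
theorem FacePair.rot_map (π : Equiv.Perm (Fin 4)) (hπ : Equiv.Perm.sign π = -1) (p : FacePair) :
    (p.map π).rot = p.rot.rot.map π := by
  revert p π; decide

/-- The sides of a face, numbered in cyclic order. -/
def FacePair.side (f : Fin 4) (l : Fin 3) : FacePair :=
  FacePair.rot^[l] ⟨(f, f + 1), by revert f; decide⟩

theorem FacePair.rot_side (f : Fin 4) (l : Fin 3) : (FacePair.side f l).rot = FacePair.side f (l + 1) := by
  revert f l; decide

theorem FacePair.side_fst (f : Fin 4) (l : Fin 3) : (FacePair.side f l).1.1 = f := by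
  revert f l; decide

theorem FacePair.side_injective (f : Fin 4) : Function.Injective (FacePair.side f) := by
  revert f; decide

theorem FacePair.exists_side (p : FacePair) : ∃ l, FacePair.side p.1.1 l = p := by
  revert p; decide

namespace Triangulation

variable {T : Type*} (M : Triangulation T)

theorem swap_ne (x : TetFlag T) : swap x ≠ x := fun h => FacePair.swap_ne _ (congrArg Prod.snd h)

theorem cross_of_onBoundary {x : TetFlag T} (h : M.OnBoundary x) : M.cross x = x := by
  unfold OnBoundary at h
  simp [cross, h]

theorem exists_glue {x : TetFlag T} (h : ¬ M.OnBoundary x) :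
    ∃ t' π, M.glue x.1 x.2.1.1 = some (t', π) ∧ M.cross x = (t', x.2.map π) := by
  unfold OnBoundary at h
  obtain ⟨⟨t', π⟩, hg⟩ := Option.ne_none_iff_exists'.mp h
  exact ⟨t', π, hg, by simp [cross, hg]⟩

theorem onBoundary_cross {x : TetFlag T} : M.OnBoundary (M.cross x) ↔ M.OnBoundary x := by
  by_cases h : M.OnBoundary x
  · rw [M.cross_of_onBoundary h]
  · obtain ⟨t', π, hg, hc⟩ := M.exists_glue h
    rw [hc]
    simp only [h, iff_false]
    have := M.symm _ _ _ _ hg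
    simp [OnBoundary, FacePair.map, this]

theorem cross_ne {x : TetFlag T} (h : ¬ M.OnBoundary x) : M.cross x ≠ x := by
  obtain ⟨t', π, hg, hc⟩ := M.exists_glue h
  intro h2
  rw [hc] at h2
  refine M.free _ _ _ _ hg (Prod.ext (congrArg (fun y : TetFlag T => y.1) h2) ?_)
  exact congrArg (fun y : TetFlag T => y.2.1.1) h2

theorem onBoundary_turn {x : TetFlag T} : M.OnBoundary (M.turn x) ↔ M.OnBoundary (swap x) :=
  M.onBoundary_cross

/-- Rotation of a side within its face. -/
def rotFlag (x : TetFlag T) : TetFlag T := (x.1, x.2.rot)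

theorem rotFlag_cross {x : TetFlag T} (h : ¬ M.OnBoundary x) :
    rotFlag (M.cross x) = M.cross (rotFlag (rotFlag x)) := by
  obtain ⟨t', π, hg, hc⟩ := M.exists_glue h
  obtain ⟨t'', π', hg', hc'⟩ := M.exists_glue (x := rotFlag (rotFlag x)) h
  have h2 : some (t', π) = some (t'', π') := hg.symm.trans hg'
  simp only [Option.some.injEq, Prod.mk.injEq] at h2
  obtain ⟨rfl, rfl⟩ := h2
  rw [hc, hc', rotFlag, FacePair.rot_map π (M.odd _ _ _ _ hg)]
  rfl

theorem turnSteps_spec [Finite T] {x : TetFlag T} (hx : M.OnBoundary x) :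
    0 < M.turnSteps x ∧ M.OnBoundary (M.turn^[M.turnSteps x] x) := by
  have hne : {i | 0 < i ∧ M.OnBoundary (M.turn^[i] x)}.Nonempty := by
    obtain ⟨i, hi, h⟩ := Function.mem_periodicPts.mp (M.turn_injective.mem_periodicPts x)
    exact ⟨i, hi, by rw [h.eq]; exact hx⟩
  exact Nat.sInf_mem hne

theorem not_onBoundary_of_lt {x : TetFlag T} {k : ℕ} (h0 : 0 < k) (hk : k < M.turnSteps x) :
    ¬ M.OnBoundary (M.turn^[k] x) := fun h => Nat.notMem_of_lt_sInf hk ⟨h0, h⟩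

/-- The last step of the rotation ends at a boundary face, where `cross` does nothing. -/
theorem opp_eq_swap [Finite T] {x : TetFlag T} (hx : M.OnBoundary x) :
    M.opp x = swap (M.turn^[M.turnSteps x - 1] x) := by
  obtain ⟨h1, h2⟩ := M.turnSteps_spec hx
  have h3 : M.turnSteps x = M.turnSteps x - 1 + 1 := by omega
  rw [opp]
  rw [h3, Function.iterate_succ_apply', onBoundary_turn] at h2
  conv_lhs => rw [h3, Function.iterate_succ_apply', turn, M.cross_of_onBoundary h2]

/-- The rotation begun at the other end runs through the same flags backwards, with the two faces of
each flag exchanged. -/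
theorem turn_iterate_opp [Finite T] {x : TetFlag T} (hx : M.OnBoundary x) {k : ℕ} (hk : k < M.turnSteps x) :
    M.turn^[k] (M.opp x) = swap (M.turn^[M.turnSteps x - 1 - k] x) := by
  induction k with
  | zero => exact M.opp_eq_swap hx
  | succ k ih =>
    have h : M.turnSteps x - 1 - k = M.turnSteps x - 1 - (k + 1) + 1 := by omega
    rw [Function.iterate_succ_apply', ih (by omega), turn, swap_swap, h, Function.iterate_succ_apply',
      turn, cross_cross]

theorem turnSteps_opp [Finite T] {x : TetFlag T} (hx : M.OnBoundary x) : M.turnSteps (M.opp x) = M.turnSteps x := by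
  obtain ⟨h1, h2⟩ := M.turnSteps_spec hx
  refine le_antisymm (Nat.sInf_le ⟨h1, ?_⟩) ?_
  · have h3 : M.turnSteps x = M.turnSteps x - 1 + 1 := by omega
    rw [h3, Function.iterate_succ_apply', onBoundary_turn, M.turn_iterate_opp hx (by omega), swap_swap,
      Nat.sub_self]
    exact hx
  · by_contra! hlt
    obtain ⟨h3, h4⟩ := M.turnSteps_spec (M.onBoundary_opp hx)
    rw [M.turn_iterate_opp hx hlt, ← onBoundary_turn, ← Function.iterate_succ_apply' M.turn] at h4
    exact M.not_onBoundary_of_lt (by omega) (by omega) h4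

theorem opp_opp [Finite T] {x : TetFlag T} (hx : M.OnBoundary x) : M.opp (M.opp x) = x := by
  obtain ⟨h1, h2⟩ := M.turnSteps_spec hx
  rw [M.opp_eq_swap (M.onBoundary_opp hx), M.turnSteps_opp hx, M.turn_iterate_opp hx (by omega),
    swap_swap, Nat.sub_self]
  rfl

/-- Otherwise the sequence of flags would be its own reversal. Its middle would then be a fixed
point of `swap` for an odd number of steps, and of `cross` at an interior face for an even number.
-/
theorem opp_ne [Finite T] {x : TetFlag T} (hx : M.OnBoundary x) : M.opp x ≠ x := by
  intro h
  obtain ⟨h1, h2⟩ := M.turnSteps_spec hx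
  have h3 : ∀ {k}, k < M.turnSteps x → M.turn^[k] x = swap (M.turn^[M.turnSteps x - 1 - k] x) := by
    intro k hk
    have := M.turn_iterate_opp hx hk
    rwa [h] at this
  obtain ⟨k, hk | hk⟩ := Nat.even_or_odd' (M.turnSteps x)
  · have h4 := h3 (k := k) (by omega)
    obtain ⟨j, rfl⟩ : ∃ j, k = j + 1 := ⟨k - 1, by omega⟩
    have h5 : M.turnSteps x - 1 - (j + 1) = j := by omega
    rw [h5] at h4
    have h6 := M.not_onBoundary_of_lt (k := j + 1) (by omega) (by omega) (x := x)
    have h7 : M.cross (swap (M.turn^[j] x)) = swap (M.turn^[j] x) := by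
      rw [← h4, Function.iterate_succ_apply', turn, ← turn, ← Function.iterate_succ_apply' M.turn, h4,
        ← turn, ← Function.iterate_succ_apply' M.turn, h4]
    rw [h4] at h6
    exact M.cross_ne h6 h7
  · have h4 := h3 (k := k) (by omega)
    have h5 : M.turnSteps x - 1 - k = k := by omega
    rw [h5] at h4
    exact swap_ne _ h4.symm

/-- Go to the other side of a face, or of a boundary edge. -/
def pass (x : TetFlag T) : TetFlag T := if M.OnBoundary x then M.opp x else M.cross x

theorem pass_of_onBoundary {x : TetFlag T} (hx : M.OnBoundary x) : M.pass x = M.opp x := if_pos hx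

theorem pass_of_not {x : TetFlag T} (hx : ¬ M.OnBoundary x) : M.pass x = M.cross x := if_neg hx

theorem pass_pass [Finite T] (x : TetFlag T) : M.pass (M.pass x) = x := by
  by_cases h : M.OnBoundary x
  · rw [M.pass_of_onBoundary h, M.pass_of_onBoundary (M.onBoundary_opp h), M.opp_opp h]
  · rw [M.pass_of_not h, M.pass_of_not (M.onBoundary_cross.not.mpr h), cross_cross]

theorem pass_ne [Finite T] (x : TetFlag T) : M.pass x ≠ x := by
  by_cases h : M.OnBoundary x
  · rw [M.pass_of_onBoundary h]
    exact M.opp_ne h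
  · rw [M.pass_of_not h]
    exact M.cross_ne h

theorem edge_swap (x : TetFlag T) : M.edge (swap x) = M.edge x :=
  (Quot.sound (r := fun x y : TetFlag T => y = swap x ∨ y = M.cross x) (Or.inl rfl)).symm

theorem edge_cross (x : TetFlag T) : M.edge (M.cross x) = M.edge x :=
  (Quot.sound (r := fun x y : TetFlag T => y = swap x ∨ y = M.cross x) (Or.inr rfl)).symm

theorem edge_pass (x : TetFlag T) : M.edge (M.pass x) = M.edge x := by
  unfold pass
  split_ifs
  · exact M.edge_opp x
  · exact M.edge_cross x

open Classical in
/-- A flag of every edge, on the boundary if possible. -/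
def edgeOut (e : M.Edge) : TetFlag T :=
  if h : ∃ x, M.OnBoundary x ∧ M.edge x = e then h.choose else Quot.out e

theorem edge_edgeOut (e : M.Edge) : M.edge (M.edgeOut e) = e := by
  unfold edgeOut
  split_ifs with h
  · exact h.choose_spec.2
  · exact Quot.out_eq e

theorem onBoundary_edgeOut {e : M.Edge} (h : ∃ x, M.OnBoundary x ∧ M.edge x = e) :
    M.OnBoundary (M.edgeOut e) := by
  unfold edgeOut
  rw [dif_pos h]
  exact h.choose_spec.1

/-- The flags of the edges in cyclic order, those of a boundary edge being closed up through the
outside. -/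
def edgeLoops [Finite T] : LoopSystem (TetFlag T) M.Edge where
  a := swap
  b := M.pass
  a_invol := swap_swap
  b_invol := M.pass_pass
  a_ne := swap_ne
  b_ne := M.pass_ne
  cls := M.edge
  out := M.edgeOut
  cls_out := M.edge_edgeOut
  cls_a := M.edge_swap
  cls_b := M.edge_pass
  ind P h1 h2 x y h hx := by
    have h3 : ∀ x, P x → P (M.cross x) := fun x hx => by
      by_cases h : M.OnBoundary x
      · rwa [M.cross_of_onBoundary h]
      · have := h2 x hx
        rwa [M.pass_of_not h] at this
    have h4 : ∀ x y : TetFlag T, (y = swap x ∨ y = M.cross x) → P x = P y := by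
      rintro x y (rfl | rfl)
      · exact propext ⟨h1 x, fun h => swap_swap x ▸ h1 _ h⟩
      · exact propext ⟨h3 x, fun h => M.cross_cross x ▸ h3 _ h⟩
    have h5 : P x = P y := congrArg (Quot.lift P h4) h
    exact h5 ▸ hx

theorem edgeLoops_step_of_not [Finite T] {x : TetFlag T} (h : ¬ M.OnBoundary (swap x)) :
    M.edgeLoops.step x = M.turn x := M.pass_of_not h

theorem edgeLoops_iterate_inner [Finite T] {x : TetFlag T} (h : ¬ ∃ y, M.OnBoundary y ∧ M.edge y = M.edge x) (k : ℕ) :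
    M.edgeLoops.step^[k] x = M.turn^[k] x := by
  induction k with
  | zero => rfl
  | succ k ih =>
    rw [Function.iterate_succ_apply', Function.iterate_succ_apply', ih]
    refine M.edgeLoops_step_of_not fun h2 => h ⟨_, h2, ?_⟩
    rw [M.edge_swap, ← ih]
    exact M.edgeLoops.cls_iterate k x

theorem edgeLoops_len_inner [Finite T] {e : M.Edge} (h : ¬ ∃ y, M.OnBoundary y ∧ M.edge y = e) :
    M.edgeLoops.len e = Function.minimalPeriod M.turn (M.edgeOut e) := by
  rw [← M.edge_edgeOut e] at h
  have h2 : ∀ k, Function.IsPeriodicPt M.edgeLoops.step k (M.edgeOut e) ↔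
      Function.IsPeriodicPt M.turn k (M.edgeOut e) := fun k => by
    rw [Function.IsPeriodicPt, Function.IsPeriodicPt, Function.IsFixedPt, Function.IsFixedPt,
      M.edgeLoops_iterate_inner h]
  exact Function.minimalPeriod_eq_minimalPeriod_iff.mpr h2

theorem edgeLoops_iterate_bdry [Finite T] {x : TetFlag T} {k : ℕ} (hk : k < M.turnSteps x) :
    M.edgeLoops.step^[k] x = M.turn^[k] x := by
  induction k with
  | zero => rfl
  | succ k ih =>
    rw [Function.iterate_succ_apply', Function.iterate_succ_apply', ih (by omega)]
    refine M.edgeLoops_step_of_not fun h2 => ?_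
    rw [← onBoundary_turn, ← Function.iterate_succ_apply' M.turn] at h2
    exact M.not_onBoundary_of_lt (by omega) hk h2

/-- The loop of a boundary edge is one rotation from a boundary face to the other one, closed up
through the outside. It cannot close earlier, as no flag in between is on the boundary. -/
theorem edgeLoops_len_bdry [Finite T] {e : M.Edge} (h : ∃ y, M.OnBoundary y ∧ M.edge y = e) :
    M.edgeLoops.len e = M.turnSteps (M.edgeOut e) := by
  have hx := M.onBoundary_edgeOut h
  obtain ⟨h1, h2⟩ := M.turnSteps_spec hx
  have hp : M.edgeLoops.step^[M.turnSteps (M.edgeOut e)] (M.edgeOut e) = M.edgeOut e := by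
    obtain ⟨m, hm⟩ : ∃ m, M.turnSteps (M.edgeOut e) = m + 1 := ⟨M.turnSteps (M.edgeOut e) - 1, by omega⟩
    have h3 := M.opp_eq_swap hx
    rw [hm, Function.iterate_succ_apply', M.edgeLoops_iterate_bdry (by omega)]
    rw [hm, Nat.add_sub_cancel] at h3
    change M.pass (swap _) = _
    rw [← h3, M.pass_of_onBoundary (M.onBoundary_opp hx), M.opp_opp hx]
  refine le_antisymm (Function.IsPeriodicPt.minimalPeriod_le h1 hp) ?_
  by_contra! hlt
  have h4 := M.edgeLoops.len_pos e
  have h5 := M.not_onBoundary_of_lt h4 hlt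
  rw [← M.edgeLoops_iterate_bdry hlt] at h5
  have h6 : M.edgeLoops.step^[M.edgeLoops.len e] (M.edgeOut e) = M.edgeOut e :=
    Function.iterate_minimalPeriod
  rw [h6] at h5
  exact h5 hx

/-! #### Connections -/

/-- Parallel transports through the faces. -/
structure IsConnection {G : Type*} [Group G] (c : T → Fin 4 → G) : Prop where
  inner : ∀ t f t' π, M.glue t f = some (t', π) → c t' (π f) = (c t f)⁻¹
  bdry : ∀ t f, M.glue t f = none → c t f = 1

/-- The parallel transport along a rotation about an edge. -/
def turnHol {G : Type*} [Group G] (c : T → Fin 4 → G) (x : TetFlag T) (m : ℕ) : G :=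
  ((List.range m).map fun i => c (M.turn^[i] x).1 (M.turn^[i] x).2.1.2).prod

variable {M} {G : Type*} [Group G] {c : T → Fin 4 → G}

theorem IsConnection.cross (hc : M.IsConnection c) (x : TetFlag T) :
    c (M.cross x).1 (M.cross x).2.1.1 = (c x.1 x.2.1.1)⁻¹ := by
  by_cases h : M.OnBoundary x
  · rw [M.cross_of_onBoundary h, hc.bdry _ _ h, inv_one]
  · obtain ⟨t', π, hg, hx⟩ := M.exists_glue h
    rw [hx]
    exact hc.inner _ _ _ _ hg

theorem turnHol_succ (x : TetFlag T) (m : ℕ) :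
    M.turnHol c x (m + 1) = M.turnHol c x m * c (M.turn^[m] x).1 (M.turn^[m] x).2.1.2 := by
  simp [turnHol, List.range_succ]

theorem turnHol_succ' (x : TetFlag T) (m : ℕ) :
    M.turnHol c x (m + 1) = c x.1 x.2.1.2 * M.turnHol c (M.turn x) m := by
  simp only [turnHol, List.range_succ_eq_map, List.map_cons, List.prod_cons, List.map_map,
    Function.iterate_zero, id]
  rfl

/-- The same faces are crossed in the opposite order and direction. In both rotations the last
factor belongs to a boundary face and is one. -/
theorem IsConnection.turnHol_opp [Finite T] (hc : M.IsConnection c) {x : TetFlag T} (hx : M.OnBoundary x) :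
    M.turnHol c (M.opp x) (M.turnSteps (M.opp x)) = (M.turnHol c x (M.turnSteps x))⁻¹ := by
  rw [M.turnSteps_opp hx]
  obtain ⟨h1, h2⟩ := M.turnSteps_spec hx
  obtain ⟨m, hm⟩ : ∃ m, M.turnSteps x = m + 1 := ⟨M.turnSteps x - 1, by omega⟩
  have ho : ∀ k, k ≤ m → M.turn^[k] (M.opp x) = swap (M.turn^[m - k] x) := fun k hk => by
    rw [M.turn_iterate_opp hx (by omega), hm, Nat.add_sub_cancel]
  have key : ∀ k, k ≤ m →
      M.turnHol c (M.opp x) k = (M.turnHol c x m)⁻¹ * M.turnHol c x (m - k) := by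
    intro k hk
    induction k with
    | zero => simp [turnHol]
    | succ k ih =>
      obtain ⟨j, hj⟩ : ∃ j, m - k = j + 1 := ⟨m - k - 1, by omega⟩
      have h3 := hc.cross (swap (M.turn^[j] x))
      rw [turnHol_succ, ih (by omega), ho k (by omega), hj, show m - (k + 1) = j by omega, turnHol_succ,
        mul_assoc, mul_assoc, Function.iterate_succ_apply']
      change _ * (_ * (_ * c (M.cross (swap (M.turn^[j] x))).1 (M.cross (swap (M.turn^[j] x))).2.1.1)) = _
      rw [h3]
      change _ * (_ * (c (M.turn^[j] x).1 (M.turn^[j] x).2.1.2 *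
        (c (M.turn^[j] x).1 (M.turn^[j] x).2.1.2)⁻¹)) = _
      rw [mul_inv_cancel, mul_one]
  have e1 : c (M.turn^[m] x).1 (M.turn^[m] x).2.1.2 = 1 := by
    have h3 := M.opp_eq_swap hx
    rw [hm, Nat.add_sub_cancel] at h3
    have h4 := M.onBoundary_opp hx
    rw [h3] at h4
    exact hc.bdry _ _ h4
  have e2 : c (M.turn^[m] (M.opp x)).1 (M.turn^[m] (M.opp x)).2.1.2 = 1 := by
    rw [ho m le_rfl, Nat.sub_self]
    exact hc.bdry _ _ hx
  rw [hm, turnHol_succ, turnHol_succ, e1, e2, key m le_rfl, Nat.sub_self]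
  simp [turnHol]

/-! #### The faces -/

variable (M)

/-- A side of a face of a tetrahedron. -/
def sideFlag (x : T × Fin 4) (l : Fin 3) : TetFlag T := (x.1, FacePair.side x.2 l)

theorem rotFlag_sideFlag (x : T × Fin 4) (l : Fin 3) : rotFlag (sideFlag x l) = sideFlag x (l + 1) :=
  Prod.ext rfl (FacePair.rot_side x.2 l)

theorem sideFlag_face (x : T × Fin 4) (l : Fin 3) : ((sideFlag x l).1, (sideFlag x l).2.1.1) = x :=
  Prod.ext rfl (FacePair.side_fst x.2 l)

theorem sideFlag_injective {x y : T × Fin 4} {l m : Fin 3} (h : sideFlag x l = sideFlag y m) :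
    x = y ∧ l = m := by
  have h1 : x = y := by
    rw [← sideFlag_face x l, h, sideFlag_face]
  subst h1
  exact ⟨rfl, FacePair.side_injective x.2 (congrArg Prod.snd h)⟩

theorem exists_sideFlag (x : TetFlag T) : ∃ l, sideFlag (x.1, x.2.1.1) l = x := by
  obtain ⟨l, hl⟩ := FacePair.exists_side x.2
  exact ⟨l, Prod.ext rfl hl⟩

theorem onBoundary_sideFlag {x : T × Fin 4} {l : Fin 3} :
    M.OnBoundary (sideFlag x l) ↔ M.glue x.1 x.2 = none := by
  have h : (sideFlag x l).2.1.1 = x.2 := FacePair.side_fst x.2 l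
  rw [OnBoundary, h]
  exact Iff.rfl

/-- The interior triangle of a flag. -/
def innerFace (x : TetFlag T) (h : ¬ M.OnBoundary x) : M.InnerFace := Quot.mk _ ⟨(x.1, x.2.1.1), h⟩

/-- The preferred side of an interior triangle. -/
def faceOut (q : M.InnerFace) : T × Fin 4 := (Quot.out q).1

theorem faceOut_ne (q : M.InnerFace) : M.glue (M.faceOut q).1 (M.faceOut q).2 ≠ none := (Quot.out q).2

/-- The generated equivalence classes have just two elements each: by `symm`, being equal or glued
to a given face does not change when a face is replaced by its partner. -/
theorem innerFace_eq_iff {x y : TetFlag T} {hx : ¬ M.OnBoundary x} {hy : ¬ M.OnBoundary y} :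
    M.innerFace x hx = M.innerFace y hy ↔ ((x.1, x.2.1.1) = (y.1, y.2.1.1) ∨
      ((M.cross x).1, (M.cross x).2.1.1) = (y.1, y.2.1.1)) := by
  constructor
  · intro h
    have h1 : ∀ u v : {x : T × Fin 4 // M.glue x.1 x.2 ≠ none},
        (∃ π, M.glue u.1.1 u.1.2 = some (v.1.1, π) ∧ π u.1.2 = v.1.2) →
        ∀ y : T × Fin 4, (u.1 = y ∨ ∃ π, M.glue u.1.1 u.1.2 = some (y.1, π) ∧ π u.1.2 = y.2) ↔
          (v.1 = y ∨ ∃ π, M.glue v.1.1 v.1.2 = some (y.1, π) ∧ π v.1.2 = y.2) := by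
      rintro ⟨⟨t, f⟩, hu⟩ ⟨⟨t', f'⟩, hv⟩ ⟨π, hg, hπ⟩ ⟨s, a⟩
      simp only at hg hπ ⊢
      subst hπ
      have hs := M.symm _ _ _ _ hg
      constructor
      · rintro (h | ⟨π', h, h'⟩)
        · obtain ⟨rfl, rfl⟩ := Prod.mk.inj h
          exact Or.inr ⟨_, hs, by simp⟩
        · rw [hg] at h
          simp only [Option.some.injEq, Prod.mk.injEq] at h
          obtain ⟨rfl, rfl⟩ := h
          exact Or.inl (by rw [h'])
      · rintro (h | ⟨π', h, h'⟩)
        · obtain ⟨rfl, rfl⟩ := Prod.mk.inj h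
          exact Or.inr ⟨_, hg, rfl⟩
        · rw [hs] at h
          simp only [Option.some.injEq, Prod.mk.injEq] at h
          obtain ⟨rfl, rfl⟩ := h
          rw [← h']
          exact Or.inl (by simp)
    -- Being equal or glued to a face is a well-defined predicate on the quotient, so that equality
    -- of classes can be evaluated.
    have h2 := congrFun (congrArg (Quot.lift (fun (u : {x : T × Fin 4 // M.glue x.1 x.2 ≠ none})
      (y : T × Fin 4) => (u.1 = y ∨ ∃ π, M.glue u.1.1 u.1.2 = some (y.1, π) ∧ π u.1.2 = y.2))
      fun u v huv => funext fun y => propext (h1 u v huv y)) h) (y.1, y.2.1.1)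
    have h3 : ((x.1, x.2.1.1) = (y.1, y.2.1.1) ∨ ∃ π, M.glue x.1 x.2.1.1 = some (y.1, π) ∧
        π x.2.1.1 = y.2.1.1) := by
      refine h2.mpr (Or.inl rfl)
    refine h3.imp id ?_
    rintro ⟨π, hg, hπ⟩
    obtain ⟨t', π', hg', hc⟩ := M.exists_glue hx
    rw [hg] at hg'
    simp only [Option.some.injEq, Prod.mk.injEq] at hg'
    obtain ⟨rfl, rfl⟩ := hg'
    rw [hc]
    exact Prod.ext rfl hπ
  · rintro (h | h)
    · exact congrArg (Quot.mk _) (Subtype.ext h)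
    · obtain ⟨t', π', hg', hc⟩ := M.exists_glue hx
      rw [hc] at h
      obtain ⟨h1, h2⟩ := Prod.mk.inj h
      exact Quot.sound ⟨π', by rw [← h1]; exact hg', h2⟩

theorem innerFace_faceOut (q : M.InnerFace) (l : Fin 3) (h) : M.innerFace (sideFlag (M.faceOut q) l) h = q := by
  conv_rhs => rw [← Quot.out_eq q]
  refine congrArg (Quot.mk _) (Subtype.ext ?_)
  exact sideFlag_face (M.faceOut q) l

theorem innerFace_cross {x : TetFlag T} (h : ¬ M.OnBoundary x) (h') :
    M.innerFace (M.cross x) h' = M.innerFace x h :=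
  ((M.innerFace_eq_iff).mpr (Or.inr rfl)).symm

theorem not_onBoundary_faceOut (q : M.InnerFace) (l : Fin 3) :
    ¬ M.OnBoundary (sideFlag (M.faceOut q) l) := M.onBoundary_sideFlag.not.mpr (M.faceOut_ne q)

/-- The flags, numbered by the faces. -/
def faceFlag (x : ((M.InnerFace × Bool) ⊕ M.BdryFace) × Fin 3) : TetFlag T :=
  match x.1 with
  | .inl (q, true) => sideFlag (M.faceOut q) x.2
  | .inl (q, false) => M.cross (sideFlag (M.faceOut q) x.2)
  | .inr b => sideFlag b.1 x.2

/-- The two sides of a face have opposite cyclic orders. -/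
def faceSign (x : (M.InnerFace × Bool) ⊕ M.BdryFace) : Bool :=
  match x with
  | .inl (_, b) => b
  | .inr _ => true

theorem not_onBoundary_faceFlag (q : M.InnerFace) (b : Bool) (l : Fin 3) :
    ¬ M.OnBoundary (M.faceFlag (.inl (q, b), l)) := by
  cases b
  · exact M.onBoundary_cross.not.mpr (M.not_onBoundary_faceOut q l)
  · exact M.not_onBoundary_faceOut q l

theorem cross_faceFlag (q : M.InnerFace) (b : Bool) (l : Fin 3) :
    M.cross (M.faceFlag (.inl (q, b), l)) = M.faceFlag (.inl (q, !b), l) := by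
  cases b
  · exact M.cross_cross _
  · rfl

theorem onBoundary_faceFlag (b : M.BdryFace) (l : Fin 3) : M.OnBoundary (M.faceFlag (.inr b, l)) :=
  M.onBoundary_sideFlag.mpr b.2

theorem rotFlag_faceFlag (x : (M.InnerFace × Bool) ⊕ M.BdryFace) (l : Fin 3) :
    rotFlag (M.faceFlag (x, l)) = M.faceFlag (x, bif M.faceSign x then l + 1 else l - 1) := by
  rcases x with ⟨q, _ | _⟩ | b
  · have e : l + 1 + 1 = l - 1 := by revert l; decide
    change rotFlag (M.cross (sideFlag (M.faceOut q) l)) = M.cross (sideFlag (M.faceOut q) (l - 1))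
    rw [M.rotFlag_cross (M.not_onBoundary_faceOut q l), rotFlag_sideFlag, rotFlag_sideFlag, e]
  · exact rotFlag_sideFlag _ _
  · exact rotFlag_sideFlag _ _

theorem innerFace_faceFlag (q : M.InnerFace) (b : Bool) (l : Fin 3) (h) :
    M.innerFace (M.faceFlag (.inl (q, b), l)) h = q := by
  cases b
  · exact (M.innerFace_cross (M.not_onBoundary_faceOut q l) h).trans (M.innerFace_faceOut q l _)
  · exact M.innerFace_faceOut q l _

theorem face_cross_ne {x : TetFlag T} (h : ¬ M.OnBoundary x) :
    ((M.cross x).1, (M.cross x).2.1.1) ≠ (x.1, x.2.1.1) := by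
  obtain ⟨t', π, hg, hc⟩ := M.exists_glue h
  rw [hc]
  exact M.free _ _ _ _ hg

theorem face_cross_congr {x y : TetFlag T} (h : (x.1, x.2.1.1) = (y.1, y.2.1.1)) :
    ((M.cross x).1, (M.cross x).2.1.1) = ((M.cross y).1, (M.cross y).2.1.1) := by
  obtain ⟨h1, h2⟩ := Prod.mk.inj h
  rcases x with ⟨t, ⟨⟨f, a⟩, hx⟩⟩
  rcases y with ⟨t', ⟨⟨f', a'⟩, hy⟩⟩
  simp only at h1 h2
  subst h1 h2
  rcases hg : M.glue t f with _ | ⟨t', π⟩ <;> simp [Triangulation.cross, hg, FacePair.map]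

/-- Every flag lies at a boundary triangle or on one of the two sides of an interior one. The two
sides differ because no face is glued to itself. -/
theorem faceFlag_bijective : Function.Bijective M.faceFlag := by
  have hc : ∀ {x y : TetFlag T}, M.cross x = M.cross y → x = y := fun {x y} h => by
    rw [← M.cross_cross x, h, M.cross_cross]
  constructor
  · rintro ⟨⟨q, b⟩ | b, l⟩ ⟨⟨q', b'⟩ | b', l'⟩ h
    · obtain rfl : q = q' := by
        rw [← M.innerFace_faceFlag q b l (M.not_onBoundary_faceFlag q b l),
          ← M.innerFace_faceFlag q' b' l' (M.not_onBoundary_faceFlag q' b' l')]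
        congr 1
      have h0 : ∀ l l', M.faceFlag (.inl (q, false), l) ≠ M.faceFlag (.inl (q, true), l') := by
        intro l l' h
        apply M.face_cross_ne (M.not_onBoundary_faceOut q l)
        refine (congrArg (fun x : TetFlag T => (x.1, x.2.1.1)) h).trans ?_
        exact (sideFlag_face _ _).trans (sideFlag_face _ _).symm
      cases b <;> cases b'
      · obtain rfl := (sideFlag_injective (hc h)).2
        rfl
      · exact absurd h (h0 _ _)
      · exact absurd h.symm (h0 _ _)
      · obtain rfl := (sideFlag_injective h).2
        rfl
    · exact absurd (h ▸ M.onBoundary_faceFlag b' l') (M.not_onBoundary_faceFlag q b l)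
    · exact absurd (h ▸ M.onBoundary_faceFlag b l) (M.not_onBoundary_faceFlag q' b' l')
    · obtain ⟨h1, rfl⟩ := sideFlag_injective h
      obtain rfl := Subtype.ext h1
      rfl
  · intro x
    obtain ⟨l, hl⟩ := exists_sideFlag x
    by_cases h : M.OnBoundary x
    · exact ⟨(.inr ⟨(x.1, x.2.1.1), h⟩, l), hl⟩
    · let q := M.innerFace x h
      have h1 : M.innerFace x h = M.innerFace (sideFlag (M.faceOut q) 0) (M.not_onBoundary_faceOut q 0) :=
        (M.innerFace_faceOut q 0 _).symm
      rw [innerFace_eq_iff, sideFlag_face] at h1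
      rcases h1 with h1 | h1
      · refine ⟨(.inl (q, true), l), ?_⟩
        change sideFlag (M.faceOut q) l = x
        rw [← h1, hl]
      · obtain ⟨m, hm⟩ := exists_sideFlag (M.cross x)
        refine ⟨(.inl (q, false), m), ?_⟩
        change M.cross (sideFlag (M.faceOut q) m) = x
        rw [← h1, hm, cross_cross]

/-- The flags, numbered by the faces. -/
def faceEquiv : ((M.InnerFace × Bool) ⊕ M.BdryFace) × Fin 3 ≃ TetFlag T :=
  Equiv.ofBijective _ M.faceFlag_bijective

/-- The connection with given parallel transports through the interior triangles. -/
def connection {G : Type*} [Group G] (g : M.InnerFace → G) (t : T) (f : Fin 4) : G :=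
  match (M.faceEquiv.symm (sideFlag (t, f) 0)).1 with
  | .inl (q, true) => g q
  | .inl (q, false) => (g q)⁻¹
  | .inr _ => 1

variable {M}

theorem faceEquiv_rotFlag (x : TetFlag T) :
    (M.faceEquiv.symm (rotFlag x)).1 = (M.faceEquiv.symm x).1 := by
  obtain ⟨⟨y, l⟩, rfl⟩ := M.faceEquiv.surjective x
  have h : rotFlag (M.faceEquiv (y, l)) = M.faceEquiv _ := M.rotFlag_faceFlag y l
  rw [h, Equiv.symm_apply_apply, Equiv.symm_apply_apply]

theorem faceEquiv_sideFlag (x : T × Fin 4) (l : Fin 3) :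
    (M.faceEquiv.symm (sideFlag x l)).1 = (M.faceEquiv.symm (sideFlag x 0)).1 := by
  have h1 : (M.faceEquiv.symm (sideFlag x 1)).1 = (M.faceEquiv.symm (sideFlag x 0)).1 := by
    rw [← faceEquiv_rotFlag (sideFlag x 0), rotFlag_sideFlag]; rfl
  have h2 : (M.faceEquiv.symm (sideFlag x 2)).1 = (M.faceEquiv.symm (sideFlag x 0)).1 := by
    rw [← h1, ← faceEquiv_rotFlag (sideFlag x 1), rotFlag_sideFlag]; rfl
  fin_cases l
  · rfl
  · exact h1
  · exact h2

theorem faceEquiv_face (y : (M.InnerFace × Bool) ⊕ M.BdryFace) (l : Fin 3) :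
    (M.faceEquiv.symm (sideFlag ((M.faceFlag (y, l)).1, (M.faceFlag (y, l)).2.1.1) 0)).1 = y := by
  obtain ⟨m, hm⟩ := exists_sideFlag (M.faceFlag (y, l))
  rw [← faceEquiv_sideFlag _ m, hm]
  exact congrArg Prod.fst (M.faceEquiv.symm_apply_apply (y, l))

variable {G : Type*} [Group G] (g : M.InnerFace → G)

theorem connection_true (q : M.InnerFace) (l : Fin 3) :
    M.connection g (M.faceFlag (.inl (q, true), l)).1 (M.faceFlag (.inl (q, true), l)).2.1.1 = g q := by
  rw [connection, faceEquiv_face]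

theorem connection_false (q : M.InnerFace) (l : Fin 3) :
    M.connection g (M.faceFlag (.inl (q, false), l)).1 (M.faceFlag (.inl (q, false), l)).2.1.1 =
      (g q)⁻¹ := by
  rw [connection, faceEquiv_face]

theorem connection_bdry (b : M.BdryFace) (l : Fin 3) :
    M.connection g (M.faceFlag (.inr b, l)).1 (M.faceFlag (.inr b, l)).2.1.1 = 1 := by
  rw [connection, faceEquiv_face]

theorem isConnection_connection : M.IsConnection (M.connection g) where
  inner t f t' π hg := by
    let x : TetFlag T := sideFlag (t, f) 0
    have hx : (x.1, x.2.1.1) = (t, f) := sideFlag_face _ _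
    have hn : ¬ M.OnBoundary x := by
      rw [onBoundary_sideFlag, hg]; simp
    have hc : ((M.cross x).1, (M.cross x).2.1.1) = (t', π f) := by
      obtain ⟨t'', π', hg', hc⟩ := M.exists_glue hn
      obtain ⟨h1, h2⟩ := Prod.mk.inj hx
      rw [h1, h2, hg] at hg'
      simp only [Option.some.injEq, Prod.mk.injEq] at hg'
      obtain ⟨rfl, rfl⟩ := hg'
      rw [hc]
      exact Prod.ext rfl (congrArg π h2)
    obtain ⟨h1, h2⟩ := Prod.mk.inj hx
    obtain ⟨h3, h4⟩ := Prod.mk.inj hc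
    rw [← h1, ← h2, ← h3]
    rw [h2, ← h4]
    obtain ⟨⟨⟨q, b⟩ | b, l⟩, hl⟩ := M.faceEquiv.surjective x
    · have hl' : M.faceFlag (.inl (q, b), l) = x := hl
      rw [← h2, ← hl', M.cross_faceFlag]
      cases b
      · rw [connection_false, inv_inv]
        exact connection_true g q l
      · rw [connection_true]
        exact connection_false g q l
    · exact absurd (hl ▸ M.onBoundary_faceFlag b l) hn
  bdry t f hg := by
    let x : TetFlag T := sideFlag (t, f) 0
    have hn : M.OnBoundary x := M.onBoundary_sideFlag.mpr hg
    obtain ⟨h1, h2⟩ := Prod.mk.inj (sideFlag_face (t, f) 0)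
    obtain ⟨⟨⟨q, b⟩ | b, l⟩, hl⟩ := M.faceEquiv.surjective x
    · have hl' : M.faceFlag (.inl (q, b), l) = x := hl
      rw [← hl'] at hn
      exact absurd hn (M.not_onBoundary_faceFlag q b l)
    · have hl' : M.faceFlag (.inr b, l) = sideFlag (t, f) 0 := hl
      have e : M.connection g t f =
          M.connection g (sideFlag (t, f) 0).1 (sideFlag (t, f) 0).2.1.1 := by rw [h2]; rfl
      rw [e, ← hl']
      exact connection_bdry g b l

end Triangulation

/-! ### Cables around the edges, and contraction of all strands. -/

/-! ### Cables -/

/-- `weight_reorient` for an alternating kernel with two states. The state given by the orientation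
of `A` has weight one for `A`, and for `A'` a factor `-1` at each reversed arc. -/
theorem OMatching.relSign_of_m_eq {S : Type*} [Fintype S] (A A' : OMatching S) (hm : A.m = A'.m) :
    ((A.relSign A' : ℤ) : ℂ) = ∏ s, if A.o s && !A'.o s then -1 else 1 := by
  let κ : S → Bool → Bool → ℂ := fun _ x y => if x = y then 0 else if x then 1 else -1
  have hκ : ∀ s x y, κ (A.m s) y x = -κ s x y := by
    intro s x y
    cases x <;> cases y <;> simp [κ]
  have h := A.weight_reorient A' hm κ hκ A.o
  have h1 : A.weight κ A.o = 1 := by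
    refine Finset.prod_eq_one fun s _ => ?_
    by_cases hs : A.o s = true
    · simp [κ, hs, A.o_m]
    · simp [hs]
  rw [h1, mul_one] at h
  rw [← h, OMatching.weight, A.prod_eq_tails, A.prod_eq_tails]
  refine Finset.prod_congr rfl fun r _ => ?_
  have h2 : A'.o (A.m r.1) = !A'.o r.1 := by rw [hm, A'.o_m]
  have h3 : A'.m (A.m r.1) = r.1 := by rw [← hm, A.invol]
  rw [h2, h3, ← hm]
  cases h : A'.o r.1 <;> simp [κ, r.2, A.o_m]

theorem sum_loop {I : Type*} [Fintype I] [DecidableEq I] (m : ℕ) (hm : 0 < m) (A B : ℕ → Matrix I I ℂ) :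
    ∑ s : Fin m × Bool → I, ∏ k : Fin m, A k (s (k, true)) (s (k, false)) *
      B k (s (k, false)) (s (finRotate m k, true)) =
      ((List.range m).map fun k => A k * B k).prod.trace := by
  rw [← sum_cycle (fun k => A k * B k) m hm]
  let e : (Fin m × Bool → I) ≃ (Fin m → I) × (Fin m → I) :=
    { toFun := fun i => (fun k => i (k, true), fun k => i (k, false))
      invFun := fun p x => bif x.2 then p.1 x.1 else p.2 x.1
      left_inv := fun i => by ext1 ⟨k, c⟩; cases c <;> rfl
      right_inv := fun p => rfl }
  rw [← e.symm.sum_comp, Fintype.sum_prod_type]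
  refine Finset.sum_congr rfl fun i _ => ?_
  simp only [Matrix.mul_apply]
  rw [Finset.prod_univ_sum, Fintype.piFinset_univ]
  rfl

/-- The state of the `m` strands of a leg. -/
def cab {D : Type*} {ℓ : D → ℕ} (i : (Σ d, Fin (ℓ d)) → Fin 2) (d : D) (m : ℕ) (h : m = ℓ d) :
    Fin m → Fin 2 := fun p => i ⟨d, Fin.cast h p⟩

theorem cab_congr {D : Type*} {ℓ : D → ℕ} (i : (Σ d, Fin (ℓ d)) → Fin 2) {d d' : D} (hd : d = d') {m : ℕ}
    (h : m = ℓ d) (h' : m = ℓ d') : cab i d m h = cab i d' m h' := by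
  subst hd
  rfl

/-- Matrices acting on the cables which pass the points of a set. -/
abbrev CableMat {D : Type*} (ℓ : D → ℕ) : Type _ :=
  ∀ (d : D) (m : ℕ), m = ℓ d → Matrix (Fin m → Fin 2) (Fin m → Fin 2) ℂ

/-- The labels at the points of a loop agree only propositionally; this moves a matrix entry to a
width common to the whole loop. -/
theorem CableMat.resize {D : Type*} {ℓ : D → ℕ} (κ : CableMat ℓ) (i : (Σ d, Fin (ℓ d)) → Fin 2)
    {d d' : D} {m : ℕ} (h : m = ℓ d) (h' : m = ℓ d') :
    κ d (ℓ d) rfl (cab i d (ℓ d) rfl) (cab i d' (ℓ d) (h.symm.trans h')) =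
      κ d m h (cab i d m h) (cab i d' m h') := by
  subst h
  rfl

namespace LoopSystem

variable {S Q : Type*} (L : LoopSystem S Q) (n : Q → ℕ)

/-- The states of cables, arranged by loops. -/
def cableStates [Finite S] : (∀ q, Fin (L.len q) × Bool → Fin (n q) → Fin 2) ≃
    ((Σ s, Fin (n (L.cls s))) → Fin 2) where
  toFun f x := f (L.equiv.symm x.1).1 (L.equiv.symm x.1).2 (Fin.cast (by
    rw [← L.cls_point (L.equiv.symm x.1), ← equiv_apply, Equiv.apply_symm_apply]) x.2)
  invFun i q y := cab i (L.point ⟨q, y⟩) (n q) (by rw [L.cls_point])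
  left_inv f := by
    ext1 q
    ext1 y
    ext1 p
    have h : ∀ z : Σ q, Fin (L.len q) × Bool, z = ⟨q, y⟩ → ∀ h, f z.1 z.2 (Fin.cast h p) = f q y p := by
      rintro _ rfl _
      rfl
    exact h _ (L.equiv.symm_apply_apply ⟨q, y⟩) (by rw [Equiv.symm_apply_apply])
  right_inv i := by
    ext1 x
    refine congrArg i (strand_ext (L.equiv.apply_symm_apply x.1) rfl)

theorem cab_cableStates [Finite S] (f : ∀ q, Fin (L.len q) × Bool → Fin (n q) → Fin 2) (q : Q)
    (y : Fin (L.len q) × Bool) (h) : cab (L.cableStates n f) (L.point ⟨q, y⟩) (n q) h = f q y :=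
  congrFun (congrFun ((L.cableStates n).left_inv f) q) y

/-- The sum over the states of all cables is a product of traces along the loops. -/
theorem sum_cables [Fintype S] [DecidableEq S] [Fintype Q] [DecidableEq Q]
    (κ κ' : CableMat fun s => n (L.cls s)) :
    ∑ i : (Σ s, Fin (n (L.cls s))) → Fin 2, ∏ s,
      (if L.color s then κ s _ rfl (cab i s _ rfl) (cab i (L.a s) _ (by rw [L.cls_a])) else
        κ' s _ rfl (cab i s _ rfl) (cab i (L.b s) _ (by rw [L.cls_b]))) =
      ∏ q, ((List.range (L.len q)).map fun k =>
        κ (L.step^[k] (L.out q)) (n q) (congrArg n (by rw [L.cls_iterate, L.cls_out])) *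
        κ' (L.a (L.step^[k] (L.out q))) (n q)
          (congrArg n (by rw [L.cls_a, L.cls_iterate, L.cls_out]))).prod.trace := by
  have h1 : ∀ q, n q = n (L.cls (L.out q)) := fun q => by rw [L.cls_out]
  have hs : ∀ q k, n q = n (L.cls (L.step^[k] (L.out q))) := fun q k => by
    rw [L.cls_iterate, L.cls_out]
  have hs' : ∀ q k, n q = n (L.cls (L.a (L.step^[k] (L.out q)))) := fun q k => by
    rw [L.cls_a, L.cls_iterate, L.cls_out]
  rw [← Equiv.sum_comp (L.cableStates n)]
  have h2 : ∀ f, ∏ s, (if L.color s then κ s _ rfl (cab (L.cableStates n f) s _ rfl)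
        (cab (L.cableStates n f) (L.a s) _ (by rw [L.cls_a])) else
        κ' s _ rfl (cab (L.cableStates n f) s _ rfl)
          (cab (L.cableStates n f) (L.b s) _ (by rw [L.cls_b]))) =
      ∏ q, ∏ k : Fin (L.len q), κ (L.step^[k] (L.out q)) (n q) (hs q k) (f q (k, true)) (f q (k, false)) *
        κ' (L.a (L.step^[k] (L.out q))) (n q) (hs' q k) (f q (k, false)) (f q (finRotate _ k, true)) := by
    intro f
    rw [L.prod_point]
    refine Finset.prod_congr rfl fun q _ => Finset.prod_congr rfl fun k _ => ?_
    have e : ∀ y, n q = n (L.cls (L.point ⟨q, y⟩)) := fun y => by rw [L.cls_point]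
    have c1 : L.color (L.point ⟨q, k, true⟩) = true := L.color_point _
    have c2 : L.color (L.point ⟨q, k, false⟩) = false := L.color_point _
    rw [if_pos c1, if_neg (by rw [c2]; simp)]
    congr 1
    · rw [κ.resize (L.cableStates n f) (e _) (by rw [L.cls_a]; exact e _), L.cab_cableStates,
        cab_congr _ (L.a_point q k true) _ (e _), L.cab_cableStates]
      rfl
    · rw [κ'.resize (L.cableStates n f) (e _) (by rw [L.cls_b]; exact e _), L.cab_cableStates,
        cab_congr _ (L.b_point_false q k) _ (e _), L.cab_cableStates]
      rfl
  simp only [h2]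
  have h3 := Finset.prod_univ_sum (fun _ => Finset.univ)
    (fun (q : Q) (f : Fin (L.len q) × Bool → (Fin (n q) → Fin 2)) => ∏ k : Fin (L.len q),
      κ (L.step^[k] (L.out q)) (n q) (hs q k) (f (k, true)) (f (k, false)) *
        κ' (L.a (L.step^[k] (L.out q))) (n q) (hs' q k) (f (k, false)) (f (finRotate _ k, true)))
  rw [Fintype.piFinset_univ] at h3
  rw [← h3]
  exact Finset.prod_congr rfl fun q _ => sum_loop (L.len q) (L.len_pos q)
    (fun k => κ (L.step^[k] (L.out q)) (n q) (hs q k))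
    (fun k => κ' (L.a (L.step^[k] (L.out q))) (n q) (hs' q k))

/-- Every join reverses the counting of the strands, and the colour alternates along a loop.
Counting from opposite ends at points of different colour yields a number which is constant along
the strand. -/
theorem cable_rev [Finite S] (f : S → S) (hf : ∀ s, L.cls (f s) = L.cls s) (hc : ∀ s, L.color (f s) = !L.color s)
    (s : Σ s, Fin (n (L.cls s))) (h) :
    ((if L.color (strandMap (fun s => n (L.cls s)) f h s).1 then
      ((strandMap (fun s => n (L.cls s)) f h s).2 : Fin (n (L.cls _))) else Fin.rev
      (strandMap (fun s => n (L.cls s)) f h s).2 : Fin _) : ℕ) =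
      ((if L.color s.1 then s.2 else Fin.rev s.2 : Fin _) : ℕ) := by
  have h1 := strandMap_val (fun s => n (L.cls s)) f h s
  have h2 : L.color (strandMap (fun s => n (L.cls s)) f h s).1 = !L.color s.1 := hc s.1
  have h3 : n (L.cls (strandMap (fun s => n (L.cls s)) f h s).1) = n (L.cls s.1) := congrArg n (hf s.1)
  have h4 := s.2.2
  rw [h2]
  cases L.color s.1
  · rw [if_pos (by rfl), if_neg (by simp), Fin.val_rev, h1]
    omega
  · rw [if_neg (by simp), if_pos rfl, Fin.val_rev, h1]
    omega

/-- Loops of cables consist of loops of strands. -/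
def strands [Finite S] : LoopSystem (Σ s, Fin (n (L.cls s))) (Σ q, Fin (n q)) where
  a := strandMap _ L.a fun s => by rw [L.cls_a]
  b := strandMap _ L.b fun s => by rw [L.cls_b]
  a_invol s := strand_ext (L.a_invol _) (by
    rw [strandMap_val, strandMap_val]
    have := s.2.2
    change n (L.cls (L.a s.1)) - 1 - _ = _
    rw [L.cls_a]
    omega)
  b_invol s := strand_ext (L.b_invol _) (by
    rw [strandMap_val, strandMap_val]
    have := s.2.2
    change n (L.cls (L.b s.1)) - 1 - _ = _
    rw [L.cls_b]
    omega)
  a_ne s h := L.a_ne s.1 (congrArg Sigma.fst h)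
  b_ne s h := L.b_ne s.1 (congrArg Sigma.fst h)
  cls s := ⟨L.cls s.1, if L.color s.1 then s.2 else Fin.rev s.2⟩
  out x := ⟨L.out x.1, Fin.cast (by rw [L.cls_out]) x.2⟩
  cls_out x := by
    refine strand_ext (L.cls_out x.1) ?_
    simp [L.color_out]
  cls_a s := strand_ext (L.cls_a s.1) (L.cable_rev n L.a L.cls_a L.color_a s _)
  cls_b s := strand_ext (L.cls_b s.1) (L.cable_rev n L.b L.cls_b L.color_b s _)
  ind P h1 h2 s s' h hs := by
    have key := L.ind (fun r => ∀ p : Fin (n (L.cls r)),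
      ((if L.color r then p else Fin.rev p : Fin _) : ℕ) =
        ((if L.color s.1 then s.2 else Fin.rev s.2 : Fin _) : ℕ) → P ⟨r, p⟩)
    have aux : ∀ f : S → S, (hi : ∀ s, f (f s) = s) → (hf : ∀ s, L.cls (f s) = L.cls s) →
        (∀ s, L.color (f s) = !L.color s) →
        (∀ s, P s → P (strandMap (fun s => n (L.cls s)) f (fun s => by rw [hf]) s)) →
        ∀ r, (∀ p : Fin (n (L.cls r)), ((if L.color r then p else Fin.rev p : Fin _) : ℕ) =
          ((if L.color s.1 then s.2 else Fin.rev s.2 : Fin _) : ℕ) → P ⟨r, p⟩) →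
        (∀ p : Fin (n (L.cls (f r))), ((if L.color (f r) then p else Fin.rev p : Fin _) : ℕ) =
          ((if L.color s.1 then s.2 else Fin.rev s.2 : Fin _) : ℕ) → P ⟨f r, p⟩) := by
      intro f hi hf hc hP r hr p hp
      have e1 := L.cable_rev n f hf hc ⟨f r, p⟩ (fun s => by rw [hf])
      have e2 : (⟨f r, p⟩ : Σ s, Fin (n (L.cls s))) = strandMap (fun s => n (L.cls s)) f
          (fun s => by rw [hf]) ⟨r, Fin.cast (by rw [hf]) (Fin.rev p)⟩ := by
        refine strand_ext rfl ?_
        rw [strandMap_val]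
        have := p.2
        have h3 : n (L.cls (f r)) = n (L.cls r) := by rw [hf]
        simp
        omega
      rw [e2]
      refine hP _ (hr _ ?_)
      rw [← hp, hc]
      have h3 : n (L.cls (f r)) = n (L.cls r) := by rw [hf]
      cases L.color r <;> simp <;> omega
    have h5 : L.cls s.1 = L.cls s'.1 := congrArg Sigma.fst h
    have h6 : ((if L.color s.1 then s.2 else Fin.rev s.2 : Fin _) : ℕ) =
        ((if L.color s'.1 then s'.2 else Fin.rev s'.2 : Fin _) : ℕ) := by
      have : ∀ x y : (Σ q, Fin (n q)), x = y → (x.2 : ℕ) = (y.2 : ℕ) := by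
        rintro x _ rfl
        rfl
      exact this _ _ h
    refine key (aux L.a L.a_invol L.cls_a L.color_a h1) (aux L.b L.b_invol L.cls_b L.color_b h2) s.1 s'.1 h5 ?_ s'.2 h6.symm
    intro p hp
    have : p = s.2 := by
      have h7 := p.2
      have h8 := s.2.2
      ext
      cases hc : L.color s.1 <;> simp [hc] at hp <;> omega
    rw [this]
    exact hs

theorem strands_color [Finite S] (s : Σ s, Fin (n (L.cls s))) :
    (L.strands n).color s = L.color s.1 := by
  refine (L.strands n).ind (fun s => (L.strands n).color s = L.color s.1) ?_ ?_
    ((L.strands n).out ((L.strands n).cls s)) s ((L.strands n).cls_out _) ?_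
  · intro s hs
    rw [(L.strands n).color_a, hs]
    exact (L.color_a s.1).symm
  · intro s hs
    rw [(L.strands n).color_b, hs]
    exact (L.color_b s.1).symm
  · rw [(L.strands n).color_out]
    exact (L.color_out _).symm

end LoopSystem

/-! ### Disjoint unions of spin networks -/

namespace SpinNetwork

variable {T D : Type*}

/-- The disjoint union of spin networks. -/
def union (N : T → SpinNetwork D) : SpinNetwork (T × D) where
  rot x := (x.1, (N x.1).rot x.2)
  opp x := (x.1, (N x.1).opp x.2)
  label x := (N x.1).label x.2
  label_opp x := (N x.1).label_opp x.2
  hol x := (N x.1).hol x.2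

variable {N : T → SpinNetwork D}

theorem union_regular (hN : ∀ t, (N t).Regular) : (union N).Regular where
  rot_rot_rot x := Prod.ext rfl ((hN x.1).rot_rot_rot x.2)
  rot_ne x h := (hN x.1).rot_ne x.2 (congrArg Prod.snd h)
  opp_opp x := Prod.ext rfl ((hN x.1).opp_opp x.2)
  opp_ne x h := (hN x.1).opp_ne x.2 (congrArg Prod.snd h)
  hol_opp x := (hN x.1).hol_opp x.2

/-- The strands of a disjoint union. -/
def unionStrands (N : T → SpinNetwork D) : (union N).Strand ≃ Σ t, (N t).Strand where
  toFun s := ⟨s.1.1, s.1.2, s.2⟩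
  invFun s := ⟨(s.1, s.2.1), s.2.2⟩
  left_inv _ := rfl
  right_inv _ := rfl

/-- The states of a disjoint union. -/
def unionStates (N : T → SpinNetwork D) : (∀ t, (N t).Strand → Fin 2) ≃ ((union N).Strand → Fin 2) where
  toFun i s := i s.1.1 ⟨s.1.2, s.2⟩
  invFun i t s := i ⟨(t, s.1), s.2⟩
  left_inv _ := rfl
  right_inv _ := rfl

theorem unionStrands_atVertex (ha : ∀ t, (N t).AllAdmissible) (s : (union N).Strand) :
    (union N).atVertex s = (unionStrands N).symm
      ⟨s.1.1, (N s.1.1).atVertex (unionStrands N s).2⟩ := by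
  have ha' : (union N).AllAdmissible := fun x => ha x.1 x.2
  cases h : (union N).toNext s
  · have h1 := atVertex_of_not_toNext ha' h
    have h2 := atVertex_of_not_toNext (ha s.1.1) (s := (unionStrands N s).2) h
    exact strand_ext (h1.1.trans (Prod.ext rfl h2.1.symm)) (h1.2.trans h2.2.symm)
  · have h1 := atVertex_of_toNext ha' h
    have h2 := atVertex_of_toNext (ha s.1.1) (s := (unionStrands N s).2) h
    exact strand_ext (h1.1.trans (Prod.ext rfl h2.1.symm)) (h1.2.trans h2.2.symm)

/-- The relative sign is multiplicative over components by `relSign_sigma`, and the sum over states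
factorizes. -/
theorem eval_union [Fintype T] [Fintype D] (hN : ∀ t, (N t).Regular)
    (ha : ∀ t, (N t).AllAdmissible) (o : T → D → Bool) (ho : ∀ t d, o t ((N t).opp d) = !o t d) :
    (union N).eval = ∏ t, (N t).eval := by
  classical
  have ha' : (union N).AllAdmissible := fun x => ha x.1 x.2
  rw [eval_eq (union_regular hN) ha' (fun x => o x.1 x.2) fun x => ho x.1 x.2,
    Finset.prod_congr rfl fun t _ => eval_eq (hN t) (ha t) (o t) (ho t), Finset.prod_mul_distrib]
  congr 1
  · rw [← Int.cast_prod, ← Units.coe_prod, ← OMatching.relSign_sigma]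
    congr 2
    refine OMatching.relSign_extend _ _ _ _ (unionStrands N).symm (unionStrands N).symm.injective
      (fun s => ⟨?_, rfl⟩) (fun s => ⟨rfl, rfl⟩) fun s hs => (hs ((unionStrands N).symm.surjective s)).elim
    exact unionStrands_atVertex ha _
  · rw [← Equiv.sum_comp (unionStates N), Finset.prod_univ_sum, Fintype.piFinset_univ]
    refine Finset.sum_congr rfl fun i _ => ?_
    rw [← Equiv.sum_comp (unionStates N), Finset.prod_univ_sum, Fintype.piFinset_univ]
    refine Finset.sum_congr rfl fun j _ => ?_
    rw [Finset.prod_mul_distrib, Finset.prod_mul_distrib, Fintype.prod_prod_type]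
    simp only [OMatching.weight]
    rw [← Equiv.prod_comp (unionStrands N).symm, Fintype.prod_sigma,
      ← Equiv.prod_comp (unionStrands N).symm, Fintype.prod_sigma]
    congr 2
    refine Finset.prod_congr rfl fun t _ => Finset.prod_congr rfl fun s _ => ?_
    change (if (N t).toNext s then vertexKernel _ (i t s) (unionStates N i ((union N).atVertex ⟨(t, s.1), s.2⟩)) else 1) = _
    rw [unionStrands_atVertex ha]
    rfl

end SpinNetwork

/-! ### Contraction along the edges -/

/-- Two strands are turned into each other at an edge of a tetrahedron. -/
def legMat (n : ℕ) : Matrix (Fin n → Fin 2) (Fin n → Fin 2) ℂ :=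
  tensorMat (Fin n) epsMat * permMat Fin.revPerm

/-- The two reversals of the strands are absorbed by the symmetrizer, and what remains is the group
element conjugated by `ε`. These conjugations cancel along a loop. -/
theorem legMat_mul_linkMat (n : ℕ) (g : Matrix (Fin 2) (Fin 2) ℂ) :
    legMat n * SpinNetwork.linkMat n g = symMat n * tensorMat (Fin n) (epsMat * g * epsInv) := by
  rw [legMat, SpinNetwork.linkMat, symMat_tensorMat, Matrix.mul_assoc _ (symMat n), symMat_mul_permMat,
    Matrix.mul_assoc, ← Matrix.mul_assoc (permMat _), permMat_tensorMat, Matrix.mul_assoc (tensorMat _ _) (permMat _),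
    permMat_mul_symMat, ← Matrix.mul_assoc, tensorMat_mul, symMat_tensorMat, Matrix.mul_assoc epsMat]

/-- The symmetrizer is idempotent and commutes with the group; only the empty product contains no
symmetrizer at all. -/
theorem prod_symMat_mul_tensorMat (n : ℕ) (g : ℕ → SU2) (m : ℕ) :
    ((List.range m).map fun j => symMat n * tensorMat (Fin n) (epsMat * (g j).1 * epsInv)).prod =
      (if m = 0 then 1 else symMat n) *
        tensorMat (Fin n) (epsMat * (((List.range m).map g).prod).1 * epsInv) := by
  induction m with
  | zero => simp [epsMat_mul_epsInv, tensorMat_one]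
  | succ m ih =>
    have h : epsMat * (((List.range (m + 1)).map g).prod).1 * epsInv =
        (epsMat * (((List.range m).map g).prod).1 * epsInv) * (epsMat * (g m).1 * epsInv) := by
      rw [List.range_succ, List.map_append, List.prod_append]
      simp only [List.map_cons, List.map_nil, List.prod_singleton, Submonoid.coe_mul]
      have := epsInv_mul_epsMat
      simp only [Matrix.mul_assoc]
      rw [← Matrix.mul_assoc epsInv epsMat, this, Matrix.one_mul]
    rw [h, List.range_succ, List.map_append, List.prod_append, ih, if_neg (Nat.succ_ne_zero m),
      ← tensorMat_mul (_ * epsInv) (_ * epsInv)]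
    simp only [List.map_cons, List.map_nil, List.prod_singleton]
    rw [Matrix.mul_assoc, ← Matrix.mul_assoc _ (symMat n), ← symMat_tensorMat]
    simp only [← Matrix.mul_assoc]
    congr 2
    split_ifs
    · rw [Matrix.one_mul]
    · exact symMat_mul_symMat n

theorem trace_prod_link (n : ℕ) (g : ℕ → SU2) {m : ℕ} (hm : 0 < m) :
    ((List.range m).map fun j => legMat n * SpinNetwork.linkMat n (g j).1).prod.trace =
      chi n (((List.range m).map g).prod).1 := by
  simp only [legMat_mul_linkMat]
  rw [prod_symMat_mul_tensorMat, if_neg hm.ne']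
  exact chi_conj n _ _ _ epsInv_mul_epsMat

/-- The transfer along an edge on the boundary. -/
def edgeMat (n m : ℕ) (g : SU2) : Matrix (Fin n → Fin 2) (Fin n → Fin 2) ℂ :=
  (if m = 0 then 1 else symMat n) * (tensorMat (Fin n) (epsMat * g.1) * permMat Fin.revPerm)

/-- Around an edge between two boundary faces of one tetrahedron no interior face is crossed, whence
the exception `m = 0` in `edgeMat`. After a further symmetrizer, taken from the boundary vertex, the
exception disappears. -/
theorem symMat_mul_edgeMat (n m : ℕ) (g : SU2) : symMat n * edgeMat n m g =
    symMat n * (tensorMat (Fin n) (epsMat * g.1) * permMat Fin.revPerm) := by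
  rw [edgeMat, ← Matrix.mul_assoc]
  congr 1
  split_ifs
  · rw [Matrix.mul_one]
  · exact symMat_mul_symMat n

/-- The matrix unit stands for the passage through the outside. It cuts the loop of a boundary edge
open and prescribes the states at both ends. -/
theorem trace_prod_link_single (n : ℕ) (g : ℕ → SU2) (m : ℕ) (u v : Fin n → Fin 2) :
    (((List.range m).map fun j => legMat n * SpinNetwork.linkMat n (g j).1).prod *
      (legMat n * Matrix.single u v 1)).trace = edgeMat n m ((List.range m).map g).prod v u := by
  simp only [legMat_mul_linkMat]
  rw [prod_symMat_mul_tensorMat, ← Matrix.mul_assoc, Matrix.trace_mul_single]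
  have h : (if m = 0 then 1 else symMat n) *
        tensorMat (Fin n) (epsMat * (((List.range m).map g).prod).1 * epsInv) * legMat n =
      edgeMat n m ((List.range m).map g).prod := by
    rw [edgeMat, legMat, Matrix.mul_assoc _ _ (tensorMat _ _ * _)]
    congr 1
    rw [← Matrix.mul_assoc, tensorMat_mul, Matrix.mul_assoc _ epsInv, epsInv_mul_epsMat, Matrix.mul_one]
  exact (one_smul _ _).trans (congrFun (congrFun h v) u)

namespace Triangulation

variable {T : Type*} {M : Triangulation T}

instance [Finite T] : Finite M.Edge := Quot.finite _

instance [Finite T] : Fintype M.Edge := Fintype.ofFinite _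

theorem not_onBoundary_of_inner {e : M.Edge} (h : ¬ ∃ y, M.OnBoundary y ∧ M.edge y = e) {x : TetFlag T}
    (hx : M.edge x = e) : ¬ M.OnBoundary x := fun hb => h ⟨x, hb, hx⟩

variable (M) in
/-- The matrices at the faces. The states of the strands at boundary faces are given by `k`. -/
def faceMat (n : M.Edge → ℕ) (c : T → Fin 4 → SU2) (k : (Σ x, Fin (n (M.edge x))) → Fin 2) :
    CableMat fun x => n (M.edge x) := fun x m h =>
  if M.OnBoundary x then Matrix.single (cab k x m h) (cab k (M.pass x) m (by
    rw [h]; exact congrArg n (M.edge_pass x).symm)) 1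
  else SpinNetwork.linkMat m (c x.1 x.2.1.1).1

theorem turnHol_pred {c : T → Fin 4 → SU2} (hc : M.IsConnection c) [Finite T] {x : TetFlag T}
    (hx : M.OnBoundary x) : M.turnHol c x (M.turnSteps x - 1) = M.turnHol c x (M.turnSteps x) := by
  obtain ⟨h1, h2⟩ := M.turnSteps_spec hx
  obtain ⟨m, hm⟩ : ∃ m, M.turnSteps x = m + 1 := ⟨M.turnSteps x - 1, by omega⟩
  have h3 := M.onBoundary_opp hx
  rw [M.opp_eq_swap hx, hm, Nat.add_sub_cancel] at h3
  rw [hm, Nat.add_sub_cancel, turnHol_succ]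
  exact (mul_eq_left.mpr (hc.bdry _ _ h3)).symm

variable (M) in
/-- The value of the cable around an edge. -/
def edgeValue [Finite T] (n : M.Edge → ℕ) (c : T → Fin 4 → SU2) (k : (Σ x, Fin (n (M.edge x))) → Fin 2)
    (e : M.Edge) : ℂ :=
  open Classical in
  if ∃ y, M.OnBoundary y ∧ M.edge y = e then
    edgeMat (n e) (M.turnSteps (M.edgeOut e) - 1) (M.turnHol c (M.edgeOut e) (M.turnSteps (M.edgeOut e)))
      (cab k (M.edgeOut e) (n e) (congrArg n (M.edge_edgeOut e).symm))
      (cab k (M.opp (M.edgeOut e)) (n e) (congrArg n ((M.edge_opp _).trans (M.edge_edgeOut e)).symm))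
  else chi (n e) (M.turnHol c (M.edgeOut e) (Function.minimalPeriod M.turn (M.edgeOut e))).1

theorem trace_edge [Finite T] (n : M.Edge → ℕ) {c : T → Fin 4 → SU2} (hc : M.IsConnection c)
    (k : (Σ x, Fin (n (M.edge x))) → Fin 2) (e : M.Edge)
    (h : ∀ j, n e = n (M.edge (swap (M.edgeLoops.step^[j] (M.edgeOut e))))) :
    ((List.range (M.edgeLoops.len e)).map fun j => legMat (n e) *
      M.faceMat n c k (swap (M.edgeLoops.step^[j] (M.edgeOut e))) (n e) (h j)).prod.trace =
      M.edgeValue n c k e := by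
  unfold edgeValue
  split_ifs with he
  · have hx := M.onBoundary_edgeOut he
    obtain ⟨h1, h2⟩ := M.turnSteps_spec hx
    obtain ⟨m, hm⟩ : ∃ m, M.turnSteps (M.edgeOut e) = m + 1 := ⟨M.turnSteps (M.edgeOut e) - 1, by omega⟩
    -- Of the `m + 1` factors the last one belongs to the outside; only the first `m` carry group
    -- elements.
    rw [← turnHol_pred hc hx, M.edgeLoops_len_bdry he, hm, Nat.add_sub_cancel, List.range_succ, List.map_append,
      List.prod_append]
    simp only [List.map_cons, List.map_nil, List.prod_singleton]
    have hl : M.edgeLoops.step^[m] (M.edgeOut e) = M.turn^[m] (M.edgeOut e) :=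
      M.edgeLoops_iterate_bdry (by omega)
    have ho : swap (M.turn^[m] (M.edgeOut e)) = M.opp (M.edgeOut e) := by
      rw [M.opp_eq_swap hx, hm, Nat.add_sub_cancel]
    have hlast : M.faceMat n c k (swap (M.edgeLoops.step^[m] (M.edgeOut e))) (n e) (h m) =
        Matrix.single (cab k (M.opp (M.edgeOut e)) (n e)
          (congrArg n ((M.edge_opp _).trans (M.edge_edgeOut e)).symm))
          (cab k (M.edgeOut e) (n e) (congrArg n (M.edge_edgeOut e).symm)) 1 := by
      have e1 : swap (M.edgeLoops.step^[m] (M.edgeOut e)) = M.opp (M.edgeOut e) := by rw [hl, ho]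
      have e2 : M.pass (swap (M.edgeLoops.step^[m] (M.edgeOut e))) = M.edgeOut e := by
        rw [e1, M.pass_of_onBoundary (M.onBoundary_opp hx), M.opp_opp hx]
      unfold faceMat
      rw [if_pos (by rw [e1]; exact M.onBoundary_opp hx)]
      congr 1
      · exact cab_congr k e1 _ _
      · exact cab_congr k e2 _ _
    rw [hlast]
    have hmap : ((List.range m).map fun j => legMat (n e) *
        M.faceMat n c k (swap (M.edgeLoops.step^[j] (M.edgeOut e))) (n e) (h j)) =
        (List.range m).map fun j => legMat (n e) * SpinNetwork.linkMat (n e)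
          (c (M.turn^[j] (M.edgeOut e)).1 (M.turn^[j] (M.edgeOut e)).2.1.2).1 := by
      refine List.map_congr_left fun j hj => ?_
      have hj := List.mem_range.mp hj
      have e1 : M.edgeLoops.step^[j] (M.edgeOut e) = M.turn^[j] (M.edgeOut e) :=
        M.edgeLoops_iterate_bdry (by omega)
      have e2 : ¬ M.OnBoundary (swap (M.edgeLoops.step^[j] (M.edgeOut e))) := by
        rw [e1, ← onBoundary_turn, ← Function.iterate_succ_apply' M.turn]
        exact M.not_onBoundary_of_lt (Nat.succ_pos j) (by omega)
      unfold faceMat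
      rw [if_neg e2, e1]
      rfl
    rw [hmap]
    exact trace_prod_link_single _ _ _ _ _
  · have hmap : ((List.range (M.edgeLoops.len e)).map fun j => legMat (n e) *
        M.faceMat n c k (swap (M.edgeLoops.step^[j] (M.edgeOut e))) (n e) (h j)) =
        (List.range (M.edgeLoops.len e)).map fun j => legMat (n e) * SpinNetwork.linkMat (n e)
          (c (M.turn^[j] (M.edgeOut e)).1 (M.turn^[j] (M.edgeOut e)).2.1.2).1 := by
      refine List.map_congr_left fun j hj => ?_
      have e1 : M.edgeLoops.step^[j] (M.edgeOut e) = M.turn^[j] (M.edgeOut e) :=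
        M.edgeLoops_iterate_inner (by rw [M.edge_edgeOut]; exact he) j
      have e2 : ¬ M.OnBoundary (swap (M.edgeLoops.step^[j] (M.edgeOut e))) := by
        refine not_onBoundary_of_inner he ((M.edge_swap _).trans ?_)
        exact (M.edgeLoops.cls_iterate j _).trans (M.edgeLoops.cls_out e)
      unfold faceMat
      rw [if_neg e2, e1]
      rfl
    rw [hmap, trace_prod_link _ _ (M.edgeLoops.len_pos e), M.edgeLoops_len_inner he]
    rfl

/-- Contraction of all strands which pass through the faces and turn around the edges. -/
theorem sum_strands [Fintype T] [DecidableEq T] (n : M.Edge → ℕ) {c : T → Fin 4 → SU2} (hc : M.IsConnection c)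
    (k : (Σ x, Fin (n (M.edge x))) → Fin 2) :
    ∑ i : (Σ x, Fin (n (M.edge x))) → Fin 2, ∏ x,
      (if M.edgeLoops.color x then legMat (n (M.edge x)) (cab i x _ rfl)
          (cab i (swap x) _ (congrArg n (M.edge_swap x).symm)) else
        M.faceMat n c k x _ rfl (cab i x _ rfl) (cab i (M.pass x) _ (congrArg n (M.edge_pass x).symm))) =
      ∏ e, M.edgeValue n c k e := by
  classical
  refine (M.edgeLoops.sum_cables n (fun _ m _ => legMat m) (M.faceMat n c k)).trans ?_
  exact Finset.prod_congr rfl fun e _ => trace_edge n hc k e _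

end Triangulation

namespace SpinNetwork

/-- The vertices absorb symmetrizations of their legs. -/
theorem sum_vertexTensor_symMat {D : Type*} [Fintype D] [DecidableEq D] (N : SpinNetwork D) (color : D → Bool)
    (hc : ∀ d, color (N.opp d) = !color d)
    (X : ∀ d, Matrix (Fin (N.label d) → Fin 2) (Fin (N.label d) → Fin 2) ℂ) :
    ∑ k : N.Strand → Fin 2, N.vertexTensor k * ∏ d, (if color d then (symMat (N.label d) * X d)
      (cab k d _ rfl) (cab k (N.opp d) _ (N.label_opp d).symm) else 1) =
    ∑ k : N.Strand → Fin 2, N.vertexTensor k * ∏ d, if color d then X d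
      (cab k d _ rfl) (cab k (N.opp d) _ (N.label_opp d).symm) else 1 := by
  let Z := ∑ k : N.Strand → Fin 2, N.vertexTensor k * ∏ d, if color d then X d
      (cab k d _ rfl) (cab k (N.opp d) _ (N.label_opp d).symm) else 1
  have h1 : ∀ σ : ∀ d, Equiv.Perm (Fin (N.label d)), ∑ k : N.Strand → Fin 2, N.vertexTensor k *
      ∏ d, (if color d then X d (cab k d _ rfl ∘ σ d) (cab k (N.opp d) _ (N.label_opp d).symm) else 1) = Z := by
    intro σ
    -- Only the coloured end of each link is permuted, so that the state at the other end is left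
    -- alone.
    let σ' : ∀ d, Equiv.Perm (Fin (N.label d)) := fun d => if color d then σ d else 1
    rw [← Equiv.sum_comp (Equiv.arrowCongr (Equiv.Perm.sigmaCongrRight σ') (Equiv.refl (Fin 2)))]
    refine Finset.sum_congr rfl fun k _ => ?_
    have e0 : ∀ s, (Equiv.arrowCongr (Equiv.Perm.sigmaCongrRight σ') (Equiv.refl (Fin 2))) k
        (Equiv.Perm.sigmaCongrRight σ' s) = k s := fun s => by
      simp only [Equiv.arrowCongr_apply, Function.comp_apply, Equiv.symm_apply_apply]
      rfl
    set k' := (Equiv.arrowCongr (Equiv.Perm.sigmaCongrRight σ') (Equiv.refl (Fin 2))) k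
    rw [← N.vertexTensor_comp σ' k']
    congr 1
    · exact congrArg N.vertexTensor (funext e0)
    · refine Finset.prod_congr rfl fun d _ => ?_
      by_cases hd : color d = true
      · rw [if_pos hd, if_pos hd]
        congr 1
        · ext1 p
          have h : k' ⟨d, σ' d p⟩ = k ⟨d, p⟩ := e0 ⟨d, p⟩
          have hσ : σ' d = σ d := if_pos hd
          rw [hσ] at h
          exact h
        · ext1 p
          have hd' : ¬ color (N.opp d) = true := by rw [hc, hd]; simp
          have h : k' ⟨N.opp d, σ' (N.opp d) (Fin.cast (N.label_opp d).symm p)⟩ = _ :=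
            e0 ⟨N.opp d, Fin.cast (N.label_opp d).symm p⟩
          have hσ : σ' (N.opp d) = 1 := if_neg hd'
          rw [hσ] at h
          exact h
      · rw [if_neg hd, if_neg hd]
  have h2 : ∀ d (u v : Fin (N.label d) → Fin 2), (symMat (N.label d) * X d) u v =
      ((N.label d).factorial : ℂ)⁻¹ * ∑ σ : Equiv.Perm (Fin (N.label d)), X d (u ∘ σ) v := by
    intro d u v
    rw [symMat_eq, Matrix.smul_mul, Finset.sum_mul, Matrix.smul_apply, Matrix.sum_apply, smul_eq_mul]
    simp only [permMat_mul_apply]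
  have h3 : ∀ k : N.Strand → Fin 2, ∏ d, (if color d then (symMat (N.label d) * X d)
      (cab k d _ rfl) (cab k (N.opp d) _ (N.label_opp d).symm) else 1) =
      (∏ d, ((N.label d).factorial : ℂ)⁻¹) * ∑ σ : ∀ d, Equiv.Perm (Fin (N.label d)),
        ∏ d, (if color d then X d (cab k d _ rfl ∘ σ d) (cab k (N.opp d) _ (N.label_opp d).symm) else 1) := by
    intro k
    rw [← Fintype.piFinset_univ, ← Finset.prod_univ_sum (fun d => Finset.univ) (fun d (σ : Equiv.Perm (Fin (N.label d))) =>
      if color d then X d (cab k d _ rfl ∘ σ) (cab k (N.opp d) _ (N.label_opp d).symm) else 1),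
      ← Finset.prod_mul_distrib]
    refine Finset.prod_congr rfl fun d _ => ?_
    split_ifs
    · exact h2 d _ _
    · rw [Finset.sum_const, Finset.card_univ, Fintype.card_perm, Fintype.card_fin, nsmul_one,
        inv_mul_cancel₀ (Nat.cast_ne_zero.mpr (Nat.factorial_ne_zero _))]
  simp only [h3]
  have h4 : ∀ k : N.Strand → Fin 2, N.vertexTensor k * ((∏ d, ((N.label d).factorial : ℂ)⁻¹) *
      ∑ σ : ∀ d, Equiv.Perm (Fin (N.label d)),
        ∏ d, (if color d then X d (cab k d _ rfl ∘ σ d) (cab k (N.opp d) _ (N.label_opp d).symm) else 1)) =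
      (∏ d, ((N.label d).factorial : ℂ)⁻¹) * ∑ σ : ∀ d, Equiv.Perm (Fin (N.label d)), N.vertexTensor k *
        ∏ d, (if color d then X d (cab k d _ rfl ∘ σ d) (cab k (N.opp d) _ (N.label_opp d).symm) else 1) := by
    intro k
    rw [← Finset.mul_sum]
    ring
  simp only [h4]
  rw [← Finset.mul_sum, Finset.sum_comm]
  simp only [h1]
  rw [Finset.sum_const, Finset.card_univ, Fintype.card_pi]
  simp only [Fintype.card_perm, Fintype.card_fin]
  rw [nsmul_eq_mul, Nat.cast_prod, ← mul_assoc, ← Finset.prod_mul_distrib, Finset.prod_eq_one, one_mul]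
  exact fun d _ => inv_mul_cancel₀ (Nat.cast_ne_zero.mpr (Nat.factorial_ne_zero _))

end SpinNetwork

/-! ### The networks on the boundary and at the tetrahedra -/

namespace Triangulation

variable {T : Type*} {M : Triangulation T}

variable (M) in
/-- The boundary network of a connection. -/
def bdryNet [Finite T] (n : M.Edge → ℕ) (c : T → Fin 4 → SU2) : SpinNetwork M.BdryDart where
  rot x := ⟨rotFlag x.1, x.2⟩
  opp x := ⟨M.opp x.1, M.onBoundary_opp x.2⟩
  label x := n (M.edge x.1)
  label_opp x := congrArg n (M.edge_opp x.1)
  hol x := M.turnHol c x.1 (M.turnSteps x.1)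

theorem bdryNet_regular [Finite T] (n : M.Edge → ℕ) {c : T → Fin 4 → SU2} (hc : M.IsConnection c) :
    (M.bdryNet n c).Regular where
  rot_rot_rot x := Subtype.ext (Prod.ext rfl (FacePair.rot_rot_rot x.1.2))
  rot_ne x h := FacePair.rot_ne x.1.2 (congrArg (fun y : M.BdryDart => y.1.2) h)
  opp_opp x := Subtype.ext (M.opp_opp x.2)
  opp_ne x h := M.opp_ne x.2 (congrArg Subtype.val h)
  hol_opp x := hc.turnHol_opp x.2

theorem color_opp [Finite T] (x : M.BdryDart) : M.edgeLoops.color (M.opp x.1) = !M.edgeLoops.color x.1 := by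
  have h := M.edgeLoops.color_b x.1
  rwa [show M.edgeLoops.b x.1 = M.opp x.1 from M.pass_of_onBoundary x.2] at h

theorem prod_bdryDart [Fintype T] (f : TetFlag T → ℂ) :
    ∏ x : M.BdryDart, f x.1 = ∏ x : TetFlag T, if M.OnBoundary x then f x else 1 := by
  rw [← Finset.prod_filter]
  exact (Finset.prod_subtype _ (fun x => by simp) f).symm

/-- The boundary edges, each with one of its two ends. -/
theorem prod_color [Fintype T] (f : TetFlag T → ℂ) :
    ∏ x : M.BdryDart, (if M.edgeLoops.color x.1 then f x.1 else 1) =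
      open Classical in ∏ e : M.Edge, if ∃ y, M.OnBoundary y ∧ M.edge y = e then f (M.edgeOut e) else 1 := by
  classical
  rw [prod_bdryDart fun x => if M.edgeLoops.color x then f x else 1, M.edgeLoops.prod_point]
  refine Finset.prod_congr rfl fun e _ => ?_
  have hcol : ∀ k, M.edgeLoops.color (M.edgeLoops.point ⟨e, k, true⟩) = true := fun k =>
    M.edgeLoops.color_point _
  have hcol2 : ∀ k, M.edgeLoops.color (M.edgeLoops.point ⟨e, k, false⟩) = false := fun k =>
    M.edgeLoops.color_point _
  have hcls : ∀ k c, M.edge (M.edgeLoops.point ⟨e, k, c⟩) = e := fun k c => M.edgeLoops.cls_point _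
  -- A boundary edge has just two flags on the boundary. The one chosen by `edgeOut` begins the loop
  -- and is coloured, the opposite one is not.
  have hk : ∀ k : Fin (M.edgeLoops.len e),
      (if M.OnBoundary (M.edgeLoops.point ⟨e, k, true⟩) then
        (if M.edgeLoops.color (M.edgeLoops.point ⟨e, k, true⟩) then f (M.edgeLoops.point ⟨e, k, true⟩) else 1) else 1) *
      (if M.OnBoundary (M.edgeLoops.point ⟨e, k, false⟩) then
        (if M.edgeLoops.color (M.edgeLoops.point ⟨e, k, false⟩) then f (M.edgeLoops.point ⟨e, k, false⟩) else 1) else 1) =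
      if (∃ y, M.OnBoundary y ∧ M.edge y = e) ∧ (k : ℕ) = 0 then f (M.edgeOut e) else 1 := by
    intro k
    rw [hcol, hcol2]
    simp only [if_true, Bool.false_eq_true, if_false, ite_self, mul_one]
    by_cases he : ∃ y, M.OnBoundary y ∧ M.edge y = e
    · have hx := M.onBoundary_edgeOut he
      have hlt : (k : ℕ) < M.turnSteps (M.edgeOut e) := M.edgeLoops_len_bdry he ▸ k.2
      have hp : M.edgeLoops.point ⟨e, k, true⟩ = M.turn^[k] (M.edgeOut e) := M.edgeLoops_iterate_bdry hlt
      rw [hp]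
      rcases Nat.eq_zero_or_pos (k : ℕ) with h0 | h0
      · have hx' : M.OnBoundary (M.turn^[0] (M.edgeOut e)) := hx
        rw [h0, if_pos hx', if_pos ⟨he, rfl⟩]
        rfl
      · rw [if_neg (M.not_onBoundary_of_lt h0 hlt), if_neg fun h => h0.ne' h.2]
    · rw [if_neg (not_onBoundary_of_inner he (hcls k true)), if_neg fun h => he h.1]
  rw [Finset.prod_congr rfl fun k _ => hk k]
  split_ifs with he
  · rw [Finset.prod_eq_single (⟨0, M.edgeLoops.len_pos e⟩ : Fin (M.edgeLoops.len e))]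
    · exact if_pos ⟨he, rfl⟩
    · intro k _ hk
      exact if_neg fun h => hk (Fin.ext h.2)
    · exact fun h => (h (Finset.mem_univ _)).elim
  · exact Finset.prod_eq_one fun k _ => if_neg fun h => he h.1

variable (M) in
/-- The matching of the strands along the links of the boundary, oriented by a colouring of the flags. -/
abbrev bdryLinks [Finite T] (n : M.Edge → ℕ) {c : T → Fin 4 → SU2} (hc : M.IsConnection c) :
    OMatching (M.bdryNet n c).Strand :=
  (M.bdryNet n c).linkMatching (bdryNet_regular n hc) (fun x => M.edgeLoops.color x.1) color_opp

/-- The strands which do not end on the boundary can be contracted. -/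
theorem sum_bdryStates [Fintype T] [DecidableEq T] (n : M.Edge → ℕ) {c : T → Fin 4 → SU2} (hc : M.IsConnection c) :
    ∑ i : (Σ x, Fin (n (M.edge x))) → Fin 2,
      (M.bdryNet n c).vertexTensor (fun s => i ⟨s.1.1, s.2⟩) * ∏ x,
      (if M.edgeLoops.color x then legMat (n (M.edge x)) (cab i x _ rfl)
          (cab i (swap x) _ (congrArg n (M.edge_swap x).symm)) else if M.OnBoundary x then 1 else
        SpinNetwork.linkMat (n (M.edge x)) (c x.1 x.2.1.1).1 (cab i x _ rfl)
          (cab i (M.pass x) _ (congrArg n (M.edge_pass x).symm))) =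
      (open Classical in ∏ e : M.Edge, if ∃ y, M.OnBoundary y ∧ M.edge y = e then 1 else
        chi (n e) (M.turnHol c (M.edgeOut e) (Function.minimalPeriod M.turn (M.edgeOut e))).1) *
      ∑ k : (M.bdryNet n c).Strand → Fin 2, (M.bdryNet n c).vertexTensor k *
        (M.bdryLinks n hc).weight (M.bdryNet n c).linkKernel k := by
  classical
  let N := M.bdryNet n c
  -- The value zero at interior flags is arbitrary, as `faceMat` uses the prescribed states at
  -- boundary faces only.
  let ext : (N.Strand → Fin 2) → (Σ x, Fin (n (M.edge x))) → Fin 2 := fun k s =>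
    if h : M.OnBoundary s.1 then k ⟨⟨s.1, h⟩, s.2⟩ else 0
  have hext : ∀ (k : N.Strand → Fin 2) (d : M.BdryDart) (m h), cab (ext k) d.1 m h = cab (D := M.BdryDart)
      (ℓ := N.label) k d m h := by
    intro k d m h
    ext1 p
    exact dif_pos d.2
  -- insertion of delta functions
  have h1 : ∀ i : (Σ x, Fin (n (M.edge x))) → Fin 2, N.vertexTensor (fun s => i ⟨s.1.1, s.2⟩) * ∏ x,
      (if M.edgeLoops.color x then legMat (n (M.edge x)) (cab i x _ rfl)
          (cab i (swap x) _ (congrArg n (M.edge_swap x).symm)) else if M.OnBoundary x then 1 else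
        SpinNetwork.linkMat (n (M.edge x)) (c x.1 x.2.1.1).1 (cab i x _ rfl)
          (cab i (M.pass x) _ (congrArg n (M.edge_pass x).symm))) =
      ∑ k : N.Strand → Fin 2, N.vertexTensor k * ∏ x,
      (if M.edgeLoops.color x then legMat (n (M.edge x)) (cab i x _ rfl)
          (cab i (swap x) _ (congrArg n (M.edge_swap x).symm)) else
        M.faceMat n c (ext k) x _ rfl (cab i x _ rfl) (cab i (M.pass x) _ (congrArg n (M.edge_pass x).symm))) := by
    intro i
    rw [Finset.sum_eq_single (fun s : N.Strand => i ⟨s.1.1, s.2⟩)]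
    · congr 1
      refine Finset.prod_congr rfl fun x _ => ?_
      split_ifs with h2 h3
      · rfl
      · unfold faceMat
        rw [if_pos h3]
        have e1 := hext (fun s : N.Strand => i ⟨s.1.1, s.2⟩) ⟨x, h3⟩ _ rfl
        have h4 : M.OnBoundary (M.pass x) := by
          rw [M.pass_of_onBoundary h3]; exact M.onBoundary_opp h3
        have e2 := hext (fun s : N.Strand => i ⟨s.1.1, s.2⟩) ⟨M.pass x, h4⟩ (n (M.edge x))
          (congrArg n (M.edge_pass x).symm)
        have e3 : ∀ u v u' v' : Fin (n (M.edge x)) → Fin 2, u = u' → v = v' →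
            (1 : ℂ) = Matrix.single u v 1 u' v' := by
          rintro u v _ _ rfl rfl
          exact (Matrix.single_apply_same _ _ _).symm
        exact e3 _ _ _ _ e1 e2
      · unfold faceMat
        rw [if_neg h3]
    · intro k _ hk
      rw [mul_eq_zero]
      right
      obtain ⟨⟨d, p⟩, hd⟩ := Function.ne_iff.mp hk
      -- The matrix unit at the uncoloured end of a boundary link tests the states at both of its
      -- ends, so every deviation of `k` from `i` makes the product vanish.
      have key : ∀ d : M.BdryDart, M.edgeLoops.color d.1 = false →
          (∃ p, k ⟨d, p⟩ ≠ i ⟨d.1, p⟩) ∨ (∃ p, k ⟨N.opp d, p⟩ ≠ i ⟨M.opp d.1, p⟩) → ∏ x,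
          (if M.edgeLoops.color x then legMat (n (M.edge x)) (cab i x _ rfl)
              (cab i (swap x) _ (congrArg n (M.edge_swap x).symm)) else
            M.faceMat n c (ext k) x _ rfl (cab i x _ rfl) (cab i (M.pass x) _ (congrArg n (M.edge_pass x).symm))) = 0 := by
        intro d hcol hd
        refine Finset.prod_eq_zero (Finset.mem_univ d.1) ?_
        rw [hcol, if_neg (by simp)]
        unfold faceMat
        rw [if_pos d.2]
        have e1 := hext k d _ rfl
        have hp := M.pass_of_onBoundary d.2
        have e2 : cab (ext k) (M.pass d.1) (n (M.edge d.1)) (congrArg n (M.edge_pass d.1).symm) =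
            cab (D := M.BdryDart) (ℓ := N.label) k (N.opp d) (n (M.edge d.1)) (N.label_opp d).symm :=
          (cab_congr _ hp _ (congrArg n (M.edge_opp d.1).symm)).trans (hext k (N.opp d) _ _)
        have e3 : ∀ u v u' v' : Fin (n (M.edge d.1)) → Fin 2, ¬ (u = u' ∧ v = v') →
            Matrix.single u v (1 : ℂ) u' v' = 0 := fun u v u' v' h => Matrix.single_apply_of_ne _ _ _ _ _ h
        refine e3 _ _ _ _ ?_
        rintro ⟨a1, a2⟩
        rcases hd with ⟨p, hp⟩ | ⟨p, hp'⟩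
        · exact hp (congrFun (e1.symm.trans a1) p)
        · have a3 := congrFun (e2.symm.trans (a2.trans (cab_congr i hp _ (congrArg n (M.edge_opp d.1).symm))))
            (Fin.cast (N.label_opp d) p)
          exact hp' a3
      cases hcol : M.edgeLoops.color d.1
      · exact key d hcol (Or.inl ⟨p, hd⟩)
      · refine key (N.opp d) (by rw [← Bool.not_true, ← hcol]; exact color_opp d) (Or.inr ?_)
        have e1 : N.opp (N.opp d) = d := Subtype.ext (M.opp_opp d.2)
        have e2 : ∀ d' : M.BdryDart, d' = d → ∃ p, k ⟨d', p⟩ ≠ i ⟨d'.1, p⟩ := by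
          rintro _ rfl
          exact ⟨p, hd⟩
        exact e2 _ e1
    · exact fun h => (h (Finset.mem_univ _)).elim
  rw [Finset.sum_congr rfl fun i _ => h1 i, Finset.sum_comm]
  simp only [← Finset.mul_sum]
  rw [Finset.sum_congr rfl fun k _ => congrArg (N.vertexTensor k * ·) (sum_strands n hc (ext k))]
  -- separation of the inner edges
  let Y : ∀ d : M.BdryDart, Matrix (Fin (N.label d) → Fin 2) (Fin (N.label d) → Fin 2) ℂ := fun d =>
    tensorMat (Fin (N.label d)) (epsMat * (N.hol d).1) * permMat Fin.revPerm
  let X : ∀ d : M.BdryDart, Matrix (Fin (N.label d) → Fin 2) (Fin (N.label d) → Fin 2) ℂ := fun d =>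
    edgeMat (N.label d) (M.turnSteps d.1 - 1) (N.hol d)
  have h2 : ∀ k : N.Strand → Fin 2, ∏ e, M.edgeValue n c (ext k) e =
      (∏ e : M.Edge, if ∃ y, M.OnBoundary y ∧ M.edge y = e then 1 else
        chi (n e) (M.turnHol c (M.edgeOut e) (Function.minimalPeriod M.turn (M.edgeOut e))).1) *
      ∏ d, if M.edgeLoops.color d.1 then X d (cab k d _ rfl) (cab k (N.opp d) _ (N.label_opp d).symm) else 1 := by
    intro k
    have h3 := prod_color (M := M) fun x => edgeMat (n (M.edge x)) (M.turnSteps x - 1)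
      (M.turnHol c x (M.turnSteps x)) (cab (ext k) x _ rfl) (cab (ext k) (M.opp x) _ (congrArg n (M.edge_opp x).symm))
    have h4 : ∀ d : M.BdryDart, (if M.edgeLoops.color d.1 then X d (cab k d _ rfl)
        (cab k (N.opp d) _ (N.label_opp d).symm) else 1) =
        if M.edgeLoops.color d.1 then edgeMat (n (M.edge d.1)) (M.turnSteps d.1 - 1)
          (M.turnHol c d.1 (M.turnSteps d.1)) (cab (ext k) d.1 _ rfl)
          (cab (ext k) (M.opp d.1) _ (congrArg n (M.edge_opp d.1).symm)) else 1 := by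
      intro d
      split_ifs
      · have e1 := hext k d _ rfl
        have e2 := hext k (N.opp d) (n (M.edge d.1)) (N.label_opp d).symm
        exact (congrArg₂ (X d) e1 e2).symm
      · rfl
    rw [Finset.prod_congr rfl fun d _ => h4 d, h3, ← Finset.prod_mul_distrib]
    refine Finset.prod_congr rfl fun e _ => ?_
    unfold edgeValue
    split_ifs with he
    · rw [one_mul]
      have e1 : ∀ (m : ℕ) (h : m = n (M.edge (M.edgeOut e))),
          edgeMat m (M.turnSteps (M.edgeOut e) - 1) (M.turnHol c (M.edgeOut e) (M.turnSteps (M.edgeOut e)))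
            (cab (ext k) (M.edgeOut e) m h) (cab (ext k) (M.opp (M.edgeOut e)) m
              (h.trans (congrArg n (M.edge_opp _).symm))) =
          edgeMat (n (M.edge (M.edgeOut e))) (M.turnSteps (M.edgeOut e) - 1)
            (M.turnHol c (M.edgeOut e) (M.turnSteps (M.edgeOut e)))
            (cab (ext k) (M.edgeOut e) _ rfl) (cab (ext k) (M.opp (M.edgeOut e)) _
              (congrArg n (M.edge_opp _).symm)) := by
        rintro _ rfl
        rfl
      exact e1 _ (congrArg n (M.edge_edgeOut e).symm)
    · rw [mul_one]
  rw [Finset.sum_congr rfl fun k _ => congrArg (N.vertexTensor k * ·) (h2 k)]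
  simp only [mul_left_comm (N.vertexTensor _)]
  rw [← Finset.mul_sum]
  congr 1
  -- Symmetrizers may be inserted and removed at the boundary vertices. In between, `edgeMat` is
  -- replaced by the bare transport along the link, also when no interior face is crossed.
  have h5 := N.sum_vertexTensor_symMat (fun x => M.edgeLoops.color x.1) color_opp
  have h6 : ∀ d, symMat (N.label d) * X d = symMat (N.label d) * Y d := fun d => symMat_mul_edgeMat _ _ _
  refine (h5 X).symm.trans (Eq.trans ?_ ((h5 Y).trans ?_))
  · simp only [h6]
  · refine Finset.sum_congr rfl fun k _ => congrArg (N.vertexTensor k * ·) ?_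
    rw [OMatching.weight, Fintype.prod_sigma]
    refine Finset.prod_congr rfl fun d _ => ?_
    by_cases hd : M.edgeLoops.color d.1 = true
    · rw [if_pos hd]
      have h7 : Y d (cab k d _ rfl) (cab k (N.opp d) _ (N.label_opp d).symm) =
          ∏ p, (epsMat * (N.hol d).1) (cab k d _ rfl p)
            (cab k (N.opp d) (N.label d) (N.label_opp d).symm (Fin.rev p)) :=
        mul_permMat_apply _ _ _ _
      rw [h7]
      refine Finset.prod_congr rfl fun p _ => ?_
      exact (if_pos hd).symm
    · rw [if_neg hd]
      exact (Finset.prod_eq_one fun p _ => if_neg hd).symm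

end Triangulation

/-! ### The total sign of the state sum. -/

/-! ### Signs -/

namespace OMatching

theorem ext_iff_of {S : Type*} {A B : OMatching S} (hm : A.m = B.m) (ho : A.o = B.o) : A = B := by
  cases A
  cases B
  subst hm ho
  rfl

/-- The matching `A` on a set, and `B` off this set. -/
def piecewise {S : Type*} (A B : OMatching S) (p : S → Prop) [DecidablePred p]
    (hA : ∀ s, p s → p (A.m s)) (hB : ∀ s, ¬ p s → ¬ p (B.m s)) : OMatching S where
  m s := if p s then A.m s else B.m s
  o s := if p s then A.o s else B.o s
  invol s := by
    by_cases h : p s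
    · simp only [if_pos h, if_pos (hA s h), A.invol]
    · simp only [if_neg h, if_neg (hB s h), B.invol]
  o_m s := by
    by_cases h : p s
    · simp only [if_pos h, if_pos (hA s h), A.o_m]
    · simp only [if_neg h, if_neg (hB s h), B.o_m]

end OMatching

namespace SpinNetwork

/-- Strands at the vertices are preserved by embeddings of networks. -/
theorem atVertex_embed {D D' : Type*} {N : SpinNetwork D} {N' : SpinNetwork D'} (ha : N.AllAdmissible)
    (ha' : N'.AllAdmissible) (f : D → D') (hl : ∀ d, N'.label (f d) = N.label d)
    (hf : ∀ d, N'.rot (f d) = f (N.rot d)) (s : N.Strand) :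
    N'.toNext ⟨f s.1, Fin.cast (hl _).symm s.2⟩ = N.toNext s ∧
      N'.atVertex ⟨f s.1, Fin.cast (hl _).symm s.2⟩ =
        ⟨f (N.atVertex s).1, Fin.cast (hl _).symm (N.atVertex s).2⟩ := by
  have h1 : N'.toNext ⟨f s.1, Fin.cast (hl _).symm s.2⟩ = N.toNext s := by
    simp only [toNext, hf, hl, Fin.val_cast]
  refine ⟨h1, ?_⟩
  cases h : N.toNext s
  · obtain ⟨a1, a2⟩ := atVertex_of_not_toNext ha h
    rw [h] at h1
    obtain ⟨a3, a4⟩ := atVertex_of_not_toNext ha' h1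
    refine strand_ext ?_ ?_
    · rw [a3]
      simp only [hf, a1]
    · rw [a4]
      simp only [hf, hl, a2, Fin.val_cast]
  · obtain ⟨a1, a2⟩ := atVertex_of_toNext ha h
    rw [h] at h1
    obtain ⟨a3, a4⟩ := atVertex_of_toNext ha' h1
    refine strand_ext ?_ ?_
    · rw [a3]
      simp only [hf, a1]
    · rw [a4]
      simp only [hl, a2, Fin.val_cast]

end SpinNetwork

namespace Triangulation

open SpinNetwork

variable {T : Type*} {M : Triangulation T}

theorem tetNetwork_regular (l : FacePair → ℕ) (hl : ∀ p, l p.swap = l p) : (tetNetwork l hl).Regular where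
  rot_rot_rot := FacePair.rot_rot_rot
  rot_ne := FacePair.rot_ne
  opp_opp _ := rfl
  opp_ne := FacePair.swap_ne
  hol_opp _ := inv_one.symm

variable (M) in
/-- The networks of all tetrahedra. -/
def flagNet (n : M.Edge → ℕ) : SpinNetwork (TetFlag T) :=
  SpinNetwork.union fun t => tetNetwork (fun p => n (M.edge (t, p))) fun p =>
    congrArg n (M.edge_swap (t, p))

theorem flagNet_regular (n : M.Edge → ℕ) : (M.flagNet n).Regular :=
  union_regular fun _ => tetNetwork_regular _ _

theorem flagNet_allAdmissible {n : M.Edge → ℕ} (hn : M.AdmissibleLabelling n) : (M.flagNet n).AllAdmissible := hn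

theorem bdryNet_allAdmissible [Finite T] {n : M.Edge → ℕ} (hn : M.AdmissibleLabelling n) (c : T → Fin 4 → SU2) :
    (M.bdryNet n c).AllAdmissible := fun x => hn x.1

variable (M) in
/-- The matching of the strands in the tetrahedra, oriented by a colouring of the flags. -/
abbrev flagLinks [Finite T] (n : M.Edge → ℕ) : OMatching (M.flagNet n).Strand :=
  (M.flagNet n).linkMatching (flagNet_regular n) M.edgeLoops.color M.edgeLoops.color_a

theorem prod_tetOf [Fintype T] {n : M.Edge → ℕ} (hn : M.AdmissibleLabelling n) :
    ∏ t, M.tetOf n t = (M.flagNet n).eval :=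
  (eval_union (fun _ => tetNetwork_regular _ _) (fun t p => hn (t, p)) (fun t p => M.edgeLoops.color (t, p))
    fun t p => M.edgeLoops.color_a (t, p)).symm

variable (M) in
/-- The side of an interior face on which a flag lies. -/
def flagSide (x : TetFlag T) : Bool := M.faceSign (M.faceEquiv.symm x).1

theorem flagSide_faceFlag (y : (M.InnerFace × Bool) ⊕ M.BdryFace) (l : Fin 3) :
    M.flagSide (M.faceFlag (y, l)) = M.faceSign y := by
  have h : M.faceEquiv.symm (M.faceFlag (y, l)) = (y, l) := M.faceEquiv.symm_apply_apply (y, l)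
  rw [flagSide, h]

theorem flagSide_rotFlag (x : TetFlag T) : M.flagSide (rotFlag x) = M.flagSide x := by
  rw [flagSide, faceEquiv_rotFlag, flagSide]

theorem flagSide_cross {x : TetFlag T} (hx : ¬ M.OnBoundary x) : M.flagSide (M.cross x) = !M.flagSide x := by
  obtain ⟨⟨⟨q, b⟩ | b, l⟩, rfl⟩ := M.faceFlag_bijective.2 x
  · rw [cross_faceFlag, flagSide_faceFlag, flagSide_faceFlag]
    rfl
  · exact (hx (M.onBoundary_faceFlag b l)).elim

variable (M) in
/-- A sign for each flag, which arises from different orientations of the strands at the faces. -/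
def flagSign [Finite T] (n : M.Edge → ℕ) (x : TetFlag T) : ℂ :=
  if ¬ M.OnBoundary x ∧ M.flagSide x = true ∧ M.edgeLoops.color x = true then (-1) ^ n (M.edge x) else 1

theorem onBoundary_pass [Finite T] (x : TetFlag T) : M.OnBoundary (M.pass x) ↔ M.OnBoundary x := by
  by_cases h : M.OnBoundary x
  · rw [M.pass_of_onBoundary h]
    exact iff_of_true (M.onBoundary_opp h) h
  · rw [M.pass_of_not h, M.onBoundary_cross]

/-- The matching of the strands at the faces. -/
def passMatching [Finite T] (n : M.Edge → ℕ) (o : TetFlag T → Bool) (ho : ∀ x, o (M.pass x) = !o x) :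
    OMatching (M.flagNet n).Strand :=
  strandMatching (fun x => n (M.edge x)) M.pass (fun x => congrArg n (M.edge_pass x)) M.pass_pass o ho

/-- The three signs on the left come from the tetrahedral networks, the faces and the boundary
network. They are compared along a chain of matchings from the vertices `V` to the links in the
tetrahedra. `M1` and `M2` join strands across interior faces but keep the vertices at boundary
faces, with different orientations; `P2` also joins strands through the outside at boundary edges.
Between `P2` and the links each strand of each edge forms one loop, which gives `(-1) ^ n e` for all
edges; those of the boundary edges are cancelled when the links of the boundary network are
reversed. -/
theorem relSign_flags [Fintype T] {n : M.Edge → ℕ} (hn : M.AdmissibleLabelling n) {c : T → Fin 4 → SU2}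
    (hc : M.IsConnection c) :
    ((OMatching.relSign (vertexMatching (flagNet_regular n).rot_rot_rot (flagNet_allAdmissible hn))
      (M.flagLinks n) : ℤ) : ℂ) * (∏ x, M.flagSign n x) *
    ((OMatching.relSign (vertexMatching (bdryNet_regular n hc).rot_rot_rot (bdryNet_allAdmissible hn c))
      (M.bdryLinks n hc) : ℤ) : ℂ) =
    open Classical in ∏ e : M.Edge, if ∃ y, M.OnBoundary y ∧ M.edge y = e then 1 else (-1) ^ n e := by
  classical
  have ha := flagNet_allAdmissible hn
  have hr := flagNet_regular n
  let V := vertexMatching hr.rot_rot_rot ha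
  let Vb := vertexMatching (bdryNet_regular n hc).rot_rot_rot (bdryNet_allAdmissible hn c)
  -- At interior faces the strands are directed from one side to the other, as is needed for the
  -- mirror symmetry; at boundary faces they follow the colouring.
  let o1 : TetFlag T → Bool := fun x => if M.OnBoundary x then !M.edgeLoops.color x else M.flagSide x
  have ho1 : ∀ x, o1 (M.pass x) = !o1 x := by
    intro x
    by_cases h : M.OnBoundary x
    · simp only [o1, if_pos h, if_pos ((M.onBoundary_pass x).mpr h)]
      exact congrArg _ (M.edgeLoops.color_b x)
    · simp only [o1, if_neg h, if_neg ((M.onBoundary_pass x).not.mpr h)]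
      rw [M.pass_of_not h, flagSide_cross h]
  have ho2 : ∀ x, (!M.edgeLoops.color (M.pass x)) = !!M.edgeLoops.color x := fun x =>
    congrArg _ (M.edgeLoops.color_b x)
  let P1 := passMatching n o1 ho1
  let P2 := passMatching n (fun x => !M.edgeLoops.color x) ho2
  let p : (M.flagNet n).Strand → Prop := fun s => M.OnBoundary s.1
  have hV : ∀ s, ((V.m s).1 = rotFlag s.1 ∨ (V.m s).1 = rotFlag (rotFlag s.1)) := by
    intro s
    cases h : (M.flagNet n).toNext s
    · exact Or.inr (atVertex_of_not_toNext ha h).1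
    · exact Or.inl (atVertex_of_toNext ha h).1
  have hVp : ∀ s, p (V.m s) ↔ p s := by
    intro s
    rcases hV s with h | h
    · exact iff_of_eq ((congrArg M.OnBoundary h).trans rfl)
    · exact iff_of_eq ((congrArg M.OnBoundary h).trans rfl)
  have hVs : ∀ s, M.flagSide (V.m s).1 = M.flagSide s.1 := by
    intro s
    rcases hV s with h | h
    · rw [h, flagSide_rotFlag]
    · rw [h, flagSide_rotFlag, flagSide_rotFlag]
  have hPp : ∀ s : (M.flagNet n).Strand, ¬ p s → ¬ p (P1.m s) := fun s h => (M.onBoundary_pass s.1).not.mpr h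
  let M1 := V.piecewise P1 p (fun s => (hVp s).mpr) hPp
  let M2 := V.piecewise P2 p (fun s => (hVp s).mpr) hPp
  -- Crossing an interior face reverses the cyclic order and hence the direction of the strands at
  -- the vertex, while the side of the face is constant along these strands.
  have e1 : OMatching.relSign V M1 = 1 := by
    refine OMatching.relSign_eq_one_of_mirror V M1 (fun s => ¬ p s) ?_ ?_
    · intro s hs
      have hs' : ¬ p (P1.m s) := hPp s hs
      have hs2 : ¬ p (V.m s) := (hVp s).not.mpr hs
      have hm : M1.m s = P1.m s := if_neg hs
      have hm2 : M1.m (V.m s) = P1.m (V.m s) := if_neg hs2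
      rw [hm, hm2]
      have hpc : M.pass s.1 = M.cross s.1 := M.pass_of_not hs
      have hmir := mirror (N := M.flagNet n) (N' := M.flagNet n) ha ha M.cross
        (fun x => congrArg n (M.edge_cross x)) (s := s) (r := P1.m s) (M.rotFlag_cross hs)
        (by
          have h1 := M.rotFlag_cross (x := s.1) hs
          have h2 := M.rotFlag_cross (x := rotFlag (rotFlag s.1)) hs
          have h3 : rotFlag (rotFlag (rotFlag s.1)) = s.1 := Prod.ext rfl (FacePair.rot_rot_rot s.1.2)
          change rotFlag (rotFlag (M.cross s.1)) = M.cross (rotFlag s.1)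
          rw [h1, h2, h3])
        hpc (strandMap_val (fun x => n (M.edge x)) M.pass (fun x => congrArg n (M.edge_pass x)) s)
      refine ⟨hs2, hs', ?_, hmir.1, ?_⟩
      · refine strand_ext (hmir.2.1.trans (M.pass_of_not hs2).symm) ?_
        exact hmir.2.2.trans (strandMap_val (fun x => n (M.edge x)) M.pass (fun x => congrArg n (M.edge_pass x)) _).symm
      · have a1 : M1.o (V.m s) = M.flagSide (V.m s).1 := (if_neg hs2).trans (if_neg hs2)
        have a2 : M1.o s = M.flagSide s.1 := (if_neg hs).trans (if_neg hs)
        rw [a1, a2, hVs]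
    · intro s hs
      rw [not_not] at hs
      exact ⟨(if_pos hs).symm, (if_pos hs).symm⟩
  have e2 : ((M1.relSign M2 : ℤ) : ℂ) = ∏ x, M.flagSign n x := by
    rw [OMatching.relSign_of_m_eq M1 M2 rfl]
    refine Eq.trans (Fintype.prod_sigma _) (Finset.prod_congr rfl fun x _ => ?_)
    by_cases hx : M.OnBoundary x
    · rw [flagSign, if_neg fun h => h.1 hx]
      refine Finset.prod_eq_one fun q _ => ?_
      have a1 : M1.o ⟨x, q⟩ = V.o ⟨x, q⟩ := if_pos hx
      have a2 : M2.o ⟨x, q⟩ = V.o ⟨x, q⟩ := if_pos hx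
      rw [a1, a2]
      simp
    · have a1 : ∀ q, M1.o ⟨x, q⟩ = M.flagSide x := fun q => (if_neg hx).trans (if_neg hx)
      have a2 : ∀ q, M2.o ⟨x, q⟩ = !M.edgeLoops.color x := fun q => if_neg hx
      simp only [a1, a2, Bool.not_not]
      by_cases h : M.flagSide x = true ∧ M.edgeLoops.color x = true
      · have hF : M.flagSign n x = (-1) ^ n (M.edge x) := if_pos ⟨hx, h⟩
        rw [hF, h.1, h.2]
        simp only [Bool.and_self, if_true, Finset.prod_const, Finset.card_univ]
        rw [Fintype.card_fin]
        rfl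
      · have hF : M.flagSign n x = 1 := if_neg fun h' => h h'.2
        rw [hF]
        refine Finset.prod_eq_one fun q _ => if_neg ?_
        simpa using h
  let Lb' := (M.bdryNet n c).linkMatching (bdryNet_regular n hc) (fun x => !M.edgeLoops.color x.1)
    fun x => congrArg _ (color_opp x)
  -- These matchings differ only at boundary faces, where they are the vertices and the reversed
  -- links of the boundary network.
  have e3 : M2.relSign P2 = Vb.relSign Lb' := by
    refine OMatching.relSign_extend _ _ _ _ (fun s => ⟨s.1.1, s.2⟩) ?_ ?_ ?_ ?_
    · rintro ⟨⟨x, hx⟩, q⟩ ⟨⟨x', hx'⟩, q'⟩ h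
      obtain rfl : x = x' := congrArg Sigma.fst h
      obtain rfl : q = q' := eq_of_heq (Sigma.mk.inj h).2
      rfl
    · intro s
      have h := atVertex_embed (bdryNet_allAdmissible hn c) ha Subtype.val (fun _ => rfl) (fun _ => rfl) s
      exact ⟨(if_pos s.1.2).trans h.2, (if_pos s.1.2).trans h.1⟩
    · intro s
      exact ⟨strand_ext (M.pass_of_onBoundary s.1.2) rfl, rfl⟩
    · intro s hs
      have hs' : ¬ p s := fun h => hs ⟨⟨⟨s.1, h⟩, s.2⟩, rfl⟩
      exact ⟨if_neg hs', if_neg hs'⟩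
  -- The two matchings are those of the loop system of single strands, in which an edge with label
  -- `n e` has `n e` loops.
  have e4 : ((P2.relSign (M.flagLinks n) : ℤ) : ℂ) = ∏ e, (-1) ^ n e := by
    have h1 : M.flagLinks n = (M.edgeLoops.strands n).matchA :=
      OMatching.ext_iff_of rfl (funext fun s => (M.edgeLoops.strands_color n s).symm)
    have h2 : P2 = (M.edgeLoops.strands n).matchB :=
      OMatching.ext_iff_of rfl (funext fun s => congrArg (fun b => !b) (M.edgeLoops.strands_color n s).symm)
    rw [OMatching.relSign_comm, h1, h2]
    refine (congrArg (fun z : ℤˣ => ((z : ℤ) : ℂ)) (M.edgeLoops.strands n).relSign_match).trans ?_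
    rw [Fintype.card_sigma]
    simp only [Fintype.card_fin]
    push_cast
    rw [Finset.prod_pow_eq_pow_sum]
  -- All strands of the boundary links are reversed, that is, `n e` of them at each boundary edge.
  have e5 : ((Lb'.relSign (M.bdryLinks n hc) : ℤ) : ℂ) =
      ∏ e : M.Edge, if ∃ y, M.OnBoundary y ∧ M.edge y = e then (-1) ^ n e else 1 := by
    rw [OMatching.relSign_comm, OMatching.relSign_of_m_eq (M.bdryLinks n hc) Lb' rfl, Fintype.prod_sigma]
    have h1 := prod_color (M := M) fun x => (-1) ^ n (M.edge x)
    simp only [edge_edgeOut] at h1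
    rw [← h1]
    refine Finset.prod_congr rfl fun x _ => ?_
    have a1 : ∀ q, (M.bdryLinks n hc).o ⟨x, q⟩ = M.edgeLoops.color x.1 := fun q => rfl
    have a2 : ∀ q, Lb'.o ⟨x, q⟩ = !M.edgeLoops.color x.1 := fun q => rfl
    simp only [a1, a2, Bool.not_not, Bool.and_self, Finset.prod_const, Finset.card_univ]
    split_ifs
    · rw [Fintype.card_fin]
      rfl
    · exact one_pow _
  have e6 : V.relSign (M.flagLinks n) = M1.relSign M2 * (Vb.relSign Lb' * P2.relSign (M.flagLinks n)) := by
    rw [← OMatching.relSign_mul V M1, e1, one_mul, ← OMatching.relSign_mul M1 M2, ← OMatching.relSign_mul M2 P2, e3]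
  have e7 : Vb.relSign Lb' * Vb.relSign (M.bdryLinks n hc) = Lb'.relSign (M.bdryLinks n hc) := by
    rw [OMatching.relSign_comm Vb Lb', OMatching.relSign_mul]
  have e8 : ((M1.relSign M2 : ℤ) : ℂ) * ((M1.relSign M2 : ℤ) : ℂ) = 1 := by
    rcases Int.units_eq_one_or (M1.relSign M2) with h | h <;> simp [h]
  have e9 : ((Vb.relSign Lb' : ℤ) : ℂ) * ((Vb.relSign (M.bdryLinks n hc) : ℤ) : ℂ) =
      ((Lb'.relSign (M.bdryLinks n hc) : ℤ) : ℂ) := by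
    rw [← e7]
    push_cast
    rfl
  change ((V.relSign (M.flagLinks n) : ℤ) : ℂ) * _ * ((Vb.relSign (M.bdryLinks n hc) : ℤ) : ℂ) = _
  rw [e6, ← e2]
  push_cast
  have e10 : (∏ e : M.Edge, if ∃ y, M.OnBoundary y ∧ M.edge y = e then (1 : ℂ) else (-1) ^ n e) =
      (∏ e, (-1) ^ n e) * ∏ e : M.Edge, if ∃ y, M.OnBoundary y ∧ M.edge y = e then (-1) ^ n e else 1 := by
    rw [← Finset.prod_mul_distrib]
    refine Finset.prod_congr rfl fun e _ => ?_
    split_ifs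
    · rw [← mul_pow]
      simp
    · rw [mul_one]
  rw [e10, ← e4, ← e5, ← e9]
  linear_combination (((Vb.relSign Lb' : ℤ) : ℂ) * ((P2.relSign (M.flagLinks n) : ℤ) : ℂ) *
    ((Vb.relSign (M.bdryLinks n hc) : ℤ) : ℂ)) * e8

end Triangulation

/-! ### The state sum with given labels as an integral over connections. -/

/-! ### The amplitude with given labels as an integral over connections -/

namespace SpinNetwork

/-- Inversion of the group element transposes `g ε⁻¹` up to a sign, one for each strand. -/
theorem linkMat_inv (n : ℕ) (g : SU2) (u v : Fin n → Fin 2) :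
    linkMat n (g⁻¹).1 u v = (-1) ^ n * linkMat n g.1 v u := by
  have h1 : ∀ u v, linkMat n g.1 u v = (symMat n * tensorMat (Fin n) (g.1 * epsInv)) u v := by
    intro u v
    rw [linkMat, symMat_tensorMat, Matrix.mul_assoc, symMat_mul_permMat]
  have h2 : ∀ u v, linkMat n (g⁻¹).1 u v = (tensorMat (Fin n) ((g⁻¹).1 * epsInv) * symMat n) u v := by
    intro u v
    rw [linkMat, symMat_tensorMat, Matrix.mul_assoc, symMat_mul_permMat]
  have h3 : ∀ a b, ((g⁻¹).1 * epsInv) a b = -(g.1 * epsInv) b a := by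
    intro a b
    have e2 : (g⁻¹).1 = epsInv * g.1.transpose * epsMat := by
      rw [Matrix.mul_assoc, ← SU2.eps_mul_inv, ← Matrix.mul_assoc, epsInv_mul_epsMat, Matrix.one_mul]
    have e3 : (g⁻¹).1 * epsInv = epsInv * g.1.transpose := by
      rw [e2, Matrix.mul_assoc, epsMat_mul_epsInv, Matrix.mul_one]
    have e4 : epsInv * g.1.transpose = (g.1 * epsInv.transpose).transpose := by
      rw [Matrix.transpose_mul, Matrix.transpose_transpose]
    rw [e3, e4, Matrix.transpose_apply, epsInv_transpose, epsInv_eq_neg, Matrix.mul_neg, Matrix.neg_apply, neg_neg]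
  rw [h1, h2, Matrix.mul_apply, Matrix.mul_apply, Finset.mul_sum]
  refine Finset.sum_congr rfl fun w _ => ?_
  have h4 : tensorMat (Fin n) ((g⁻¹).1 * epsInv) u w = (-1) ^ n * tensorMat (Fin n) (g.1 * epsInv) w u := by
    simp only [tensorMat, Matrix.of_apply, h3]
    rw [Finset.prod_neg, Finset.card_univ, Fintype.card_fin]
  have h5 : symMat n w v = symMat n v w := symKernel_comm n v w
  rw [h4, h5]
  ring

/-- The labels of a vertex may be replaced by equal ones. -/
theorem vertexNet_tensor_congr {b : Bool} {k k' : Fin 3 → ℕ} (h : k = k') (j : (vertexNet b k').Strand → Fin 2) :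
    (vertexNet b k').vertexTensor j =
      (vertexNet b k).vertexTensor fun s => j ⟨s.1, Fin.cast (congrFun h s.1) s.2⟩ := by
  subst h
  rfl

end SpinNetwork

namespace Triangulation

open SpinNetwork

variable {T : Type*} {M : Triangulation T}

instance [Finite T] : Finite M.InnerFace := Quot.finite _

instance [Finite T] : Fintype M.InnerFace := Fintype.ofFinite _

/-- The product over the matrices at the interior faces. -/
theorem prod_faces [Fintype T] (n : M.Edge → ℕ) (g : M.InnerFace → SU2) (i : (Σ x, Fin (n (M.edge x))) → Fin 2) :
    ∏ q, ∏ l, linkMat (n (M.edge (M.faceFlag (.inl (q, true), l)))) (g q).1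
        (cab i (M.faceFlag (.inl (q, true), l)) _ rfl)
        (cab i (M.cross (M.faceFlag (.inl (q, true), l))) _ (congrArg n (M.edge_cross _).symm)) =
      (∏ x, M.flagSign n x) * ∏ x, if M.edgeLoops.color x then 1 else if M.OnBoundary x then 1 else
        linkMat (n (M.edge x)) (M.connection g x.1 x.2.1.1).1 (cab i x _ rfl)
          (cab i (M.pass x) _ (congrArg n (M.edge_pass x).symm)) := by
  let G : TetFlag T → ℂ := fun x => if M.edgeLoops.color x then 1 else if M.OnBoundary x then 1 else
        linkMat (n (M.edge x)) (M.connection g x.1 x.2.1.1).1 (cab i x _ rfl)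
          (cab i (M.pass x) _ (congrArg n (M.edge_pass x).symm))
  have h1 : ∏ x, (M.flagSign n x * G x) = ∏ q, ∏ l,
      (M.flagSign n (M.faceFlag (.inl (q, true), l)) * G (M.faceFlag (.inl (q, true), l))) *
      (M.flagSign n (M.faceFlag (.inl (q, false), l)) * G (M.faceFlag (.inl (q, false), l))) := by
    have hb : ∀ b l, M.flagSign n (M.faceFlag (.inr b, l)) * G (M.faceFlag (.inr b, l)) = 1 := by
      intro b l
      have h := M.onBoundary_faceFlag b l
      have e1 : M.flagSign n (M.faceFlag (.inr b, l)) = 1 := if_neg fun h' => h'.1 h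
      have e2 : G (M.faceFlag (.inr b, l)) = 1 := by
        simp only [G, if_pos h, ite_self]
      rw [e1, e2, mul_one]
    rw [← Equiv.prod_comp M.faceEquiv, Fintype.prod_prod_type, Fintype.prod_sum_type, Fintype.prod_prod_type]
    have hb' : ∏ b : M.BdryFace, ∏ l : Fin 3, (M.flagSign n (M.faceEquiv (.inr b, l)) * G (M.faceEquiv (.inr b, l))) = 1 :=
      Finset.prod_eq_one fun b _ => Finset.prod_eq_one fun l _ => hb b l
    rw [hb', mul_one]
    refine Finset.prod_congr rfl fun q _ => ?_
    rw [Fintype.prod_bool, ← Finset.prod_mul_distrib]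
    rfl
  rw [← Finset.prod_mul_distrib]
  refine Eq.trans ?_ h1.symm
  refine Finset.prod_congr rfl fun q _ => Finset.prod_congr rfl fun l _ => ?_
  have hx := M.not_onBoundary_faceFlag q true l
  have hx' := M.not_onBoundary_faceFlag q false l
  have hc : M.pass (M.faceFlag (.inl (q, true), l)) = M.faceFlag (.inl (q, false), l) :=
    (M.pass_of_not hx).trans (M.cross_faceFlag q true l)
  have hc' : M.pass (M.faceFlag (.inl (q, false), l)) = M.faceFlag (.inl (q, true), l) :=
    (M.pass_of_not hx').trans (M.cross_faceFlag q false l)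
  have hs : M.flagSide (M.faceFlag (.inl (q, true), l)) = true := M.flagSide_faceFlag _ l
  have hs' : M.flagSide (M.faceFlag (.inl (q, false), l)) = false := M.flagSide_faceFlag _ l
  have hcol : M.edgeLoops.color (M.faceFlag (.inl (q, false), l)) =
      !M.edgeLoops.color (M.faceFlag (.inl (q, true), l)) := by
    rw [← hc]
    exact M.edgeLoops.color_b _
  have hg := M.connection_true (g := g) q l
  have hg' := M.connection_false (g := g) q l
  have hcr : M.cross (M.faceFlag (.inl (q, true), l)) = M.faceFlag (.inl (q, false), l) :=
    M.cross_faceFlag q true l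
  have e2 : M.flagSign n (M.faceFlag (.inl (q, false), l)) = 1 := if_neg fun h => by
    rw [hs'] at h
    simp at h
  rw [e2, one_mul]
  -- Of the two flags on either side of the face exactly one is uncoloured and carries the link
  -- matrix. If it lies on the side where the group element is inverted, then `linkMat_inv` gives
  -- the sign contained in `flagSign`.
  cases hcolx : M.edgeLoops.color (M.faceFlag (.inl (q, true), l))
  · have e1 : M.flagSign n (M.faceFlag (.inl (q, true), l)) = 1 := if_neg fun h => by
      rw [hcolx] at h
      simp at h
    have e3 : G (M.faceFlag (.inl (q, false), l)) = 1 := if_pos (by rw [hcol, hcolx]; rfl)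
    have e4 : G (M.faceFlag (.inl (q, true), l)) = _ := (if_neg (by rw [hcolx]; simp)).trans (if_neg hx)
    rw [e1, e3, e4, one_mul, mul_one, hg]
    congr 1
    exact cab_congr i (M.pass_of_not hx).symm _ _
  · have e1 : M.flagSign n (M.faceFlag (.inl (q, true), l)) = (-1) ^ n (M.edge (M.faceFlag (.inl (q, true), l))) :=
      if_pos ⟨hx, hs, hcolx⟩
    have e3 : G (M.faceFlag (.inl (q, true), l)) = 1 := if_pos hcolx
    have e4 : G (M.faceFlag (.inl (q, false), l)) = _ := (if_neg (by rw [hcol, hcolx]; simp)).trans (if_neg hx')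
    rw [e1, e3, e4, mul_one, hg']
    have hl : n (M.edge (M.faceFlag (.inl (q, true), l))) = n (M.edge (M.faceFlag (.inl (q, false), l))) := by
      rw [← hcr, M.edge_cross]
    have e5 := CableMat.resize (ℓ := fun x => n (M.edge x)) (fun _ m _ => linkMat m ((g q)⁻¹).1) i
      (d := M.faceFlag (.inl (q, false), l)) (d' := M.pass (M.faceFlag (.inl (q, false), l))) hl
      (congrArg n ((congrArg M.edge hc').symm))
    refine Eq.trans ?_ (congrArg _ e5.symm)
    rw [linkMat_inv, ← mul_assoc, ← mul_pow, neg_one_mul, neg_neg, one_pow, one_mul]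
    exact congrArg₂ (linkMat _ (g q).1) (cab_congr i hc'.symm _ _) (cab_congr i hcr _ _)

/-- The boundary half-links, numbered by the boundary faces. -/
def bdryEquiv [Finite T] : M.BdryFace × Fin 3 ≃ M.BdryDart :=
  Equiv.ofBijective (fun y => ⟨M.faceFlag (.inr y.1, y.2), M.onBoundary_faceFlag y.1 y.2⟩) (by
    constructor
    · intro y z h
      have h0 : M.faceFlag (.inr y.1, y.2) = M.faceFlag (.inr z.1, z.2) := congrArg Subtype.val h
      have h1 := M.faceFlag_bijective.1 h0
      simp only [Prod.mk.injEq, Sum.inr.injEq] at h1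
      exact Prod.ext h1.1 h1.2
    · rintro ⟨x, hx⟩
      obtain ⟨⟨⟨q, b⟩ | b, l⟩, rfl⟩ := M.faceFlag_bijective.2 x
      · exact (M.not_onBoundary_faceFlag q b l hx).elim
      · exact ⟨(b, l), rfl⟩)

/-- The intertwiners at the faces are obtained by integration. -/
theorem theta_vertexTensor [Fintype T] [DecidableEq T] {n : M.Edge → ℕ} (hn : M.AdmissibleLabelling n) (c : T → Fin 4 → SU2)
    (i : (Σ x, Fin (n (M.edge x))) → Fin 2) :
    (∏ q : M.InnerFace, (M.thetaOf n (Quot.out q).1.1 (Quot.out q).1.2)⁻¹) * (M.flagNet n).vertexTensor i =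
      (M.bdryNet n c).vertexTensor (fun s => i ⟨s.1.1, s.2⟩) *
      ∏ q : M.InnerFace, ∫ g : SU2, ∏ l, linkMat (n (M.edge (M.faceFlag (.inl (q, true), l)))) g.1
        (cab i (M.faceFlag (.inl (q, true), l)) _ rfl)
        (cab i (M.cross (M.faceFlag (.inl (q, true), l))) _ (congrArg n (M.edge_cross _).symm)) ∂haarSU2 := by
  have h1 := vertexTensor_eq_prod (flagNet_allAdmissible hn) M.faceSign M.faceEquiv M.rotFlag_faceFlag i
  have h2 := vertexTensor_eq_prod (bdryNet_allAdmissible hn c) (fun _ => true) (M.bdryEquiv)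
    (fun y l => Subtype.ext (M.rotFlag_faceFlag (.inr y) l)) (fun s => i ⟨s.1.1, s.2⟩)
  rw [h1, h2, Fintype.prod_sum_type, Fintype.prod_prod_type, ← mul_assoc, ← Finset.prod_mul_distrib, mul_comm]
  congr 1
  refine Finset.prod_congr rfl fun q _ => ?_
  rw [Fintype.prod_bool]
  let k : Fin 3 → ℕ := fun l => n (M.edge (M.faceFlag (.inl (q, true), l)))
  have hk : Admissible (k 0) (k 1) (k 2) := by
    have h := hn (M.faceFlag (.inl (q, true), 0))
    have e0 := M.rotFlag_faceFlag (.inl (q, true)) 0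
    have e1 := M.rotFlag_faceFlag (.inl (q, true)) 1
    have h' : Admissible (n (M.edge (M.faceFlag (.inl (q, true), 0))))
      (n (M.edge (rotFlag (M.faceFlag (.inl (q, true), 0)))))
      (n (M.edge (rotFlag (rotFlag (M.faceFlag (.inl (q, true), 0)))))) := h
    rw [e0] at h'
    change Admissible _ _ (n (M.edge (rotFlag (M.faceFlag (.inl (q, true), 1))))) at h'
    rw [e1] at h'
    exact h'
  have hkk : k = fun l => n (M.edge (M.faceFlag (.inl (q, false), l))) := funext fun l =>
    congrArg n ((M.edge_cross _).symm.trans (congrArg M.edge (M.cross_faceFlag q true l)))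
  have h3 := vertexNet_tensor_congr (b := false) hkk (fun s => i ⟨M.faceFlag (.inl (q, false), s.1), s.2⟩)
  have h4 := integral_linkMat hk (fun s => i ⟨M.faceFlag (.inl (q, true), s.1), s.2⟩)
    (fun s => i ⟨M.faceFlag (.inl (q, false), s.1), Fin.cast (congrFun hkk s.1) s.2⟩)
  refine Eq.trans (congrArg₂ (· * ·) rfl (congrArg₂ (· * ·) rfl h3)) (h4.symm.trans ?_)
  refine integral_congr_ae (Filter.Eventually.of_forall fun g => Finset.prod_congr rfl fun l _ => ?_)
  refine congrArg (linkMat (k l) g.1 _) ?_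
  exact cab_congr i (M.cross_faceFlag q true l).symm (congrFun hkk l) _

variable (M) in
/-- The holonomy about an interior edge. -/
def edgeHol {G : Type*} [Group G] (c : T → Fin 4 → G) (e : M.Edge) : G :=
  M.turnHol c (M.edgeOut e) (Function.minimalPeriod M.turn (M.edgeOut e))

variable (M) in
/-- Integrands for the faces, when the states of the strands are given. -/
def faceInt (n : M.Edge → ℕ) (i : (Σ x, Fin (n (M.edge x))) → Fin 2) (q : M.InnerFace) (g : SU2) : ℂ :=
  ∏ l, linkMat (n (M.edge (M.faceFlag (.inl (q, true), l)))) g.1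
    (cab i (M.faceFlag (.inl (q, true), l)) _ rfl)
    (cab i (M.cross (M.faceFlag (.inl (q, true), l))) _ (congrArg n (M.edge_cross _).symm))

theorem continuous_linkMat (n : ℕ) (u v : Fin n → Fin 2) : Continuous fun g : SU2 => linkMat n g.1 u v := by
  have h : ∀ g : SU2, linkMat n g.1 u v = ∑ w, symMat n u w * ∑ w', tensorMat (Fin n) g.1 w w' *
      tensorMat (Fin n) epsInv w' v := by
    intro g
    rw [linkMat, symMat_tensorMat, Matrix.mul_assoc, symMat_mul_permMat, ← symMat_tensorMat, ← tensorMat_mul]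
    rfl
  simp only [h]
  exact continuous_finsetSum _ fun w _ => continuous_const.mul
    (continuous_finsetSum _ fun w' _ => (continuous_tensorMat w w').mul continuous_const)

theorem continuous_faceInt (n : M.Edge → ℕ) (i : (Σ x, Fin (n (M.edge x))) → Fin 2) (q : M.InnerFace) :
    Continuous (M.faceInt n i q) := continuous_finsetProd _ fun _ _ => continuous_linkMat _ _ _

variable (M) in
/-- The product of the characters of the holonomies about the interior edges. -/
def edgeChi [Finite T] (n : M.Edge → ℕ) (c : T → Fin 4 → SU2) : ℂ :=
  open Classical in ∏ e : M.Edge, if ∃ y, M.OnBoundary y ∧ M.edge y = e then 1 else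
    chi (n e) (M.edgeHol c e).1

variable (M) in
/-- The sign of the interior edges. -/
def edgeSign [Finite T] (n : M.Edge → ℕ) : ℂ :=
  open Classical in ∏ e : M.Edge, if ∃ y, M.OnBoundary y ∧ M.edge y = e then 1 else (-1) ^ n e

theorem prod_flagSign_mul_self [Fintype T] (n : M.Edge → ℕ) : (∏ x, M.flagSign n x) * ∏ x, M.flagSign n x = 1 := by
  rw [← Finset.prod_mul_distrib]
  refine Finset.prod_eq_one fun x _ => ?_
  unfold flagSign
  split_ifs
  · exact neg_one_pow_mul_self _
  · exact one_mul 1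

theorem flagLinks_weight [Fintype T] (n : M.Edge → ℕ) (i : (Σ x, Fin (n (M.edge x))) → Fin 2) :
    (M.flagLinks n).weight (M.flagNet n).linkKernel i = ∏ x, if M.edgeLoops.color x then
      legMat (n (M.edge x)) (cab i x _ rfl) (cab i (swap x) _ (congrArg n (M.edge_swap x).symm)) else 1 := by
  refine (Fintype.prod_sigma _).trans (Finset.prod_congr rfl fun x _ => ?_)
  by_cases hx : M.edgeLoops.color x = true
  · rw [if_pos hx]
    have h7 : legMat (n (M.edge x)) (cab i x _ rfl) (cab i (swap x) _ (congrArg n (M.edge_swap x).symm)) =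
        ∏ p, epsMat (cab i x _ rfl p) (cab i (swap x) (n (M.edge x)) (congrArg n (M.edge_swap x).symm) (Fin.rev p)) :=
      mul_permMat_apply _ _ _ _
    rw [h7]
    refine Finset.prod_congr rfl fun p _ => ?_
    refine (if_pos hx).trans ?_
    change (epsMat * (1 : Matrix (Fin 2) (Fin 2) ℂ)) _ _ = _
    rw [Matrix.mul_one]
    rfl
  · rw [if_neg hx]
    exact Finset.prod_eq_one fun p _ => if_neg hx

/-- `sum_bdryStates` read backwards: coloured flags yield the links of the tetrahedra, the other
flags at interior faces yield the matrices to be integrated. On the right the group elements occur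
in the factors `faceInt` only, one for each face, so that the integral will factorize. -/
theorem edgeChi_mul_sum [Fintype T] [DecidableEq T] (n : M.Edge → ℕ) (g : M.InnerFace → SU2)
    (hc : M.IsConnection (M.connection g)) :
    M.edgeChi n (M.connection g) * ∑ k, (M.bdryNet n (M.connection g)).vertexTensor k *
      (M.bdryLinks n hc).weight (M.bdryNet n (M.connection g)).linkKernel k =
    (∏ x, M.flagSign n x) * ∑ i : (Σ x, Fin (n (M.edge x))) → Fin 2,
      (M.bdryNet n fun _ _ => 1).vertexTensor (fun s => i ⟨s.1.1, s.2⟩) *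
        (M.flagLinks n).weight (M.flagNet n).linkKernel i * ∏ q, M.faceInt n i q (g q) := by
  refine (congrArg (· * _) ?_).trans ((sum_bdryStates n hc).symm.trans ?_)
  · exact Finset.prod_congr rfl fun e _ => by congr
  rw [Finset.mul_sum]
  refine Finset.sum_congr rfl fun i _ => ?_
  have h1 := prod_faces n g i
  have h2 : ∏ q, M.faceInt n i q (g q) = _ := h1
  rw [h2, flagLinks_weight]
  have h3 : ∀ x, (if M.edgeLoops.color x then legMat (n (M.edge x)) (cab i x _ rfl)
          (cab i (swap x) _ (congrArg n (M.edge_swap x).symm)) else if M.OnBoundary x then 1 else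
        SpinNetwork.linkMat (n (M.edge x)) (M.connection g x.1 x.2.1.1).1 (cab i x _ rfl)
          (cab i (M.pass x) _ (congrArg n (M.edge_pass x).symm))) =
      (if M.edgeLoops.color x then
        legMat (n (M.edge x)) (cab i x _ rfl) (cab i (swap x) _ (congrArg n (M.edge_swap x).symm)) else 1) *
      if M.edgeLoops.color x then 1 else if M.OnBoundary x then 1 else
        linkMat (n (M.edge x)) (M.connection g x.1 x.2.1.1).1 (cab i x _ rfl)
          (cab i (M.pass x) _ (congrArg n (M.edge_pass x).symm)) := by
    intro x
    by_cases hx : M.edgeLoops.color x = true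
    · simp only [if_pos hx, mul_one]
    · simp only [if_neg hx, one_mul]
  simp only [h3, Finset.prod_mul_distrib]
  have h4 := prod_flagSign_mul_self n
  -- The vertex tensor does not involve the group elements on the links.
  have h5 : (M.bdryNet n (M.connection g)).vertexTensor (fun s => i ⟨s.1.1, s.2⟩) =
    (M.bdryNet n fun _ _ => 1).vertexTensor (fun s => i ⟨s.1.1, s.2⟩) := rfl
  rw [h5]
  have h6 : ∀ s B A C : ℂ, s * s = 1 → B * (A * C) = s * (B * A * (s * C)) := fun s B A C h => by
    linear_combination (-(B * A * C)) * h
  exact h6 _ _ _ _ h4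

end Triangulation

namespace Triangulation

open SpinNetwork

variable {T : Type*} {M : Triangulation T}

variable (M) in
/-- The normalised Haar measure on the group elements at the interior faces. -/
abbrev haarFaces [Finite T] : Measure (M.InnerFace → SU2) := Measure.pi fun _ => haarSU2

/-- Integration over the group elements at the interior faces. -/
theorem integral_edgeChi [Fintype T] [DecidableEq T] (n : M.Edge → ℕ) :
    ∫ g, M.edgeChi n (M.connection g) * ∑ k, (M.bdryNet n (M.connection g)).vertexTensor k *
      (M.bdryLinks n (M.isConnection_connection g)).weight (M.bdryNet n (M.connection g)).linkKernel k ∂M.haarFaces =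
    (∏ x, M.flagSign n x) * ∑ i : (Σ x, Fin (n (M.edge x))) → Fin 2,
      (M.bdryNet n fun _ _ => 1).vertexTensor (fun s => i ⟨s.1.1, s.2⟩) *
        (M.flagLinks n).weight (M.flagNet n).linkKernel i * ∏ q, ∫ g, M.faceInt n i q g ∂haarSU2 := by
  simp only [edgeChi_mul_sum]
  rw [integral_const_mul, integral_finsetSum]
  · simp only [integral_const_mul]
    congr 1
    refine Finset.sum_congr rfl fun i _ => congrArg _ ?_
    exact integral_fintype_prod_eq_prod _
  · intro i _
    refine Integrable.const_mul (Continuous.integrable_of_hasCompactSupport ?_ (HasCompactSupport.of_compactSpace _)) _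
    exact continuous_finsetProd _ fun q _ => (continuous_faceInt n i q).comp (continuous_apply q)

theorem sign_cast_mul_self (u : ℤˣ) : ((u : ℤ) : ℂ) * ((u : ℤ) : ℂ) = 1 := by
  rcases Int.units_eq_one_or u with h | h <;> simp [h]

theorem bdryNet_eval [Fintype T] [DecidableEq T] {n : M.Edge → ℕ} {c : T → Fin 4 → SU2} (hc : M.IsConnection c)
    (ha : (M.bdryNet n c).AllAdmissible) : (M.bdryNet n c).eval =
      ((OMatching.relSign (vertexMatching (bdryNet_regular n hc).rot_rot_rot ha) (M.bdryLinks n hc) : ℤ) : ℂ) *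
      ∑ k, (M.bdryNet n c).vertexTensor k * (M.bdryLinks n hc).weight (M.bdryNet n c).linkKernel k :=
  eval_eq_vertexTensor (bdryNet_regular n hc) ha _ _

/-- The product of the theta and tetrahedral networks is an integral over connections. -/
theorem amplitude_eq_integral [Fintype T] {n : M.Edge → ℕ} (hn : M.AdmissibleLabelling n) :
    (∏ q : M.InnerFace, (M.thetaOf n (Quot.out q).1.1 (Quot.out q).1.2)⁻¹) * ∏ t, M.tetOf n t =
      M.edgeSign n * ∫ g, M.edgeChi n (M.connection g) * (M.bdryNet n (M.connection g)).eval ∂M.haarFaces := by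
  classical
  have ha := flagNet_allAdmissible hn
  let ρ : ℂ := ((OMatching.relSign (vertexMatching (flagNet_regular n).rot_rot_rot ha) (M.flagLinks n) : ℤ) : ℂ)
  have h1 : ∏ t, M.tetOf n t = ρ * ∑ i, (M.flagNet n).vertexTensor i * (M.flagLinks n).weight (M.flagNet n).linkKernel i :=
    (prod_tetOf hn).trans (eval_eq_vertexTensor _ _ _ _)
  have h2 : ∀ g : M.InnerFace → SU2, M.edgeSign n *
      (M.edgeChi n (M.connection g) * (M.bdryNet n (M.connection g)).eval) =
      (ρ * ∏ x, M.flagSign n x) * (M.edgeChi n (M.connection g) * ∑ k, (M.bdryNet n (M.connection g)).vertexTensor k *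
        (M.bdryLinks n (M.isConnection_connection g)).weight (M.bdryNet n (M.connection g)).linkKernel k) := by
    intro g
    have h3 := relSign_flags hn (M.isConnection_connection g)
    have h4 := bdryNet_eval (M.isConnection_connection g) (bdryNet_allAdmissible hn (M.connection g))
    have h5 := sign_cast_mul_self (OMatching.relSign (vertexMatching
      (bdryNet_regular n (M.isConnection_connection g)).rot_rot_rot (bdryNet_allAdmissible hn (M.connection g)))
      (M.bdryLinks n (M.isConnection_connection g)))
    have h6 : M.edgeSign n = _ := (Finset.prod_congr rfl fun e _ => by congr).trans h3.symm
    rw [h4, h6]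
    have h7 : ∀ ρ s b X S : ℂ, b * b = 1 → ρ * s * b * (X * (b * S)) = ρ * s * (X * S) := fun ρ s b X S h => by
      linear_combination (ρ * s * X * S) * h
    exact h7 _ _ _ _ _ h5
  rw [← integral_const_mul]
  simp only [h2]
  rw [integral_const_mul, integral_edgeChi, h1]
  have h3 := prod_flagSign_mul_self n
  have h4 : ∀ ρ s X : ℂ, s * s = 1 → ρ * s * (s * X) = ρ * X := fun ρ s X h => by
    linear_combination (ρ * X) * h
  rw [h4 _ _ _ h3, mul_left_comm, Finset.mul_sum]
  congr 1
  refine Finset.sum_congr rfl fun i _ => ?_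
  -- For each state of the strands the integrals at the faces supply the intertwiners of the
  -- tetrahedra, divided by the theta evaluations.
  rw [← mul_assoc, theta_vertexTensor hn (fun _ _ => 1) i, mul_right_comm]
  rfl

theorem admissible_perm {a b c : ℕ} (h : Admissible a b c) : Admissible b c a ∧ Admissible a c b := by
  obtain ⟨h1, h2, h3, h4⟩ := h
  refine ⟨⟨?_, h3, h4, h2⟩, ⟨?_, ?_, ?_, ?_⟩⟩
  · rwa [show b + c + a = a + b + c by ring]
  · rwa [show a + c + b = a + b + c by ring]
  all_goals omega

theorem admissible_faceFlag {n : M.Edge → ℕ} {q : M.InnerFace}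
    (h : Admissible (n (M.edge (M.faceFlag (.inl (q, true), 0)))) (n (M.edge (M.faceFlag (.inl (q, true), 1))))
      (n (M.edge (M.faceFlag (.inl (q, true), 2))))) (b : Bool) (l : Fin 3) :
    Admissible (n (M.edge (M.faceFlag (.inl (q, b), l)))) (n (M.edge (rotFlag (M.faceFlag (.inl (q, b), l)))))
      (n (M.edge (rotFlag (rotFlag (M.faceFlag (.inl (q, b), l)))))) := by
  have h1 : ∀ l, M.edge (M.faceFlag (.inl (q, b), l)) = M.edge (M.faceFlag (.inl (q, true), l)) := by
    intro l
    cases b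
    · exact (M.edge_cross _).symm.trans (congrArg M.edge (M.cross_faceFlag q false l))
    · rfl
  rw [rotFlag_faceFlag, rotFlag_faceFlag]
  simp only [h1]
  generalize M.faceSign (.inl (q, b)) = s
  have e := admissible_perm h
  have e1 := admissible_perm e.1
  have e2 := admissible_perm e1.1
  have f1 : (1 + 1 : Fin 3) = 2 := rfl
  have f2 : (2 + 1 : Fin 3) = 0 := rfl
  have f3 : (0 - 1 : Fin 3) = 2 := rfl
  have f4 : (2 - 1 : Fin 3) = 1 := rfl
  fin_cases l <;> cases s <;> simp [f1, f2, f3, f4] <;> tauto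

/-- Labels which are not admissible do not contribute. -/
theorem integral_eq_zero [Fintype T] {n : M.Edge → ℕ} (hn : ¬ M.AdmissibleLabelling n) :
    ∫ g, M.edgeChi n (M.connection g) * (M.bdryNet n (M.connection g)).eval ∂M.haarFaces = 0 := by
  classical
  -- Either the violation is at a boundary triangle, and the boundary evaluation is zero by
  -- definition, or it is at an interior one, and the integral over the group element of this
  -- triangle vanishes for every state.
  by_cases hb : (M.bdryNet n fun _ _ => 1).AllAdmissible
  · obtain ⟨x, hx⟩ := not_forall.mp hn
    obtain ⟨⟨⟨q, b⟩ | b, l⟩, rfl⟩ := M.faceFlag_bijective.2 x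
    swap
    · exact (hx (hb ⟨_, M.onBoundary_faceFlag b l⟩)).elim
    let k : Fin 3 → ℕ := fun l => n (M.edge (M.faceFlag (.inl (q, true), l)))
    have hk : ¬ Admissible (k 0) (k 1) (k 2) := fun h => hx (admissible_faceFlag h b l)
    have hq : ∀ i, ∫ g, M.faceInt n i q g ∂haarSU2 = 0 := by
      intro i
      have h4 := integral_linkMat_eq_zero hk (fun s => i ⟨M.faceFlag (.inl (q, true), s.1), s.2⟩)
        (fun s => i ⟨M.cross (M.faceFlag (.inl (q, true), s.1)), Fin.cast (congrArg n (M.edge_cross _).symm) s.2⟩)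
      refine Eq.trans ?_ h4
      exact integral_congr_ae (Filter.Eventually.of_forall fun g => Finset.prod_congr rfl fun l _ => rfl)
    have h2 : ∀ g : M.InnerFace → SU2, M.edgeChi n (M.connection g) * (M.bdryNet n (M.connection g)).eval =
        ((OMatching.relSign (vertexMatching (bdryNet_regular n (M.isConnection_connection fun _ => 1)).rot_rot_rot hb)
          (M.bdryLinks n (M.isConnection_connection fun _ => 1)) : ℤ) : ℂ) *
        (M.edgeChi n (M.connection g) * ∑ k, (M.bdryNet n (M.connection g)).vertexTensor k *
        (M.bdryLinks n (M.isConnection_connection g)).weight (M.bdryNet n (M.connection g)).linkKernel k) := by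
      intro g
      rw [bdryNet_eval (M.isConnection_connection g) hb]
      exact mul_left_comm _ _ _
    simp only [h2]
    rw [integral_const_mul, integral_edgeChi]
    have h3 : ∀ i, ∏ q, ∫ g, M.faceInt n i q g ∂haarSU2 = 0 := fun i =>
      Finset.prod_eq_zero (Finset.mem_univ q) (hq i)
    simp only [h3, mul_zero, Finset.sum_const_zero]
  · have h : ∀ g, (M.bdryNet n (M.connection g)).eval = 0 := fun g => eval_eq_zero (N := M.bdryNet n (M.connection g)) hb
    simp only [h, mul_zero, integral_zero]

end Triangulation

/-! ### Approximate delta functions; continuity and gauge invariance. -/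

/-! ### Concentration of class functions at the identity -/

open Filter Topology in
/-- Powers of a function with maximum one, normalised to mass one, concentrate on the maximum. -/
theorem tendsto_integral_pow_of_max {X : Type*} [TopologicalSpace X] [CompactSpace X] [MeasurableSpace X]
    [BorelSpace X] (μ : Measure X) [IsProbabilityMeasure μ] [μ.IsOpenPosMeasure] {f : X → ℝ}
    (hf : Continuous f) (h0 : ∀ x, 0 ≤ f x) (h1 : ∀ x, f x ≤ 1) {x₀ : X} (hx₀ : f x₀ = 1) {c : ℕ → ℝ}
    (hc : ∀ N, ∫ x, c N * f x ^ N ∂μ = 1) {G : X → ℂ} (hG : Continuous G) {v : ℂ}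
    (hv : ∀ x, f x = 1 → G x = v) :
    Tendsto (fun N => ∫ x, ((c N * f x ^ N : ℝ) : ℂ) * G x ∂μ) atTop (𝓝 v) := by
  have hint : ∀ {g : X → ℝ}, Continuous g → Integrable g μ := fun hg =>
    hg.integrable_of_hasCompactSupport (HasCompactSupport.of_compactSpace _)
  have hintC : ∀ {g : X → ℂ}, Continuous g → Integrable g μ := fun hg =>
    hg.integrable_of_hasCompactSupport (HasCompactSupport.of_compactSpace _)
  have hpos : ∀ N, 0 < c N := by
    intro N
    by_contra! h
    have h2 : ∫ x, c N * f x ^ N ∂μ ≤ 0 :=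
      integral_nonpos fun x => mul_nonpos_of_nonpos_of_nonneg h (pow_nonneg (h0 x) N)
    rw [hc] at h2
    linarith
  have hcont : ∀ N, Continuous fun x => c N * f x ^ N := fun N => continuous_const.mul (hf.pow N)
  obtain ⟨B, hB⟩ : ∃ B, ∀ x, ‖G x - v‖ ≤ B := by
    obtain ⟨x, -, hx⟩ := isCompact_univ.exists_isMaxOn ⟨x₀, Set.mem_univ _⟩
      (hG.sub continuous_const).norm.continuousOn
    exact ⟨‖G x - v‖, fun y => hx (Set.mem_univ y)⟩
  have hB0 : 0 ≤ B := (norm_nonneg _).trans (hB x₀)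
  have hdiff : ∀ N, ‖(∫ x, ((c N * f x ^ N : ℝ) : ℂ) * G x ∂μ) - v‖ ≤ ∫ x, c N * f x ^ N * ‖G x - v‖ ∂μ := by
    intro N
    have e1 : ∫ x, ((c N * f x ^ N : ℝ) : ℂ) * v ∂μ = v := by
      rw [integral_mul_const, integral_complex_ofReal, hc N]
      simp
    have hcN : Continuous fun x => ((c N * f x ^ N : ℝ) : ℂ) := Complex.continuous_ofReal.comp (hcont N)
    have e2 : (∫ x, ((c N * f x ^ N : ℝ) : ℂ) * G x ∂μ) - v = ∫ x, ((c N * f x ^ N : ℝ) : ℂ) * (G x - v) ∂μ := by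
      simp only [mul_sub]
      rw [integral_sub (f := fun x => ((c N * f x ^ N : ℝ) : ℂ) * G x) (g := fun x => ((c N * f x ^ N : ℝ) : ℂ) * v)
        (hintC (hcN.mul hG)) (hintC (hcN.mul continuous_const)), e1]
    rw [e2]
    refine (norm_integral_le_integral_norm _).trans (le_of_eq (integral_congr_ae (Eventually.of_forall fun x => ?_)))
    change ‖_ * _‖ = _
    rw [norm_mul, Complex.norm_real, Real.norm_of_nonneg]
    exact mul_nonneg (hpos N).le (pow_nonneg (h0 x) N)
  -- Where `G` is within `ε` of `v`, the mass one gives the bound `ε`. On the compact rest `f` is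
  -- bounded by some `m < 1`, and there the normalised powers tend to zero uniformly.
  have key : ∀ ε > 0, ∃ a : ℕ → ℝ, Tendsto a atTop (𝓝 0) ∧ ∀ N,
      ∫ x, c N * f x ^ N * ‖G x - v‖ ∂μ ≤ ε + a N := by
    intro ε hε
    let K := {x | ε ≤ ‖G x - v‖}
    have hK : IsCompact K := (isClosed_le continuous_const (hG.sub continuous_const).norm).isCompact
    obtain ⟨m, hm0, hm1, hmK⟩ : ∃ m, 0 ≤ m ∧ m < 1 ∧ ∀ x ∈ K, f x ≤ m := by
      rcases K.eq_empty_or_nonempty with hE | hne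
      · exact ⟨0, le_rfl, one_pos, fun x hx => by simp [hE] at hx⟩
      · obtain ⟨x, hxK, hx⟩ := hK.exists_isMaxOn hne hf.continuousOn
        refine ⟨f x, h0 x, lt_of_le_of_ne (h1 x) fun h => ?_, fun y hy => hx hy⟩
        have : ε ≤ ‖G x - v‖ := hxK
        rw [hv x h, sub_self, norm_zero] at this
        linarith
    -- Any number strictly between `m` and one serves: the set where `f` exceeds `r` is open and not
    -- empty, so it has positive measure.
    let r := (1 + m) / 2
    have hr0 : 0 < r := by positivity
    have hr1 : r < 1 := by
      change (1 + m) / 2 < 1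
      linarith
    have hmr : m < r := by
      change m < (1 + m) / 2
      linarith
    let U := {x | r < f x}
    have hU : IsOpen U := isOpen_lt continuous_const hf
    have hp : 0 < μ.real U := by
      refine ENNReal.toReal_pos (hU.measure_pos μ ⟨x₀, ?_⟩).ne' (measure_ne_top _ _)
      change r < f x₀
      rwa [hx₀]
    -- The mass of `U` alone bounds the normalisation by a multiple of `r⁻¹ ^ N`, which is beaten by
    -- `m ^ N`.
    have hcle : ∀ N, c N * r ^ N * μ.real U ≤ 1 := by
      intro N
      rw [← hc N, mul_comm _ (μ.real U)]
      have e1 : ∫ x in U, c N * r ^ N ∂μ = μ.real U * (c N * r ^ N) := by simp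
      rw [← e1]
      refine (setIntegral_mono_on (integrable_const _).integrableOn (hint (hcont N)).integrableOn hU.measurableSet
        fun x hx => ?_).trans (setIntegral_le_integral (hint (hcont N)) (Eventually.of_forall fun x => ?_))
      · exact mul_le_mul_of_nonneg_left (pow_le_pow_left₀ hr0.le (le_of_lt hx) N) (hpos N).le
      · exact mul_nonneg (hpos N).le (pow_nonneg (h0 x) N)
    refine ⟨fun N => (m / r) ^ N * (B / μ.real U), ?_, fun N => ?_⟩
    · rw [← zero_mul (B / μ.real U)]
      exact (tendsto_pow_atTop_nhds_zero_of_lt_one (by positivity) ((div_lt_one hr0).mpr hmr)).mul_const _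
    · have e2 : c N * m ^ N * B ≤ (m / r) ^ N * (B / μ.real U) := by
        rw [div_pow, div_mul_div_comm, le_div_iff₀ (by positivity)]
        calc c N * m ^ N * B * (r ^ N * μ.real U) = (c N * r ^ N * μ.real U) * (m ^ N * B) := by ring
          _ ≤ 1 * (m ^ N * B) := mul_le_mul_of_nonneg_right (hcle N) (by positivity)
          _ = m ^ N * B := one_mul _
      have e3 : ∀ x, c N * f x ^ N * ‖G x - v‖ ≤ ε * (c N * f x ^ N) + (m / r) ^ N * (B / μ.real U) := by
        intro x
        have hx0 : 0 ≤ c N * f x ^ N := mul_nonneg (hpos N).le (pow_nonneg (h0 x) N)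
        by_cases hx : x ∈ K
        · have e4 : c N * f x ^ N * ‖G x - v‖ ≤ c N * m ^ N * B :=
            mul_le_mul (mul_le_mul_of_nonneg_left (pow_le_pow_left₀ (h0 x) (hmK x hx) N) (hpos N).le) (hB x)
              (norm_nonneg _) (mul_nonneg (hpos N).le (pow_nonneg hm0 N))
          have := mul_nonneg hε.le hx0
          linarith
        · have e4 : ‖G x - v‖ ≤ ε := le_of_lt (not_le.mp hx)
          have e5 := mul_le_mul_of_nonneg_left e4 hx0
          have e6 : 0 ≤ (m / r) ^ N * (B / μ.real U) := by positivity
          linarith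
      refine (integral_mono (g := fun x => ε * (c N * f x ^ N) + (m / r) ^ N * (B / μ.real U)) (hint ((hcont N).mul (hG.sub continuous_const).norm))
        (hint ((continuous_const.mul (hcont N)).add continuous_const)) e3).trans ?_
      rw [integral_add (f := fun x => ε * (c N * f x ^ N)) (hint (continuous_const.mul (hcont N))) (integrable_const _), integral_const_mul, hc N]
      simp
  rw [tendsto_iff_norm_sub_tendsto_zero]
  rw [Metric.tendsto_atTop]
  intro ε hε
  obtain ⟨a, ha, hle⟩ := key (ε / 2) (half_pos hε)
  obtain ⟨N₀, hN⟩ := Metric.tendsto_atTop.mp ha (ε / 2) (half_pos hε)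
  refine ⟨N₀, fun N hN' => ?_⟩
  have h2 := hN N hN'
  rw [Real.dist_eq, sub_zero] at h2 ⊢
  rw [abs_of_nonneg (norm_nonneg _)]
  have := (hdiff N).trans (hle N)
  have := le_abs_self (a N)
  linarith

namespace SU2

theorem coe_inv (g : SU2) : (g⁻¹).1 = star g.1 := rfl

theorem trace_inv (g : SU2) : (g⁻¹).1.trace = g.1.trace := by
  have e2 : (g⁻¹).1 = epsInv * g.1.transpose * epsMat := by
    rw [Matrix.mul_assoc, ← SU2.eps_mul_inv, ← Matrix.mul_assoc, epsInv_mul_epsMat, Matrix.one_mul]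
  rw [e2, Matrix.trace_mul_comm, ← Matrix.mul_assoc, epsMat_mul_epsInv, Matrix.one_mul, Matrix.trace_transpose]

theorem trace_re (g : SU2) : ((g.1.trace.re : ℝ) : ℂ) = g.1.trace := by
  have h := g.trace_inv
  rw [coe_inv, Matrix.star_eq_conjTranspose, Matrix.trace_conjTranspose] at h
  exact Complex.conj_eq_iff_re.mp h

theorem norm_entry_le (g : SU2) (i j : Fin 2) : ‖g.1 i j‖ ≤ 1 :=
  entry_norm_bound_of_unitary (Matrix.specialUnitaryGroup_le_unitaryGroup g.2) i j

/-- A function on the group with values in the unit interval, which is one at the identity only. -/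
def peak (g : SU2) : ℝ := (2 + g.1.trace.re) / 4

theorem continuous_peak : Continuous peak :=
  (continuous_const.add (Complex.continuous_re.comp SU2.continuous_trace)).div_const _

theorem peak_nonneg (g : SU2) : 0 ≤ g.peak := by
  have h0 := (Complex.abs_re_le_norm _).trans (g.norm_entry_le 0 0)
  have h1 := (Complex.abs_re_le_norm _).trans (g.norm_entry_le 1 1)
  rw [abs_le] at h0 h1
  rw [peak, Matrix.trace_fin_two, Complex.add_re]
  linarith

theorem peak_le_one (g : SU2) : g.peak ≤ 1 := by
  have h0 := (Complex.abs_re_le_norm _).trans (g.norm_entry_le 0 0)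
  have h1 := (Complex.abs_re_le_norm _).trans (g.norm_entry_le 1 1)
  rw [abs_le] at h0 h1
  rw [peak, Matrix.trace_fin_two, Complex.add_re]
  linarith

theorem peak_one : peak 1 = 1 := by
  simp [peak]
  norm_num

/-- The diagonal entries have modulus at most one, so both real parts must be one. The rows being
unit vectors, the imaginary parts and the other entries vanish. -/
theorem eq_one_of_peak {g : SU2} (h : g.peak = 1) : g = 1 := by
  have h0 := g.norm_entry_le 0 0
  have h1 := g.norm_entry_le 1 1
  have h0' := Complex.re_le_norm (g.1 0 0)
  have h1' := Complex.re_le_norm (g.1 1 1)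
  rw [peak, Matrix.trace_fin_two, Complex.add_re] at h
  have hu : g.1 * star g.1 = 1 := (Matrix.mem_unitaryGroup_iff).mp (Matrix.specialUnitaryGroup_le_unitaryGroup g.2)
  have aux : ∀ i j : Fin 2, i ≠ j → (g.1 i i).re = 1 → g.1 i i = 1 ∧ g.1 i j = 0 := by
    intro i j hij hi
    have h2 := congrFun (congrFun hu i) i
    rw [Matrix.mul_apply, Matrix.star_eq_conjTranspose] at h2
    have h3 : Complex.normSq (g.1 i i) + Complex.normSq (g.1 i j) = 1 := by
      have h4 : ∑ k, g.1 i k * (g.1.conjTranspose) k i = ∑ k, ((Complex.normSq (g.1 i k) : ℝ) : ℂ) :=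
        Finset.sum_congr rfl fun k _ => Complex.mul_conj _
      rw [h4, Matrix.one_apply_eq, ← Complex.ofReal_sum] at h2
      have h5 : ∑ k, Complex.normSq (g.1 i k) = 1 := by exact_mod_cast h2
      rw [← h5, Fin.sum_univ_two]
      fin_cases i <;> fin_cases j <;> first | exact (hij rfl).elim | rfl | exact add_comm _ _
    have h6 := Complex.normSq_nonneg (g.1 i j)
    have h7 := Complex.normSq_apply (g.1 i i)
    rw [hi] at h7
    have h8 : (g.1 i i).im = 0 := by nlinarith [sq_nonneg (g.1 i i).im]
    refine ⟨Complex.ext hi h8, Complex.normSq_eq_zero.mp ?_⟩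
    rw [h8] at h7
    linarith
  have a0 := aux 0 1 (by decide) (by linarith)
  have a1 := aux 1 0 (by decide) (by linarith)
  refine Subtype.ext (Matrix.ext fun i j => ?_)
  fin_cases i <;> fin_cases j
  · exact a0.1
  · exact a0.2
  · exact a1.2
  · exact a1.1

theorem peak_eq (g : SU2) : ((g.peak : ℝ) : ℂ) = (2 + g.1.trace) / 4 := by
  rw [peak]
  push_cast
  rw [g.trace_re]

theorem peak_inv (g : SU2) : (g⁻¹).peak = g.peak := by rw [peak, peak, trace_inv]

theorem peak_conj (u g : SU2) : (u⁻¹ * g * u).peak = g.peak := by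
  have h : (u⁻¹ * g * u).1.trace = g.1.trace := by
    change ((u⁻¹).1 * g.1 * u.1).trace = _
    rw [Matrix.trace_mul_comm, ← Matrix.mul_assoc, SU2.coe_mul_inv, Matrix.one_mul]
  rw [peak, peak, h]

/-- The powers of `peak` are combinations of characters. -/
theorem peak_pow_eq_sum (N : ℕ) : ∃ a : ℕ → ℂ, (∀ n, N < n → a n = 0) ∧
    ∀ g : SU2, ((g.peak ^ N : ℝ) : ℂ) = ∑ n ∈ Finset.range (N + 1), a n * chi n g.1 := by
  induction N with
  | zero => exact ⟨fun n => if n = 0 then 1 else 0, fun n hn => if_neg (by omega), fun g => by simp [chi_zero]⟩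
  | succ N ih =>
    obtain ⟨a, ha, h⟩ := ih
    -- Multiplication by `(2 + tr) / 4` acts on the coefficients through the Clebsch–Gordan rule;
    -- the missing neighbour of the trivial character counts as zero.
    refine ⟨fun n => (2 * a n + (if n = 0 then 0 else a (n - 1)) + a (n + 1)) / 4, fun n hn => ?_, fun g => ?_⟩
    · simp only [ha n (by omega), ha (n + 1) (by omega), ha (n - 1) (by omega)]
      simp
    · have e0 : ∀ n, g.1.trace * chi n g.1 = chi (n + 1) g.1 + (if n = 0 then 0 else chi (n - 1) g.1) := by
        intro n
        cases n with
        | zero => rw [chi_zero, mul_one, ← chi_one, if_pos rfl, add_zero]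
        | succ n => rw [trace_mul_chi, if_neg (Nat.succ_ne_zero n), Nat.add_sub_cancel]
      have e1 : ∑ n ∈ Finset.range (N + 1 + 1), a n * chi n g.1 = ∑ n ∈ Finset.range (N + 1), a n * chi n g.1 := by
        rw [Finset.sum_range_succ, ha (N + 1) (by omega), zero_mul, add_zero]
      have e2 : ∑ n ∈ Finset.range (N + 1 + 1), (if n = 0 then 0 else a (n - 1)) * chi n g.1 =
          ∑ n ∈ Finset.range (N + 1), a n * chi (n + 1) g.1 := by
        rw [Finset.sum_range_succ']
        simp
      have e3 : ∑ n ∈ Finset.range (N + 1), a n * (if n = 0 then 0 else chi (n - 1) g.1) =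
          ∑ n ∈ Finset.range (N + 1 + 1), a (n + 1) * chi n g.1 := by
        rw [Finset.sum_range_succ', Finset.sum_range_succ, Finset.sum_range_succ, ha (N + 1) (by omega),
          ha (N + 1 + 1) (by omega)]
        simp
      have e4 : ∑ n ∈ Finset.range (N + 1 + 1), (2 * a n + (if n = 0 then 0 else a (n - 1)) + a (n + 1)) / 4 * chi n g.1 =
          (2 * ∑ n ∈ Finset.range (N + 1 + 1), a n * chi n g.1 +
            ∑ n ∈ Finset.range (N + 1 + 1), (if n = 0 then 0 else a (n - 1)) * chi n g.1 +
            ∑ n ∈ Finset.range (N + 1 + 1), a (n + 1) * chi n g.1) / 4 := by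
        rw [Finset.mul_sum, ← Finset.sum_add_distrib, ← Finset.sum_add_distrib, Finset.sum_div]
        exact Finset.sum_congr rfl fun n _ => by ring
      rw [e4, e1, e2, ← e3, pow_succ]
      push_cast
      rw [g.peak_eq]
      have h' := h g
      push_cast at h'
      rw [g.peak_eq] at h'
      rw [h']
      have e5 : g.1.trace * ∑ n ∈ Finset.range (N + 1), a n * chi n g.1 =
          ∑ n ∈ Finset.range (N + 1), a n * chi (n + 1) g.1 +
            ∑ n ∈ Finset.range (N + 1), a n * (if n = 0 then 0 else chi (n - 1) g.1) := by
        rw [Finset.mul_sum, ← Finset.sum_add_distrib]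
        refine Finset.sum_congr rfl fun n _ => ?_
        rw [mul_left_comm, e0, mul_add]
      linear_combination e5 / 4

theorem integral_peak_pow_pos (N : ℕ) : 0 < ∫ g : SU2, g.peak ^ N ∂haarSU2 := by
  refine (continuous_peak.pow N).integral_pos_of_hasCompactSupport_nonneg_nonzero (HasCompactSupport.of_compactSpace _)
    (fun g => pow_nonneg g.peak_nonneg N) (x := 1) ?_
  rw [peak_one, one_pow]
  exact one_ne_zero

/-- The normalised powers of `peak`: an approximation to the delta function. -/
def delta (N : ℕ) (g : SU2) : ℝ := (∫ g : SU2, g.peak ^ N ∂haarSU2)⁻¹ * g.peak ^ N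

/-- The coefficients of the approximate delta functions. -/
theorem exists_delta_coeff : ∃ b : ℕ → ℕ → ℂ, (∀ N n, N < n → b N n = 0) ∧ (∀ N, b N 0 = 1) ∧
    (∀ N g, ((delta N g : ℝ) : ℂ) = ∑ n ∈ Finset.range (N + 1), b N n * chi n g.1) ∧
    ∀ n, Filter.Tendsto (fun N => b N n) Filter.atTop (nhds ((n : ℂ) + 1)) := by
  choose a ha hsum using peak_pow_eq_sum
  let I : ℕ → ℝ := fun N => ∫ g : SU2, g.peak ^ N ∂haarSU2
  have hsum' : ∀ N g, ((delta N g : ℝ) : ℂ) = ∑ n ∈ Finset.range (N + 1), (((I N)⁻¹ : ℝ) : ℂ) * a N n * chi n g.1 := by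
    intro N g
    rw [delta, Complex.ofReal_mul, hsum, Finset.mul_sum]
    exact Finset.sum_congr rfl fun n _ => (mul_assoc _ _ _).symm
  have hmass : ∀ N, ∫ g : SU2, (I N)⁻¹ * g.peak ^ N ∂haarSU2 = 1 := fun N => by
    rw [integral_const_mul]
    exact inv_mul_cancel₀ (integral_peak_pow_pos N).ne'
  -- Orthogonality recovers the coefficients as integrals against characters. For `n = 0` this is
  -- the total mass, and for all `n` it allows the passage to the limit.
  have hcoef : ∀ N n, ∫ g : SU2, (((I N)⁻¹ * g.peak ^ N : ℝ) : ℂ) * chi n g.1 ∂haarSU2 = (((I N)⁻¹ : ℝ) : ℂ) * a N n := by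
    intro N n
    have h1 : ∀ g : SU2, (((I N)⁻¹ * g.peak ^ N : ℝ) : ℂ) * chi n g.1 =
        ∑ m ∈ Finset.range (N + 1), ((((I N)⁻¹ : ℝ) : ℂ) * a N m) * (chi m g.1 * chi n g.1) := by
      intro g
      rw [show (((I N)⁻¹ * g.peak ^ N : ℝ) : ℂ) = _ from hsum' N g, Finset.sum_mul]
      exact Finset.sum_congr rfl fun m _ => mul_assoc _ _ _
    simp only [h1]
    rw [integral_finsetSum _ fun m _ => Integrable.const_mul (f := fun g : SU2 => chi m g.1 * chi n g.1)
      (integrable_of_continuous ((continuous_chi m).mul (continuous_chi n))) _]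
    simp only [integral_const_mul, integral_chi_mul_chi]
    by_cases hn : n ∈ Finset.range (N + 1)
    · rw [Finset.sum_eq_single n]
      · simp
      · intro m _ hm
        simp [hm]
      · exact fun h => (h hn).elim
    · rw [ha N n (by simpa [Nat.lt_succ_iff] using hn), mul_zero]
      refine Finset.sum_eq_zero fun m hm => ?_
      rw [if_neg, mul_zero]
      rintro rfl
      exact hn hm
  refine ⟨fun N n => (((I N)⁻¹ : ℝ) : ℂ) * a N n, fun N n h => ?_, fun N => ?_, hsum', fun n => ?_⟩
  · simp only [ha N n h, mul_zero]
  · change (((I N)⁻¹ : ℝ) : ℂ) * a N 0 = 1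
    rw [← hcoef]
    simp only [chi_zero, mul_one]
    rw [integral_complex_ofReal, hmass, Complex.ofReal_one]
  -- By concentration at the identity the coefficients tend to the value of the character there, the
  -- dimension of the representation.
  · have h1 : chi n (1 : SU2).1 = (n : ℂ) + 1 := by
      have h2 : ((1 : SU2).1 : Matrix (Fin 2) (Fin 2) ℂ) = Matrix.diagonal ![1, 1] := by
        ext i j
        fin_cases i <;> fin_cases j <;> simp
      rw [h2, chi_diagonal]
      simp
    rw [← h1]
    simp only [← hcoef]
    refine tendsto_integral_pow_of_max haarSU2 continuous_peak peak_nonneg peak_le_one peak_one hmass (continuous_chi n) ?_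
    intro g hg
    rw [eq_one_of_peak hg]

end SU2

/-! ### Continuity and gauge invariance -/

namespace SpinNetwork

variable {D : Type*}

/-- The network with other group elements on the links. -/
def withHol (N : SpinNetwork D) (η : D → SU2) : SpinNetwork D := ⟨N.rot, N.opp, N.label, N.label_opp, η⟩

/-- The loops do not depend on the group elements, so the evaluation is a finite sum of products of
traces of words in them. -/
theorem continuous_eval_withHol [Fintype D] (N : SpinNetwork D) : Continuous fun η : D → SU2 => (N.withHol η).eval := by
  classical
  by_cases h : N.AllAdmissible
  · have h1 : ∀ η : D → SU2, (N.withHol η).eval = ∑ τ : (∀ d, Equiv.Perm (Fin (N.label d))),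
        (∏ d, ((Equiv.Perm.sign (τ d) : ℤ) : ℂ) / (N.label d).factorial) *
          ∏ᶠ l : N.Loop τ, -((N.withHol η).loopHol τ (Quot.out l)).1.trace := fun η => if_pos h
    refine Continuous.congr ?_ fun η => (h1 η).symm
    refine continuous_finsetSum _ fun τ _ => Continuous.mul continuous_const ?_
    have : Finite (N.Loop τ) := Quot.finite _
    have : Fintype (N.Loop τ) := Fintype.ofFinite _
    have h2 : ∀ η : D → SU2, ∏ᶠ l : (N.withHol η).Loop τ, -((N.withHol η).loopHol τ (Quot.out l)).1.trace =
        ∏ l : N.Loop τ, -((N.withHol η).loopHol τ (Quot.out l)).1.trace := fun η =>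
      finprod_eq_prod_of_fintype fun l : N.Loop τ => -((N.withHol η).loopHol τ (Quot.out l)).1.trace
    refine Continuous.congr ?_ fun η => (h2 η).symm
    refine continuous_finsetProd _ fun l _ => (SU2.continuous_trace.comp ?_).neg
    exact continuous_list_prod (M := SU2) (f := fun (i : ℕ) (η : D → SU2) => η (N.atVertex
      ((fun r => N.alongLink τ (N.atVertex r))^[i] (Quot.out l))).1)
      (List.range (Function.minimalPeriod (fun r => N.alongLink τ (N.atVertex r)) (Quot.out l)))
      fun i _ => continuous_apply _
  · have h1 : ∀ η : D → SU2, (N.withHol η).eval = 0 := fun η => if_neg h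
    simp only [h1]
    exact continuous_const

theorem atVertex_cases (N : SpinNetwork D) (s : N.Strand) :
    (N.atVertex s).1 = N.rot (N.rot s.1) ∨ (N.atVertex s).1 = N.rot s.1 ∨ (N.atVertex s).1 = s.1 := by
  unfold atVertex
  dsimp only
  split_ifs <;> simp

/-- Gauge transformations of the group elements do not change the evaluation. -/
theorem eval_gauge [Fintype D] (N : SpinNetwork D) {η η' : D → SU2} (κ : D → SU2)
    (hκ : ∀ d, κ (N.rot d) = κ d) (h : ∀ d, η' d = (κ d)⁻¹ * η d * κ (N.opp d)) :
    (N.withHol η').eval = (N.withHol η).eval := by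
  classical
  by_cases ha : N.AllAdmissible
  · have h1 : ∀ η : D → SU2, (N.withHol η).eval = ∑ τ : (∀ d, Equiv.Perm (Fin (N.label d))),
        (∏ d, ((Equiv.Perm.sign (τ d) : ℤ) : ℂ) / (N.label d).factorial) *
          ∏ᶠ l : N.Loop τ, -((N.withHol η).loopHol τ (Quot.out l)).1.trace := fun η => if_pos ha
    rw [h1, h1]
    refine Finset.sum_congr rfl fun τ _ => congrArg _ ?_
    refine finprod_congr fun l => ?_
    have h2 : ∀ s : N.Strand, κ (N.atVertex s).1 = κ s.1 := fun s => by
      rcases N.atVertex_cases s with h | h | h <;> rw [h] <;> simp only [hκ]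
    let step := fun r => N.alongLink τ (N.atVertex r)
    -- The gauge transformation is constant at each vertex and telescopes along a strand. On a
    -- closed loop a conjugation remains, which the trace ignores.
    have h3 : ∀ (s : N.Strand) (m : ℕ), ((List.range m).map fun i => η' (N.atVertex (step^[i] s)).1).prod =
        (κ s.1)⁻¹ * ((List.range m).map fun i => η (N.atVertex (step^[i] s)).1).prod * κ (step^[m] s).1 := by
      intro s m
      induction m with
      | zero => simp
      | succ m ih =>
        rw [List.range_succ, List.map_append, List.map_append, List.prod_append, List.prod_append, ih,
          Function.iterate_succ_apply']
        simp only [List.map_cons, List.map_nil, List.prod_singleton]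
        have h4 : (step (step^[m] s)).1 = N.opp (N.atVertex (step^[m] s)).1 := rfl
        rw [h, h2, h4]
        group
    have h5 := h3 (Quot.out l) (Function.minimalPeriod step (Quot.out l))
    rw [Function.iterate_minimalPeriod] at h5
    have h6 : (N.withHol η').loopHol τ (Quot.out l) = (κ (Quot.out l).1)⁻¹ *
      (N.withHol η).loopHol τ (Quot.out l) * κ (Quot.out l).1 := h5
    change -((N.withHol η').loopHol τ (Quot.out l)).1.trace = -((N.withHol η).loopHol τ (Quot.out l)).1.trace
    rw [h6]
    change -(((κ (Quot.out l).1)⁻¹).1 * ((N.withHol η).loopHol τ (Quot.out l)).1 * (κ (Quot.out l).1).1).trace = _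
    rw [Matrix.trace_mul_comm, ← Matrix.mul_assoc, SU2.coe_mul_inv, Matrix.one_mul]
  · have h1 : ∀ η : D → SU2, (N.withHol η).eval = 0 := fun η => if_neg ha
    rw [h1, h1]

end SpinNetwork

namespace Triangulation

variable {T : Type*} {M : Triangulation T}

variable (M) in
/-- The evaluation of the boundary network with given labels, as a function of a connection. -/
def bdryEval [Fintype T] (k : M.BdryEdge → ℕ) (c : T → Fin 4 → SU2) : ℂ :=
  SpinNetwork.eval (D := M.BdryDart)
    { rot := fun x => ⟨rotFlag x.1, x.2⟩
      opp := fun x => ⟨M.opp x.1, M.onBoundary_opp x.2⟩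
      label := fun x => k ⟨M.edge x.1, x.1, x.2, rfl⟩
      label_opp := fun x => congrArg k (Subtype.ext (M.edge_opp x.1))
      hol := fun x => M.turnHol c x.1 (M.turnSteps x.1) }

theorem bdryNet_eval_eq [Fintype T] {n : M.Edge → ℕ} {k : M.BdryEdge → ℕ} (h : ∀ e : M.BdryEdge, n e.1 = k e)
    (c : T → Fin 4 → SU2) : (M.bdryNet n c).eval = M.bdryEval k c := by
  obtain rfl : (fun e : M.BdryEdge => n e.1) = k := funext h
  rfl

theorem continuous_turnHol (x : TetFlag T) (m : ℕ) : Continuous fun c : T → Fin 4 → SU2 => M.turnHol c x m :=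
  continuous_list_prod (M := SU2) (f := fun (i : ℕ) (c : T → Fin 4 → SU2) => c (M.turn^[i] x).1 (M.turn^[i] x).2.1.2)
    _ fun _ _ => (continuous_apply _).comp (continuous_apply _)

theorem continuous_bdryEval [Fintype T] (k : M.BdryEdge → ℕ) : Continuous (M.bdryEval k) :=
  (SpinNetwork.continuous_eval_withHol (D := M.BdryDart)
    { rot := fun x => ⟨rotFlag x.1, x.2⟩
      opp := fun x => ⟨M.opp x.1, M.onBoundary_opp x.2⟩
      label := fun x => k ⟨M.edge x.1, x.1, x.2, rfl⟩
      label_opp := fun x => congrArg k (Subtype.ext (M.edge_opp x.1))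
      hol := fun _ => 1 }).comp (continuous_pi fun x => continuous_turnHol x.1 (M.turnSteps x.1))

variable (M) in
/-- The connection `c'` arises from `c` by a gauge transformation. -/
def Gauge {G : Type*} [Group G] (h : T → G) (c c' : T → Fin 4 → G) : Prop :=
  ∀ x : TetFlag T, c' x.1 x.2.1.2 = (h x.1)⁻¹ * c x.1 x.2.1.2 * h (M.turn x).1

theorem Gauge.turnHol {G : Type*} [Group G] {h : T → G} {c c' : T → Fin 4 → G} (hg : M.Gauge h c c')
    (x : TetFlag T) (m : ℕ) : M.turnHol c' x m = (h x.1)⁻¹ * M.turnHol c x m * h (M.turn^[m] x).1 := by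
  induction m with
  | zero => simp [Triangulation.turnHol]
  | succ m ih =>
    rw [turnHol_succ, turnHol_succ, ih, hg, Function.iterate_succ_apply']
    group

theorem Gauge.bdryEval [Fintype T] {h : T → SU2} {c c' : T → Fin 4 → SU2} (hg : M.Gauge h c c')
    (k : M.BdryEdge → ℕ) : M.bdryEval k c' = M.bdryEval k c :=
  SpinNetwork.eval_gauge (D := M.BdryDart)
    { rot := fun x => ⟨rotFlag x.1, x.2⟩
      opp := fun x => ⟨M.opp x.1, M.onBoundary_opp x.2⟩
      label := fun x => k ⟨M.edge x.1, x.1, x.2, rfl⟩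
      label_opp := fun x => congrArg k (Subtype.ext (M.edge_opp x.1))
      hol := fun _ => 1 } (fun x => h x.1.1) (fun _ => rfl) fun x => hg.turnHol x.1 (M.turnSteps x.1)

/-- The holonomy of the rotation about an edge, beginning at a flag. -/
def flagHol (M : Triangulation T) {G : Type*} [Group G] (c : T → Fin 4 → G) (x : TetFlag T) : G :=
  M.turnHol c x (Function.minimalPeriod M.turn x)

theorem Gauge.flagHol {G : Type*} [Group G] {h : T → G} {c c' : T → Fin 4 → G} (hg : M.Gauge h c c')
    (x : TetFlag T) : M.flagHol c' x = (h x.1)⁻¹ * M.flagHol c x * h x.1 := by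
  rw [Triangulation.flagHol, hg.turnHol, Function.iterate_minimalPeriod, Triangulation.flagHol]

theorem turn_iterate_swap (x : TetFlag T) (m : ℕ) : M.turn^[m] (swap (M.turn^[m] x)) = swap x := by
  induction m with
  | zero => rfl
  | succ m ih =>
    rw [Function.iterate_succ_apply, Function.iterate_succ_apply']
    have h : M.turn (swap (M.turn (M.turn^[m] x))) = swap (M.turn^[m] x) := M.cross_cross _
    rw [h, ih]

theorem isPeriodicPt_swap {x : TetFlag T} {m : ℕ} (h : Function.IsPeriodicPt M.turn m x) :
    Function.IsPeriodicPt M.turn m (swap x) := by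
  have h1 := M.turn_iterate_swap x m
  rw [h.eq] at h1
  exact h1

theorem minimalPeriod_swap (x : TetFlag T) :
    Function.minimalPeriod M.turn (swap x) = Function.minimalPeriod M.turn x := by
  refine Nat.dvd_antisymm ?_ ?_
  · exact (isPeriodicPt_swap (Function.isPeriodicPt_minimalPeriod _ _)).minimalPeriod_dvd
  · have h := isPeriodicPt_swap (Function.isPeriodicPt_minimalPeriod M.turn (swap x))
    exact h.minimalPeriod_dvd

theorem IsConnection.turnHol_swap {G : Type*} [Group G] {c : T → Fin 4 → G} (hc : M.IsConnection c)
    (x : TetFlag T) (m : ℕ) : M.turnHol c (swap (M.turn^[m] x)) m = (M.turnHol c x m)⁻¹ := by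
  induction m with
  | zero => simp [Triangulation.turnHol]
  | succ m ih =>
    rw [turnHol_succ', Function.iterate_succ_apply']
    have h : M.turn (swap (M.turn (M.turn^[m] x))) = swap (M.turn^[m] x) := M.cross_cross _
    have h2 := hc.cross (swap (M.turn^[m] x))
    rw [h, ih, turnHol_succ, mul_inv_rev]
    congr 1

theorem IsConnection.flagHol_swap {G : Type*} [Group G] {c : T → Fin 4 → G} (hc : M.IsConnection c)
    (x : TetFlag T) : M.flagHol c (swap x) = (M.flagHol c x)⁻¹ := by
  have h := hc.turnHol_swap x (Function.minimalPeriod M.turn x)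
  rw [Function.iterate_minimalPeriod] at h
  rw [flagHol, minimalPeriod_swap, h, flagHol]

/-- Starting the rotation one step later conjugates the holonomy by the first transport. -/
theorem flagHol_turn [Finite T] {G : Type*} [Group G] (c : T → Fin 4 → G) (x : TetFlag T) :
    M.flagHol c (M.turn x) = (c x.1 x.2.1.2)⁻¹ * M.flagHol c x * c x.1 x.2.1.2 := by
  have h1 : Function.minimalPeriod M.turn (M.turn x) = Function.minimalPeriod M.turn x :=
    Function.minimalPeriod_apply (M.turn_injective.mem_periodicPts x)
  have h2 := M.turnHol_succ (c := c) x (Function.minimalPeriod M.turn x)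
  rw [turnHol_succ', Function.iterate_minimalPeriod] at h2
  rw [flagHol, h1, flagHol, mul_assoc, ← h2]
  group

/-- The conjugacy class of the holonomy about an interior edge does not depend on the initial flag. -/
theorem IsConnection.peak_flagHol [Finite T] {c : T → Fin 4 → SU2} (hc : M.IsConnection c) {x y : TetFlag T}
    (hx : ¬ ∃ z, M.OnBoundary z ∧ M.edge z = M.edge x) (h : M.edge x = M.edge y) :
    (M.flagHol c x).peak = (M.flagHol c y).peak := by
  have hsw : ∀ z, (M.flagHol c (swap z)).peak = (M.flagHol c z).peak := fun z => by
    rw [hc.flagHol_swap, SU2.peak_inv]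
  have key := M.edgeLoops.ind (fun z => M.edge z = M.edge x ∧ (M.flagHol c z).peak = (M.flagHol c x).peak)
    (fun z hz => ⟨(M.edge_swap z).trans hz.1, (hsw z).trans hz.2⟩)
    (fun z hz => by
      refine ⟨(M.edge_pass z).trans hz.1, ?_⟩
      have h1 : M.edgeLoops.b z = M.turn (swap z) := M.pass_of_not fun hb => hx ⟨z, hb, hz.1⟩
      rw [h1, flagHol_turn, SU2.peak_conj, hsw, hz.2]) x y h ⟨rfl, rfl⟩
  exact key.2.symm

theorem continuous_connection : Continuous fun g : M.InnerFace → SU2 => M.connection g := by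
  refine continuous_pi fun t => continuous_pi fun f => ?_
  unfold connection
  rcases (M.faceEquiv.symm (sideFlag (t, f) 0)).1 with ⟨q, _ | _⟩ | b
  · exact (continuous_apply q).inv
  · exact continuous_apply q
  · exact continuous_const

end Triangulation

/-! ### The state sum as a limit, and the total mass. -/

/-! ### The state sum as a limit of integrals -/

/-- There are no strands: one family of permutations and an empty product of loops. With zero
boundary spins the integrals below thus become total masses. -/
theorem SpinNetwork.eval_of_label_eq_zero {D : Type*} [Fintype D] (N : SpinNetwork D) (h : ∀ d, N.label d = 0) :
    N.eval = 1 := by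
  classical
  have hi : ∀ d, Fin (N.label d) → False := fun d i =>
    (Fin.cast (h d) i).elim0
  have ha : ∀ d, Admissible (N.label d) (N.label (N.rot d)) (N.label (N.rot (N.rot d))) := fun d => by
    simp [h, Admissible]
  let τ : ∀ d, Equiv.Perm (Fin (N.label d)) := fun _ => 1
  have h1 : ∀ l : N.Loop τ, -(N.loopHol τ (Quot.out l)).1.trace = 1 := fun l => (hi _ (Quot.out l).2).elim
  refine (if_pos ha).trans ((Finset.sum_eq_single_of_mem τ ?_ fun τ' _ h' =>
    (h' (funext fun d => Equiv.ext fun i => (hi d i).elim)).elim).trans ?_)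
  · exact Finset.mem_univ _
  exact (congrArg₂ (· * ·) (Finset.prod_eq_one fun d _ => by simp [h, τ])
    (finprod_eq_one_of_forall_eq_one h1)).trans (mul_one 1)

namespace Triangulation

variable {T : Type*} {M : Triangulation T}

open Classical in
variable (M) in
/-- The product of the peaked class functions of the holonomies about the interior edges. -/
def edgeDelta [Finite T] (N : M.Edge → ℕ) (c : T → Fin 4 → SU2) : ℝ :=
  ∏ e : M.Edge, if ∃ y, M.OnBoundary y ∧ M.edge y = e then 1 else SU2.delta (N e) (M.edgeHol c e)

theorem continuous_edgeHol (e : M.Edge) : Continuous fun c : T → Fin 4 → SU2 => M.edgeHol c e :=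
  continuous_turnHol _ _

theorem continuous_edgeChi [Finite T] (n : M.Edge → ℕ) : Continuous (M.edgeChi n) := by
  classical
  refine continuous_finsetProd _ fun e _ => ?_
  split_ifs
  · exact continuous_const
  · exact (continuous_chi _).comp (continuous_edgeHol e)

open Classical in
variable (M) in
/-- The product of coefficients over the interior edges. -/
def innerProd [Finite T] (a : M.Edge → ℂ) : ℂ :=
  ∏ e : M.Edge, if ∃ y, M.OnBoundary y ∧ M.edge y = e then 1 else a e

variable (M) in
/-- The contribution of a labelling to the integral of class functions about the interior edges. -/
def edgeCoeff [Fintype T] (k : M.BdryEdge → ℕ) (n : M.Edge → ℕ) : ℂ :=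
  ∫ g, M.edgeChi n (M.connection g) * M.bdryEval k (M.connection g) ∂M.haarFaces

theorem edgeDelta_eq_sum [Finite T] {b : ℕ → ℕ → ℂ}
    (hb : ∀ N g, (SU2.delta N g : ℂ) = ∑ n ∈ Finset.range (N + 1), b N n * chi n g.1)
    (k : M.BdryEdge → ℕ) (N : M.Edge → ℕ) (c : T → Fin 4 → SU2) :
    open Classical in (M.edgeDelta N c : ℂ) =
      ∑ n ∈ Fintype.piFinset fun e : M.Edge => if h : ∃ y, M.OnBoundary y ∧ M.edge y = e then {k ⟨e, h⟩}
        else Finset.range (N e + 1), M.innerProd (fun e => b (N e) (n e)) * M.edgeChi n c := by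
  classical
  have h1 : ∀ e : M.Edge, (((if ∃ y, M.OnBoundary y ∧ M.edge y = e then 1
      else SU2.delta (N e) (M.edgeHol c e) : ℝ)) : ℂ) =
      ∑ m ∈ (if h : ∃ y, M.OnBoundary y ∧ M.edge y = e then {k ⟨e, h⟩} else Finset.range (N e + 1)),
        (if ∃ y, M.OnBoundary y ∧ M.edge y = e then 1 else b (N e) m) *
          (if ∃ y, M.OnBoundary y ∧ M.edge y = e then 1 else chi m (M.edgeHol c e).1) := by
    intro e
    by_cases he : ∃ y, M.OnBoundary y ∧ M.edge y = e
    · simp only [if_pos he, dif_pos he, Finset.sum_singleton, Complex.ofReal_one, mul_one]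
    · simp only [if_neg he, dif_neg he, hb]
  rw [edgeDelta, Complex.ofReal_prod, Finset.prod_congr rfl fun e _ => h1 e, Finset.prod_univ_sum]
  refine Finset.sum_congr rfl fun n _ => ?_
  rw [Finset.prod_mul_distrib]
  rfl

/-- The expansion into characters runs over a box which grows with `N`, but it may be replaced by
the fixed finite set of admissible extensions: other labellings in the box integrate to zero by
`integral_eq_zero`, and extensions outside the box have a vanishing coefficient. -/
theorem integral_edgeDelta [Fintype T] {b : ℕ → ℕ → ℂ} (hb0 : ∀ N n, N < n → b N n = 0)
    (hb : ∀ N g, (SU2.delta N g : ℂ) = ∑ n ∈ Finset.range (N + 1), b N n * chi n g.1)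
    {k : M.BdryEdge → ℕ} (hk : (M.Extensions k).Finite) (N : M.Edge → ℕ) :
    ∫ g, (M.edgeDelta N (M.connection g) : ℂ) * M.bdryEval k (M.connection g) ∂M.haarFaces =
      ∑ n ∈ hk.toFinset, M.innerProd (fun e => b (N e) (n e)) * M.edgeCoeff k n := by
  classical
  simp only [edgeDelta_eq_sum hb k N, Finset.sum_mul, mul_assoc]
  have hint : ∀ n, Integrable (fun g => M.edgeChi n (M.connection g) * M.bdryEval k (M.connection g))
      M.haarFaces := fun n =>
    (((continuous_edgeChi n).comp continuous_connection).mul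
      ((continuous_bdryEval k).comp continuous_connection)).integrable_of_hasCompactSupport
        (HasCompactSupport.of_compactSpace _)
  rw [integral_finsetSum _ fun n _ => Integrable.const_mul (hint n) _]
  simp only [integral_const_mul]
  refine Finset.sum_congr_of_eq_on_inter ?_ ?_ fun _ _ _ => rfl
  · intro n hn hn'
    rw [Set.Finite.mem_toFinset] at hn'
    rw [Fintype.mem_piFinset] at hn
    have h1 : ∀ e : M.BdryEdge, n e.1 = k e := fun e => by
      have := hn e.1
      rwa [dif_pos e.2, Finset.mem_singleton] at this
    have h2 : ¬ M.AdmissibleLabelling n := fun h => hn' ⟨h, h1⟩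
    have h3 := integral_eq_zero h2
    simp only [bdryNet_eval_eq h1] at h3
    rw [h3, mul_zero]
  · intro n hn hn'
    rw [Set.Finite.mem_toFinset] at hn
    rw [Fintype.mem_piFinset] at hn'
    push Not at hn'
    obtain ⟨e, he⟩ := hn'
    by_cases hb' : ∃ y, M.OnBoundary y ∧ M.edge y = e
    · rw [dif_pos hb', Finset.mem_singleton] at he
      exact absurd (hn.2 ⟨e, hb'⟩) he
    · rw [dif_neg hb', Finset.mem_range] at he
      have h4 : M.innerProd (fun e => b (N e) (n e)) = 0 :=
        Finset.prod_eq_zero (Finset.mem_univ e) ((if_neg hb').trans (hb0 _ _ (by omega)))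
      rw [h4, zero_mul]

theorem edgeSign_mul_self [Finite T] (n : M.Edge → ℕ) : M.edgeSign n * M.edgeSign n = 1 := by
  classical
  rw [edgeSign, ← Finset.prod_mul_distrib]
  refine Finset.prod_eq_one fun e _ => ?_
  split_ifs
  · exact mul_one 1
  · rw [← mul_pow]; simp

theorem finprod_inner [Finite T] (a : M.Edge → ℂ) : ∏ᶠ e : M.InnerEdge, a e.1 = M.innerProd a := by
  classical
  have : Fintype M.InnerEdge := Fintype.ofFinite _
  rw [finprod_eq_prod_of_fintype, innerProd, Finset.prod_ite, Finset.prod_const_one, one_mul]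
  exact (Finset.prod_subtype _ (fun e => by simp) a).symm

/-- The sign `edgeSign` from the strand calculus and the signs `(-1)^(2j)` of the edge weights are
the same and cancel. -/
theorem weight_eq [Fintype T] {k : M.BdryEdge → ℕ} {n : M.Edge → ℕ} (hn : n ∈ M.Extensions k) :
    M.weight n = M.innerProd (fun e => (n e : ℂ) + 1) * M.edgeCoeff k n := by
  classical
  have h1 := amplitude_eq_integral hn.1
  simp only [bdryNet_eval_eq hn.2] at h1
  rw [weight, finprod_eq_prod_of_fintype (M := ℂ) (fun q : M.InnerFace => _), mul_assoc]
  rw [h1, finprod_inner fun e => (-1) ^ n e * ((n e : ℂ) + 1)]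
  have h2 : M.innerProd (fun e => (-1) ^ n e * ((n e : ℂ) + 1)) =
      M.edgeSign n * M.innerProd fun e => (n e : ℂ) + 1 := by
    rw [innerProd, innerProd, edgeSign, ← Finset.prod_mul_distrib]
    refine Finset.prod_congr rfl fun e _ => ?_
    split_ifs <;> simp
  rw [h2, edgeCoeff]
  linear_combination M.innerProd (fun e => (n e : ℂ) + 1) * (∫ g, M.edgeChi n (M.connection g) *
    M.bdryEval k (M.connection g) ∂M.haarFaces) * edgeSign_mul_self n

/-! #### The total mass -/

/-- Admissible labellings can be multiplied by even integers. A nonzero one which vanishes on the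
boundary would therefore give infinitely many extensions of the zero labels. -/
theorem extensions_zero (hM : M.NonTardis) : M.Extensions (fun _ => 0) = {fun _ => 0} := by
  refine Set.eq_singleton_iff_unique_mem.mpr ⟨⟨fun x => by simp [Admissible], fun _ => rfl⟩, ?_⟩
  intro n hn
  by_contra hne
  obtain ⟨e, he⟩ : ∃ e, n e ≠ 0 := by
    by_contra! h
    exact hne (funext h)
  refine Set.infinite_of_injective_forall_mem (f := fun (m : ℕ) (e : M.Edge) => 2 * m * n e) ?_ ?_ (hM fun _ => 0)
  · intro m m' h
    have h1 := congrFun h e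
    simp only at h1
    have h2 := Nat.eq_of_mul_eq_mul_right (Nat.pos_of_ne_zero he) h1
    omega
  · refine fun m => ⟨fun x => ?_, fun e => ?_⟩
    · obtain ⟨h0, h1, h2, h3⟩ := hn.1 x
      refine ⟨⟨m * (n (M.edge x) + n (M.edge (x.1, x.2.rot)) + n (M.edge (x.1, x.2.rot.rot))), by ring⟩, ?_, ?_, ?_⟩
      · rw [← mul_add]; exact Nat.mul_le_mul_left _ h1
      · rw [← mul_add]; exact Nat.mul_le_mul_left _ h2
      · rw [← mul_add]; exact Nat.mul_le_mul_left _ h3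
    · simp only [hn.2 e, mul_zero]

theorem bdryEval_zero [Fintype T] (c : T → Fin 4 → SU2) : M.bdryEval (fun _ => 0) c = 1 :=
  SpinNetwork.eval_of_label_eq_zero _ fun _ => rfl

/-- For zero boundary spins the boundary evaluation is one, and only the zero labelling contributes,
with coefficient `b N 0 = 1`. This normalisation is what the concentration argument requires of the
product of delta functions. -/
theorem integral_edgeDelta_eq_one [Fintype T] (hM : M.NonTardis) (N : M.Edge → ℕ) :
    ∫ g, M.edgeDelta N (M.connection g) ∂M.haarFaces = 1 := by
  classical
  obtain ⟨b, hb0, hb1, hb, -⟩ := SU2.exists_delta_coeff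
  have h := integral_edgeDelta hb0 hb (hM fun _ => 0) N
  have h1 : (hM fun _ => 0).toFinset = {fun _ => 0} := by
    rw [← Finset.coe_inj, Set.Finite.coe_toFinset, extensions_zero hM, Finset.coe_singleton]
  have h2 : M.edgeChi (fun _ => 0) = fun _ => 1 := by
    funext c
    refine Finset.prod_eq_one fun e _ => ?_
    split_ifs
    · rfl
    · exact chi_zero _
  have h3 : M.innerProd (fun e => b (N e) 0) = 1 := by
    refine Finset.prod_eq_one fun e _ => ?_
    split_ifs
    · rfl
    · exact hb1 _
  rw [h1, Finset.sum_singleton, h3, edgeCoeff, h2] at h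
  simp only [bdryEval_zero, mul_one] at h
  rw [integral_const, probReal_univ, one_smul, integral_complex_ofReal] at h
  rw [mul_one] at h
  exact_mod_cast h

/-! #### The limit -/

open Filter Topology in
/-- Iterated limits, first for the edges in a set and then for the others. -/
theorem sum_weight_eq_of_tendsto [Fintype T] {k : M.BdryEdge → ℕ} (hk : (M.Extensions k).Finite)
    (S : M.Edge → Prop) [DecidablePred S] {L : ℕ → ℂ} {v : ℂ}
    (h1 : ∀ N', Tendsto (fun N => ∫ g, (M.edgeDelta (fun e => if S e then N else N') (M.connection g) : ℂ) *
      M.bdryEval k (M.connection g) ∂M.haarFaces) atTop (𝓝 (L N'))) (h2 : Tendsto L atTop (𝓝 v)) :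
    ∑ᶠ n ∈ M.Extensions k, M.weight n = v := by
  classical
  obtain ⟨b, hb0, -, hb, hlim⟩ := SU2.exists_delta_coeff
  have hprod : ∀ (a : ℕ → M.Edge → ℂ) (l : M.Edge → ℂ), (∀ e, Tendsto (fun N => a N e) atTop (𝓝 (l e))) →
      Tendsto (fun N => M.innerProd (a N)) atTop (𝓝 (M.innerProd l)) := by
    intro a l h
    refine tendsto_finsetProd _ fun e _ => ?_
    split_ifs
    · exact tendsto_const_nhds
    · exact h e
  -- The sum is finite and independent of `N`, so the limit is taken in each coefficient; it must
  -- coincide with the given limit of the integrals.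
  have h3 : ∀ N', L N' = ∑ n ∈ hk.toFinset,
      M.innerProd (fun e => if S e then (n e : ℂ) + 1 else b N' (n e)) * M.edgeCoeff k n := by
    intro N'
    refine tendsto_nhds_unique (h1 N') ?_
    simp only [integral_edgeDelta hb0 hb hk]
    refine tendsto_finsetSum _ fun n _ => Tendsto.mul_const _ (hprod _ _ fun e => ?_)
    split_ifs
    · exact hlim (n e)
    · exact tendsto_const_nhds
  have h4 : ∑ᶠ n ∈ M.Extensions k, M.weight n = ∑ n ∈ hk.toFinset,
      M.innerProd (fun e => (n e : ℂ) + 1) * M.edgeCoeff k n := by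
    rw [finsum_mem_eq_finite_toFinset_sum _ hk]
    refine Finset.sum_congr rfl fun n hn => weight_eq ?_
    rwa [Set.Finite.mem_toFinset] at hn
  rw [h4]
  refine tendsto_nhds_unique ?_ h2
  refine (tendsto_congr h3).mpr (tendsto_finsetSum _ fun n _ => Tendsto.mul_const _ (hprod _ _ fun e => ?_))
  split_ifs
  · exact tendsto_const_nhds
  · exact hlim (n e)

end Triangulation

/-! ### Evaluation of the limits: orbits, gauge fixing and the cuts. -/

/-! ### Integration over orbits -/

open Filter Topology in
/-- If the powers of an invariant function concentrate on its maximum, then the limit of the integrals of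
a function is determined by its means over the orbits in the maximum. -/
theorem tendsto_integral_pow_of_orbits {X Y : Type*} [TopologicalSpace X] [CompactSpace X] [MeasurableSpace X]
    [BorelSpace X] [SecondCountableTopology X] [T2Space X] [TopologicalSpace Y] [CompactSpace Y] [MeasurableSpace Y]
    [BorelSpace Y] [SecondCountableTopology Y]
    (μ : Measure X) [IsProbabilityMeasure μ] [μ.IsOpenPosMeasure]
    (ν : Measure Y) [IsProbabilityMeasure ν] {f : X → ℝ}
    (hf : Continuous f) (h0 : ∀ x, 0 ≤ f x) (h1 : ∀ x, f x ≤ 1) {x₀ : X} (hx₀ : f x₀ = 1) {c : ℕ → ℝ}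
    (hc : ∀ N, ∫ x, c N * f x ^ N ∂μ = 1) {φ : Y → X → X} (hφ : Continuous fun p : Y × X => φ p.1 p.2)
    (hμ : ∀ y (E : X → ℂ), ∫ x, E (φ y x) ∂μ = ∫ x, E x ∂μ) (hfφ : ∀ y x, f (φ y x) = f x)
    {F : X → ℂ} (hF : Continuous F) {v : ℂ} (hv : ∀ x, f x = 1 → ∫ y, F (φ y x) ∂ν = v) :
    Tendsto (fun N => ∫ x, ((c N * f x ^ N : ℝ) : ℂ) * F x ∂μ) atTop (𝓝 v) := by
  have hcF : Continuous fun p : X × Y => F (φ p.2 p.1) := hF.comp (hφ.comp continuous_swap)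
  -- The mean of `F` over the orbits is continuous and has the constant value `v` at the maximum of
  -- `f`; this is all that concentration needs.
  have hG : Continuous fun x => ∫ y, F (φ y x) ∂ν := by
    have := continuous_parametric_integral_of_continuous (μ := ν) (f := fun x y => F (φ y x)) hcF
      (isCompact_univ (X := Y))
    simpa only [Measure.restrict_univ] using this
  refine (tendsto_integral_pow_of_max μ hf h0 h1 hx₀ hc hG hv).congr fun N => ?_
  have hcont : Continuous fun x => ((c N * f x ^ N : ℝ) : ℂ) :=
    Complex.continuous_ofReal.comp (continuous_const.mul (hf.pow N))
  -- As `μ` and `f` are invariant, replacing `F` by its mean over the orbits does not change the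
  -- integrals.
  have h2 : ∀ y, ∫ x, ((c N * f x ^ N : ℝ) : ℂ) * F (φ y x) ∂μ = ∫ x, ((c N * f x ^ N : ℝ) : ℂ) * F x ∂μ := by
    intro y
    rw [← hμ y fun x => ((c N * f x ^ N : ℝ) : ℂ) * F x]
    simp only [hfφ]
  have h3 : ∫ x, ((c N * f x ^ N : ℝ) : ℂ) * ∫ y, F (φ y x) ∂ν ∂μ =
      ∫ x, ∫ y, ((c N * f x ^ N : ℝ) : ℂ) * F (φ y x) ∂ν ∂μ := by
    simp only [integral_const_mul]
  rw [h3, integral_integral_swap]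
  · simp only [h2]
    rw [integral_const, probReal_univ, one_smul]
  · exact ((hcont.comp continuous_fst).mul hcF).integrable_of_hasCompactSupport
      (HasCompactSupport.of_compactSpace _)

/-- Translations of a product of groups. -/
theorem integral_pi_mul_mul {ι : Type*} [Fintype ι] (a b : ι → SU2) (E : (ι → SU2) → ℂ) :
    ∫ u, E (a * u * b) ∂(Measure.pi fun _ : ι => haarSU2) = ∫ u, E u ∂(Measure.pi fun _ : ι => haarSU2) := by
  rw [integral_mul_left_eq_self (μ := Measure.pi fun _ : ι => haarSU2) (fun u => E (u * b)) a,
    integral_mul_right_eq_self]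

/-! ### Connections, faces and gauge transformations -/

theorem SU2.delta_zero (g : SU2) : SU2.delta 0 g = 1 := by
  simp [SU2.delta]

namespace Triangulation

variable {T : Type*} {M : Triangulation T}

/-- The group element of a connection at a face. -/
theorem connection_cases {G : Type*} [Group G] {x : TetFlag T} (hx : ¬ M.OnBoundary x) : ∃ q,
    ((x.1, x.2.1.1) = M.faceOut q ∧ (M.cross x).1 = (M.cross (sideFlag (M.faceOut q) 0)).1 ∧
      ∀ g : M.InnerFace → G, M.connection g x.1 x.2.1.1 = g q) ∨
    (((M.cross x).1, (M.cross x).2.1.1) = M.faceOut q ∧ x.1 = (M.cross (sideFlag (M.faceOut q) 0)).1 ∧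
      ∀ g : M.InnerFace → G, M.connection g x.1 x.2.1.1 = (g q)⁻¹) := by
  obtain ⟨⟨⟨q, b⟩ | b, l⟩, rfl⟩ := M.faceFlag_bijective.2 x
  · have h : (M.cross (sideFlag (M.faceOut q) l)).1 = (M.cross (sideFlag (M.faceOut q) 0)).1 :=
      congrArg (fun y : T × Fin 4 => y.1) (M.face_cross_congr ((sideFlag_face _ _).trans (sideFlag_face _ _).symm))
    cases b
    · refine ⟨q, Or.inr ⟨?_, h, fun g => connection_false g q l⟩⟩
      rw [M.cross_faceFlag]
      exact sideFlag_face _ _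
    · exact ⟨q, Or.inl ⟨sideFlag_face _ _, h, fun g => connection_true g q l⟩⟩
  · exact absurd (M.onBoundary_faceFlag b l) hx

theorem connection_of_onBoundary {G : Type*} [Group G] {x : TetFlag T} (hx : M.OnBoundary x)
    (g : M.InnerFace → G) : M.connection g x.1 x.2.1.1 = 1 :=
  (isConnection_connection g).bdry _ _ hx

theorem cross_fst_of_onBoundary {x : TetFlag T} (hx : M.OnBoundary x) : (M.cross x).1 = x.1 := by
  rw [M.cross_of_onBoundary hx]

/-- Gauge transformations are translations of the group elements at the faces. -/
theorem gauge_connection {G : Type*} [Group G] (h : T → G) (g : M.InnerFace → G) :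
    M.Gauge h (M.connection g) (M.connection ((fun q => (h (M.faceOut q).1)⁻¹) * g *
      fun q => h (M.cross (sideFlag (M.faceOut q) 0)).1)) := by
  intro y
  change M.connection _ (swap y).1 (swap y).2.1.1 =
    (h (swap y).1)⁻¹ * M.connection g (swap y).1 (swap y).2.1.1 * h (M.cross (swap y)).1
  generalize swap y = x
  by_cases hx : M.OnBoundary x
  · rw [connection_of_onBoundary hx, connection_of_onBoundary hx, M.cross_fst_of_onBoundary hx]
    group
  · obtain ⟨q, ⟨h1, h2, h3⟩ | ⟨h1, h2, h3⟩⟩ := connection_cases (G := G) hx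
    · have e : (M.faceOut q).1 = x.1 := (congrArg Prod.fst h1).symm
      rw [h3, h3]
      simp only [Pi.mul_apply, e, h2]
    · have e : (M.faceOut q).1 = (M.cross x).1 := (congrArg Prod.fst h1).symm
      rw [h3, h3]
      simp only [Pi.mul_apply, mul_inv_rev, inv_inv, ← h2, e, mul_assoc]

/-- The product of the peaked functions of the holonomies about some edges. -/
def peakProd (M : Triangulation T) [Finite T] (S : Set M.Edge) (c : T → Fin 4 → SU2) : ℝ :=
  open Classical in ∏ e : M.Edge, if e ∈ S then (M.edgeHol c e).peak else 1

/-- The product of the approximate delta functions of the holonomies about some edges. -/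
def deltaProd (M : Triangulation T) [Finite T] (S : Set M.Edge) (N : ℕ) (c : T → Fin 4 → SU2) : ℝ :=
  open Classical in ∏ e : M.Edge, if e ∈ S then SU2.delta N (M.edgeHol c e) else 1

section

variable [Finite T]

/-- A product of normalised powers is a multiple of the power of one function with maximum one, so
that concentration applies to all edges at once. -/
theorem exists_deltaProd_eq (S : Set M.Edge) : ∃ a : ℕ → ℝ, ∀ N c, M.deltaProd S N c = a N * M.peakProd S c ^ N := by
  classical
  refine ⟨fun N => ∏ e : M.Edge, if e ∈ S then (∫ g : SU2, g.peak ^ N ∂haarSU2)⁻¹ else 1, fun N c => ?_⟩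
  rw [peakProd, deltaProd, ← Finset.prod_pow, ← Finset.prod_mul_distrib]
  refine Finset.prod_congr rfl fun e _ => ?_
  split_ifs
  · rfl
  · rw [one_pow, mul_one]

theorem deltaProd_zero (S : Set M.Edge) (c : T → Fin 4 → SU2) : M.deltaProd S 0 c = 1 :=
  Finset.prod_eq_one fun e _ => by rw [SU2.delta_zero, ite_self]

theorem continuous_peakProd (S : Set M.Edge) : Continuous (M.peakProd S) := by
  classical
  refine continuous_finsetProd _ fun e _ => ?_
  split_ifs
  · exact SU2.continuous_peak.comp (continuous_edgeHol e)
  · exact continuous_const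

theorem continuous_deltaProd (S : Set M.Edge) (N : ℕ) : Continuous (M.deltaProd S N) := by
  obtain ⟨a, ha⟩ := exists_deltaProd_eq S
  refine Continuous.congr ?_ fun c => (ha N c).symm
  exact continuous_const.mul ((continuous_peakProd S).pow N)

theorem peakProd_congr {S : Set M.Edge} {c c' : T → Fin 4 → SU2}
    (h : ∀ e ∈ S, (M.edgeHol c e).peak = (M.edgeHol c' e).peak) : M.peakProd S c = M.peakProd S c' := by
  classical
  refine Finset.prod_congr rfl fun e _ => ?_
  split_ifs with he
  · exact h e he
  · rfl

theorem peakProd_nonneg (S : Set M.Edge) (c : T → Fin 4 → SU2) : 0 ≤ M.peakProd S c := by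
  refine Finset.prod_nonneg fun e _ => ?_
  split_ifs
  · exact SU2.peak_nonneg _
  · exact zero_le_one

theorem peakProd_le_one (S : Set M.Edge) (c : T → Fin 4 → SU2) : M.peakProd S c ≤ 1 := by
  refine Finset.prod_le_one (fun e _ => ?_) fun e _ => ?_
  · split_ifs
    · exact SU2.peak_nonneg _
    · exact zero_le_one
  · split_ifs
    · exact SU2.peak_le_one _
    · exact le_rfl

theorem peakProd_one (S : Set M.Edge) : M.peakProd S (M.connection 1) = 1 := by
  refine Finset.prod_eq_one fun e _ => ?_
  have h1 : ∀ t f, M.connection (1 : M.InnerFace → SU2) t f = 1 := fun t f => by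
    unfold connection
    split <;> simp
  have h2 : M.edgeHol (M.connection (1 : M.InnerFace → SU2)) e = 1 := by
    refine List.prod_eq_one fun g hg => ?_
    obtain ⟨i, -, rfl⟩ := List.mem_map.mp hg
    exact h1 _ _
  rw [h2, SU2.peak_one, ite_self]

/-- At a maximum the holonomies are trivial. -/
theorem edgeHol_eq_one_of_peakProd {S : Set M.Edge} {c : T → Fin 4 → SU2} (h : M.peakProd S c = 1) {e : M.Edge}
    (he : e ∈ S) : M.edgeHol c e = 1 := by
  classical
  refine SU2.eq_one_of_peak (le_antisymm (SU2.peak_le_one _) ?_)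
  rw [← h, peakProd, ← Finset.mul_prod_erase _ _ (Finset.mem_univ e), if_pos he]
  refine mul_le_of_le_one_right (SU2.peak_nonneg _) (Finset.prod_le_one (fun e _ => ?_) fun e _ => ?_)
  · split_ifs
    · exact SU2.peak_nonneg _
    · exact zero_le_one
  · split_ifs
    · exact SU2.peak_le_one _
    · exact le_rfl

theorem flagHol_eq_one_of_peakProd {S : Set M.Edge} {c : T → Fin 4 → SU2} (hc : M.IsConnection c)
    (h : M.peakProd S c = 1) {x : TetFlag T} (he : M.edge x ∈ S)
    (hx : ¬ ∃ z, M.OnBoundary z ∧ M.edge z = M.edge x) : M.flagHol c x = 1 := by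
  refine SU2.eq_one_of_peak ?_
  rw [hc.peak_flagHol hx (M.edge_edgeOut _).symm]
  exact (congrArg SU2.peak (edgeHol_eq_one_of_peakProd h he)).trans SU2.peak_one

theorem Gauge.deltaProd {h : T → SU2} {c c' : T → Fin 4 → SU2} (hg : M.Gauge h c c') (S : Set M.Edge) (N : ℕ) :
    M.deltaProd S N c' = M.deltaProd S N c := by
  obtain ⟨a, ha⟩ := exists_deltaProd_eq S
  rw [ha, ha, peakProd_congr fun e _ => ?_]
  have h1 : M.edgeHol c' e = _ := hg.flagHol (M.edgeOut e)
  rw [h1, SU2.peak_conj]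
  rfl

theorem edgeDelta_eq_mul (S : Set M.Edge) [DecidablePred (· ∈ S)]
    (hS : ∀ e ∈ S, ¬ ∃ y, M.OnBoundary y ∧ M.edge y = e) (N N' : ℕ) (c : T → Fin 4 → SU2) :
    M.edgeDelta (fun e => if e ∈ S then N else N') c = M.deltaProd S N c *
      M.deltaProd {e | e ∉ S ∧ ¬ ∃ y, M.OnBoundary y ∧ M.edge y = e} N' c := by
  classical
  rw [edgeDelta, deltaProd, deltaProd, ← Finset.prod_mul_distrib]
  refine Finset.prod_congr rfl fun e _ => ?_
  by_cases h : e ∈ S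
  · have h1 := hS e h
    simp only [h, h1, if_true, if_false, Set.mem_ofPred_eq, not_true, false_and, mul_one]
  · by_cases h1 : ∃ y, M.OnBoundary y ∧ M.edge y = e
    · simp only [h, h1, if_true, if_false, Set.mem_ofPred_eq, not_true, and_false, mul_one]
    · simp only [h, h1, if_true, if_false, Set.mem_ofPred_eq, not_false_eq_true, and_self, one_mul]

end

end Triangulation

/-! ### Cut manifolds -/

namespace Triangulation

variable {T : Type*} {M : Triangulation T}

theorem edge_turn_iterate (x : TetFlag T) (i : ℕ) : M.edge (M.turn^[i] x) = M.edge x := by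
  induction i with
  | zero => rfl
  | succ i ih => rw [Function.iterate_succ_apply', edge_turn, ih]

theorem gauge_deltaProd_mul_bdryEval [Fintype T] (S : Set M.Edge) (N : ℕ) (k : M.BdryEdge → ℕ) (h : T → SU2)
    (c c' : T → Fin 4 → SU2) (hg : M.Gauge h c c') :
    (M.deltaProd S N c' : ℂ) * M.bdryEval k c' = (M.deltaProd S N c : ℂ) * M.bdryEval k c := by
  rw [hg.deltaProd, hg.bdryEval]

end Triangulation

namespace CutSystem

open Triangulation

variable {T C : Type*} {M : Triangulation T} (D : CutSystem M C)

theorem cutOpen_glue {t : T} {f : Fin 4} (h : D.side t f = none) : D.cutOpen.glue t f = M.glue t f := if_pos h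

theorem cutOpen_glue' {t : T} {f : Fin 4} (h : D.side t f ≠ none) : D.cutOpen.glue t f = none := if_neg h

theorem not_onBoundary_of_cutOpen {x : TetFlag T} (h : ¬ D.cutOpen.OnBoundary x) :
    D.side x.1 x.2.1.1 = none ∧ ¬ M.OnBoundary x := by
  have h1 : D.side x.1 x.2.1.1 = none := by
    by_contra h1
    exact h (D.cutOpen_glue' h1)
  exact ⟨h1, fun h2 => h ((D.cutOpen_glue h1).trans h2)⟩

theorem onBoundary_cutOpen_of_side {x : TetFlag T} (h : D.side x.1 x.2.1.1 ≠ none) : D.cutOpen.OnBoundary x :=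
  D.cutOpen_glue' h

theorem not_onBoundary_of_side {x : TetFlag T} (h : D.side x.1 x.2.1.1 ≠ none) : ¬ M.OnBoundary x := fun h1 =>
  h (D.inner _ _ h1)

theorem cross_cutOpen {x : TetFlag T} (h : D.side x.1 x.2.1.1 = none) : D.cutOpen.cross x = M.cross x := by
  unfold Triangulation.cross
  rw [D.cutOpen_glue h]

theorem side_cross (x : TetFlag T) (h : ¬ M.OnBoundary x) : D.side (M.cross x).1 (M.cross x).2.1.1 =
    (D.side x.1 x.2.1.1).map fun s => (s.1, !s.2) := by
  obtain ⟨t', π, hg, hc⟩ := M.exists_glue h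
  rw [hc]
  exact D.opposite _ _ _ _ hg

theorem side_cross_eq_none {x : TetFlag T} : D.side (M.cross x).1 (M.cross x).2.1.1 = none ↔
    D.side x.1 x.2.1.1 = none := by
  by_cases h : M.OnBoundary x
  · rw [M.cross_of_onBoundary h]
  · rw [D.side_cross x h, Option.map_eq_none_iff]

/-- The edges which are interior and do not lie on a cut. -/
def awayEdges : Set M.Edge :=
  {e | ∀ x : TetFlag T, M.edge x = e → ¬ M.OnBoundary x ∧ D.side x.1 x.2.1.1 = none}

/-- The interior edges on the cuts. -/
def cutEdges : Set M.Edge := {e | e ∉ D.awayEdges ∧ ¬ ∃ y, M.OnBoundary y ∧ M.edge y = e}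

theorem not_bdry_of_mem_awayEdges {e : M.Edge} (h : e ∈ D.awayEdges) : ¬ ∃ y, M.OnBoundary y ∧ M.edge y = e :=
  fun ⟨y, h1, h2⟩ => (h y h2).1 h1

open Classical in
/-- Keep the group elements of the interior triangles on the cuts only. -/
def mask (u : M.InnerFace → SU2) (q : M.InnerFace) : SU2 :=
  if D.side (M.faceOut q).1 (M.faceOut q).2 = none then 1 else u q

theorem continuous_mask : Continuous D.mask := by
  refine continuous_pi fun q => ?_
  unfold mask
  split_ifs
  · exact continuous_const
  · exact continuous_apply q

theorem side_faceOut {x : TetFlag T} {q : M.InnerFace}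
    (h : (x.1, x.2.1.1) = M.faceOut q ∨ ((M.cross x).1, (M.cross x).2.1.1) = M.faceOut q) :
    D.side (M.faceOut q).1 (M.faceOut q).2 = none ↔ D.side x.1 x.2.1.1 = none := by
  rcases h with h | h
  · rw [← h]
  · rw [← h, D.side_cross_eq_none]

/-- Away from the cuts the masked connection is trivial. -/
theorem connection_mask_eq_one (u : M.InnerFace → SU2) {x : TetFlag T} (h : D.side x.1 x.2.1.1 = none) :
    M.connection (D.mask u) x.1 x.2.1.1 = 1 := by
  by_cases hx : M.OnBoundary x
  · exact connection_of_onBoundary hx _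
  · obtain ⟨q, ⟨h1, -, h3⟩ | ⟨h1, -, h3⟩⟩ := connection_cases (G := SU2) hx
    · rw [h3, mask, if_pos ((D.side_faceOut (Or.inl h1)).mpr h)]
    · rw [h3, mask, if_pos ((D.side_faceOut (Or.inr h1)).mpr h), inv_one]

section

variable [Finite T]

theorem turn_iterate_cutOpen {x : TetFlag T} (hx : ¬ ∃ y, D.cutOpen.OnBoundary y ∧ D.cutOpen.edge y = D.cutOpen.edge x)
    (m : ℕ) : M.turn^[m] x = D.cutOpen.turn^[m] x := by
  induction m with
  | zero => rfl
  | succ m ih =>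
    have h1 : ¬ D.cutOpen.OnBoundary (swap (D.cutOpen.turn^[m] x)) := fun h => hx ⟨_, h, by
      rw [edge_swap, ← D.cutOpen.edgeLoops_iterate_inner hx]
      exact D.cutOpen.edgeLoops.cls_iterate m x⟩
    rw [Function.iterate_succ_apply', Function.iterate_succ_apply', ih]
    exact (D.cross_cutOpen (D.not_onBoundary_of_cutOpen h1).1).symm

/-- Interior edges of the cut manifold are away from the cuts. -/
theorem edge_mem_awayEdges {x : TetFlag T}
    (hx : ¬ ∃ y, D.cutOpen.OnBoundary y ∧ D.cutOpen.edge y = D.cutOpen.edge x) : M.edge x ∈ D.awayEdges := by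
  have key : ∀ y, M.edge y = M.edge x → D.cutOpen.edge y = D.cutOpen.edge x := by
    intro y h
    refine M.edgeLoops.ind (fun z => D.cutOpen.edge z = D.cutOpen.edge x)
      (fun z hz => (D.cutOpen.edge_swap z).trans hz) (fun z hz => ?_) x y h.symm rfl
    have h1 := D.not_onBoundary_of_cutOpen fun h => hx ⟨z, h, hz⟩
    have h2 : M.edgeLoops.b z = M.cross z := M.pass_of_not h1.2
    rw [h2, ← D.cross_cutOpen h1.1, edge_cross, hz]
  intro y h
  have h1 := D.not_onBoundary_of_cutOpen fun h1 => hx ⟨y, h1, key y h⟩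
  exact ⟨h1.2, h1.1⟩

open Classical in
/-- If the holonomies about the interior edges away from the cuts are trivial and the cut manifold is
simply connected, then the connection is trivial away from the cuts, up to a gauge transformation. -/
theorem exists_gauge (hD : D.cutOpen.SimplyConnected) {c : T → Fin 4 → SU2} (hc : M.IsConnection c)
    (h : M.peakProd D.awayEdges c = 1) : ∃ κ : T → SU2, ∀ x : TetFlag T, ¬ M.OnBoundary x →
      D.side x.1 x.2.1.1 = none → (κ x.1)⁻¹ * c x.1 x.2.1.1 * κ (M.cross x).1 = 1 := by
  -- The restriction of the connection to the cut manifold, where the triangles of the cuts belong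
  -- to the boundary.
  let c₀ : T → Fin 4 → SU2 := fun t f => if D.side t f = none then c t f else 1
  have hc₀ : D.cutOpen.IsFlat c₀ := by
    refine ⟨fun t f t' π hg => ?_, fun x hx => ?_⟩
    · have h1 : D.side t f = none := by
        by_contra h1
        rw [D.cutOpen_glue' h1] at hg
        cases hg
      rw [D.cutOpen_glue h1] at hg
      have h2 : D.side t' (π f) = none := by rw [D.opposite _ _ _ _ hg, h1]; rfl
      simp only [c₀, if_pos h1, if_pos h2]
      exact hc.inner _ _ _ _ hg
    · have h1 := D.edge_mem_awayEdges hx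
      have h2 := flagHol_eq_one_of_peakProd hc h h1 (D.not_bdry_of_mem_awayEdges h1)
      -- Around an interior edge of the cut manifold no cut is met, so both manifolds have the same
      -- rotation.
      have h3 : Function.minimalPeriod D.cutOpen.turn x = Function.minimalPeriod M.turn x :=
        Function.minimalPeriod_eq_minimalPeriod_iff.mpr fun m => by
          rw [Function.IsPeriodicPt, Function.IsPeriodicPt, Function.IsFixedPt, Function.IsFixedPt,
            D.turn_iterate_cutOpen hx]
      rw [← h2, flagHol, turnHol, h3]
      refine congrArg List.prod (List.map_congr_left fun i _ => ?_)
      rw [← D.turn_iterate_cutOpen hx]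
      refine if_pos (h1 (swap (M.turn^[i] x)) ?_).2
      rw [edge_swap]
      refine Nat.rec (motive := fun i => M.edge (M.turn^[i] x) = M.edge x) rfl (fun i ih => ?_) i
      rw [Function.iterate_succ_apply', edge_turn, ih]
  obtain ⟨κ, hκ⟩ := hD SU2 c₀ hc₀
  refine ⟨κ, fun x hx hs => ?_⟩
  obtain ⟨t', π, hg, hcr⟩ := M.exists_glue hx
  have h1 := hκ _ _ _ _ ((D.cutOpen_glue hs).trans hg)
  simp only [c₀, if_pos hs] at h1
  rw [h1, hcr]
  group

end

/-! #### Integration over the faces away from the cuts -/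

/-- The mean over the group elements at the cuts, for a connection which is trivial away from them up to
a gauge transformation. -/
theorem integral_mul_mask [Finite T] (hD : D.cutOpen.SimplyConnected) {F : (T → Fin 4 → SU2) → ℂ}
    (hF : ∀ (h : T → SU2) c c', M.Gauge h c c' → F c' = F c) {g : M.InnerFace → SU2}
    (hg : M.peakProd D.awayEdges (M.connection g) = 1) :
    ∫ u, F (M.connection (g * D.mask u)) ∂M.haarFaces = ∫ u, F (M.connection (D.mask u)) ∂M.haarFaces := by
  obtain ⟨κ, hκ⟩ := D.exists_gauge hD (isConnection_connection g) hg
  let a : M.InnerFace → SU2 := fun q => (κ (M.faceOut q).1)⁻¹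
  let b : M.InnerFace → SU2 := fun q => κ (M.cross (sideFlag (M.faceOut q) 0)).1
  have h1 : ∀ u, F (M.connection (g * D.mask u)) = F (M.connection (D.mask (a * g * u * b))) := by
    intro u
    rw [← hF κ _ _ (gauge_connection κ (g * D.mask u))]
    congr 2
    funext q
    -- Off the cuts the gauge transformation makes `g` trivial. At the cuts it multiplies `u` by
    -- fixed group elements from both sides, which the Haar measure does not see.
    change a q * (g q * D.mask u q) * b q = D.mask (a * g * u * b) q
    unfold mask
    split_ifs with hq
    · have h2 := hκ (sideFlag (M.faceOut q) 0) (M.not_onBoundary_faceOut q 0)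
        (by rw [show (sideFlag (M.faceOut q) 0).2.1.1 = (M.faceOut q).2 from FacePair.side_fst _ _]; exact hq)
      have h3 : M.connection g (sideFlag (M.faceOut q) 0).1 (sideFlag (M.faceOut q) 0).2.1.1 = g q :=
        connection_true g q 0
      rw [h3] at h2
      rw [mul_one]
      exact h2
    · simp only [Pi.mul_apply, mul_assoc]
  simp only [h1]
  exact integral_pi_mul_mul (a * g) b fun u => F (M.connection (D.mask u))

theorem connection_mul_mask (g u : M.InnerFace → SU2) {x : TetFlag T} (h : D.side x.1 x.2.1.1 = none) :
    M.connection (g * D.mask u) x.1 x.2.1.1 = M.connection g x.1 x.2.1.1 := by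
  by_cases hx : M.OnBoundary x
  · rw [connection_of_onBoundary hx, connection_of_onBoundary hx]
  · obtain ⟨q, ⟨h1, -, h3⟩ | ⟨h1, -, h3⟩⟩ := connection_cases (G := SU2) hx
    · rw [h3, h3, Pi.mul_apply, mask, if_pos ((D.side_faceOut (Or.inl h1)).mpr h), mul_one]
    · rw [h3, h3, Pi.mul_apply, mask, if_pos ((D.side_faceOut (Or.inr h1)).mpr h), mul_one]

theorem edgeHol_mul_mask (g u : M.InnerFace → SU2) {e : M.Edge} (he : e ∈ D.awayEdges) :
    M.edgeHol (M.connection (g * D.mask u)) e = M.edgeHol (M.connection g) e := by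
  refine congrArg List.prod (List.map_congr_left fun i _ => ?_)
  refine D.connection_mul_mask g u (x := swap (M.turn^[i] (M.edgeOut e))) (he _ ?_).2
  rw [edge_swap, edge_turn_iterate, edge_edgeOut]

open Filter Topology in
/-- Removal of the delta functions at the edges away from the cuts. -/
theorem tendsto_integral_awayEdges [Fintype T] (hD : D.cutOpen.SimplyConnected) (hM : M.NonTardis)
    {F : (T → Fin 4 → SU2) → ℂ} (hcF : Continuous F) (hF : ∀ (h : T → SU2) c c', M.Gauge h c c' → F c' = F c) :
    Tendsto (fun N => ∫ g, (M.deltaProd D.awayEdges N (M.connection g) : ℂ) * F (M.connection g) ∂M.haarFaces)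
      atTop (𝓝 (∫ u, F (M.connection (D.mask u)) ∂M.haarFaces)) := by
  classical
  obtain ⟨a, ha⟩ := exists_deltaProd_eq D.awayEdges
  simp only [ha]
  refine tendsto_integral_pow_of_orbits M.haarFaces M.haarFaces
    ((continuous_peakProd D.awayEdges).comp continuous_connection)
    (fun g => peakProd_nonneg _ _) (fun g => peakProd_le_one _ _) (peakProd_one D.awayEdges) (fun N => ?_)
    -- The orbits are translations at the triangles of the cuts, which do not enter the holonomies
    -- about the edges away from the cuts.
    (φ := fun u g => g * D.mask u)
    (continuous_snd.mul (D.continuous_mask.comp continuous_fst)) (fun u E => ?_) (fun u g => ?_)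
    (hcF.comp continuous_connection) fun g hg => D.integral_mul_mask hD hF hg
  -- The mass is known for the product over all interior edges. At the other ones the exponent zero
  -- is chosen, for which the approximate delta function is one.
  · have h := integral_edgeDelta_eq_one hM fun e => if e ∈ D.awayEdges then N else 0
    simp only [edgeDelta_eq_mul D.awayEdges (fun e he => D.not_bdry_of_mem_awayEdges he), deltaProd_zero, mul_one,
      ha] at h
    exact h
  · exact integral_mul_right_eq_self E (D.mask u)
  · exact peakProd_congr fun e he => by rw [D.edgeHol_mul_mask g u he]

-- The first of the two limits: the delta functions on the cuts, with fixed exponent `N'`, are part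
-- of the gauge invariant integrand.
open Filter Topology in
theorem tendsto_integral_edgeDelta [Fintype T] [DecidablePred (· ∈ D.awayEdges)] (hD : D.cutOpen.SimplyConnected)
    (hM : M.NonTardis) (k : M.BdryEdge → ℕ) (N' : ℕ) :
    Tendsto (fun N => ∫ g, (M.edgeDelta (fun e => if e ∈ D.awayEdges then N else N') (M.connection g) : ℂ) *
      M.bdryEval k (M.connection g) ∂M.haarFaces) atTop
      (𝓝 (∫ u, (M.deltaProd D.cutEdges N' (M.connection (D.mask u)) : ℂ) *
        M.bdryEval k (M.connection (D.mask u)) ∂M.haarFaces)) := by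
  have h := D.tendsto_integral_awayEdges hD hM
    ((Complex.continuous_ofReal.comp (continuous_deltaProd D.cutEdges N')).mul (continuous_bdryEval k))
    (gauge_deltaProd_mul_bdryEval D.cutEdges N' k)
  refine h.congr fun N => ?_
  refine integral_congr_ae (Eventually.of_forall fun g => ?_)
  simp only [edgeDelta_eq_mul D.awayEdges (fun e he => D.not_bdry_of_mem_awayEdges he), Complex.ofReal_mul,
    mul_assoc]
  rfl

/-- For zero boundary spins the first limit is a limit of ones. Its value is the mass which
normalises the second limit. -/
theorem integral_deltaProd_cutEdges [Fintype T] (hD : D.cutOpen.SimplyConnected) (hM : M.NonTardis) (N' : ℕ) :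
    ∫ u, M.deltaProd D.cutEdges N' (M.connection (D.mask u)) ∂M.haarFaces = 1 := by
  classical
  have h := D.tendsto_integral_edgeDelta hD hM (fun _ => 0) N'
  simp only [bdryEval_zero, mul_one, integral_complex_ofReal, integral_edgeDelta_eq_one hM] at h
  have h1 := tendsto_nhds_unique h tendsto_const_nhds
  exact_mod_cast h1

end CutSystem

namespace Triangulation

variable {T : Type*} {M : Triangulation T}

/-- An edge is interior if no boundary triangle is met in the rotation about it. -/
theorem not_bdry_of_turn [Finite T] {x : TetFlag T} (h : ∀ m, ¬ M.OnBoundary (M.turn^[m] x)) :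
    ¬ ∃ y, M.OnBoundary y ∧ M.edge y = M.edge x := by
  have hs : ∀ m, ¬ M.OnBoundary (swap (M.turn^[m] x)) := fun m h1 => by
    rw [← onBoundary_turn, ← Function.iterate_succ_apply' M.turn] at h1
    exact h _ h1
  obtain ⟨p, hp, hx⟩ := Function.mem_periodicPts.mp (M.turn_injective.mem_periodicPts x)
  have key := M.edgeLoops.ind (fun z => ∃ m, z = M.turn^[m] x ∨ z = swap (M.turn^[m] x)) (fun z => by
      rintro ⟨m, rfl | rfl⟩
      · exact ⟨m, Or.inr rfl⟩
      · exact ⟨m, Or.inl rfl⟩) (fun z => by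
      rintro ⟨m, rfl | rfl⟩
      · have h1 : M.edgeLoops.b (M.turn^[m] x) = M.cross (M.turn^[m] x) := M.pass_of_not (h m)
        -- By periodicity every flag of the rotation has a predecessor, also the initial one with `m
        -- = 0`.
        obtain ⟨j, hj⟩ : ∃ j, M.turn^[m] x = M.turn^[j + 1] x := by
          refine ⟨m + p - 1, ?_⟩
          rw [show m + p - 1 + 1 = m + p by omega, Function.iterate_add_apply, hx.eq]
        refine ⟨j, Or.inr ?_⟩
        rw [h1, hj, Function.iterate_succ_apply']
        exact M.cross_cross _
      · have h1 : M.edgeLoops.b (swap (M.turn^[m] x)) = M.cross (swap (M.turn^[m] x)) := M.pass_of_not (hs m)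
        refine ⟨m + 1, Or.inl ?_⟩
        rw [h1, Function.iterate_succ_apply']
        rfl)
  rintro ⟨y, hy, hxy⟩
  obtain ⟨m, rfl | rfl⟩ := key x y hxy.symm ⟨0, Or.inl rfl⟩
  · exact h m hy
  · exact hs m hy

/-- The end points of an edge, seen in the rotation about it. -/
theorem exists_vertex_turn (x : TetFlag T) {v : Fin 4} (h1 : v ≠ x.2.1.1) (h2 : v ≠ x.2.1.2) (m : ℕ) :
    ∃ w, w ≠ (M.turn^[m] x).2.1.1 ∧ w ≠ (M.turn^[m] x).2.1.2 ∧ M.vertex ((M.turn^[m] x).1, w) = M.vertex (x.1, v) := by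
  induction m with
  | zero => exact ⟨v, h1, h2, rfl⟩
  | succ m ih =>
    obtain ⟨w, h3, h4, h5⟩ := ih
    rw [Function.iterate_succ_apply']
    rw [← h5]
    generalize M.turn^[m] x = y at h3 h4
    by_cases hy : M.OnBoundary (swap y)
    · have e : M.turn y = swap y := M.cross_of_onBoundary hy
      rw [e]
      exact ⟨w, h4, h3, rfl⟩
    · obtain ⟨t', π, hg, hc⟩ := M.exists_glue hy
      have e : M.turn y = (t', (swap y).2.map π) := hc
      rw [e]
      refine ⟨π w, fun h => h4 (π.injective h), fun h => h3 (π.injective h), ?_⟩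
      exact (Quot.sound ⟨(swap y).2.1.1, t', π, fun h => h4 h.symm, hg, rfl⟩).symm

end Triangulation

namespace CutSystem

open Triangulation

variable {T C : Type*} {M : Triangulation T} (D : CutSystem M C)

/-! #### The edges on the cuts -/

theorem turn_iterate_of_lt {x : TetFlag T} {m : ℕ} (hm : m < D.cutOpen.turnSteps x) :
    M.turn^[m] x = D.cutOpen.turn^[m] x := by
  induction m with
  | zero => rfl
  | succ m ih =>
    rw [Function.iterate_succ_apply', Function.iterate_succ_apply', ih (by omega)]
    have h1 := D.cutOpen.not_onBoundary_of_lt (Nat.succ_pos m) hm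
    rw [Function.iterate_succ_apply', onBoundary_turn] at h1
    exact (D.cross_cutOpen (D.not_onBoundary_of_cutOpen h1).1).symm

section

variable [Finite T]

/-- Where the rotation in the cut manifold ends, the rotation in `M` goes on by crossing the face at
which it ended. -/
theorem turn_turnSteps {x : TetFlag T} (hx : D.cutOpen.OnBoundary x) :
    M.turn^[D.cutOpen.turnSteps x] x = M.cross (D.cutOpen.opp x) := by
  have h := (D.cutOpen.turnSteps_spec hx).1
  have h1 : D.cutOpen.turnSteps x = D.cutOpen.turnSteps x - 1 + 1 := by omega
  rw [D.cutOpen.opp_eq_swap hx, h1, Function.iterate_succ_apply', D.turn_iterate_of_lt (by omega), ← h1]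
  rfl

/-- All faces before the last one are interior in the cut manifold and carry the trivial element. -/
theorem turnHol_turnSteps {c : T → Fin 4 → SU2} (hc : ∀ x : TetFlag T, D.side x.1 x.2.1.1 = none → c x.1 x.2.1.1 = 1)
    {x : TetFlag T} (hx : D.cutOpen.OnBoundary x) :
    M.turnHol c x (D.cutOpen.turnSteps x) = c (D.cutOpen.opp x).1 (D.cutOpen.opp x).2.1.1 := by
  have h := (D.cutOpen.turnSteps_spec hx).1
  have h2 : ∀ m, m < D.cutOpen.turnSteps x → M.turnHol c x m = 1 := by
    intro m hm
    induction m with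
    | zero => rfl
    | succ m ih =>
      rw [turnHol_succ, ih (by omega), one_mul, D.turn_iterate_of_lt (by omega)]
      have h1 := D.cutOpen.not_onBoundary_of_lt (Nat.succ_pos m) hm
      rw [Function.iterate_succ_apply', onBoundary_turn] at h1
      exact hc (swap (D.cutOpen.turn^[m] x)) (D.not_onBoundary_of_cutOpen h1).1
  obtain ⟨n, hn⟩ : ∃ n, D.cutOpen.turnSteps x = n + 1 := ⟨D.cutOpen.turnSteps x - 1, by omega⟩
  rw [D.cutOpen.opp_eq_swap hx, hn, turnHol_succ, h2 n (by omega), one_mul, D.turn_iterate_of_lt (by omega),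
    Nat.add_sub_cancel]
  rfl

end

variable {D}

/-- A side of a triangle of a copy of a cut which is shared with another triangle of this copy. -/
structure IsCutFlag (D : CutSystem M C) (i : C) (s : Bool) (x : TetFlag T) : Prop where
  mem : (x.1, x.2.1.1) ∈ D.copy i s
  opp_mem : ((D.cutOpen.opp x).1, (D.cutOpen.opp x).2.1.1) ∈ D.copy i s

variable {i : C} {s : Bool} {x : TetFlag T}

theorem IsCutFlag.side (h : D.IsCutFlag i s x) : D.side x.1 x.2.1.1 = some (i, s) := h.mem

theorem IsCutFlag.side_opp (h : D.IsCutFlag i s x) :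
    D.side (D.cutOpen.opp x).1 (D.cutOpen.opp x).2.1.1 = some (i, s) := h.opp_mem

theorem IsCutFlag.onBoundary (h : D.IsCutFlag i s x) : D.cutOpen.OnBoundary x :=
  D.onBoundary_cutOpen_of_side (by rw [h.side]; simp)

theorem IsCutFlag.side_cross_opp (h : D.IsCutFlag i s x) :
    D.side (M.cross (D.cutOpen.opp x)).1 (M.cross (D.cutOpen.opp x)).2.1.1 = some (i, !s) := by
  have h1 : ¬ M.OnBoundary (D.cutOpen.opp x) := D.not_onBoundary_of_side (by rw [h.side_opp]; simp)
  rw [D.side_cross _ h1, h.side_opp]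
  rfl

theorem IsCutFlag.onBoundary_cross_opp (h : D.IsCutFlag i s x) :
    D.cutOpen.OnBoundary (M.cross (D.cutOpen.opp x)) :=
  D.onBoundary_cutOpen_of_side (by rw [h.side_cross_opp]; simp)

section

variable [Finite T]

/-- This is the condition that the two copies of a cut are identified simplicially, along common
edges as well. It makes the two half rotations on either side of a cut close up. -/
theorem IsCutFlag.cross_opp (hD : D.IsHandlebody) (h : D.IsCutFlag i s x) :
    D.cutOpen.opp (M.cross (D.cutOpen.opp x)) = M.cross x := by
  have h1 : ¬ M.OnBoundary x := D.not_onBoundary_of_side (by rw [h.side]; simp)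
  have h2 : D.cutOpen.OnBoundary (M.cross x) := D.onBoundary_cutOpen_of_side (by
    rw [D.side_cross x h1, h.side]; simp)
  rw [← hD.simplicial i s x h.mem h.opp_mem, D.cutOpen.opp_opp h2]

/-- The rotation about an edge in the interior of a cut consists of the two halves on either side. -/
theorem IsCutFlag.minimalPeriod_eq (hD : D.IsHandlebody) (h : D.IsCutFlag i s x) :
    Function.minimalPeriod M.turn x =
      D.cutOpen.turnSteps (M.cross (D.cutOpen.opp x)) + D.cutOpen.turnSteps x ∧
    ∀ m, ¬ M.OnBoundary (M.turn^[m] x) := by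
  set y := M.cross (D.cutOpen.opp x) with hy
  have h1 : M.turn^[D.cutOpen.turnSteps x] x = y := D.turn_turnSteps h.onBoundary
  have h2 : M.turn^[D.cutOpen.turnSteps y + D.cutOpen.turnSteps x] x = x := by
    rw [Function.iterate_add_apply, h1, D.turn_turnSteps h.onBoundary_cross_opp, h.cross_opp hD, M.cross_cross]
  have hx0 : D.side x.1 x.2.1.1 ≠ none := by rw [h.side]; simp
  have hy0 : D.side y.1 y.2.1.1 ≠ none := by rw [h.side_cross_opp]; simp
  -- Strictly within each half rotation the flags are interior in the cut manifold, hence neither on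
  -- a cut nor on the boundary.
  have h3 : ∀ m, m < D.cutOpen.turnSteps y + D.cutOpen.turnSteps x → m ≠ 0 → m ≠ D.cutOpen.turnSteps x →
      D.side (M.turn^[m] x).1 (M.turn^[m] x).2.1.1 = none ∧ ¬ M.OnBoundary (M.turn^[m] x) := by
    intro m hm h0 hne
    apply D.not_onBoundary_of_cutOpen
    rcases lt_or_gt_of_ne hne with hlt | hgt
    · rw [D.turn_iterate_of_lt hlt]
      exact D.cutOpen.not_onBoundary_of_lt (Nat.pos_of_ne_zero h0) hlt
    · obtain ⟨j, rfl⟩ : ∃ j, m = j + D.cutOpen.turnSteps x := ⟨m - D.cutOpen.turnSteps x, by omega⟩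
      rw [Function.iterate_add_apply, h1, D.turn_iterate_of_lt (by omega)]
      exact D.cutOpen.not_onBoundary_of_lt (by omega) (by omega)
  have hpos := (D.cutOpen.turnSteps_spec h.onBoundary).1
  have h4 : Function.minimalPeriod M.turn x = D.cutOpen.turnSteps y + D.cutOpen.turnSteps x := by
    have h5 : Function.IsPeriodicPt M.turn (D.cutOpen.turnSteps y + D.cutOpen.turnSteps x) x := h2
    have h6 : 0 < Function.minimalPeriod M.turn x := h5.minimalPeriod_pos (by omega)
    by_contra hne
    have hlt := lt_of_le_of_ne (h5.minimalPeriod_le (by omega)) hne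
    have h7 : M.turn^[Function.minimalPeriod M.turn x] x = x := Function.iterate_minimalPeriod
    -- The only other place where a cut is met is half-way, and the flag found there lies on the
    -- opposite side of the cut.
    by_cases h8 : Function.minimalPeriod M.turn x = D.cutOpen.turnSteps x
    · rw [h8, h1] at h7
      have h9 := h.side_cross_opp
      rw [← hy, h7, h.side] at h9
      simp at h9
    · have h9 := (h3 _ hlt (by omega) h8).1
      rw [h7] at h9
      exact hx0 h9
  refine ⟨h4, fun m => ?_⟩
  rw [← Function.iterate_mod_minimalPeriod_eq]
  have hlt := Nat.mod_lt m (show 0 < Function.minimalPeriod M.turn x by omega)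
  generalize m % Function.minimalPeriod M.turn x = j at hlt
  by_cases hj : j = 0
  · subst hj
    exact D.not_onBoundary_of_side hx0
  · by_cases hj' : j = D.cutOpen.turnSteps x
    · rw [hj', h1]
      exact D.not_onBoundary_of_side hy0
    · exact (h3 j (by omega) hj hj').2

theorem IsCutFlag.edge_mem (hD : D.IsHandlebody) (h : D.IsCutFlag i s x) : M.edge x ∈ D.cutEdges := by
  refine ⟨fun h1 => ?_, not_bdry_of_turn (h.minimalPeriod_eq hD).2⟩
  have h2 := (h1 x rfl).2
  rw [h.side] at h2
  cases h2

/-- The holonomy about an edge in the interior of a cut. -/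
theorem IsCutFlag.flagHol (hD : D.IsHandlebody) (h : D.IsCutFlag i s x) {c : T → Fin 4 → SU2} (hc : M.IsConnection c)
    (hc1 : ∀ x : TetFlag T, D.side x.1 x.2.1.1 = none → c x.1 x.2.1.1 = 1) :
    M.flagHol c x = c (D.cutOpen.opp x).1 (D.cutOpen.opp x).2.1.1 * (c x.1 x.2.1.1)⁻¹ := by
  have h1 : ∀ m, M.turnHol c x (m + D.cutOpen.turnSteps x) =
      M.turnHol c x (D.cutOpen.turnSteps x) * M.turnHol c (M.cross (D.cutOpen.opp x)) m := by
    intro m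
    induction m with
    | zero => rw [Nat.zero_add]; exact (mul_one _).symm
    | succ m ih =>
      rw [show m + 1 + D.cutOpen.turnSteps x = m + D.cutOpen.turnSteps x + 1 by omega, turnHol_succ, turnHol_succ,
        ih, Function.iterate_add_apply, D.turn_turnSteps h.onBoundary, mul_assoc]
  rw [Triangulation.flagHol, (h.minimalPeriod_eq hD).1, h1, D.turnHol_turnSteps hc1 h.onBoundary,
    D.turnHol_turnSteps hc1 h.onBoundary_cross_opp, h.cross_opp hD, hc.cross]

/-- Every interior edge which meets a cut lies in the interior of this cut. -/
theorem exists_isCutFlag (hD : D.IsHandlebody) {e : M.Edge} (he : e ∈ D.cutEdges) :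
    ∃ i s x, D.IsCutFlag i s x ∧ M.edge x = e := by
  obtain ⟨h1, h2⟩ := he
  have h3 : ∃ x : TetFlag T, M.edge x = e ∧ D.side x.1 x.2.1.1 ≠ none := by
    by_contra! h
    exact h1 fun x hx => ⟨fun hb => h2 ⟨x, hb, hx⟩, h x hx⟩
  obtain ⟨x, rfl, hx⟩ := h3
  obtain ⟨⟨i, s⟩, his⟩ := Option.ne_none_iff_exists'.mp hx
  have hb := D.onBoundary_cutOpen_of_side hx
  refine ⟨i, s, x, ⟨his, ?_⟩, rfl⟩
  have hb' := D.cutOpen.onBoundary_opp hb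
  have hpos := (D.cutOpen.turnSteps_spec hb).1
  have h4 : D.cutOpen.opp x = swap (M.turn^[D.cutOpen.turnSteps x - 1] x) := by
    rw [D.cutOpen.opp_eq_swap hb, D.turn_iterate_of_lt (by omega)]
  -- The rotation in the cut manifold ends at its boundary. As the edge is interior in `M`, it ends
  -- at a triangle of some copy of a cut.
  have h5 : ¬ M.OnBoundary (D.cutOpen.opp x) := fun h => h2 ⟨_, h, by rw [h4, edge_swap, edge_turn_iterate]⟩
  have h6 : D.side (D.cutOpen.opp x).1 (D.cutOpen.opp x).2.1.1 ≠ none := fun h =>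
    h5 ((D.cutOpen_glue h).symm.trans hb')
  obtain ⟨⟨j, r⟩, hjr⟩ := Option.ne_none_iff_exists'.mp h6
  obtain ⟨v, hv1, hv2⟩ : ∃ v : Fin 4, v ≠ x.2.1.1 ∧ v ≠ x.2.1.2 := by
    generalize x.2.1.1 = a
    generalize x.2.1.2 = b
    revert a b
    decide
  obtain ⟨w, hw1, hw2, hw⟩ := exists_vertex_turn (M := D.cutOpen) x hv1 hv2 (D.cutOpen.turnSteps x)
  by_contra hne
  have hne' : (i, s) ≠ (j, r) := by
    intro h
    apply hne
    change D.side _ _ = _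
    rw [hjr, h]
  -- The triangles at both ends of the rotation share an end point of the edge, so they belong to
  -- the same copy of the same cut.
  exact hD.disjoint i s j r hne' (x.1, x.2.1.1) his ((D.cutOpen.opp x).1, (D.cutOpen.opp x).2.1.1) hjr
    v w hv1 hw1 hw.symm

end

variable (D)

/-! #### Translation of the group elements at the cuts -/

/-- Translation of the group elements at all triangles of the cuts, from one side. -/
def shiftL (v : C → SU2) (q : M.InnerFace) : SU2 :=
  match D.side (M.faceOut q).1 (M.faceOut q).2 with
  | some (i, false) => (v i)⁻¹
  | _ => 1

/-- Translation of the group elements at all triangles of the cuts, from the other side. -/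
def shiftR (v : C → SU2) (q : M.InnerFace) : SU2 :=
  match D.side (M.faceOut q).1 (M.faceOut q).2 with
  | some (i, true) => v i
  | _ => 1

theorem continuous_shiftL : Continuous D.shiftL := by
  refine continuous_pi fun q => ?_
  unfold shiftL
  rcases D.side (M.faceOut q).1 (M.faceOut q).2 with _ | ⟨i, _ | _⟩
  · exact continuous_const
  · exact (continuous_apply i).inv
  · exact continuous_const

theorem continuous_shiftR : Continuous D.shiftR := by
  refine continuous_pi fun q => ?_
  unfold shiftR
  rcases D.side (M.faceOut q).1 (M.faceOut q).2 with _ | ⟨i, _ | _⟩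
  · exact continuous_const
  · exact continuous_const
  · exact continuous_apply i

/-- The triangles carry preferred sides which need not agree with the sides of the cut. The two
shifts are made such that, in either case, the transport out of the side `true` is multiplied by `v
i` on the right. -/
theorem connection_shift (v : C → SU2) (u : M.InnerFace → SU2) {x : TetFlag T} {i : C} :
    (D.side x.1 x.2.1.1 = some (i, true) →
      M.connection (D.mask (D.shiftL v * u * D.shiftR v)) x.1 x.2.1.1 = M.connection (D.mask u) x.1 x.2.1.1 * v i) ∧
    (D.side x.1 x.2.1.1 = some (i, false) →
      M.connection (D.mask (D.shiftL v * u * D.shiftR v)) x.1 x.2.1.1 =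
        (v i)⁻¹ * M.connection (D.mask u) x.1 x.2.1.1) := by
  by_cases hx : M.OnBoundary x
  · have h := D.inner _ _ hx
    rw [h]
    simp
  obtain ⟨q, ⟨h1, -, h3⟩ | ⟨h1, -, h3⟩⟩ := connection_cases (G := SU2) hx
  · have e : D.side (M.faceOut q).1 (M.faceOut q).2 = D.side x.1 x.2.1.1 := by rw [← h1]
    constructor <;> intro h <;> rw [h] at e <;> simp [h3, mask, e, shiftL, shiftR]
  · have e : D.side (M.faceOut q).1 (M.faceOut q).2 = (D.side x.1 x.2.1.1).map fun s => (s.1, !s.2) := by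
      rw [← h1, ← D.side_cross x hx]
    constructor <;> intro h <;> rw [h] at e <;> simp [h3, mask, e, shiftL, shiftR]

/-- The holonomy about an edge inside a cut is the quotient of the group elements at the two
adjacent triangles. A common right factor cancels, a common left factor conjugates. -/
theorem peakProd_shift [Finite T] (hD : D.IsHandlebody) (v : C → SU2) (u : M.InnerFace → SU2) :
    M.peakProd D.cutEdges (M.connection (D.mask (D.shiftL v * u * D.shiftR v))) =
      M.peakProd D.cutEdges (M.connection (D.mask u)) := by
  refine peakProd_congr fun e he => ?_
  obtain ⟨i, s, x, hx, rfl⟩ := exists_isCutFlag hD he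
  have h1 : ∀ c : T → Fin 4 → SU2, M.IsConnection c → (M.edgeHol c (M.edge x)).peak = (M.flagHol c x).peak :=
    fun c hc => hc.peak_flagHol (by rw [edge_edgeOut]; exact he.2) (M.edge_edgeOut _)
  rw [h1 _ (isConnection_connection _), h1 _ (isConnection_connection _),
    hx.flagHol hD (isConnection_connection _) fun _ => D.connection_mask_eq_one _,
    hx.flagHol hD (isConnection_connection _) fun _ => D.connection_mask_eq_one _]
  cases s
  · rw [(D.connection_shift v u).2 hx.side, (D.connection_shift v u).2 hx.side_opp, ← SU2.peak_conj (v i)⁻¹]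
    congr 1
    group
  · rw [(D.connection_shift v u).1 hx.side, (D.connection_shift v u).1 hx.side_opp]
    congr 1
    group

/-- If the holonomies about the edges in the interior of the cuts are trivial, then the group elements at
the triangles of a cut agree. -/
theorem exists_transport [Finite T] (hD : D.IsHandlebody) {u : M.InnerFace → SU2}
    (hu : M.peakProd D.cutEdges (M.connection (D.mask u)) = 1) :
    ∃ h : C → SU2, ∀ t f i, D.side t f = some (i, true) → M.connection (D.mask u) t f = h i := by
  have key : ∀ i, ∀ x ∈ D.copy i true, ∀ y ∈ D.copy i true,
      M.connection (D.mask u) x.1 x.2 = M.connection (D.mask u) y.1 y.2 := by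
    intro i x hx y hy
    have h := (hD.disc i true).connected x hx y hy
    have h1 : y ∈ D.copy i true ∧ M.connection (D.mask u) x.1 x.2 = M.connection (D.mask u) y.1 y.2 := by
      -- The disc is connected through its inner edges, and at each of these the trivial holonomy
      -- says that the two neighbouring group elements are equal.
      refine h.rec (motive := fun y _ => y ∈ D.copy i true ∧
        M.connection (D.mask u) x.1 x.2 = M.connection (D.mask u) y.1 y.2) ⟨hx, rfl⟩ ?_
      rintro ⟨t, f⟩ ⟨t', f'⟩ - ⟨h1, p, r, hp, hr, ho⟩ ⟨h2, h3⟩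
      simp only at hp hr ho h3
      subst hp hr
      have h4 : D.IsCutFlag i true (t, p) := ⟨h2, by rw [ho]; exact h1⟩
      have h5 := flagHol_eq_one_of_peakProd (isConnection_connection (D.mask u)) hu (h4.edge_mem hD) (h4.edge_mem hD).2
      rw [h4.flagHol hD (isConnection_connection _) fun _ => D.connection_mask_eq_one _, ho, mul_inv_eq_one] at h5
      exact ⟨h1, h3.trans h5.symm⟩
    exact h1.2
  have h2 : ∀ i, ∃ g : SU2, ∀ t f, D.side t f = some (i, true) → M.connection (D.mask u) t f = g := by
    intro i
    by_cases h : ∃ x, x ∈ D.copy i true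
    · obtain ⟨x, hx⟩ := h
      exact ⟨M.connection (D.mask u) x.1 x.2, fun t f htf => key i (t, f) htf x hx⟩
    · exact ⟨1, fun t f htf => (h ⟨(t, f), htf⟩).elim⟩
  choose h hh using h2
  exact ⟨h, fun t f i hi => hh i t f hi⟩

theorem continuous_transport : Continuous D.transport := by
  refine continuous_pi fun t => continuous_pi fun f => ?_
  unfold transport
  rcases D.side t f with _ | ⟨i, _ | _⟩
  · exact continuous_const
  · exact (continuous_apply i).inv
  · exact continuous_apply i

theorem connection_shift_eq_transport {u : M.InnerFace → SU2} {h : C → SU2}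
    (hh : ∀ t f i, D.side t f = some (i, true) → M.connection (D.mask u) t f = h i) (v : C → SU2) :
    M.connection (D.mask (D.shiftL v * u * D.shiftR v)) = D.transport (h * v) := by
  funext t f
  let x : TetFlag T := sideFlag (t, f) 0
  obtain ⟨e1, e2⟩ := Prod.mk.inj (sideFlag_face (t, f) 0)
  have e1' : x.1 = t := e1
  have e2' : x.2.1.1 = f := e2
  rw [← e1', ← e2']
  unfold transport
  rcases hs : D.side x.1 x.2.1.1 with _ | ⟨i, _ | _⟩
  · exact D.connection_mask_eq_one _ hs
  · have hx := D.not_onBoundary_of_side (x := x) (by rw [hs]; simp)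
    have h1 := D.side_cross x hx
    rw [hs] at h1
    have h2 := hh _ _ i h1
    rw [(isConnection_connection (D.mask u)).cross] at h2
    rw [(D.connection_shift v u).2 hs]
    simp only [Pi.mul_apply, mul_inv_rev, ← h2, inv_inv]
  · rw [(D.connection_shift v u).1 hs, hh _ _ i hs]
    rfl

open Filter Topology in
/-- Removal of the delta functions at the edges in the interior of the cuts. -/
theorem tendsto_integral_cutEdges [Fintype T] [Fintype C] (hD : D.IsHandlebody) (hM : M.NonTardis)
    (k : M.BdryEdge → ℕ) :
    Tendsto (fun N => ∫ u, (M.deltaProd D.cutEdges N (M.connection (D.mask u)) : ℂ) *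
        M.bdryEval k (M.connection (D.mask u)) ∂M.haarFaces) atTop
      (𝓝 (∫ h : C → SU2, M.bdryEval k (D.transport h) ∂(Measure.pi fun _ : C => haarSU2))) := by
  obtain ⟨a, ha⟩ := exists_deltaProd_eq D.cutEdges
  have hmass := D.integral_deltaProd_cutEdges hD.ball.simplyConnected hM
  have hcm : Continuous fun u => M.connection (D.mask u) := continuous_connection.comp D.continuous_mask
  simp only [ha] at hmass ⊢
  have hone : M.peakProd D.cutEdges (M.connection (D.mask 1)) = 1 := by
    have h1 : D.mask 1 = 1 := by
      funext q
      unfold mask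
      split_ifs <;> rfl
    rw [h1, peakProd_one]
  refine tendsto_integral_pow_of_orbits M.haarFaces (Measure.pi fun _ : C => haarSU2)
    ((continuous_peakProd D.cutEdges).comp hcm)
    (fun g => peakProd_nonneg _ _) (fun g => peakProd_le_one _ _) hone hmass
    (φ := fun v u => D.shiftL v * u * D.shiftR v)
    (((D.continuous_shiftL.comp continuous_fst).mul continuous_snd).mul (D.continuous_shiftR.comp continuous_fst))
    (fun v E => integral_pi_mul_mul _ _ _) (fun v u => D.peakProd_shift hD v u)
    ((continuous_bdryEval k).comp hcm) fun u hu => ?_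
  obtain ⟨h, hh⟩ := D.exists_transport hD hu
  have h1 : ∀ v, M.bdryEval k (M.connection (D.mask (D.shiftL v * u * D.shiftR v))) =
      M.bdryEval k (D.transport (h * v)) := fun v => by rw [D.connection_shift_eq_transport hh]
  -- At the maximum the orbit runs through all transports `h * v`; the left factor `h` is removed by
  -- invariance of the Haar measure.
  refine (integral_congr_ae (Eventually.of_forall h1)).trans ?_
  exact integral_mul_left_eq_self (μ := Measure.pi fun _ : C => haarSU2) (fun v => M.bdryEval k (D.transport v)) h

end CutSystem

end

/-! ### The amplitude as an integral over the cuts. -/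

theorem mainTheorem4 {T C : Type*} [Fintype T] [Fintype C]
    (M : Triangulation T) (D : CutSystem M C) (hD : D.IsHandlebody) (hM : M.NonTardis)
    (Ψ : M.BoundaryState) :
    Integrable (D.boundaryEval Ψ) (Measure.pi fun _ : C => haarSU2) ∧
      M.ponzanoRegge Ψ =
        ∫ h : C → SU2, D.boundaryEval Ψ h ∂(Measure.pi fun _ : C => haarSU2) := by
  have hcont : Continuous fun h : C → SU2 => M.bdryEval Ψ.spin (D.transport h) :=
    (Triangulation.continuous_bdryEval Ψ.spin).comp D.continuous_transport
  have heval : D.boundaryEval Ψ = fun h => (∏ x, Ψ.coeff x) * M.bdryEval Ψ.spin (D.transport h) := rfl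
  refine ⟨?_, ?_⟩
  · rw [heval]
    exact integrable_of_continuous (continuous_const.mul hcont)
  · classical
    rw [heval, integral_const_mul, Triangulation.ponzanoRegge,
      -- The edges away from the cuts are treated first, with the exponent at the edges on the cuts
      -- fixed; then this exponent tends to infinity.
      Triangulation.sum_weight_eq_of_tendsto (hM Ψ.spin) (· ∈ D.awayEdges)
        (D.tendsto_integral_edgeDelta hD.ball.simplyConnected hM Ψ.spin)
        (D.tendsto_integral_cutEdges hD hM Ψ.spin)]
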